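/- Let $n\in\mathbb N$, $\alpha>0$, $b>0$, $r_0=\frac{nb}{2\alpha}$ with $1<r_0\le r<\infty$, and fix the sign in $f(u)=\pm|u|^bu$; functions are real- or complex-valued. For $t>0$ let $S_\alpha(t)=e^{-t(-\Delta)^\alpha}$, i.e. convolution on $\mathbb R^n$ with $K_t(x)=(2\pi)^{-n}\int_{\mathbb R^n}e^{ix\cdot\xi}e^{-t|\xi|^{2\alpha}}\,d\xi$. Call $(q,p,r)$ admissible if $\frac1q=\frac n{2\alpha}\left(\frac1r-\frac1p\right)$ with $1<r\le p<\infty$, and moreover $p<\frac{nr}{n-2\alpha}$ if $n>2\alpha$ (so $q=\infty$ iff $p=r$). For an interval $I\ni 0$ in $[0,\infty)$ let $X(I)=C(I;L^r(\mathbb R^n))\cap L^q(I;L^p(\mathbb R^n))$. A mild solution on $I$ of $$u_t+(-\Delta)^\alpha u=\pm|u|^bu,\qquad u(0)=\varphi\in L^r(\mathbb R^n),\tag{1}$$ is a curve $u$ in $L^r$ with $u(0)=\varphi$ and $u(t)=S_\alpha(t)\varphi+\int_0^tS_\alpha(t-\tau)f(u(\tau))\,d\tau$ a.e. on $\mathbb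 R^n$ for every $0<t\in I$, the integral converging absolutely a.e.; so that the nonlinear term makes sense, it is also required that for some admissible $(q',p',r)$ with $p'>b+1$ one has $u\in L^{q'}([0,T');L^{p'}(\mathbb R^n))$ for all $T'\in I$ (this is automatic for $u\in X(I)$ if $p>b+1$). **Theorem.** Let $(q,p,r)$ be any admissible triplet. (i) For every $\varphi\in L^r(\mathbb R^n)$ there are $T>0$ and a mild solution $u\in X([0,T))$ of (1). If $r>r_0$, then $T$ can be chosen depending only on an upper bound for $\|\varphi\|_{L^r}$ (and on $n,\alpha,b,p,r$ and the sign); if $r=r_0$, then $T$ may depend on $\varphi$. For every $T>0$, any two mild solutions of (1) in $X([0,T))$ with the same data coincide. (ii) If $r=r_0$, there is $\delta>0$ such that for every $\varphi$ with $\|\varphi\|_{L^r}\le\delta$ there is a mild solution on $[0,\infty)$ with $u\in C_b([0,\infty);L^r(\mathbb R^n))\cap L^q([0,\infty);L^p(\mathbb R^n))$. (iii) If $r>r_0$, there is $C>0$, independent of $\varphi$, $u$ and $T^*$, such that the following holds. Let $0<T^*<\infty$ and let $[0,T^*)$ be the maximal existence interval of $u$: $u$ is a mild solution of (1) on $[0,T^*)$,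 $u\in X([0,T'))$ for all $T'<T^*$, and for no $T'>T^*$ is $u$ the restriction to $[0,T^*)$ of a mild solution in $X([0,T'))$. Then $$\|u(s)\|_{L^r}\ge\frac{C}{(T^*-s)^{\frac1b-\frac n{2r\alpha}}}\qquad\text{for all }0\le s<T^*.$$ -/

import Mathlib

open MeasureTheory Set
open scoped ENNReal FourierTransform Convolution

noncomputable section

namespace FracHeat

/-- The kernel `K_t(x) = (2π)⁻ⁿ ∫ exp(i x·η) exp(-t |η|^{2α}) dη` of `exp(-t(-Δ)^α)` on `ℝⁿ`, for
`t > 0`, written with Mathlib's inverse Fourier transform (substitute `η = 2πξ`). The transform is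
real because the symbol is even. -/
def kernel (n : ℕ) (α t : ℝ) (x : EuclideanSpace ℝ (Fin n)) : ℝ :=
  (𝓕⁻ (fun ξ : EuclideanSpace ℝ (Fin n) =>
    ((Real.exp (-t * (2 * Real.pi * ‖ξ‖) ^ (2 * α)) : ℝ) : ℂ)) x).re

/-- `S_α(t) g = K_t * g` for `t > 0`. -/
def semigroup {𝕜 : Type*} [RCLike 𝕜] (n : ℕ) (α t : ℝ) (g : EuclideanSpace ℝ (Fin n) → 𝕜) :
    EuclideanSpace ℝ (Fin n) → 𝕜 :=
  kernel n α t ⋆[ContinuousLinearMap.lsmul ℝ ℝ, volume] g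

/-- The nonlinearity `ε |z|^b z`, with `ε = ±1`. -/
def nonlin {𝕜 : Type*} [RCLike 𝕜] (b ε : ℝ) (z : 𝕜) : 𝕜 := (ε * ‖z‖ ^ b) • z

/-- Admissible triplets `(q, p, r)`: `1/q = n/(2α) (1/r - 1/p)` and `1 < r ≤ p < nr/(n-2α)` if
`n > 2α`, `1 < r ≤ p < ∞` if `n ≤ 2α`. Here `q = ∞` exactly when `p = r`. -/
def IsAdmissible (n : ℕ) (α : ℝ) (q : ℝ≥0∞) (p r : ℝ) : Prop :=
  q⁻¹ = ENNReal.ofReal (n / (2 * α) * (1 / r - 1 / p)) ∧ 1 < r ∧ r ≤ p ∧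
    (2 * α < n → p < n * r / (n - 2 * α))

/-- `u ∈ L^q(I; L^p(ℝⁿ))`, for a curve `u` in `L^r(ℝⁿ)`: the function `t ↦ ‖u(t)‖_{L^p}`, with
value `∞` where `u(t) ∉ L^p`, is in `L^q(I)`. It is only used for curves that are continuous into
`L^r`, and those are strongly measurable into `L^p` (`p < ∞`) as soon as `u(t) ∈ L^p` for a.e. `t`. -/
def MemLqLp {𝕜 : Type*} [RCLike 𝕜] {n : ℕ} {r : ℝ} (q : ℝ≥0∞) (p : ℝ) (I : Set ℝ)
    (u : ℝ → Lp 𝕜 (ENNReal.ofReal r) (volume : Measure (EuclideanSpace ℝ (Fin n)))) : Prop :=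
  MemLp (fun t => eLpNorm (u t) (ENNReal.ofReal p) volume) q (volume.restrict I)

/-- `u ∈ X(I) = C(I; L^r(ℝⁿ)) ∩ L^q(I; L^p(ℝⁿ))`. -/
def MemX {𝕜 : Type*} [RCLike 𝕜] {n : ℕ} {r : ℝ} [Fact (1 ≤ ENNReal.ofReal r)]
    (q : ℝ≥0∞) (p : ℝ) (I : Set ℝ)
    (u : ℝ → Lp 𝕜 (ENNReal.ofReal r) (volume : Measure (EuclideanSpace ℝ (Fin n)))) : Prop :=
  ContinuousOn u I ∧ MemLqLp q p I u

/-- `u` is a mild solution of `u_t + (-Δ)^α u = ε |u|^b u`, `u(0) = φ`, on the interval `I ∋ 0`: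
`u(t) = S_α(t) φ + ∫₀ᵗ S_α(t-τ) (ε |u(τ)|^b u(τ)) dτ` for all `t ∈ I`. -/
structure IsMildSolution {𝕜 : Type*} [RCLike 𝕜] {n : ℕ} {r : ℝ} (α b ε : ℝ) (I : Set ℝ)
    (φ : Lp 𝕜 (ENNReal.ofReal r) (volume : Measure (EuclideanSpace ℝ (Fin n))))
    (u : ℝ → Lp 𝕜 (ENNReal.ofReal r) (volume : Measure (EuclideanSpace ℝ (Fin n)))) : Prop where
  /-- The nonlinear term makes sense: locally in time `u` is in `L^{q'}(L^{p'})` for some admissible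
  triplet with `p' > b + 1`, so that `|u|^b u ∈ L^{q'/(b+1)}(L^{p'/(b+1)})`. If `u ∈ L^q(I; L^p)`
  with `(q, p, r)` admissible and `p > b + 1`, this holds automatically. -/
  regular : ∃ (q' : ℝ≥0∞) (p' : ℝ), IsAdmissible n α q' p' r ∧ b + 1 < p' ∧
    ∀ T ∈ I, MemLqLp q' p' (Ico 0 T) u
  initial : u 0 = φ
  /-- The Duhamel integral converges absolutely at almost every `x`. -/
  converges : ∀ t ∈ I, 0 < t → ∀ᵐ x : EuclideanSpace ℝ (Fin n),
    (∀ᵐ τ ∂(volume.restrict (Ioo 0 t)),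
      ConvolutionExistsAt (kernel n α (t - τ)) (fun y => nonlin b ε (u τ y)) x
        (ContinuousLinearMap.lsmul ℝ ℝ) volume) ∧
    IntegrableOn (fun τ => semigroup n α (t - τ) (fun y => nonlin b ε (u τ y)) x) (Ioo 0 t)
  duhamel : ∀ t ∈ I, 0 < t → ∀ᵐ x : EuclideanSpace ℝ (Fin n),
    u t x = semigroup n α t φ x +
      ∫ τ in Ioo 0 t, semigroup n α (t - τ) (fun y => nonlin b ε (u τ y)) x

/-- `[0, T)`, with `0 < T < ∞`, is the maximal existence interval of the mild solution `u`: `u`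
is a mild solution on `[0, T)` of class `X([0, T'))` for all `T' < T`, and it is not the restriction
of a mild solution of class `X([0, T'))` with `T' > T`. -/
def IsMaximal {𝕜 : Type*} [RCLike 𝕜] {n : ℕ} {r : ℝ} [Fact (1 ≤ ENNReal.ofReal r)]
    (α b ε : ℝ) (q : ℝ≥0∞) (p T : ℝ)
    (φ : Lp 𝕜 (ENNReal.ofReal r) (volume : Measure (EuclideanSpace ℝ (Fin n))))
    (u : ℝ → Lp 𝕜 (ENNReal.ofReal r) (volume : Measure (EuclideanSpace ℝ (Fin n)))) : Prop :=
  0 < T ∧ IsMildSolution α b ε (Ico 0 T) φ u ∧ (∀ T' < T, MemX q p (Ico 0 T') u) ∧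
    ∀ T' > T, ∀ v : ℝ → Lp 𝕜 (ENNReal.ofReal r) (volume : Measure (EuclideanSpace ℝ (Fin n))),
      IsMildSolution α b ε (Ico 0 T') φ v → MemX q p (Ico 0 T') v → ∃ t ∈ Ico 0 T, v t ≠ u t

end FracHeat

end

/-! Write ν = n/(2α), so that r₀ = νb. The analysis uses only that the kernel has mass at most c and
height at most c t^{-ν} (`exists_heatBound`), together with its evenness and the semigroup law. By
scaling, the two bounds reduce to the integrability of K₁ and of its symbol. The symbol
exp(-|ξ|^{2α}) need not be smooth at 0. It is therefore written as a Schwartz function times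
exp(-χ|ξ|^{2α}) with a cutoff χ. The function χ|ξ|^{2α} is a sum of dilates of one smooth bump with
geometrically decreasing coefficients, hence the Fourier transform of an integrable function. Such
transforms form an algebra, in which the exponential series converges (`exists_fourier_eq_exp`).

The linear estimates are of Strichartz type. The free evolution maps L^r to L^q_t L^p_x: at time t
the datum is cut at height t^{-ν/r}, and the two pieces are estimated from different Lebesgue spaces
(`lpn_lpn_pconv_le`). The Duhamel integral is controlled by the smoothing estimate in space and the
Hardy–Littlewood–Sobolev inequality in time (`mixed_pduh_le`). Its bound in L^∞_t L^r_x is dual to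
the homogeneous estimate (`lpn_pduh_endpoint`).

Existence is a Picard iteration in an auxiliary space L^q_t L^p_x, with p and q both between
max(b+1, r) and r(b+1) (`exists_exponents`, `exists_fixed_point`). The smallness condition is that
T^{1-r₀/r} ‖S(·)φ‖^b is small, the norm being that of L^q([0,T); L^p). For r > r₀ the power of T
provides this, with T depending only on ‖φ‖. For r = r₀ it holds on a short interval by absolute
continuity of the integral, or for all times if φ is small. The integral equation then places the
solution in every admissible space, and restarting it just before a given time gives continuity into
L^r.

Uniqueness is a contraction on short intervals after a time of agreement, followed by a
connectedness argument. If r > r₀ or r ≤ b+1, both solutions lie in a common mixed space in which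
the contraction closes (`FMild.exists_ae_eq`). If r = r₀ > b+1, the time integral in the strong L^r
estimate diverges logarithmically. It converges in weak L^r, and the potential |u|^b is split into a
part small in L^ν and a bounded part whose contribution is small for short times
(`FMild.exists_ae_eq_critical`).

For the lower bound, a maximal solution with T₁^{1-r₀/r} ‖u(s)‖^b small for some T₁ > T* - s could
be restarted at s and glued past T*, where uniqueness contradicts maximality. Letting T₁ decrease to
T* - s gives the rate. -/

set_option linter.unusedSectionVars false

noncomputable section

namespace FracHeat

/-! ### Lebesgue norms of functions with values in [0, ∞]. -/

section Lpn

variable {α β : Type*} [MeasurableSpace α] [MeasurableSpace β] {μ : Measure α} {ν : Measure β}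

/-- The `L^a` norm of a function with values in `[0, ∞]`, for a real exponent `a`. -/
def lpn (μ : Measure α) (a : ℝ) (g : α → ℝ≥0∞) : ℝ≥0∞ := (∫⁻ x, g x ^ a ∂μ) ^ (1 / a)

theorem lpn_rpow_self {a : ℝ} (ha : 0 < a) (g : α → ℝ≥0∞) : lpn μ a g ^ a = ∫⁻ x, g x ^ a ∂μ := by
  rw [lpn, ← ENNReal.rpow_mul, one_div, inv_mul_cancel₀ ha.ne', ENNReal.rpow_one]

theorem lpn_one (g : α → ℝ≥0∞) : lpn μ 1 g = ∫⁻ x, g x ∂μ := by simp [lpn]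

theorem lpn_mono_ae {a : ℝ} (ha : 0 < a) {f g : α → ℝ≥0∞} (h : ∀ᵐ x ∂μ, f x ≤ g x) :
    lpn μ a f ≤ lpn μ a g := by
  unfold lpn
  refine ENNReal.rpow_le_rpow (lintegral_mono_ae ?_) (by positivity)
  filter_upwards [h] with x hx using ENNReal.rpow_le_rpow hx ha.le

theorem lpn_mono {a : ℝ} (ha : 0 < a) {f g : α → ℝ≥0∞} (h : ∀ x, f x ≤ g x) :
    lpn μ a f ≤ lpn μ a g := lpn_mono_ae ha (Filter.Eventually.of_forall h)

theorem lpn_congr_ae {a : ℝ} {f g : α → ℝ≥0∞} (h : ∀ᵐ x ∂μ, f x = g x) :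
    lpn μ a f = lpn μ a g := by
  unfold lpn
  congr 1
  refine lintegral_congr_ae ?_
  filter_upwards [h] with x hx
  rw [hx]

theorem lpn_mono_measure {a : ℝ} (ha : 0 < a) {μ' : Measure α} (h : μ ≤ μ') (f : α → ℝ≥0∞) :
    lpn μ a f ≤ lpn μ' a f :=
  ENNReal.rpow_le_rpow (lintegral_mono' h le_rfl) (by positivity)

theorem lpn_zero {a : ℝ} (ha : 0 < a) : lpn μ a (fun _ => 0) = 0 := by
  simp [lpn, ENNReal.zero_rpow_of_pos ha, ENNReal.zero_rpow_of_pos (inv_pos.2 ha)]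

theorem lpn_eq_zero {a : ℝ} (ha : 0 < a) {f : α → ℝ≥0∞} (hf : Measurable f)
    (h : lpn μ a f = 0) : ∀ᵐ x ∂μ, f x = 0 := by
  unfold lpn at h
  rw [ENNReal.rpow_eq_zero_iff_of_pos (by positivity),
    lintegral_eq_zero_iff (hf.pow_const _)] at h
  filter_upwards [h] with x hx
  simpa [ENNReal.rpow_eq_zero_iff_of_pos ha] using hx

theorem lpn_ae_lt_top {a : ℝ} (ha : 0 < a) {f : α → ℝ≥0∞} (hf : Measurable f)
    (h : lpn μ a f ≠ ∞) : ∀ᵐ x ∂μ, f x < ∞ := by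
  have h1 : ∫⁻ x, f x ^ a ∂μ ≠ ∞ := by
    rw [← lpn_rpow_self ha]; exact ENNReal.rpow_ne_top_of_nonneg ha.le h
  filter_upwards [ae_lt_top (hf.pow_const a) h1] with x hx
  by_contra hx'
  rw [not_lt, top_le_iff] at hx'
  simp [hx', ENNReal.top_rpow_of_pos ha] at hx

theorem lpn_const_mul {a : ℝ} (ha : 0 < a) {c : ℝ≥0∞} (hc : c ≠ ∞) (g : α → ℝ≥0∞) :
    lpn μ a (fun x => c * g x) = c * lpn μ a g := by
  unfold lpn
  simp_rw [ENNReal.mul_rpow_of_nonneg _ _ ha.le]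
  rw [lintegral_const_mul' _ _ (ENNReal.rpow_ne_top_of_nonneg ha.le hc),
    ENNReal.mul_rpow_of_nonneg _ _ (by positivity), ← ENNReal.rpow_mul, mul_one_div,
    div_self ha.ne', ENNReal.rpow_one]

theorem lpn_add_le {a : ℝ} (ha : 1 ≤ a) {f g : α → ℝ≥0∞} (hf : Measurable f)
    (hg : Measurable g) : lpn μ a (fun x => f x + g x) ≤ lpn μ a f + lpn μ a g :=
  ENNReal.lintegral_Lp_add_le hf.aemeasurable hg.aemeasurable ha

theorem lpn_rpow {a s : ℝ} (ha : 0 < a) (hs : 0 < s) (g : α → ℝ≥0∞) :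
    lpn μ a (fun x => g x ^ s) = lpn μ (a * s) g ^ s := by
  unfold lpn
  simp_rw [← ENNReal.rpow_mul]
  congr 1
  · simp_rw [mul_comm s a]
  · field_simp

/-- Hölder's inequality `1/a = 1/p + 1/q`. -/
theorem lpn_mul_le {a p q : ℝ} (ha : 0 < a) (hp : 0 < p) (hq : 0 < q) (h : 1 / a = 1 / p + 1 / q)
    {f g : α → ℝ≥0∞} (hf : Measurable f) (hg : Measurable g) :
    lpn μ a (fun x => f x * g x) ≤ lpn μ p f * lpn μ q g := by
  refine ENNReal.lintegral_Lp_mul_le_Lq_mul_Lr ha ?_ h μ hf.aemeasurable hg.aemeasurable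
  have h1 : 1 / p < 1 / a := by rw [h]; have := one_div_pos.2 hq; linarith
  exact (one_div_lt_one_div hp ha).1 h1

theorem lintegral_mul_le_lpn {p q : ℝ} (h : p.HolderConjugate q)
    {f g : α → ℝ≥0∞} (hf : Measurable f) (hg : Measurable g) :
    ∫⁻ x, f x * g x ∂μ ≤ lpn μ p f * lpn μ q g :=
  ENNReal.lintegral_mul_le_Lp_mul_Lq μ h hf.aemeasurable hg.aemeasurable

/-- Interpolation: `1/p = s/p₀ + (1-s)/p₁`. -/
theorem lpn_interpolate {p p₀ p₁ s : ℝ} (hp : 0 < p) (hp₀ : 0 < p₀) (hp₁ : 0 < p₁)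
    (hs0 : 0 < s) (hs1 : s < 1) (h : 1 / p = s / p₀ + (1 - s) / p₁)
    {f : α → ℝ≥0∞} (hf : Measurable f) :
    lpn μ p f ≤ lpn μ p₀ f ^ s * lpn μ p₁ f ^ (1 - s) := by
  have h1s : 0 < 1 - s := by linarith
  have e : f = fun x => f x ^ s * f x ^ (1 - s) := by
    funext x
    rw [← ENNReal.rpow_add_of_nonneg _ _ hs0.le h1s.le]; simp
  have := lpn_mul_le (μ := μ) (a := p) (p := p₀ / s) (q := p₁ / (1 - s)) hp (by positivity)
    (by positivity) (by rw [h]; field_simp) (hf.pow_const s) (hf.pow_const (1 - s))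
  rw [← e, lpn_rpow (by positivity) hs0, lpn_rpow (by positivity) h1s,
    div_mul_cancel₀ _ hs0.ne', div_mul_cancel₀ _ h1s.ne'] at this
  exact this

/-- Converse of Hölder's inequality. -/
theorem lpn_le_of_dual [SigmaFinite μ] {p q : ℝ} (hpq : p.HolderConjugate q) {N : α → ℝ≥0∞}
    (hN : Measurable N) {C : ℝ≥0∞}
    (h : ∀ ψ : α → ℝ≥0∞, Measurable ψ → ∫⁻ x, N x * ψ x ∂μ ≤ C * lpn μ q ψ) :
    lpn μ p N ≤ C := by
  have hp := hpq.pos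
  have hq := hpq.symm.pos
  -- Cutting off in height and to sets of finite measure makes the integral of `M k ^ p` finite, so
  -- that a power of it can be divided out below.
  let M : ℕ → α → ℝ≥0∞ := fun k => (spanningSets μ k).indicator (fun x => min (N x) k)
  have hMm : ∀ k, Measurable (M k) := fun k =>
    (hN.min measurable_const).indicator (measurableSet_spanningSets μ k)
  have hMle : ∀ k x, M k x ≤ N x := fun k x => by
    simp only [M, indicator]; split_ifs <;> simp
  have hMmono : Monotone M := by
    intro i j hij x
    simp only [M, indicator]
    split_ifs with h1 h2
    · exact min_le_min le_rfl (by exact_mod_cast hij)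
    · exact absurd (monotone_spanningSets μ hij h1) h2
    · exact zero_le
    · exact le_rfl
  have hsup : ∀ x, ⨆ k, M k x ^ p = N x ^ p := by
    intro x
    apply le_antisymm
    · exact iSup_le fun k => ENNReal.rpow_le_rpow (hMle k x) hp.le
    · have hlim : Filter.Tendsto (fun k => M k x) Filter.atTop (nhds (N x)) := by
        have h1 : Filter.Tendsto (fun k : ℕ => min (N x) (k : ℝ≥0∞)) Filter.atTop
            (nhds (min (N x) ∞)) :=
          tendsto_const_nhds.min ENNReal.tendsto_nat_nhds_top
        rw [min_eq_left le_top] at h1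
        refine h1.congr' ?_
        filter_upwards [Filter.eventually_ge_atTop (spanningSetsIndex μ x)] with k hk
        have : x ∈ spanningSets μ k :=
          monotone_spanningSets μ hk (mem_spanningSetsIndex μ x)
        simp [M, this]
      exact le_of_tendsto ((ENNReal.continuous_rpow_const.tendsto _).comp hlim)
        (Filter.Eventually.of_forall fun k => le_iSup (fun k => M k x ^ p) k)
  have key : ∀ k, ∫⁻ x, M k x ^ p ∂μ ≤ C ^ p := by
    intro k
    set I := ∫⁻ x, M k x ^ p ∂μ with hI
    have hfin : I ≠ ∞ := by
      have : I ≤ ∫⁻ x, (spanningSets μ k).indicator (fun _ => (k : ℝ≥0∞) ^ p) x ∂μ := by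
        refine lintegral_mono fun x => ?_
        simp only [M, indicator]
        split_ifs
        · exact ENNReal.rpow_le_rpow (min_le_right _ _) hp.le
        · simp [ENNReal.zero_rpow_of_pos hp]
      rw [lintegral_indicator (measurableSet_spanningSets μ k), lintegral_const] at this
      refine ne_top_of_le_ne_top (ENNReal.mul_ne_top
        (ENNReal.rpow_ne_top_of_nonneg hp.le (ENNReal.natCast_ne_top k)) ?_) this
      simpa using (measure_spanningSets_lt_top μ k).ne
    -- The extremal test function `M k ^ (p - 1)` is inserted in the hypothesis.
    have h1 : I ≤ C * I ^ (1 / q) := by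
      have h2 := h (fun x => M k x ^ (p - 1)) ((hMm k).pow_const _)
      have h3 : lpn μ q (fun x => M k x ^ (p - 1)) = I ^ (1 / q) := by
        unfold lpn
        simp_rw [← ENNReal.rpow_mul]
        rw [show (p - 1) * q = p from hpq.sub_one_mul_conj]
      rw [h3] at h2
      refine le_trans (lintegral_mono fun x => ?_) h2
      calc M k x ^ p = M k x ^ (1 : ℝ) * M k x ^ (p - 1) := by
            rw [← ENNReal.rpow_add_of_nonneg _ _ zero_le_one hpq.sub_one_pos.le]; congr 1; ring
        _ ≤ _ := by rw [ENNReal.rpow_one]; gcongr; exact hMle k x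
    rcases eq_or_ne I 0 with h0 | h0
    · rw [h0]; exact zero_le
    have h4 : I ^ (1 / p) ≤ C := by
      have h5 : I = I ^ (1 / p) * I ^ (1 / q) := by
        rw [← ENNReal.rpow_add _ _ h0 hfin, one_div, one_div, hpq.inv_add_inv_eq_one,
          ENNReal.rpow_one]
      rw [h5] at h1
      have hq0 : (I ^ (1 / q)) ≠ 0 := by
        simp [ENNReal.rpow_eq_zero_iff, h0, hfin]
      have hqt : (I ^ (1 / q)) ≠ ∞ := ENNReal.rpow_ne_top_of_nonneg (by positivity) hfin
      rw [← h5] at h1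
      have h6 : I / I ^ (1 / q) ≤ C := ENNReal.div_le_of_le_mul h1
      refine le_trans (le_of_eq ?_) h6
      nth_rewrite 2 [h5]
      rw [ENNReal.mul_div_cancel_right hq0 hqt]
    calc I = (I ^ (1 / p)) ^ p := by
          rw [← ENNReal.rpow_mul, one_div, inv_mul_cancel₀ hp.ne', ENNReal.rpow_one]
      _ ≤ C ^ p := ENNReal.rpow_le_rpow h4 hp.le
  have : ∫⁻ x, N x ^ p ∂μ ≤ C ^ p := by
    simp_rw [← hsup]
    rw [lintegral_iSup (fun k => (hMm k).pow_const p)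
      (fun i j hij x => ENNReal.rpow_le_rpow (hMmono hij x) hp.le)]
    exact iSup_le key
  calc lpn μ p N ≤ (C ^ p) ^ (1 / p) := ENNReal.rpow_le_rpow this (by positivity)
    _ = C := by rw [← ENNReal.rpow_mul, mul_one_div, div_self hp.ne', ENNReal.rpow_one]

/-- Minkowski's integral inequality. -/
theorem lpn_lintegral_le [SigmaFinite μ] [SFinite ν] {a : ℝ} (ha : 1 ≤ a) {F : β → α → ℝ≥0∞}
    (hF : Measurable (Function.uncurry F)) :
    lpn μ a (fun x => ∫⁻ t, F t x ∂ν) ≤ ∫⁻ t, lpn μ a (F t) ∂ν := by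
  have hF' : Measurable (fun z : α × β => F z.2 z.1) := hF.comp measurable_swap
  rcases ha.eq_or_lt with rfl | ha
  · simp_rw [lpn_one]
    rw [lintegral_lintegral_swap hF'.aemeasurable]
  have hc := Real.HolderConjugate.conjExponent ha
  -- For a > 1 the norm is tested against ψ; Tonelli then allows Hölder's inequality at each fixed
  -- t.
  refine lpn_le_of_dual hc hF'.lintegral_prod_right' fun ψ hψ => ?_
  calc ∫⁻ x, (∫⁻ t, F t x ∂ν) * ψ x ∂μ = ∫⁻ x, ∫⁻ t, F t x * ψ x ∂ν ∂μ := by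
        refine lintegral_congr fun x => ?_
        rw [lintegral_mul_const]
        exact hF'.comp measurable_prodMk_left
    _ = ∫⁻ t, ∫⁻ x, F t x * ψ x ∂μ ∂ν := by
        rw [lintegral_lintegral_swap]
        exact (hF'.mul (hψ.comp measurable_fst)).aemeasurable
    _ ≤ ∫⁻ t, lpn μ a (F t) * lpn μ (Real.conjExponent a) ψ ∂ν :=
        lintegral_mono fun t => lintegral_mul_le_lpn hc (hF.comp measurable_prodMk_left) hψ
    _ = _ := by
        rw [lintegral_mul_const]
        unfold lpn
        exact ((hF.pow_const a).lintegral_prod_right').pow_const _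

theorem measurable_lpn [SFinite μ] {a : ℝ} {F : β → α → ℝ≥0∞}
    (hF : Measurable (Function.uncurry F)) : Measurable (fun t => lpn μ a (F t)) := by
  unfold lpn
  exact ((hF.pow_const a).lintegral_prod_right').pow_const _

/-- This is Minkowski's integral inequality for the counting measure on ℕ. -/
theorem lpn_tsum_le [SigmaFinite μ] {a : ℝ} (ha : 1 ≤ a) {F : ℕ → α → ℝ≥0∞}
    (hF : ∀ k, Measurable (F k)) :
    lpn μ a (fun x => ∑' k, F k x) ≤ ∑' k, lpn μ a (F k) := by
  have h := lpn_lintegral_le (μ := μ) (ν := Measure.count) ha (F := F)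
    (measurable_from_prod_countable_right hF)
  simpa [lintegral_count] using h

end Lpn

end FracHeat

namespace FracHeat

/-! ### Convolution with kernels of bounded mass and decaying height. -/

section Kernel

variable {G : Type*} [AddCommGroup G] [MeasurableSpace G] [MeasurableAdd₂ G] [MeasurableNeg G]
  {μ : Measure G}

/-- Convolution of `k t` with a nonnegative function. -/
def pconv (μ : Measure G) (k : ℝ → G → ℝ≥0∞) (t : ℝ) (g : G → ℝ≥0∞) (x : G) : ℝ≥0∞ :=
  ∫⁻ y, k t (x - y) * g y ∂μ

/-- The bounds `‖k t‖₁ ≤ c` and `‖k t‖_∞ ≤ c t^{-ν}`, the only ones that matter for the decay of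
`‖k t * g‖_p`. -/
structure HeatBound (μ : Measure G) (ν : ℝ) (c : ℝ≥0∞) (k : ℝ → G → ℝ≥0∞) : Prop where
  meas : Measurable (Function.uncurry k)
  ne_top : c ≠ ∞
  l1 : ∀ t, 0 < t → ∫⁻ x, k t x ∂μ ≤ c
  sup : ∀ t, 0 < t → ∀ x, k t x ≤ c * ENNReal.ofReal t ^ (-ν)
  neg : ∀ t x, k t (-x) = k t x

variable {ν : ℝ} {c : ℝ≥0∞} {k : ℝ → G → ℝ≥0∞}

theorem HeatBound.meas_sub (hk : HeatBound μ ν c k) (t : ℝ) :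
    Measurable (fun z : G × G => k t (z.1 - z.2)) :=
  hk.meas.comp (measurable_const.prodMk (measurable_fst.sub measurable_snd))

theorem HeatBound.sub_comm (hk : HeatBound μ ν c k) (t : ℝ) (x y : G) :
    k t (x - y) = k t (y - x) := by
  rw [← hk.neg, neg_sub]

theorem HeatBound.meas_apply (hk : HeatBound μ ν c k) (t : ℝ) : Measurable (k t) :=
  hk.meas.comp measurable_prodMk_left

theorem HeatBound.meas_sub_left (hk : HeatBound μ ν c k) (t : ℝ) (x : G) :
    Measurable (fun y : G => k t (x - y)) :=
  (hk.meas_apply t).comp (measurable_const.sub measurable_id)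

theorem pconv_mono {t : ℝ} {g g' : G → ℝ≥0∞} (h : ∀ x, g x ≤ g' x) (x : G) :
    pconv μ k t g x ≤ pconv μ k t g' x :=
  lintegral_mono fun y => by gcongr; exact h y

theorem pconv_const_mul {t : ℝ} {C : ℝ≥0∞} (hC : C ≠ ∞) (g : G → ℝ≥0∞) (x : G) :
    pconv μ k t (fun y => C * g y) x = C * pconv μ k t g x := by
  unfold pconv
  rw [← lintegral_const_mul' _ _ hC]
  refine lintegral_congr fun y => ?_
  ring

theorem pconv_add (hk : HeatBound μ ν c k) {t : ℝ} {g g' : G → ℝ≥0∞} (hg : Measurable g) (x : G) :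
    pconv μ k t (fun y => g y + g' y) x = pconv μ k t g x + pconv μ k t g' x := by
  unfold pconv
  simp_rw [mul_add]
  exact lintegral_add_left ((hk.meas_sub_left t x).mul hg) _

variable [SFinite μ] [μ.IsAddLeftInvariant] [μ.IsNegInvariant]

theorem HeatBound.lintegral_sub_left (hk : HeatBound μ ν c k) {t : ℝ} (ht : 0 < t) (x : G) :
    ∫⁻ y, k t (x - y) ∂μ ≤ c :=
  (lintegral_sub_left_eq_self (fun y => k t y) x).trans_le (hk.l1 t ht)

theorem measurable_pconv (hk : HeatBound μ ν c k) {t : ℝ} {g : G → ℝ≥0∞} (hg : Measurable g) :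
    Measurable (pconv μ k t g) :=
  ((hk.meas_sub t).mul (hg.comp measurable_snd)).lintegral_prod_right'

/-- Tonelli's theorem and the evenness of the kernel. All duality arguments below rest on this
symmetry. -/
theorem lintegral_pconv_mul (hk : HeatBound μ ν c k) {t : ℝ} {g ψ : G → ℝ≥0∞}
    (hg : Measurable g) (hψ : Measurable ψ) :
    ∫⁻ x, pconv μ k t g x * ψ x ∂μ = ∫⁻ x, g x * pconv μ k t ψ x ∂μ := by
  have e1 : ∀ x, pconv μ k t g x * ψ x = ∫⁻ y, k t (x - y) * g y * ψ x ∂μ := fun x => by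
    rw [lintegral_mul_const]; rfl
    exact (hk.meas_sub_left t x).mul hg
  have e2 : ∀ y, g y * pconv μ k t ψ y = ∫⁻ x, k t (x - y) * g y * ψ x ∂μ := fun y => by
    unfold pconv
    rw [← lintegral_const_mul]
    · refine lintegral_congr fun x => ?_
      rw [hk.sub_comm]; ring
    · exact (hk.meas_sub_left t y).mul hψ
  simp_rw [e1, e2]
  rw [lintegral_lintegral_swap]
  exact (((hk.meas_sub t).mul (hg.comp measurable_snd)).mul (hψ.comp measurable_fst)).aemeasurable

/-- The symmetry is applied with the constant function 1, whose convolution is bounded by the mass.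
-/
theorem lintegral_pconv_le (hk : HeatBound μ ν c k) {t : ℝ} (ht : 0 < t) {g : G → ℝ≥0∞}
    (hg : Measurable g) : ∫⁻ x, pconv μ k t g x ∂μ ≤ c * ∫⁻ x, g x ∂μ := by
  have h := lintegral_pconv_mul hk (t := t) hg (measurable_const (a := (1 : ℝ≥0∞)))
  simp only [mul_one] at h
  rw [h, mul_comm, ← lintegral_mul_const _ hg]
  refine lintegral_mono fun x => ?_
  dsimp only
  gcongr
  simpa [pconv] using hk.lintegral_sub_left ht x

/-- Jensen's inequality for the convolution with a kernel of mass at most `c`. -/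
theorem pconv_rpow_le (hk : HeatBound μ ν c k) {t : ℝ} (ht : 0 < t) {a : ℝ} (ha : 1 ≤ a)
    {g : G → ℝ≥0∞} (hg : Measurable g) (x : G) :
    pconv μ k t g x ^ a ≤ c ^ (a - 1) * pconv μ k t (fun y => g y ^ a) x := by
  have ha0 : 0 < a := by linarith
  have h1a : 1 / a ≤ 1 := by rw [div_le_one ha0]; exact ha
  have hkx := hk.meas_sub_left t x
  -- Hölder's inequality for the factorization k g = k^{1-1/a} (k g^a)^{1/a}.
  have h := ENNReal.lintegral_mul_norm_pow_le (μ := μ) (f := fun y => k t (x - y))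
    (g := fun y => k t (x - y) * g y ^ a) hkx.aemeasurable (hkx.mul (hg.pow_const a)).aemeasurable
    (p := 1 - 1 / a) (q := 1 / a) (by linarith) (by positivity) (by ring)
  have e : ∀ y, k t (x - y) ^ (1 - 1 / a) * (k t (x - y) * g y ^ a) ^ (1 / a)
      = k t (x - y) * g y := fun y => by
    rw [ENNReal.mul_rpow_of_nonneg _ _ (by positivity), ← mul_assoc,
      ← ENNReal.rpow_add_of_nonneg _ _ (by linarith) (by positivity), ← ENNReal.rpow_mul,
      mul_one_div, div_self ha0.ne']
    simp
  simp_rw [e] at h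
  calc pconv μ k t g x ^ a
      ≤ ((∫⁻ y, k t (x - y) ∂μ) ^ (1 - 1 / a) *
          (∫⁻ y, k t (x - y) * g y ^ a ∂μ) ^ (1 / a)) ^ a := ENNReal.rpow_le_rpow h ha0.le
    _ ≤ (c ^ (1 - 1 / a) * (∫⁻ y, k t (x - y) * g y ^ a ∂μ) ^ (1 / a)) ^ a := by
        gcongr
        exact hk.lintegral_sub_left ht x
    _ = _ := by
        rw [ENNReal.mul_rpow_of_nonneg _ _ ha0.le, ← ENNReal.rpow_mul, ← ENNReal.rpow_mul,
          one_div, inv_mul_cancel₀ ha0.ne', ENNReal.rpow_one, sub_mul, one_mul,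
          inv_mul_cancel₀ ha0.ne']
        rfl

theorem c_rpow_mul {a : ℝ} (ha : 1 ≤ a) (c : ℝ≥0∞) : c ^ (a - 1) * c = c ^ a := by
  nth_rewrite 2 [← ENNReal.rpow_one c]
  rw [← ENNReal.rpow_add_of_nonneg _ _ (by linarith) zero_le_one]
  congr 1; ring

theorem lpn_pconv_le_self (hk : HeatBound μ ν c k) {t : ℝ} (ht : 0 < t) {a : ℝ} (ha : 1 ≤ a)
    {g : G → ℝ≥0∞} (hg : Measurable g) : lpn μ a (pconv μ k t g) ≤ c * lpn μ a g := by
  have ha0 : 0 < a := by linarith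
  have h1 : ∫⁻ x, pconv μ k t g x ^ a ∂μ ≤ c ^ a * ∫⁻ x, g x ^ a ∂μ := by
    calc _ ≤ ∫⁻ x, c ^ (a - 1) * pconv μ k t (fun y => g y ^ a) x ∂μ :=
          lintegral_mono fun x => pconv_rpow_le hk ht ha hg x
      _ = c ^ (a - 1) * ∫⁻ x, pconv μ k t (fun y => g y ^ a) x ∂μ :=
          lintegral_const_mul _ (measurable_pconv hk (hg.pow_const a))
      _ ≤ c ^ (a - 1) * (c * ∫⁻ x, g x ^ a ∂μ) := by
          gcongr; exact lintegral_pconv_le hk ht (hg.pow_const a)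
      _ = _ := by rw [← mul_assoc, c_rpow_mul ha]
  refine (ENNReal.rpow_le_rpow h1 (one_div_nonneg.2 ha0.le)).trans_eq ?_
  rw [ENNReal.mul_rpow_of_nonneg _ _ (by positivity), ← ENNReal.rpow_mul, mul_one_div,
    div_self ha0.ne', ENNReal.rpow_one]
  rfl

/-- Jensen's inequality again, the convolution of g^a now being bounded by the height of the kernel
instead of its mass. -/
theorem pconv_le_sup (hk : HeatBound μ ν c k) {t : ℝ} (ht : 0 < t) {a : ℝ} (ha : 1 ≤ a)
    {g : G → ℝ≥0∞} (hg : Measurable g) (x : G) :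
    pconv μ k t g x ≤ c * ENNReal.ofReal t ^ (-(ν / a)) * lpn μ a g := by
  have ha0 : 0 < a := by linarith
  have h1 : pconv μ k t (fun y => g y ^ a) x ≤
      c * ENNReal.ofReal t ^ (-ν) * ∫⁻ x, g x ^ a ∂μ := by
    rw [← lintegral_const_mul _ (hg.pow_const a)]
    refine lintegral_mono fun y => ?_
    dsimp only
    gcongr
    exact hk.sup t ht _
  have h2 : pconv μ k t g x ^ a ≤ (c * ENNReal.ofReal t ^ (-(ν / a)) * lpn μ a g) ^ a := by
    refine (pconv_rpow_le hk ht ha hg x).trans ?_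
    rw [ENNReal.mul_rpow_of_nonneg _ _ ha0.le, ENNReal.mul_rpow_of_nonneg _ _ ha0.le,
      lpn_rpow_self ha0, ← ENNReal.rpow_mul, neg_mul, div_mul_cancel₀ _ ha0.ne', ← c_rpow_mul ha]
    calc _ ≤ c ^ (a - 1) * (c * ENNReal.ofReal t ^ (-ν) * ∫⁻ x, g x ^ a ∂μ) := by gcongr
      _ = _ := by ring
  exact (ENNReal.rpow_le_rpow_iff ha0).1 h2

theorem ofReal_rpow_ne_top {t : ℝ} (ht : 0 < t) (s : ℝ) : ENNReal.ofReal t ^ s ≠ ∞ := by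
  rw [ENNReal.ofReal_rpow_of_pos ht]; exact ENNReal.ofReal_ne_top

theorem ofReal_rpow_ne_zero {t : ℝ} (ht : 0 < t) (s : ℝ) : ENNReal.ofReal t ^ s ≠ 0 := by
  rw [ENNReal.ofReal_rpow_of_pos ht]
  exact (ENNReal.ofReal_pos.2 (Real.rpow_pos_of_pos ht _)).ne'

theorem ofReal_rpow_add {t : ℝ} (ht : 0 < t) (x y : ℝ) :
    ENNReal.ofReal t ^ (x + y) = ENNReal.ofReal t ^ x * ENNReal.ofReal t ^ y :=
  ENNReal.rpow_add _ _ (ENNReal.ofReal_pos.2 ht).ne' ENNReal.ofReal_ne_top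

/-- The smoothing estimate `‖k t * g‖_p ≤ c t^{-ν(1/a - 1/p)} ‖g‖_a`. -/
theorem lpn_pconv_le (hk : HeatBound μ ν c k) {t : ℝ} (ht : 0 < t) {a p : ℝ} (ha : 1 ≤ a)
    (hap : a ≤ p) {g : G → ℝ≥0∞} (hg : Measurable g) :
    lpn μ p (pconv μ k t g) ≤ c * ENNReal.ofReal t ^ (-(ν * (1 / a - 1 / p))) * lpn μ a g := by
  have ha0 : 0 < a := by linarith
  have hp0 : 0 < p := by linarith
  set F := pconv μ k t g with hF
  set S := c * ENNReal.ofReal t ^ (-(ν / a)) * lpn μ a g with hS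
  -- Interpolation by hand: F^p = F^{p-a} F^a, where the first factor takes the uniform bound S and
  -- the second the L^a bound.
  have h1 : ∫⁻ x, F x ^ p ∂μ ≤ S ^ (p - a) * (c * lpn μ a g) ^ a := by
    calc ∫⁻ x, F x ^ p ∂μ ≤ ∫⁻ x, S ^ (p - a) * F x ^ a ∂μ := by
          refine lintegral_mono fun x => ?_
          calc F x ^ p = F x ^ (p - a) * F x ^ a := by
                rw [← ENNReal.rpow_add_of_nonneg _ _ (by linarith) ha0.le]; congr 1; ring
            _ ≤ _ := by
                gcongr
                exact pconv_le_sup hk ht ha hg x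
      _ = S ^ (p - a) * ∫⁻ x, F x ^ a ∂μ :=
          lintegral_const_mul _ ((measurable_pconv hk hg).pow_const a)
      _ ≤ _ := by
          gcongr
          rw [← lpn_rpow_self ha0]
          exact ENNReal.rpow_le_rpow (lpn_pconv_le_self hk ht ha hg) ha0.le
  refine (ENNReal.rpow_le_rpow h1 (one_div_nonneg.2 hp0.le)).trans_eq ?_
  have e1 : S = ENNReal.ofReal t ^ (-(ν / a)) * (c * lpn μ a g) := by rw [hS]; ring
  rw [e1, ENNReal.mul_rpow_of_nonneg _ _ (show 0 ≤ p - a by linarith), mul_assoc,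
    ← ENNReal.rpow_add_of_nonneg _ _ (show 0 ≤ p - a by linarith) ha0.le, sub_add_cancel,
    ENNReal.mul_rpow_of_nonneg _ _ (by positivity), ← ENNReal.rpow_mul, ← ENNReal.rpow_mul,
    ← ENNReal.rpow_mul, mul_one_div p, div_self hp0.ne', ENNReal.rpow_one]
  have e2 : -(ν / a) * ((p - a) * (1 / p)) = -(ν * (1 / a - 1 / p)) := by field_simp
  rw [e2]; ring

end Kernel

end FracHeat

namespace FracHeat

/-! ### Power integrals and the layer-cake formula. -/

section LayerCake

theorem lintegral_Ioo_rpow {q : ℝ} (hq : 0 < q) {Y : ℝ} (hY : 0 < Y) :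
    ∫⁻ l in Ioo (0 : ℝ) Y, ENNReal.ofReal l ^ (q - 1) = ENNReal.ofReal (1 / q) *
      ENNReal.ofReal Y ^ q := by
  have e1 : ∫⁻ l in Ioo (0 : ℝ) Y, ENNReal.ofReal l ^ (q - 1) =
      ∫⁻ l in Ioo (0 : ℝ) Y, ENNReal.ofReal (l ^ (q - 1)) :=
    setLIntegral_congr_fun measurableSet_Ioo fun l hl => ENNReal.ofReal_rpow_of_pos hl.1
  have hint : IntervalIntegrable (fun l : ℝ => l ^ (q - 1)) volume 0 Y :=
    intervalIntegral.intervalIntegrable_rpow' (by linarith)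
  rw [e1, ← ofReal_integral_eq_lintegral_ofReal]
  · rw [← integral_Ioc_eq_integral_Ioo, ← intervalIntegral.integral_of_le hY.le,
      integral_rpow (Or.inl (by linarith)), sub_add_cancel, Real.zero_rpow hq.ne', sub_zero,
      ENNReal.ofReal_rpow_of_pos hY, ← ENNReal.ofReal_mul (by positivity)]
    congr 1; ring
  · exact ((intervalIntegrable_iff_integrableOn_Ioc_of_le hY.le).1 hint).mono_set Ioo_subset_Ioc_self
  · filter_upwards [ae_restrict_mem measurableSet_Ioo] with l hl
    exact Real.rpow_nonneg hl.1.le _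

theorem lintegral_Ioi_rpow {q : ℝ} (hq : 0 < q) {Y : ℝ} (hY : 0 < Y) :
    ∫⁻ l in Ioi Y, ENNReal.ofReal l ^ (-q - 1) = ENNReal.ofReal (1 / q) *
      ENNReal.ofReal Y ^ (-q) := by
  have e1 : ∫⁻ l in Ioi Y, ENNReal.ofReal l ^ (-q - 1) =
      ∫⁻ l in Ioi Y, ENNReal.ofReal (l ^ (-q - 1)) :=
    setLIntegral_congr_fun measurableSet_Ioi fun l hl =>
      ENNReal.ofReal_rpow_of_pos (hY.trans hl)
  rw [e1, ← ofReal_integral_eq_lintegral_ofReal]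
  · rw [integral_Ioi_rpow_of_lt (by linarith) hY, ENNReal.ofReal_rpow_of_pos hY,
      ← ENNReal.ofReal_mul (by positivity), sub_add_cancel]
    congr 1; field_simp
  · exact integrableOn_Ioi_rpow_of_lt (by linarith) hY
  · filter_upwards [ae_restrict_mem measurableSet_Ioi] with l hl
    exact Real.rpow_nonneg (hY.trans hl).le _

theorem rpow_eq_lintegral {q : ℝ} (hq : 0 < q) (y : ℝ≥0∞) :
    y ^ q = ENNReal.ofReal q *
      ∫⁻ l in Ioi (0 : ℝ), (if ENNReal.ofReal l < y then ENNReal.ofReal l ^ (q - 1) else 0) := by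
  have key : ∀ Y : ℝ, 0 < Y → ENNReal.ofReal Y ^ q = ENNReal.ofReal q * ∫⁻ l in Ioi (0 : ℝ),
      (if ENNReal.ofReal l < ENNReal.ofReal Y then ENNReal.ofReal l ^ (q - 1) else 0) := by
    intro Y hY
    have e : ∫⁻ l in Ioi (0 : ℝ), (if ENNReal.ofReal l < ENNReal.ofReal Y then
        ENNReal.ofReal l ^ (q - 1) else 0) = ∫⁻ l in Ioo (0 : ℝ) Y, ENNReal.ofReal l ^ (q - 1) := by
      rw [← lintegral_indicator measurableSet_Ioi, ← lintegral_indicator measurableSet_Ioo]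
      refine lintegral_congr fun l => ?_
      by_cases h0 : 0 < l
      · by_cases h1 : l < Y
        · simp [indicator, h0, h1, ENNReal.ofReal_lt_ofReal_iff hY]
        · simp [indicator, h1, ENNReal.ofReal_lt_ofReal_iff hY]
      · simp [indicator, h0]
    rw [e, lintegral_Ioo_rpow hq hY, ← mul_assoc, ← ENNReal.ofReal_mul hq.le,
      mul_one_div, div_self hq.ne']
    simp
  rcases eq_or_ne y 0 with rfl | h0
  · simp [ENNReal.zero_rpow_of_pos hq]
  rcases eq_or_ne y ∞ with rfl | ht
  -- For y = ∞ the right-hand side dominates its value at each finite Y, and that value Y^q can be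
  -- any positive number.
  · rw [ENNReal.top_rpow_of_pos hq]
    symm
    refine top_le_iff.1 (ENNReal.le_of_forall_nnreal_lt fun r _ => ?_)
    rcases eq_or_ne r 0 with rfl | hr
    · simp
    have hr0 : 0 < r := pos_iff_ne_zero.2 hr
    have hpos : 0 < (r : ℝ) ^ (1 / q) := Real.rpow_pos_of_pos hr0 _
    have := key _ hpos
    rw [ENNReal.ofReal_rpow_of_pos hpos, ← Real.rpow_mul r.coe_nonneg, one_div,
      inv_mul_cancel₀ hq.ne', Real.rpow_one, ENNReal.ofReal_coe_nnreal] at this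
    rw [this]
    gcongr with l
    split_ifs with h1 h2
    · exact le_rfl
    · exact absurd ENNReal.ofReal_lt_top h2
    · exact zero_le
    · exact le_rfl
  · rw [← ENNReal.ofReal_toReal ht]
    exact key _ (ENNReal.toReal_pos h0 ht)

/-- Tonelli's theorem applied to the pointwise identity `rpow_eq_lintegral`. -/
theorem lintegral_rpow_layer {α : Type*} [MeasurableSpace α] {μ : Measure α} [SFinite μ]
    {F : α → ℝ≥0∞} (hF : Measurable F) {q : ℝ} (hq : 0 < q) :
    ∫⁻ x, F x ^ q ∂μ = ENNReal.ofReal q *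
      ∫⁻ l in Ioi (0 : ℝ), ENNReal.ofReal l ^ (q - 1) * μ {x | ENNReal.ofReal l < F x} := by
  have hm : Measurable (fun z : α × ℝ =>
      (if ENNReal.ofReal z.2 < F z.1 then ENNReal.ofReal z.2 ^ (q - 1) else 0 : ℝ≥0∞)) :=
    Measurable.ite (measurableSet_lt (by fun_prop) (by fun_prop)) (by fun_prop) measurable_const
  simp_rw [rpow_eq_lintegral hq (F _)]
  rw [lintegral_const_mul _ hm.lintegral_prod_right', lintegral_lintegral_swap hm.aemeasurable]
  congr 1
  refine lintegral_congr fun l => ?_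
  have hs : MeasurableSet {x | ENNReal.ofReal l < F x} := measurableSet_lt measurable_const hF
  rw [← lintegral_indicator_one hs, ← lintegral_const_mul _ (measurable_one.indicator hs)]
  refine lintegral_congr fun x => ?_
  by_cases h : ENNReal.ofReal l < F x <;> simp [indicator, h]

theorem ofReal_rpow_lt_iff {l m : ℝ} (hm : 0 < m) (y : ℝ≥0∞) :
    ENNReal.ofReal l ^ m < y ↔ ENNReal.ofReal l < y ^ (1 / m) := by
  rw [← ENNReal.rpow_lt_rpow_iff (one_div_pos.2 hm), ← ENNReal.rpow_mul, mul_one_div,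
    div_self hm.ne', ENNReal.rpow_one]

end LayerCake

/-! ### The Hardy–Littlewood–Sobolev inequality for one-sided fractional integrals. -/

section HLS

/-- The one-sided Riesz kernel `σ ↦ σ₊^{-κ}`. -/
def riesz (κ : ℝ) (s : ℝ) : ℝ≥0∞ := if 0 < s then ENNReal.ofReal s ^ (-κ) else 0

theorem measurable_riesz (κ : ℝ) : Measurable (riesz κ) :=
  Measurable.ite measurableSet_Ioi (by fun_prop) measurable_const

/-- The fractional integral `t ↦ ∫_{τ < t} (t - τ)^{-κ} G τ dτ`. -/
def fracInt (κ : ℝ) (G : ℝ → ℝ≥0∞) (t : ℝ) : ℝ≥0∞ := ∫⁻ τ, riesz κ (t - τ) * G τ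

theorem measurable_fracInt {κ : ℝ} {G : ℝ → ℝ≥0∞} (hG : Measurable G) :
    Measurable (fracInt κ G) :=
  (((measurable_riesz κ).comp (measurable_fst.sub measurable_snd)).mul
    (hG.comp measurable_snd)).lintegral_prod_right'

theorem fracInt_const_mul {κ : ℝ} {C : ℝ≥0∞} (hC : C ≠ ∞) (G : ℝ → ℝ≥0∞) (t : ℝ) :
    fracInt κ (fun s => C * G s) t = C * fracInt κ G t := by
  unfold fracInt
  rw [← lintegral_const_mul' _ _ hC]
  exact lintegral_congr fun _ => by ring

/-- The kernel is split at a distance depending on the level l. The far part, by Hölder's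
inequality, and the near part acting on the values of G below l^{q/s} contribute at most constant
multiples of l. Only large values of G are left, and Chebyshev's inequality applies to them. Keeping
the integral of the large values on the right, instead of a norm, lets the bound be integrated in l
to a strong estimate. -/
theorem fracInt_level {κ s q : ℝ} (hs : 1 < s) (hκ : κ < 1) (hq : 0 < q)
    (h : 1 / q = 1 / s - (1 - κ)) :
    ∃ B c : ℝ≥0∞, B ≠ 0 ∧ B ≠ ∞ ∧ c ≠ ∞ ∧ ∀ G : ℝ → ℝ≥0∞, Measurable G → ∫⁻ τ, G τ ^ s ≤ 1 →
      ∀ l : ℝ, 0 < l → volume {t | B * ENNReal.ofReal l < fracInt κ G t} ≤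
        c * ENNReal.ofReal l ^ (-(q / s)) *
          ∫⁻ τ, (if ENNReal.ofReal l ^ (q / s) < G τ then G τ else 0) := by
  have hc := Real.HolderConjugate.conjExponent hs
  set s' := Real.conjExponent s with hs'
  have hs0 : 0 < s := by linarith
  have hs'0 : 0 < s' := hc.symm.pos
  have hinv : 1 / s' = 1 - 1 / s := by have := hc.inv_add_inv_eq_one; simp only [one_div]; linarith
  have hκs : 0 < κ * s' - 1 := by
    have : 0 < κ - 1 / s' := by rw [hinv]; have := one_div_pos.2 hq; linarith
    have h2 := mul_pos this hs'0
    rw [sub_mul, one_div, inv_mul_cancel₀ hs'0.ne'] at h2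
    exact h2
  set cf : ℝ≥0∞ := ENNReal.ofReal (1 / (κ * s' - 1)) ^ (1 / s') with hcf
  set cl : ℝ≥0∞ := ENNReal.ofReal (1 / (1 - κ)) with hcl
  have hcft : cf ≠ ∞ := ENNReal.rpow_ne_top_of_nonneg (by positivity) ENNReal.ofReal_ne_top
  have hclt : cl ≠ ∞ := ENNReal.ofReal_ne_top
  refine ⟨cf + cl + 1, cl, by simp, by simp [hcft, hclt], hclt, fun G hG hG1 l hl => ?_⟩
  set L := ENNReal.ofReal l with hL
  -- With this splitting distance and the threshold θ = l^{q/s}, both discarded contributions scale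
  -- exactly like l, by the relation between q, s and κ.
  set δ : ℝ := l ^ (-q) with hδ
  have hδ0 : 0 < δ := Real.rpow_pos_of_pos hl _
  have hδr : ∀ x : ℝ, ENNReal.ofReal δ ^ x = L ^ (-q * x) := fun x => by
    rw [hδ, ← ENNReal.ofReal_rpow_of_pos hl, ← ENNReal.rpow_mul]
  set θ : ℝ≥0∞ := L ^ (q / s) with hθ
  let k₁ : ℝ → ℝ≥0∞ := (Ioo 0 δ).indicator (fun x => ENNReal.ofReal x ^ (-κ))
  let k₂ : ℝ → ℝ≥0∞ := (Ici δ).indicator (fun x => ENNReal.ofReal x ^ (-κ))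
  have hk₁m : Measurable k₁ := Measurable.indicator (by fun_prop) measurableSet_Ioo
  have hk₂m : Measurable k₂ := Measurable.indicator (by fun_prop) measurableSet_Ici
  let H : ℝ → ℝ≥0∞ := fun τ => if θ < G τ then G τ else 0
  have hHm : Measurable H :=
    Measurable.ite (measurableSet_lt measurable_const hG) hG measurable_const
  have hk : ∀ x, riesz κ x ≤ k₁ x + k₂ x := fun x => by
    simp only [riesz, k₁, k₂, indicator, mem_Ioo, mem_Ici]
    split_ifs with h1 h2 h3 h4 h5 h6 <;> simp
    exact absurd ⟨h1, not_le.1 h4⟩ h2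
  have hk₁i : ∫⁻ x, k₁ x = cl * L ^ (-q * (1 - κ)) := by
    rw [lintegral_indicator measurableSet_Ioo]
    have := lintegral_Ioo_rpow (q := 1 - κ) (by linarith) hδ0
    rw [show 1 - κ - 1 = -κ by ring] at this
    rw [this, hδr]
  have hfar : ∀ t, ∫⁻ τ, k₂ (t - τ) * G τ ≤ cf * L := by
    intro t
    have hm : Measurable (fun τ : ℝ => k₂ (t - τ)) :=
      hk₂m.comp (measurable_const.sub measurable_id)
    refine (lintegral_mul_le_lpn hc.symm hm hG).trans ?_
    have e1 : lpn volume s' (fun τ => k₂ (t - τ)) = cf * L := by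
      unfold lpn
      have e2 : ∫⁻ τ, k₂ (t - τ) ^ s' = ∫⁻ τ, k₂ τ ^ s' :=
        lintegral_sub_left_eq_self (fun τ => k₂ τ ^ s') t
      have e3 : ∫⁻ τ, k₂ τ ^ s' = ∫⁻ τ in Ioi δ, ENNReal.ofReal τ ^ (-(κ * s' - 1) - 1) := by
        rw [setLIntegral_congr Ioi_ae_eq_Ici, ← lintegral_indicator measurableSet_Ici]
        refine lintegral_congr fun τ => ?_
        by_cases h1 : δ ≤ τ
        · simp only [k₂, indicator, mem_Ici, h1, if_true]
          rw [← ENNReal.rpow_mul]; congr 1; ring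
        · simp [k₂, indicator, h1, ENNReal.zero_rpow_of_pos hs'0]
      rw [e2, e3, lintegral_Ioi_rpow hκs hδ0, ENNReal.mul_rpow_of_nonneg _ _ (by positivity), hδr,
        ← ENNReal.rpow_mul]
      have : -q * -(κ * s' - 1) * (1 / s') = 1 := by
        have h1 : q * (κ - 1 / s') = 1 := by
          rw [hinv, show κ - (1 - 1 / s) = 1 / q by linarith, mul_one_div, div_self hq.ne']
        have h3 : -q * -(κ * s' - 1) * (1 / s') = q * (κ - 1 / s') := by field_simp
        rw [h3, h1]
      rw [this, ENNReal.rpow_one]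
    rw [e1]
    have e4 : lpn volume s G ≤ 1 := by
      unfold lpn
      exact ENNReal.rpow_le_one hG1 (by positivity)
    calc cf * L * lpn volume s G ≤ cf * L * 1 := by gcongr
      _ = _ := mul_one _
  have hnear : ∀ t, ∫⁻ τ, k₁ (t - τ) * θ ≤ cl * L := by
    intro t
    have hm : Measurable (fun τ : ℝ => k₁ (t - τ)) := by fun_prop
    rw [lintegral_mul_const _ hm,
      lintegral_sub_left_eq_self (fun τ => k₁ τ) t, hk₁i, mul_assoc, hθ,
      ← ofReal_rpow_add hl]
    refine le_of_eq ?_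
    have : -q * (1 - κ) + q / s = 1 := by
      have h2 : 1 - κ = 1 / s - 1 / q := by linarith
      rw [h2]; field_simp; ring
    rw [this, ENNReal.rpow_one]
  let M : ℝ → ℝ≥0∞ := fun t => ∫⁻ τ, k₁ (t - τ) * H τ
  have hMm2 : Measurable (fun z : ℝ × ℝ => k₁ (z.1 - z.2) * H z.2) :=
    (hk₁m.comp (measurable_fst.sub measurable_snd)).mul (hHm.comp measurable_snd)
  have hMm : Measurable M := hMm2.lintegral_prod_right'
  have hI : ∀ t, fracInt κ G t ≤ cf * L + cl * L + M t := by
    intro t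
    have a1 : Measurable (fun τ : ℝ => k₁ (t - τ)) := hk₁m.comp (measurable_const.sub measurable_id)
    have a2 : Measurable (fun τ : ℝ => k₂ (t - τ)) := hk₂m.comp (measurable_const.sub measurable_id)
    calc fracInt κ G t ≤ ∫⁻ τ, (k₂ (t - τ) * G τ + k₁ (t - τ) * θ + k₁ (t - τ) * H τ) := by
          refine lintegral_mono fun τ => ?_
          have hGH : G τ ≤ θ + H τ := by
            simp only [H]; split_ifs with h1
            · exact le_add_self
            · simpa using h1
          calc riesz κ (t - τ) * G τ ≤ (k₁ (t - τ) + k₂ (t - τ)) * G τ := by gcongr; exact hk _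
            _ = k₂ (t - τ) * G τ + k₁ (t - τ) * G τ := by ring
            _ ≤ k₂ (t - τ) * G τ + k₁ (t - τ) * (θ + H τ) := by gcongr
            _ = _ := by ring
      _ = (∫⁻ τ, k₂ (t - τ) * G τ) + (∫⁻ τ, k₁ (t - τ) * θ) + M t := by
          have a3 : Measurable (fun τ : ℝ => k₂ (t - τ) * G τ) := a2.mul hG
          have a4 : Measurable (fun τ : ℝ => k₂ (t - τ) * G τ + k₁ (t - τ) * θ) :=
            a3.add (a1.mul measurable_const)
          rw [lintegral_add_left a4, lintegral_add_left a3]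
      _ ≤ _ := by gcongr; exacts [hfar t, hnear t]
  have hsub : {t | (cf + cl + 1) * L < fracInt κ G t} ⊆ {t | L ≤ M t} := by
    intro t ht
    by_contra hlt
    simp only [mem_ofPred_eq, not_le] at ht hlt
    refine absurd (ht.trans_le (hI t)) (not_lt.2 ?_)
    calc cf * L + cl * L + M t ≤ cf * L + cl * L + L := by gcongr
      _ = _ := by ring
  have hL0 : L ≠ 0 := (ENNReal.ofReal_pos.2 hl).ne'
  refine (measure_mono hsub).trans ((meas_ge_le_lintegral_div hMm.aemeasurable hL0
    ENNReal.ofReal_ne_top).trans (le_of_eq ?_))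
  have e5 : ∫⁻ t, M t = cl * L ^ (-q * (1 - κ)) * ∫⁻ τ, H τ := by
    rw [lintegral_lintegral_swap hMm2.aemeasurable, ← lintegral_const_mul _ hHm]
    refine lintegral_congr fun τ => ?_
    have hm : Measurable (fun t : ℝ => k₁ (t - τ)) := by fun_prop
    rw [lintegral_mul_const _ hm,
      lintegral_sub_right_eq_self (fun t => k₁ t) τ, hk₁i]
  rw [e5, ENNReal.div_eq_inv_mul, ← ENNReal.rpow_neg_one, ← mul_assoc, mul_left_comm,
    ← ofReal_rpow_add hl]
  congr 3
  have h2 : 1 - κ = 1 / s - 1 / q := by linarith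
  rw [h2]; field_simp; ring

/-- Marcinkiewicz's argument: the level bound is integrated against l^{q-1} dl, and Tonelli
exchanges the integrals over l and τ. -/
theorem fracInt_strong {κ s q : ℝ} (hs : 1 < s) (hκ : κ < 1) (hq : 0 < q)
    (h : 1 / q = 1 / s - (1 - κ)) :
    ∃ C : ℝ≥0∞, C ≠ ∞ ∧ ∀ G : ℝ → ℝ≥0∞, Measurable G → ∫⁻ τ, G τ ^ s ≤ 1 →
      ∫⁻ t, fracInt κ G t ^ q ≤ C := by
  obtain ⟨B, c, hB0, hBt, hct, hlev⟩ := fracInt_level hs hκ hq h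
  have hs0 : 0 < s := by linarith
  have hqs : 0 < q - q / s := by
    have : q / s < q := div_lt_self hq hs
    linarith
  have hqs' : 0 < q / s := by positivity
  refine ⟨B ^ q * (ENNReal.ofReal q * (c * ENNReal.ofReal (1 / (q - q / s)))), ?_,
    fun G hG hG1 => ?_⟩
  · exact ENNReal.mul_ne_top (ENNReal.rpow_ne_top_of_nonneg hq.le hBt)
      (ENNReal.mul_ne_top ENNReal.ofReal_ne_top (ENNReal.mul_ne_top hct ENNReal.ofReal_ne_top))
  have hm : Measurable (fun z : ℝ × ℝ => (if ENNReal.ofReal z.1 ^ (q / s) < G z.2 then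
      ENNReal.ofReal z.1 ^ (q - q / s - 1) * G z.2 else 0 : ℝ≥0∞)) :=
    Measurable.ite (measurableSet_lt (by fun_prop) (by fun_prop)) (by fun_prop) measurable_const
  have e1 : ∫⁻ t, fracInt κ G t ^ q = B ^ q * ∫⁻ t, (fracInt κ G t / B) ^ q := by
    rw [← lintegral_const_mul _ (((measurable_fracInt hG).div_const B).pow_const q)]
    refine lintegral_congr fun t => ?_
    rw [← ENNReal.mul_rpow_of_nonneg _ _ hq.le, ENNReal.mul_div_cancel hB0 hBt]
  rw [e1, lintegral_rpow_layer ((measurable_fracInt hG).div_const B) hq]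
  gcongr
  -- At fixed τ the variable l runs up to G(τ)^{s/q}. The resulting power of G is (s/q)(q - q/s) + 1
  -- = s.
  have inner : ∀ τ, ∫⁻ l in Ioi (0 : ℝ), (if ENNReal.ofReal l ^ (q / s) < G τ then
      ENNReal.ofReal l ^ (q - q / s - 1) * G τ else 0) =
        ENNReal.ofReal (1 / (q - q / s)) * G τ ^ s := by
    intro τ
    have h1 := rpow_eq_lintegral hqs (G τ ^ (1 / (q / s)))
    have h2 : ∀ l : ℝ, (if ENNReal.ofReal l ^ (q / s) < G τ then
      ENNReal.ofReal l ^ (q - q / s - 1) * G τ else 0) = (if ENNReal.ofReal l < G τ ^ (1 / (q / s))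
        then ENNReal.ofReal l ^ (q - q / s - 1) else 0) * G τ := fun l => by
      simp only [ofReal_rpow_lt_iff hqs']
      split_ifs <;> simp
    simp_rw [h2]
    rw [lintegral_mul_const]
    · have h3 : ENNReal.ofReal (1 / (q - q / s)) * (G τ ^ (1 / (q / s))) ^ (q - q / s) * G τ =
          ENNReal.ofReal (1 / (q - q / s)) * G τ ^ s := by
        rw [mul_assoc, ← ENNReal.rpow_mul]
        congr 1
        nth_rewrite 2 [← ENNReal.rpow_one (G τ)]
        rw [← ENNReal.rpow_add_of_nonneg _ _ (by positivity) zero_le_one]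
        congr 1; field_simp; ring
      rw [← h3, h1, ← mul_assoc, ← ENNReal.ofReal_mul (by positivity),
        one_div_mul_cancel hqs.ne']
      simp
    · exact Measurable.ite (measurableSet_lt (by fun_prop) (by fun_prop)) (by fun_prop)
        measurable_const
  calc ∫⁻ l in Ioi (0 : ℝ), ENNReal.ofReal l ^ (q - 1) *
        volume {x | ENNReal.ofReal l < fracInt κ G x / B}
      ≤ ∫⁻ l in Ioi (0 : ℝ), c * ∫⁻ τ, (if ENNReal.ofReal l ^ (q / s) < G τ then
          ENNReal.ofReal l ^ (q - q / s - 1) * G τ else 0) := by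
        refine setLIntegral_mono' measurableSet_Ioi fun l hl => ?_
        have h1 : {x | ENNReal.ofReal l < fracInt κ G x / B} =
            {t | B * ENNReal.ofReal l < fracInt κ G t} := by
          ext t
          simp only [mem_ofPred_eq]
          rw [ENNReal.lt_div_iff_mul_lt (Or.inl hB0) (Or.inl hBt), mul_comm]
        rw [h1]
        calc _ ≤ ENNReal.ofReal l ^ (q - 1) * (c * ENNReal.ofReal l ^ (-(q / s)) *
              ∫⁻ τ, (if ENNReal.ofReal l ^ (q / s) < G τ then G τ else 0)) := by
              gcongr; exact hlev G hG hG1 l hl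
          _ = c * ((ENNReal.ofReal l ^ (q - 1) * ENNReal.ofReal l ^ (-(q / s))) *
              ∫⁻ τ, (if ENNReal.ofReal l ^ (q / s) < G τ then G τ else 0)) := by ring
          _ = _ := by
              rw [← ofReal_rpow_add hl, ← lintegral_const_mul]
              · congr 1
                refine lintegral_congr fun τ => ?_
                rw [show q - 1 + -(q / s) = q - q / s - 1 by ring]
                split_ifs <;> simp
              · exact Measurable.ite (measurableSet_lt measurable_const hG) hG measurable_const
    _ = c * ∫⁻ l in Ioi (0 : ℝ), ∫⁻ τ, (if ENNReal.ofReal l ^ (q / s) < G τ then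
          ENNReal.ofReal l ^ (q - q / s - 1) * G τ else 0) :=
        lintegral_const_mul _ hm.lintegral_prod_right'
    _ = c * (ENNReal.ofReal (1 / (q - q / s)) * ∫⁻ τ, G τ ^ s) := by
        rw [lintegral_lintegral_swap hm.aemeasurable]
        simp_rw [inner]
        rw [lintegral_const_mul _ (hG.pow_const s)]
    _ ≤ c * (ENNReal.ofReal (1 / (q - q / s)) * 1) := by gcongr
    _ = _ := by rw [mul_one]

/-- The Hardy–Littlewood–Sobolev inequality for one-sided fractional integrals on the line. -/
theorem lpn_fracInt_le {κ s q : ℝ} (hs : 1 < s) (hκ : κ < 1) (hq : 0 < q)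
    (h : 1 / q = 1 / s - (1 - κ)) :
    ∃ C : ℝ≥0∞, C ≠ ∞ ∧ ∀ G : ℝ → ℝ≥0∞, Measurable G →
      lpn volume q (fracInt κ G) ≤ C * lpn volume s G := by
  obtain ⟨C, hC, hs'⟩ := fracInt_strong hs hκ hq h
  have hs0 : 0 < s := by linarith
  -- The summand 1 keeps the constant positive, so that the bound is trivially true when the norm of
  -- G is infinite.
  refine ⟨C ^ (1 / q) + 1, by simp [hq.le, hC], fun G hG => ?_⟩
  set N := lpn volume s G with hN
  rcases eq_or_ne N 0 with h0 | h0
  · have : ∀ t, fracInt κ G t = 0 := fun t => by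
      unfold fracInt
      have hm : Measurable (fun τ => riesz κ (t - τ) * G τ) :=
        ((measurable_riesz κ).comp (by fun_prop)).mul hG
      rw [lintegral_eq_zero_iff hm]
      filter_upwards [lpn_eq_zero hs0 hG h0] with τ hτ
      simp [hτ]
    have h2 : fracInt κ G = fun _ => 0 := funext this
    rw [h2, lpn_zero hq]; exact zero_le
  rcases eq_or_ne N ∞ with ht | ht
  · rw [ht, ENNReal.mul_top (by simp)]; exact le_top
  have hNi : N⁻¹ ≠ ∞ := ENNReal.inv_ne_top.2 h0
  have h1 := hs' (fun τ => N⁻¹ * G τ) (hG.const_mul _) (by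
    rw [← lpn_rpow_self hs0, lpn_const_mul hs0 hNi, ← hN, ENNReal.inv_mul_cancel h0 ht]
    simp)
  have h2 : lpn volume q (fracInt κ fun τ => N⁻¹ * G τ) ≤ C ^ (1 / q) :=
    ENNReal.rpow_le_rpow h1 (by positivity)
  have h3 : (fracInt κ fun τ => N⁻¹ * G τ) = fun t => N⁻¹ * fracInt κ G t :=
    funext fun t => fracInt_const_mul hNi G t
  rw [h3, lpn_const_mul hq hNi, mul_comm, ← div_eq_mul_inv, ENNReal.div_le_iff h0 ht] at h2
  exact h2.trans (by gcongr; exact le_self_add)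

end HLS

end FracHeat

namespace FracHeat

/-! ### Time integrals cut where t^{-ρ} crosses a given height. -/

section Levels

theorem ofReal_rpow_neg_lt_iff {ρ : ℝ} (hρ : 0 < ρ) {y t : ℝ} (hy : 0 < y) (ht : 0 < t) :
    ENNReal.ofReal t ^ (-ρ) < ENNReal.ofReal y ↔ y ^ (-1 / ρ) < t := by
  have hY : 0 < y ^ (-1 / ρ) := Real.rpow_pos_of_pos hy _
  have e : y = (y ^ (-1 / ρ)) ^ (-ρ) := by
    rw [← Real.rpow_mul hy.le, show -1 / ρ * -ρ = 1 by field_simp, Real.rpow_one]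
  rw [ENNReal.ofReal_rpow_of_pos ht, ENNReal.ofReal_lt_ofReal_iff hy]
  nth_rewrite 1 [e]
  exact Real.rpow_lt_rpow_iff_of_neg ht hY (by linarith)

/-- The condition under the integral says t > y^{-1/ρ}. This and `lintegral_level_le` evaluate, at a
fixed point x, the time integrals left after Tonelli in the high and low parts of the homogeneous
estimate. -/
theorem lintegral_level_gt {ρ m : ℝ} (hρ : 0 < ρ) (hm : 0 < m) {y : ℝ≥0∞} (hy0 : y ≠ 0)
    (hyt : y ≠ ∞) :
    ∫⁻ t in Ioi (0 : ℝ), (if ENNReal.ofReal t ^ (-ρ) < y then ENNReal.ofReal t ^ (-m - 1) else 0)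
      = ENNReal.ofReal (1 / m) * y ^ (m / ρ) := by
  obtain ⟨y, hy, rfl⟩ : ∃ z : ℝ, 0 < z ∧ ENNReal.ofReal z = y :=
    ⟨y.toReal, ENNReal.toReal_pos hy0 hyt, ENNReal.ofReal_toReal hyt⟩
  have hY : 0 < y ^ (-1 / ρ) := Real.rpow_pos_of_pos hy _
  have h1 : ∫⁻ t in Ioi (0 : ℝ), (if ENNReal.ofReal t ^ (-ρ) < ENNReal.ofReal y then
      ENNReal.ofReal t ^ (-m - 1) else 0) =
      ∫⁻ t in Ioi (y ^ (-1 / ρ)), ENNReal.ofReal t ^ (-m - 1) := by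
    rw [← lintegral_indicator measurableSet_Ioi, ← lintegral_indicator measurableSet_Ioi]
    refine lintegral_congr fun t => ?_
    by_cases h0 : 0 < t
    · by_cases h2 : y ^ (-1 / ρ) < t <;>
        simp [indicator, h0, h2, ofReal_rpow_neg_lt_iff hρ hy h0]
    · have : ¬ y ^ (-1 / ρ) < t := fun h => h0 (hY.trans h)
      simp [indicator, h0, this]
  rw [h1, lintegral_Ioi_rpow hm hY, ← ENNReal.ofReal_rpow_of_pos hy, ← ENNReal.rpow_mul]
  congr 2; field_simp

theorem lintegral_level_le {ρ m : ℝ} (hρ : 0 < ρ) (hm : 0 < m) {y : ℝ≥0∞} (hy0 : y ≠ 0)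
    (hyt : y ≠ ∞) :
    ∫⁻ t in Ioi (0 : ℝ), (if ENNReal.ofReal t ^ (-ρ) < y then 0 else ENNReal.ofReal t ^ (m - 1))
      = ENNReal.ofReal (1 / m) * y ^ (-(m / ρ)) := by
  obtain ⟨y, hy, rfl⟩ : ∃ z : ℝ, 0 < z ∧ ENNReal.ofReal z = y :=
    ⟨y.toReal, ENNReal.toReal_pos hy0 hyt, ENNReal.ofReal_toReal hyt⟩
  have hY : 0 < y ^ (-1 / ρ) := Real.rpow_pos_of_pos hy _
  have h1 : ∫⁻ t in Ioi (0 : ℝ), (if ENNReal.ofReal t ^ (-ρ) < ENNReal.ofReal y then 0 else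
      ENNReal.ofReal t ^ (m - 1)) =
      ∫⁻ t in Ioo 0 (y ^ (-1 / ρ)), ENNReal.ofReal t ^ (m - 1) := by
    rw [setLIntegral_congr Ioo_ae_eq_Ioc,
      ← lintegral_indicator measurableSet_Ioi, ← lintegral_indicator measurableSet_Ioc]
    refine lintegral_congr fun t => ?_
    by_cases h0 : 0 < t
    · by_cases h2 : y ^ (-1 / ρ) < t
      · simp [indicator, h0, h2, ofReal_rpow_neg_lt_iff hρ hy h0]
      · simp [indicator, h0, h2, ofReal_rpow_neg_lt_iff hρ hy h0, not_lt.1 h2]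
    · simp [indicator, h0]
  rw [h1, lintegral_Ioo_rpow hm hY, ← ENNReal.ofReal_rpow_of_pos hy, ← ENNReal.rpow_mul]
  congr 2; field_simp

end Levels

/-! ### Homogeneous and endpoint space-time estimates. -/

section Strichartz

variable {G : Type*} [AddCommGroup G] [MeasurableSpace G] [MeasurableAdd₂ G] [MeasurableNeg G]
  {μ : Measure G} {ν : ℝ} {c : ℝ≥0∞} {k : ℝ → G → ℝ≥0∞}

theorem measurable_pconv_uncurry [SFinite μ] (hk : HeatBound μ ν c k) {β : Type*}
    [MeasurableSpace β] {τ : β → ℝ} (hτ : Measurable τ) {g : β → G → ℝ≥0∞}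
    (hg : Measurable (Function.uncurry g)) :
    Measurable (fun z : β × G => pconv μ k (τ z.1) (g z.1) z.2) := by
  unfold pconv
  have h1 : Measurable (fun z : (β × G) × G => k (τ z.1.1) (z.1.2 - z.2)) :=
    hk.meas.comp ((hτ.comp (measurable_fst.comp measurable_fst)).prodMk
      ((measurable_snd.comp measurable_fst).sub measurable_snd))
  have h2 : Measurable (fun z : (β × G) × G => g z.1.1 z.2) :=
    hg.comp ((measurable_fst.comp measurable_fst).prodMk measurable_snd)
  exact (h1.mul h2).lintegral_prod_right'

variable [SigmaFinite μ] [μ.IsAddLeftInvariant] [μ.IsNegInvariant]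

theorem lintegral_high_le {r l : ℝ≥0∞} {s : ℝ} (hs : 1 ≤ s) (hl0 : l ≠ 0) (hlt : l ≠ ∞)
    (hr : l < r) : r ≤ l ^ (1 - s) * r ^ s := by
  have h1 : l ^ (s - 1) * r ≤ r ^ s := by
    calc l ^ (s - 1) * r ≤ r ^ (s - 1) * r := by gcongr
      _ = r ^ s := c_rpow_mul hs r
  calc r = l ^ (1 - s) * (l ^ (s - 1) * r) := by
        rw [← mul_assoc, ← ENNReal.rpow_add _ _ hl0 hlt]; simp
    _ ≤ _ := by gcongr

/-- The high part in the proof of the homogeneous space-time estimate. -/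
theorem lintegral_high_part {r p q : ℝ} (hν : 0 < ν) (hr : 1 < r) (hq : 1 ≤ q)
    (h : 1 / q = ν * (1 / r - 1 / p)) {φ : G → ℝ≥0∞} (hφ : Measurable φ)
    (hφ1 : ∫⁻ x, φ x ^ r ∂μ ≤ 1) :
    ∫⁻ t in Ioi (0 : ℝ), (ENNReal.ofReal t ^ (-(ν * (1 / 1 - 1 / p))) *
      ∫⁻ x, (if ENNReal.ofReal t ^ (-(ν / r)) < φ x then φ x else 0) ∂μ) ^ q ≤
      ENNReal.ofReal (1 / (ν * (1 - 1 / r))) := by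
  have hr0 : 0 < r := by linarith
  have hq0 : 0 < q := by linarith
  have hρ : 0 < ν / r := by positivity
  have h1r : 0 < 1 - 1 / r := by
    have : 1 / r < 1 := by rw [div_lt_one hr0]; exact hr
    linarith
  have hm : 0 < ν * (1 - 1 / r) := by positivity
  have hφt : ∀ᵐ x ∂μ, φ x < ∞ :=
    lpn_ae_lt_top hr0 hφ (ENNReal.rpow_ne_top_of_nonneg (by positivity)
      (ne_top_of_le_ne_top ENNReal.one_ne_top hφ1))
  have hmeas : Measurable (fun z : ℝ × G => (if ENNReal.ofReal z.1 ^ (-(ν / r)) < φ z.2 then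
      ENNReal.ofReal z.1 ^ (-(ν * (1 - 1 / r)) - 1) * φ z.2 else 0 : ℝ≥0∞)) :=
    Measurable.ite (measurableSet_lt (by fun_prop) (by fun_prop)) (by fun_prop) measurable_const
  calc _ ≤ ∫⁻ t in Ioi (0 : ℝ), ∫⁻ x, (if ENNReal.ofReal t ^ (-(ν / r)) < φ x then
      ENNReal.ofReal t ^ (-(ν * (1 - 1 / r)) - 1) * φ x else 0) ∂μ := by
        refine setLIntegral_mono' measurableSet_Ioi fun t ht => ?_
        have ht : 0 < t := ht
        set T := ENNReal.ofReal t
        set J := ∫⁻ x, (if T ^ (-(ν / r)) < φ x then φ x else 0) ∂μ with hJ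
        -- On the set of integration φ is at most T^{-(ν/r)(1-r)} φ^r. This controls the factor
        -- J^{q-1}; the remaining factor J stays linear, so that Tonelli can be applied.
        have hJle : J ≤ T ^ (-(ν / r) * (1 - r)) := by
          calc J ≤ ∫⁻ x, T ^ (-(ν / r) * (1 - r)) * φ x ^ r ∂μ := by
                refine lintegral_mono fun x => ?_
                split_ifs with hx
                · rw [ENNReal.rpow_mul]
                  exact lintegral_high_le hr.le (ofReal_rpow_ne_zero ht _)
                    (ofReal_rpow_ne_top ht _) hx
                · exact zero_le
            _ ≤ T ^ (-(ν / r) * (1 - r)) * 1 := by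
                rw [lintegral_const_mul _ (hφ.pow_const r)]; gcongr
            _ = _ := mul_one _
        calc (T ^ (-(ν * (1 / 1 - 1 / p))) * J) ^ q
            = T ^ (-(ν * (1 / 1 - 1 / p)) * q) * (J ^ (q - 1) * J) := by
              rw [ENNReal.mul_rpow_of_nonneg _ _ hq0.le, ← ENNReal.rpow_mul, c_rpow_mul hq]
          _ ≤ T ^ (-(ν * (1 / 1 - 1 / p)) * q) * ((T ^ (-(ν / r) * (1 - r))) ^ (q - 1) * J) := by
              gcongr
          _ = T ^ (-(ν * (1 - 1 / r)) - 1) * J := by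
              rw [← ENNReal.rpow_mul, ← mul_assoc, ← ofReal_rpow_add ht]
              congr 2
              have h2 : q * (ν * (1 / r - 1 / p)) = 1 := by rw [← h]; field_simp
              have e : -(ν / r) * (1 - r) * (q - 1) = ν * (1 - 1 / r) * (q - 1) := by
                field_simp; ring
              rw [e]
              linear_combination -h2
          _ = _ := by
              rw [hJ, ← lintegral_const_mul]
              · refine lintegral_congr fun x => ?_
                split_ifs <;> simp
              · exact Measurable.ite (measurableSet_lt measurable_const hφ) hφ measurable_const
    _ = ∫⁻ x, (∫⁻ t in Ioi (0 : ℝ), (if ENNReal.ofReal t ^ (-(ν / r)) < φ x then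
      ENNReal.ofReal t ^ (-(ν * (1 - 1 / r)) - 1) * φ x else 0)) ∂μ :=
        lintegral_lintegral_swap hmeas.aemeasurable
    _ ≤ ∫⁻ x, ENNReal.ofReal (1 / (ν * (1 - 1 / r))) * φ x ^ r ∂μ := by
        refine lintegral_mono_ae ?_
        filter_upwards [hφt] with x hx
        rcases eq_or_ne (φ x) 0 with h0 | h0
        · simp [h0]
        have e : ∀ t : ℝ, (if ENNReal.ofReal t ^ (-(ν / r)) < φ x then
            ENNReal.ofReal t ^ (-(ν * (1 - 1 / r)) - 1) * φ x else 0) =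
            (if ENNReal.ofReal t ^ (-(ν / r)) < φ x then
            ENNReal.ofReal t ^ (-(ν * (1 - 1 / r)) - 1) else 0) * φ x := fun t => by
          split_ifs <;> simp
        simp_rw [e]
        rw [lintegral_mul_const' _ _ hx.ne, lintegral_level_gt hρ hm h0 hx.ne, mul_assoc,
          show ν * (1 - 1 / r) / (ν / r) = r - 1 by field_simp, c_rpow_mul hr.le]
    _ ≤ ENNReal.ofReal (1 / (ν * (1 - 1 / r))) * 1 := by
        rw [lintegral_const_mul _ (hφ.pow_const r)]; gcongr
    _ = _ := mul_one _

/-- The low part in the proof of the homogeneous space-time estimate. -/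
theorem lintegral_low_part {r r₂ p q : ℝ} (hν : 0 < ν) (hr : 1 < r) (hr₂ : r < r₂) (hq : r₂ ≤ q)
    (h : 1 / q = ν * (1 / r - 1 / p)) {φ : G → ℝ≥0∞} (hφ : Measurable φ)
    (hφ1 : ∫⁻ x, φ x ^ r ∂μ ≤ 1) :
    ∫⁻ t in Ioi (0 : ℝ), (ENNReal.ofReal t ^ (-(ν * (1 / r₂ - 1 / p))) *
      lpn μ r₂ (fun x => if ENNReal.ofReal t ^ (-(ν / r)) < φ x then 0 else φ x)) ^ q ≤
      ENNReal.ofReal (1 / (ν * (r₂ / r - 1))) := by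
  have hr0 : 0 < r := by linarith
  have hr₂0 : 0 < r₂ := by linarith
  have hq0 : 0 < q := by linarith
  have hρ : 0 < ν / r := by positivity
  have h1r : 0 < r₂ / r - 1 := by
    have : 1 < r₂ / r := by rw [one_lt_div hr0]; exact hr₂
    linarith
  have hqr : 1 ≤ q / r₂ := by rw [one_le_div hr₂0]; exact hq
  have hm : 0 < ν * (r₂ / r - 1) := by positivity
  have hφt : ∀ᵐ x ∂μ, φ x < ∞ :=
    lpn_ae_lt_top hr0 hφ (ENNReal.rpow_ne_top_of_nonneg (by positivity)
      (ne_top_of_le_ne_top ENNReal.one_ne_top hφ1))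
  have hmeas : Measurable (fun z : ℝ × G => (if ENNReal.ofReal z.1 ^ (-(ν / r)) < φ z.2 then
      0 else ENNReal.ofReal z.1 ^ (ν * (r₂ / r - 1) - 1) * φ z.2 ^ r₂ : ℝ≥0∞)) :=
    Measurable.ite (measurableSet_lt (by fun_prop) (by fun_prop)) measurable_const (by fun_prop)
  calc _ ≤ ∫⁻ t in Ioi (0 : ℝ), ∫⁻ x, (if ENNReal.ofReal t ^ (-(ν / r)) < φ x then 0 else
      ENNReal.ofReal t ^ (ν * (r₂ / r - 1) - 1) * φ x ^ r₂) ∂μ := by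
        refine setLIntegral_mono' measurableSet_Ioi fun t ht => ?_
        have ht : 0 < t := ht
        set T := ENNReal.ofReal t
        have hφ2m : Measurable (fun x => if T ^ (-(ν / r)) < φ x then 0 else φ x) :=
          Measurable.ite (measurableSet_lt measurable_const hφ) measurable_const hφ
        set J := ∫⁻ x, (if T ^ (-(ν / r)) < φ x then 0 else φ x) ^ r₂ ∂μ with hJ
        -- Where φ ≤ T^{-ν/r}, the excess power r₂ - r of φ is a power of time. The factor
        -- J^{q/r₂-1} is bounded by it, which needs r₂ ≤ q, and the last factor J is kept for
        -- Tonelli.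
        have hJle : J ≤ T ^ (-(ν / r) * (r₂ - r)) := by
          calc J ≤ ∫⁻ x, T ^ (-(ν / r) * (r₂ - r)) * φ x ^ r ∂μ := by
                refine lintegral_mono fun x => ?_
                split_ifs with hx
                · simp [ENNReal.zero_rpow_of_pos hr₂0]
                · rw [ENNReal.rpow_mul]
                  calc φ x ^ r₂ = φ x ^ (r₂ - r) * φ x ^ r := by
                        rw [← ENNReal.rpow_add_of_nonneg _ _ (by linarith) hr0.le]; congr 1; ring
                    _ ≤ _ := by
                        gcongr
                        exact not_lt.1 hx
            _ ≤ T ^ (-(ν / r) * (r₂ - r)) * 1 := by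
                rw [lintegral_const_mul _ (hφ.pow_const r)]; gcongr
            _ = _ := mul_one _
        calc _ = T ^ (-(ν * (1 / r₂ - 1 / p)) * q) * (J ^ (q / r₂ - 1) * J) := by
              rw [ENNReal.mul_rpow_of_nonneg _ _ hq0.le, ← ENNReal.rpow_mul, c_rpow_mul hqr]
              congr 1
              unfold lpn
              rw [← ENNReal.rpow_mul]; congr 1; ring
          _ ≤ T ^ (-(ν * (1 / r₂ - 1 / p)) * q) *
                ((T ^ (-(ν / r) * (r₂ - r))) ^ (q / r₂ - 1) * J) := by
              gcongr
          _ = T ^ (ν * (r₂ / r - 1) - 1) * J := by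
              rw [← ENNReal.rpow_mul, ← mul_assoc, ← ofReal_rpow_add ht]
              congr 2
              have h2 : q * (ν * (1 / r - 1 / p)) = 1 := by rw [← h]; field_simp
              have e : -(ν / r) * (r₂ - r) * (q / r₂ - 1) =
                -(ν * q / r) + ν * q / r₂ + ν * r₂ / r - ν := by
                field_simp; ring
              rw [e]
              linear_combination -h2
          _ = _ := by
              rw [hJ, ← lintegral_const_mul _ (hφ2m.pow_const r₂)]
              refine lintegral_congr fun x => ?_
              split_ifs <;> simp [ENNReal.zero_rpow_of_pos hr₂0]
    _ = ∫⁻ x, (∫⁻ t in Ioi (0 : ℝ), (if ENNReal.ofReal t ^ (-(ν / r)) < φ x then 0 else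
      ENNReal.ofReal t ^ (ν * (r₂ / r - 1) - 1) * φ x ^ r₂)) ∂μ :=
        lintegral_lintegral_swap hmeas.aemeasurable
    _ ≤ ∫⁻ x, ENNReal.ofReal (1 / (ν * (r₂ / r - 1))) * φ x ^ r ∂μ := by
        refine lintegral_mono_ae ?_
        filter_upwards [hφt] with x hx
        rcases eq_or_ne (φ x) 0 with h0 | h0
        · simp [h0, ENNReal.zero_rpow_of_pos hr₂0]
        have e : ∀ t : ℝ, (if ENNReal.ofReal t ^ (-(ν / r)) < φ x then 0 else
            ENNReal.ofReal t ^ (ν * (r₂ / r - 1) - 1) * φ x ^ r₂) =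
            (if ENNReal.ofReal t ^ (-(ν / r)) < φ x then 0 else
            ENNReal.ofReal t ^ (ν * (r₂ / r - 1) - 1)) * φ x ^ r₂ := fun t => by
          split_ifs <;> simp
        simp_rw [e]
        rw [lintegral_mul_const' _ _ (ENNReal.rpow_ne_top_of_nonneg hr₂0.le hx.ne),
          lintegral_level_le hρ hm h0 hx.ne, mul_assoc, ← ENNReal.rpow_add _ _ h0 hx.ne]
        refine le_of_eq ?_
        congr 2
        field_simp; ring
    _ ≤ ENNReal.ofReal (1 / (ν * (r₂ / r - 1))) * 1 := by
        rw [lintegral_const_mul _ (hφ.pow_const r)]; gcongr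
    _ = _ := mul_one _

/-- The homogeneous space-time estimate: `t ↦ ‖k t * φ‖_p` is in `L^q(0, ∞)` for `φ ∈ L^r` if
`1/q = ν (1/r - 1/p)` and `r < q`. -/
theorem lpn_lpn_pconv_le (hk : HeatBound μ ν c k) {r p q : ℝ} (hν : 0 < ν) (hr : 1 < r)
    (hrp : r < p) (hrq : r < q) (h : 1 / q = ν * (1 / r - 1 / p)) :
    ∃ C : ℝ≥0∞, C ≠ ∞ ∧ ∀ φ : G → ℝ≥0∞, Measurable φ →
      lpn (volume.restrict (Ioi 0)) q (fun t => lpn μ p (pconv μ k t φ)) ≤ C * lpn μ r φ := by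
  have hr0 : 0 < r := by linarith
  have hp0 : 0 < p := by linarith
  have hq0 : 0 < q := by linarith
  -- The exponent must be at most p for the smoothing estimate into L^p, at most q for the low part,
  -- and above r for the time integral to converge at 0.
  set r₂ := min p q with hr₂
  have hrr₂ : r < r₂ := lt_min hrp hrq
  have hc := hk.ne_top
  set D₁ := ENNReal.ofReal (1 / (ν * (1 - 1 / r)))
  set D₂ := ENNReal.ofReal (1 / (ν * (r₂ / r - 1)))
  have key : ∀ φ : G → ℝ≥0∞, Measurable φ → ∫⁻ x, φ x ^ r ∂μ ≤ 1 →
      lpn (volume.restrict (Ioi 0)) q (fun t => lpn μ p (pconv μ k t φ)) ≤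
        c * D₁ ^ (1 / q) + c * D₂ ^ (1 / q) := by
    intro φ hφ hφ1
    -- The cut at height t^{-ν/r} moves with time. The high part is smoothed from L¹ and the low
    -- part from L^{r₂}.
    let φ₁ : ℝ → G → ℝ≥0∞ := fun t x => if ENNReal.ofReal t ^ (-(ν / r)) < φ x then φ x else 0
    let φ₂ : ℝ → G → ℝ≥0∞ := fun t x => if ENNReal.ofReal t ^ (-(ν / r)) < φ x then 0 else φ x
    have hs : MeasurableSet {z : ℝ × G | ENNReal.ofReal z.1 ^ (-(ν / r)) < φ z.2} :=
      measurableSet_lt (by fun_prop) (by fun_prop)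
    have hm₁ : Measurable (Function.uncurry φ₁) :=
      Measurable.ite hs (hφ.comp measurable_snd) measurable_const
    have hm₂ : Measurable (Function.uncurry φ₂) :=
      Measurable.ite hs measurable_const (hφ.comp measurable_snd)
    have hm₁' : ∀ t, Measurable (φ₁ t) := fun t => hm₁.comp measurable_prodMk_left
    have hm₂' : ∀ t, Measurable (φ₂ t) := fun t => hm₂.comp measurable_prodMk_left
    let F₁ : ℝ → ℝ≥0∞ := fun t => ENNReal.ofReal t ^ (-(ν * (1 / 1 - 1 / p))) * ∫⁻ x, φ₁ t x ∂μ
    let F₂ : ℝ → ℝ≥0∞ := fun t => ENNReal.ofReal t ^ (-(ν * (1 / r₂ - 1 / p))) * lpn μ r₂ (φ₂ t)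
    have hF₁ : Measurable F₁ := Measurable.mul (by fun_prop) hm₁.lintegral_prod_right'
    have hF₂ : Measurable F₂ := Measurable.mul (by fun_prop) (measurable_lpn hm₂)
    calc _ ≤ lpn (volume.restrict (Ioi 0)) q (fun t => c * F₁ t + c * F₂ t) := by
          refine lpn_mono_ae hq0 ?_
          filter_upwards [ae_restrict_mem measurableSet_Ioi] with t ht
          have hsum : φ = fun x => φ₁ t x + φ₂ t x := by
            funext x
            simp only [φ₁, φ₂]; split_ifs <;> simp
          calc lpn μ p (pconv μ k t φ)
              = lpn μ p (fun x => pconv μ k t (φ₁ t) x + pconv μ k t (φ₂ t) x) := by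
                congr 1; funext x
                rw [← pconv_add hk (hm₁' t)]; congr 1
            _ ≤ _ := lpn_add_le (by linarith) (measurable_pconv hk (hm₁' t))
                (measurable_pconv hk (hm₂' t))
            _ ≤ _ := by
                gcongr
                · have := lpn_pconv_le hk ht le_rfl (by linarith : 1 ≤ p) (hm₁' t)
                  rw [lpn_one, mul_assoc] at this
                  exact this
                · have := lpn_pconv_le hk ht (by linarith) (min_le_left p q) (hm₂' t)
                  rw [mul_assoc] at this
                  exact this
      _ ≤ c * lpn (volume.restrict (Ioi 0)) q F₁ + c * lpn (volume.restrict (Ioi 0)) q F₂ := by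
          refine (lpn_add_le (by linarith) (hF₁.const_mul c) (hF₂.const_mul c)).trans_eq ?_
          rw [lpn_const_mul hq0 hc, lpn_const_mul hq0 hc]
      _ ≤ _ := by
          gcongr
          · exact ENNReal.rpow_le_rpow (lintegral_high_part hν hr (by linarith) h hφ hφ1)
              (by positivity)
          · exact ENNReal.rpow_le_rpow (lintegral_low_part hν hr hrr₂ (min_le_right _ _) h hφ hφ1)
              (by positivity)
  set C := c * D₁ ^ (1 / q) + c * D₂ ^ (1 / q)
  have hC : C ≠ ∞ := ENNReal.add_ne_top.2
    ⟨ENNReal.mul_ne_top hc (ENNReal.rpow_ne_top_of_nonneg (by positivity) ENNReal.ofReal_ne_top),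
     ENNReal.mul_ne_top hc (ENNReal.rpow_ne_top_of_nonneg (by positivity) ENNReal.ofReal_ne_top)⟩
  -- The summand 1 again serves data of infinite norm; data of positive finite norm are normalized.
  refine ⟨C + 1, by simp [hC], fun φ hφ => ?_⟩
  set N := lpn μ r φ with hN
  rcases eq_or_ne N 0 with h0 | h0
  · have h1 : ∀ t x, pconv μ k t φ x = 0 := fun t x => by
      have hm : Measurable (fun y => k t (x - y) * φ y) := (hk.meas_sub_left t x).mul hφ
      unfold pconv
      rw [lintegral_eq_zero_iff hm]
      filter_upwards [lpn_eq_zero hr0 hφ h0] with y hy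
      simp [hy]
    have h2 : (fun t => lpn μ p (pconv μ k t φ)) = fun _ => 0 := by
      funext t
      rw [show pconv μ k t φ = fun _ => 0 from funext (h1 t), lpn_zero hp0]
    rw [h2, lpn_zero hq0]; exact zero_le
  rcases eq_or_ne N ∞ with ht | ht
  · rw [ht, ENNReal.mul_top (by simp)]; exact le_top
  have hNi : N⁻¹ ≠ ∞ := ENNReal.inv_ne_top.2 h0
  have h1 := key (fun x => N⁻¹ * φ x) (hφ.const_mul _) (by
    rw [← lpn_rpow_self hr0, lpn_const_mul hr0 hNi, ← hN, ENNReal.inv_mul_cancel h0 ht]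
    simp)
  have h3 : (fun t => lpn μ p (pconv μ k t fun x => N⁻¹ * φ x)) =
      fun t => N⁻¹ * lpn μ p (pconv μ k t φ) := funext fun t => by
    rw [← lpn_const_mul hp0 hNi]
    congr 1; funext x; exact pconv_const_mul hNi _ x
  rw [h3, lpn_const_mul hq0 hNi, mul_comm, ← div_eq_mul_inv, ENNReal.div_le_iff h0 ht] at h1
  exact h1.trans (by gcongr; exact le_self_add)

/-- The positive Duhamel integral `∫_s^t k(t-τ) * g(τ) dτ`. -/
def pduh (μ : Measure G) (k : ℝ → G → ℝ≥0∞) (s : ℝ) (g : ℝ → G → ℝ≥0∞) (t : ℝ) (x : G) : ℝ≥0∞ :=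
  ∫⁻ τ in Ioo s t, pconv μ k (t - τ) (g τ) x

theorem pduh_mono {s t : ℝ} {g g' : ℝ → G → ℝ≥0∞} (h : ∀ τ ∈ Ioo s t, ∀ x, g τ x ≤ g' τ x) (x : G) :
    pduh μ k s g t x ≤ pduh μ k s g' t x :=
  setLIntegral_mono' measurableSet_Ioo fun τ hτ => pconv_mono (h τ hτ) x

theorem measurable_pduh_uncurry (hk : HeatBound μ ν c k) (s : ℝ) {g : ℝ → G → ℝ≥0∞}
    (hg : Measurable (Function.uncurry g)) :
    Measurable (Function.uncurry (pduh μ k s g)) := by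
  have h1 : ∀ t x, pduh μ k s g t x =
      ∫⁻ τ, (if s < τ ∧ τ < t then pconv μ k (t - τ) (g τ) x else 0) := fun t x => by
    unfold pduh
    rw [← lintegral_indicator measurableSet_Ioo]
    refine lintegral_congr fun τ => ?_
    simp [indicator]
  have h2 : Measurable (fun z : (ℝ × G) × ℝ => pconv μ k (z.1.1 - z.2) (g z.2) z.1.2) := by
    have h3 := measurable_pconv_uncurry (μ := μ) hk (β := ℝ × ℝ) (τ := fun z => z.1 - z.2)
      (by fun_prop) (g := fun z => g z.2)
      (hg.comp ((measurable_snd.comp measurable_fst).prodMk measurable_snd))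
    exact h3.comp (((measurable_fst.comp measurable_fst).prodMk measurable_snd).prodMk
      (measurable_snd.comp measurable_fst))
  have h4 : Function.uncurry (pduh μ k s g) = fun z : ℝ × G => ∫⁻ τ,
      (if s < τ ∧ τ < z.1 then pconv μ k (z.1 - τ) (g τ) z.2 else 0) :=
    funext fun z => h1 z.1 z.2
  rw [h4]
  refine Measurable.lintegral_prod_right' (f := fun z : (ℝ × G) × ℝ =>
    (if s < z.2 ∧ z.2 < z.1.1 then pconv μ k (z.1.1 - z.2) (g z.2) z.1.2 else 0)) ?_
  refine Measurable.ite ?_ h2 measurable_const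
  exact (measurableSet_lt measurable_const measurable_snd).inter
    (measurableSet_lt measurable_snd (measurable_fst.comp measurable_fst))

theorem measurable_pduh (hk : HeatBound μ ν c k) (s : ℝ) {g : ℝ → G → ℝ≥0∞}
    (hg : Measurable (Function.uncurry g)) (t : ℝ) : Measurable (pduh μ k s g t) :=
  (measurable_pduh_uncurry hk s hg).comp measurable_prodMk_left

theorem measurable_pconv_sub (hk : HeatBound μ ν c k) {g : ℝ → G → ℝ≥0∞}
    (hg : Measurable (Function.uncurry g)) (t : ℝ) :
    Measurable (Function.uncurry fun τ => pconv μ k (t - τ) (g τ)) :=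
  measurable_pconv_uncurry hk (τ := fun τ => t - τ) (by fun_prop) hg

theorem lpn_pduh_le (hk : HeatBound μ ν c k) (s t : ℝ) {g : ℝ → G → ℝ≥0∞}
    (hg : Measurable (Function.uncurry g)) {p : ℝ} (hp : 1 ≤ p) :
    lpn μ p (pduh μ k s g t) ≤ ∫⁻ τ in Ioo s t, lpn μ p (pconv μ k (t - τ) (g τ)) :=
  lpn_lintegral_le (ν := volume.restrict (Ioo s t)) hp (measurable_pconv_sub hk hg t)

/-- The endpoint (`L^∞` in time) inhomogeneous estimate, dual to the homogeneous one. -/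
theorem lpn_pduh_endpoint (hk : HeatBound μ ν c k) {r a Q : ℝ} (hν : 0 < ν) (ha : 1 < a)
    (har : a < r) (hQ : 1 < Q) (hQr : Q < r) (h : 1 / Q = 1 - ν * (1 / a - 1 / r)) :
    ∃ C : ℝ≥0∞, C ≠ ∞ ∧ ∀ (s t : ℝ) (g : ℝ → G → ℝ≥0∞), Measurable (Function.uncurry g) →
      lpn μ r (pduh μ k s g t) ≤
        C * lpn (volume.restrict (Ioo s t)) Q (fun τ => lpn μ a (g τ)) := by
  have hr : 1 < r := ha.trans har
  have ca := Real.HolderConjugate.conjExponent ha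
  have cr := Real.HolderConjugate.conjExponent hr
  have cQ := Real.HolderConjugate.conjExponent hQ
  set a' := Real.conjExponent a
  set r' := Real.conjExponent r
  set Q' := Real.conjExponent Q
  have ia : 1 / a' = 1 - 1 / a := by have := ca.inv_add_inv_eq_one; simp only [one_div]; linarith
  have ir : 1 / r' = 1 - 1 / r := by have := cr.inv_add_inv_eq_one; simp only [one_div]; linarith
  have iQ : 1 / Q' = 1 - 1 / Q := by have := cQ.inv_add_inv_eq_one; simp only [one_div]; linarith
  have hlt1 : r' < a' := by
    rw [← one_div_lt_one_div ca.symm.pos cr.symm.pos, ia, ir]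
    have := one_div_lt_one_div_of_lt ca.pos har
    linarith
  have hlt2 : r' < Q' := by
    rw [← one_div_lt_one_div cQ.symm.pos cr.symm.pos, iQ, ir]
    have := one_div_lt_one_div_of_lt cQ.pos hQr
    linarith
  -- The conjugate exponents satisfy 1/Q' = ν(1/r' - 1/a'), the scaling of the homogeneous estimate
  -- from L^{r'} to L^{Q'}_t L^{a'}_x. The conditions a < r and Q < r become r' < a' and r' < Q'.
  obtain ⟨C, hC, hhom⟩ := lpn_lpn_pconv_le hk hν cr.symm.lt hlt1 hlt2
    (by rw [iQ, ir, ia, h]; ring)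
  refine ⟨C, hC, fun s t g hg => lpn_le_of_dual cr (measurable_pduh hk s hg t) fun ψ hψ => ?_⟩
  have hg' : ∀ τ, Measurable (g τ) := fun τ => hg.comp measurable_prodMk_left
  have hm1 := measurable_pconv_sub hk hg t
  have hm2 : Measurable (Function.uncurry fun τ => pconv μ k (t - τ) ψ) :=
    measurable_pconv_uncurry hk (τ := fun τ => t - τ) (by fun_prop) (g := fun _ => ψ)
      (hψ.comp measurable_snd)
  calc ∫⁻ x, pduh μ k s g t x * ψ x ∂μ
      = ∫⁻ x, (∫⁻ τ in Ioo s t, pconv μ k (t - τ) (g τ) x * ψ x) ∂μ := by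
        refine lintegral_congr fun x => ?_
        unfold pduh
        rw [lintegral_mul_const]
        exact hm1.comp measurable_prodMk_right
    _ = ∫⁻ τ in Ioo s t, ∫⁻ x, pconv μ k (t - τ) (g τ) x * ψ x ∂μ := by
        rw [lintegral_lintegral_swap]
        exact ((hm1.comp measurable_swap).mul (hψ.comp measurable_fst)).aemeasurable
    _ = ∫⁻ τ in Ioo s t, ∫⁻ x, g τ x * pconv μ k (t - τ) ψ x ∂μ :=
        lintegral_congr fun τ => lintegral_pconv_mul hk (hg' τ) hψ
    _ ≤ ∫⁻ τ in Ioo s t, lpn μ a (g τ) * lpn μ a' (pconv μ k (t - τ) ψ) :=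
        lintegral_mono fun τ => lintegral_mul_le_lpn ca (hg' τ) (measurable_pconv hk hψ)
    _ ≤ lpn (volume.restrict (Ioo s t)) Q (fun τ => lpn μ a (g τ)) *
          lpn (volume.restrict (Ioo s t)) Q' (fun τ => lpn μ a' (pconv μ k (t - τ) ψ)) :=
        lintegral_mul_le_lpn cQ (measurable_lpn hg) (measurable_lpn hm2)
    _ ≤ lpn (volume.restrict (Ioo s t)) Q (fun τ => lpn μ a (g τ)) * (C * lpn μ r' ψ) := by
        gcongr
        refine le_trans ?_ (hhom ψ hψ)
        unfold lpn
        refine ENNReal.rpow_le_rpow ?_ (one_div_nonneg.2 cQ.symm.pos.le)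
        rw [← lintegral_indicator measurableSet_Ioo, ← lintegral_indicator measurableSet_Ioi,
          ← lintegral_sub_left_eq_self _ t]
        refine lintegral_mono fun τ => ?_
        by_cases h1 : t - τ ∈ Ioo s t
        · have h2 : τ ∈ Ioi (0 : ℝ) := by simp only [mem_Ioi]; linarith [h1.2]
          simp [h1, h2]
        · simp [h1]
    _ = _ := by ring

end Strichartz

end FracHeat

namespace FracHeat

/-! ### The mixed norms of L^q_t L^p_x. -/

section Mixed

variable {G : Type*} [MeasurableSpace G] {μ : Measure G}

/-- The `L^q(I; L^p)` norm. -/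
def mixed (μ : Measure G) (I : Set ℝ) (q p : ℝ) (U : ℝ → G → ℝ≥0∞) : ℝ≥0∞ :=
  lpn (volume.restrict I) q (fun t => lpn μ p (U t))

theorem mixed_mono {I : Set ℝ} (hI : MeasurableSet I) {q p : ℝ} (hq : 0 < q) (hp : 0 < p)
    {U V : ℝ → G → ℝ≥0∞} (h : ∀ t ∈ I, ∀ x, U t x ≤ V t x) : mixed μ I q p U ≤ mixed μ I q p V := by
  refine lpn_mono_ae hq ?_
  filter_upwards [ae_restrict_mem hI] with t ht using lpn_mono hp (h t ht)

theorem mixed_mono_set {I J : Set ℝ} (hIJ : I ⊆ J) {q p : ℝ} (hq : 0 < q)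
    (U : ℝ → G → ℝ≥0∞) : mixed μ I q p U ≤ mixed μ J q p U :=
  lpn_mono_measure hq (Measure.restrict_mono hIJ le_rfl) _

theorem mixed_add_le [SFinite μ] {I : Set ℝ} {q p : ℝ} (hq : 1 ≤ q) (hp : 1 ≤ p)
    {U V : ℝ → G → ℝ≥0∞} (hU : Measurable (Function.uncurry U))
    (hV : Measurable (Function.uncurry V)) :
    mixed μ I q p (fun t x => U t x + V t x) ≤ mixed μ I q p U + mixed μ I q p V := by
  refine le_trans (lpn_mono (by linarith) fun t => ?_)
    (lpn_add_le hq (measurable_lpn hU) (measurable_lpn hV))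
  exact lpn_add_le hp (hU.comp measurable_prodMk_left) (hV.comp measurable_prodMk_left)

theorem mixed_const_mul {I : Set ℝ} {q p : ℝ} (hq : 0 < q) (hp : 0 < p) {C : ℝ≥0∞} (hC : C ≠ ∞)
    (U : ℝ → G → ℝ≥0∞) : mixed μ I q p (fun t x => C * U t x) = C * mixed μ I q p U := by
  unfold mixed
  rw [← lpn_const_mul hq hC]
  congr 1; funext t
  exact lpn_const_mul hp hC _

theorem mixed_tsum_le [SigmaFinite μ] {I : Set ℝ} {q p : ℝ} (hq : 1 ≤ q) (hp : 1 ≤ p)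
    {U : ℕ → ℝ → G → ℝ≥0∞} (hU : ∀ j, Measurable (Function.uncurry (U j))) :
    mixed μ I q p (fun t x => ∑' j, U j t x) ≤ ∑' j, mixed μ I q p (U j) := by
  refine le_trans (lpn_mono (by linarith) fun t => ?_)
    (lpn_tsum_le hq fun j => measurable_lpn (hU j))
  exact lpn_tsum_le hp fun j => (hU j).comp measurable_prodMk_left

theorem mixed_ae_lt_top [SFinite μ] {I : Set ℝ} {q p : ℝ} (hq : 0 < q) (hp : 0 < p)
    {U : ℝ → G → ℝ≥0∞} (hU : Measurable (Function.uncurry U)) (h : mixed μ I q p U ≠ ∞) :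
    ∀ᵐ z ∂((volume.restrict I).prod μ), U z.1 z.2 < ∞ := by
  refine (Measure.ae_prod_iff_ae_ae (measurableSet_lt hU measurable_const)).2 ?_
  filter_upwards [lpn_ae_lt_top hq (measurable_lpn hU) h] with t ht
  exact lpn_ae_lt_top hp (hU.comp measurable_prodMk_left) ht.ne

/-- Hölder's inequality in space for `U^b W`. -/
theorem lpn_rpow_mul_le {p b : ℝ} (hb : 0 < b) (hp : 0 < p) {U W : G → ℝ≥0∞}
    (hU : Measurable U) (hW : Measurable W) :
    lpn μ (p / (b + 1)) (fun x => U x ^ b * W x) ≤ lpn μ p U ^ b * lpn μ p W := by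
  have := lpn_mul_le (μ := μ) (a := p / (b + 1)) (p := p / b) (q := p) (by positivity)
    (by positivity) hp (by field_simp) (hU.pow_const b) hW
  rwa [lpn_rpow (by positivity) hb, div_mul_cancel₀ _ hb.ne'] at this

theorem lpn_rpow_add_one {p b : ℝ} (hb : 0 < b) (hp : 0 < p) (U : G → ℝ≥0∞) :
    lpn μ (p / (b + 1)) (fun x => U x ^ (b + 1)) = lpn μ p U ^ (b + 1) := by
  rw [lpn_rpow (by positivity) (by positivity), div_mul_cancel₀]
  positivity

end Mixed

/-! ### Estimates for the Duhamel integral in mixed norms. -/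

section Inhomogeneous

variable {G : Type*} [AddCommGroup G] [MeasurableSpace G] [MeasurableAdd₂ G] [MeasurableNeg G]
  {μ : Measure G} {ν : ℝ} {c : ℝ≥0∞} {k : ℝ → G → ℝ≥0∞}
  [SigmaFinite μ] [μ.IsAddLeftInvariant] [μ.IsNegInvariant]

/-- The inhomogeneous space-time estimate. The constant `A` bounds `σ^{κ' - κ}` for the relevant
time differences `σ`. -/
theorem mixed_pduh_le (hk : HeatBound μ ν c k) {a p s₁ q κ' : ℝ} (ha : 1 ≤ a) (hap : a ≤ p)
    (hs₁ : 1 < s₁) (hq : 0 < q) (hκ' : κ' < 1) (h : 1 / q = 1 / s₁ - (1 - κ')) :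
    ∃ C : ℝ≥0∞, C ≠ ∞ ∧ ∀ (s : ℝ) (I : Set ℝ), MeasurableSet I → (∀ t ∈ I, Ioo s t ⊆ I) →
      ∀ A : ℝ≥0∞, A ≠ ∞ → (∀ t ∈ I, ∀ σ, 0 < σ → σ < t - s →
        ENNReal.ofReal σ ^ (κ' - ν * (1 / a - 1 / p)) ≤ A) →
      ∀ g : ℝ → G → ℝ≥0∞, Measurable (Function.uncurry g) →
      mixed μ I q p (pduh μ k s g) ≤ C * A * mixed μ I s₁ a g := by
  obtain ⟨C, hC, hls⟩ := lpn_fracInt_le hs₁ hκ' hq h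
  refine ⟨C * c, ENNReal.mul_ne_top hC hk.ne_top, fun s I hI hsub A hA hAle g hg => ?_⟩
  set κ := ν * (1 / a - 1 / p)
  have hg' : ∀ τ, Measurable (g τ) := fun τ => hg.comp measurable_prodMk_left
  let N : ℝ → ℝ≥0∞ := I.indicator (fun τ => lpn μ a (g τ))
  have hN : Measurable N := (measurable_lpn hg).indicator hI
  have hcA : c * A ≠ ∞ := ENNReal.mul_ne_top hk.ne_top hA
  have hpt : ∀ t ∈ I, lpn μ p (pduh μ k s g t) ≤ c * A * fracInt κ' N t := by
    intro t ht
    calc lpn μ p (pduh μ k s g t)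
        ≤ ∫⁻ τ in Ioo s t, lpn μ p (pconv μ k (t - τ) (g τ)) :=
          lpn_pduh_le hk s t hg (ha.trans hap)
      _ ≤ ∫⁻ τ in Ioo s t, c * A * (riesz κ' (t - τ) * N τ) := by
          refine setLIntegral_mono' measurableSet_Ioo fun τ hτ => ?_
          have h0 : 0 < t - τ := by linarith [hτ.2]
          have hN' : N τ = lpn μ a (g τ) := indicator_of_mem (hsub t ht hτ) _
          refine (lpn_pconv_le hk h0 ha hap (hg' τ)).trans ?_
          rw [hN', riesz, if_pos h0]
          -- The decay rate κ of the kernel is traded for the rate κ' dictated by the exponents in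
          -- time; the quotient of the two powers is what A bounds.
          have e : ENNReal.ofReal (t - τ) ^ (-κ) =
              ENNReal.ofReal (t - τ) ^ (κ' - κ) * ENNReal.ofReal (t - τ) ^ (-κ') := by
            rw [← ofReal_rpow_add h0]; congr 1; ring
          rw [e]
          calc _ ≤ c * (A * ENNReal.ofReal (t - τ) ^ (-κ')) * lpn μ a (g τ) := by
                gcongr
                exact hAle t ht _ h0 (by linarith [hτ.1])
            _ = _ := by ring
      _ ≤ ∫⁻ τ, c * A * (riesz κ' (t - τ) * N τ) := setLIntegral_le_lintegral _ _
      _ = c * A * fracInt κ' N t := lintegral_const_mul' _ _ hcA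
  calc mixed μ I q p (pduh μ k s g)
      ≤ lpn (volume.restrict I) q (fun t => c * A * fracInt κ' N t) := by
        refine lpn_mono_ae hq ?_
        filter_upwards [ae_restrict_mem hI] with t ht using hpt t ht
    _ ≤ lpn volume q (fun t => c * A * fracInt κ' N t) :=
        lpn_mono_measure hq Measure.restrict_le_self _
    _ = c * A * lpn volume q (fracInt κ' N) := lpn_const_mul hq hcA _
    _ ≤ c * A * (C * lpn volume s₁ N) := by gcongr; exact hls N hN
    _ = C * c * A * mixed μ I s₁ a g := by
        have : lpn volume s₁ N = mixed μ I s₁ a g := by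
          unfold mixed
          rw [lpn, lpn, ← lintegral_indicator hI]
          congr 1
          refine lintegral_congr fun τ => ?_
          by_cases hτ : τ ∈ I
          · simp [N, hτ]
          · simp [N, hτ, ENNReal.zero_rpow_of_pos (by linarith : 0 < s₁)]
        rw [this]; ring

theorem mixed_rpow_mul_le {I : Set ℝ} {q p b : ℝ} (hb : 0 < b) (hp : 0 < p) (hq : 0 < q)
    {U W : ℝ → G → ℝ≥0∞} (hU : Measurable (Function.uncurry U))
    (hW : Measurable (Function.uncurry W)) :
    mixed μ I (q / (b + 1)) (p / (b + 1)) (fun t x => U t x ^ b * W t x) ≤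
      mixed μ I q p U ^ b * mixed μ I q p W := by
  refine le_trans (lpn_mono (by positivity) fun t => ?_)
    (lpn_rpow_mul_le hb hq (measurable_lpn hU) (measurable_lpn hW))
  exact lpn_rpow_mul_le hb hp (hU.comp measurable_prodMk_left) (hW.comp measurable_prodMk_left)

theorem mixed_rpow_add_one {I : Set ℝ} {q p b : ℝ} (hb : 0 < b) (hp : 0 < p) (hq : 0 < q)
    (U : ℝ → G → ℝ≥0∞) :
    mixed μ I (q / (b + 1)) (p / (b + 1)) (fun t x => U t x ^ (b + 1)) =
      mixed μ I q p U ^ (b + 1) := by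
  unfold mixed
  rw [← lpn_rpow_add_one hb hq]
  congr 1; funext t
  exact lpn_rpow_add_one hb hp _

/-- The multilinear estimate behind existence and uniqueness. -/
theorem mixed_pduh_rpow_mul_le (hk : HeatBound μ ν c k) {b p q : ℝ} (hb : 0 < b)
    (hp : b + 1 ≤ p) (hq : b + 1 < q) :
    ∃ C : ℝ≥0∞, C ≠ ∞ ∧ ∀ (s : ℝ) (I : Set ℝ), MeasurableSet I → (∀ t ∈ I, Ioo s t ⊆ I) →
      ∀ A : ℝ≥0∞, A ≠ ∞ → (∀ t ∈ I, ∀ σ, 0 < σ → σ < t - s →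
        ENNReal.ofReal σ ^ (1 - ν * b / p - b / q) ≤ A) →
      ∀ U W : ℝ → G → ℝ≥0∞, Measurable (Function.uncurry U) → Measurable (Function.uncurry W) →
      mixed μ I q p (pduh μ k s (fun t x => U t x ^ b * W t x)) ≤
        C * A * (mixed μ I q p U ^ b * mixed μ I q p W) := by
  have hb1 : 0 < b + 1 := by linarith
  have hp0 : 0 < p := by linarith
  have hq0 : 0 < q := by linarith
  -- By Hölder the source lies in L^{q/(b+1)}_t L^{p/(b+1)}_x. The gain in time from q/(b+1) to q is
  -- (b+1)/q - 1/q = b/q, whence κ' = 1 - b/q.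
  obtain ⟨C, hC, hest⟩ := mixed_pduh_le (μ := μ) (k := k) hk (a := p / (b + 1)) (p := p)
    (s₁ := q / (b + 1)) (q := q) (κ' := 1 - b / q)
    (by rw [le_div_iff₀ hb1]; linarith) (div_le_self hp0.le (by linarith))
    (by rw [lt_div_iff₀ hb1]; linarith) hq0 (by have : 0 < b / q := by positivity
                                                linarith)
    (by field_simp; ring)
  refine ⟨C, hC, fun s I hI hsub A hA hAle U W hU hW => ?_⟩
  refine (hest s I hI hsub A hA ?_ (fun t x => U t x ^ b * W t x) ((hU.pow_const b).mul hW)).trans ?_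
  · intro t ht σ h0 h1
    have e : 1 - b / q - ν * (1 / (p / (b + 1)) - 1 / p) = 1 - ν * b / p - b / q := by
      field_simp; ring
    rw [e]; exact hAle t ht σ h0 h1
  · gcongr
    exact mixed_rpow_mul_le hb hp0 hq0 hU hW

end Inhomogeneous

/-! ### Pointwise bounds for the nonlinearity. -/

section Nonlinearity

variable {𝕜 : Type*} [RCLike 𝕜]

/-- For |w| ≤ |z| the difference is ε times |z|^b (z - w) + (|z|^b - |w|^b) w. The second summand is
controlled by Bernoulli's inequality for (|w|/|z|)^{b+1}, which needs no derivative of |z|^b and so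
covers b < 1 as well. The constant is 1 + (b + 1). -/
theorem norm_nonlin_sub_le {b ε : ℝ} (hb : 0 < b) (hε : |ε| = 1) (z w : 𝕜) :
    ‖nonlin b ε z - nonlin b ε w‖ ≤ (b + 2) * (‖z‖ ^ b + ‖w‖ ^ b) * ‖z - w‖ := by
  have key : ∀ z w : 𝕜, ‖w‖ ≤ ‖z‖ →
      ‖nonlin b ε z - nonlin b ε w‖ ≤ (b + 2) * ‖z‖ ^ b * ‖z - w‖ := by
    intro z w hwz
    rcases eq_or_lt_of_le (norm_nonneg z) with hz | hz
    · have hz0 : z = 0 := norm_eq_zero.1 hz.symm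
      have hw0 : w = 0 := norm_eq_zero.1 (le_antisymm (by linarith) (norm_nonneg w))
      simp [hz0, hw0, nonlin]
    have e : nonlin b ε z - nonlin b ε w =
        ε • (‖z‖ ^ b • (z - w) + (‖z‖ ^ b - ‖w‖ ^ b) • w) := by
      simp only [nonlin, mul_smul, smul_sub, sub_smul, smul_add]
      abel
    have hpow : (‖z‖ ^ b - ‖w‖ ^ b) * ‖w‖ ≤ (b + 1) * ‖z‖ ^ b * (‖z‖ - ‖w‖) := by
      set x := ‖z‖
      set y := ‖w‖
      have hy : 0 ≤ y := norm_nonneg w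
      have hB := one_add_mul_self_le_rpow_one_add (s := y / x - 1)
        (by have : 0 ≤ y / x := by positivity
            linarith) (p := b + 1) (by linarith)
      have h1 : (1 + (y / x - 1)) ^ (b + 1) = y ^ (b + 1) / x ^ (b + 1) := by
        rw [show 1 + (y / x - 1) = y / x by ring, Real.div_rpow hy hz.le]
      rw [h1, le_div_iff₀ (Real.rpow_pos_of_pos hz _)] at hB
      have hx1 : x ^ (b + 1) = x ^ b * x := by
        rw [Real.rpow_add hz, Real.rpow_one]
      have hy1 : y ^ (b + 1) = y ^ b * y := by
        rw [Real.rpow_add_of_nonneg hy hb.le zero_le_one, Real.rpow_one]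
      have h2 : (1 + (b + 1) * (y / x - 1)) * x ^ (b + 1) =
          x ^ (b + 1) - (b + 1) * x ^ b * (x - y) := by
        rw [hx1]; field_simp; ring
      rw [h2, hy1, hx1] at hB
      have h3 : x ^ b * y ≤ x ^ b * x := by gcongr
      nlinarith
    have hmono : ‖w‖ ^ b ≤ ‖z‖ ^ b := Real.rpow_le_rpow (norm_nonneg w) hwz hb.le
    have hb0 : 0 ≤ ‖z‖ ^ b := Real.rpow_nonneg (norm_nonneg z) b
    have htri : ‖z‖ - ‖w‖ ≤ ‖z - w‖ := norm_sub_norm_le z w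
    calc ‖nonlin b ε z - nonlin b ε w‖
        = ‖‖z‖ ^ b • (z - w) + (‖z‖ ^ b - ‖w‖ ^ b) • w‖ := by
          rw [e, norm_smul, Real.norm_eq_abs, hε, one_mul]
      _ ≤ ‖z‖ ^ b * ‖z - w‖ + (‖z‖ ^ b - ‖w‖ ^ b) * ‖w‖ := by
          refine (norm_add_le _ _).trans_eq ?_
          rw [norm_smul, norm_smul, Real.norm_of_nonneg hb0,
            Real.norm_of_nonneg (sub_nonneg.2 hmono)]
      _ ≤ ‖z‖ ^ b * ‖z - w‖ + (b + 1) * ‖z‖ ^ b * (‖z‖ - ‖w‖) := by linarith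
      _ ≤ ‖z‖ ^ b * ‖z - w‖ + (b + 1) * ‖z‖ ^ b * ‖z - w‖ := by gcongr
      _ = _ := by ring
  have hz0 : 0 ≤ ‖z‖ ^ b := Real.rpow_nonneg (norm_nonneg z) b
  have hw0 : 0 ≤ ‖w‖ ^ b := Real.rpow_nonneg (norm_nonneg w) b
  rcases le_total ‖w‖ ‖z‖ with h | h
  · refine (key z w h).trans ?_
    gcongr; linarith
  · rw [norm_sub_rev, norm_sub_rev z w]
    refine (key w z h).trans ?_
    gcongr; linarith

theorem enorm_nonlin {b ε : ℝ} (hb : 0 < b) (hε : |ε| = 1) (z : 𝕜) :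
    ‖nonlin b ε z‖ₑ = ‖z‖ₑ ^ (b + 1) := by
  have h1 : ‖nonlin b ε z‖ = ‖z‖ ^ (b + 1) := by
    rw [nonlin, norm_smul, norm_mul, Real.norm_eq_abs, hε, one_mul,
      Real.norm_of_nonneg (Real.rpow_nonneg (norm_nonneg z) b),
      Real.rpow_add_of_nonneg (norm_nonneg z) hb.le zero_le_one, Real.rpow_one]
  rw [← ofReal_norm, h1, ← ofReal_norm,
    ENNReal.ofReal_rpow_of_nonneg (norm_nonneg z) (by linarith)]

theorem enorm_nonlin_sub_le {b ε : ℝ} (hb : 0 < b) (hε : |ε| = 1) (z w : 𝕜) :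
    ‖nonlin b ε z - nonlin b ε w‖ₑ ≤
      ENNReal.ofReal (b + 2) * (‖z‖ₑ ^ b * ‖z - w‖ₑ + ‖w‖ₑ ^ b * ‖z - w‖ₑ) := by
  have h := norm_nonlin_sub_le hb hε z w
  rw [← ofReal_norm, ← ofReal_norm, ← ofReal_norm,
    ← ofReal_norm, ENNReal.ofReal_rpow_of_nonneg (norm_nonneg z) hb.le,
    ENNReal.ofReal_rpow_of_nonneg (norm_nonneg w) hb.le, ← add_mul,
    ← ENNReal.ofReal_add (by positivity) (by positivity), ← ENNReal.ofReal_mul (by positivity),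
    ← ENNReal.ofReal_mul (by positivity)]
  refine ENNReal.ofReal_le_ofReal (h.trans_eq (by ring))

theorem continuous_nonlin {b ε : ℝ} (hb : 0 < b) : Continuous (nonlin b ε : 𝕜 → 𝕜) := by
  unfold nonlin
  exact (continuous_const.mul (continuous_norm.rpow_const fun _ => Or.inr hb.le)).smul continuous_id

end Nonlinearity

end FracHeat

/-! ### The Duhamel integral and the Picard iteration. -/

namespace FracHeat

/-- No integrability is assumed. If f - g is integrable, then f and g are either both integrable or
both not, and in the latter case both integrals are 0 by convention. If f - g is not integrable, the
right-hand side is infinite. -/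
theorem enorm_integral_sub_le {α F : Type*} [MeasurableSpace α] {μ : Measure α}
    [NormedAddCommGroup F] [NormedSpace ℝ F] {f g : α → F} (hf : AEStronglyMeasurable f μ)
    (hg : AEStronglyMeasurable g μ) :
    ‖(∫ x, f x ∂μ) - ∫ x, g x ∂μ‖ₑ ≤ ∫⁻ x, ‖f x - g x‖ₑ ∂μ := by
  by_cases h : Integrable (fun x => f x - g x) μ
  · by_cases h1 : Integrable f μ
    · have h2 : Integrable g μ := by
        have h2 : Integrable (fun x => f x - (f x - g x)) μ := h1.sub h
        simpa using h2
      rw [← integral_sub h1 h2]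
      exact enorm_integral_le_lintegral_enorm _
    · have h2 : ¬ Integrable g μ := fun h2 => h1 <| by
        have h3 : Integrable (fun x => f x - g x + g x) μ := h.add h2
        simpa using h3
      rw [integral_undef h1, integral_undef h2]
      simp
  · have : ∫⁻ x, ‖f x - g x‖ₑ ∂μ = ∞ := by
      by_contra hne
      exact h ⟨hf.sub hg, lt_top_iff_ne_top.2 hne⟩
    rw [this]; exact le_top

section Uncurry

variable {β G 𝕜 : Type*} [MeasurableSpace β] [MeasurableSpace G] [RCLike 𝕜]

theorem meas_enorm {u : β → G → 𝕜} (hu : Measurable (Function.uncurry u)) :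
    Measurable (Function.uncurry fun t x => ‖u t x‖ₑ) := hu.enorm

theorem meas_enorm_sub {u v : β → G → 𝕜} (hu : Measurable (Function.uncurry u))
    (hv : Measurable (Function.uncurry v)) :
    Measurable (Function.uncurry fun t x => ‖u t x - v t x‖ₑ) := (hu.sub hv).enorm

theorem meas_rpow_mul {U W : β → G → ℝ≥0∞} (b : ℝ) (hU : Measurable (Function.uncurry U))
    (hW : Measurable (Function.uncurry W)) :
    Measurable (Function.uncurry fun t x => U t x ^ b * W t x) := (hU.pow_const b).mul hW

end Uncurry

section Duhamel

variable {𝕜 : Type*} [RCLike 𝕜]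
  {G : Type*} [AddCommGroup G] [MeasurableSpace G] [MeasurableAdd₂ G] [MeasurableNeg G]
  {μ : Measure G} {ν : ℝ} {c : ℝ≥0∞} {K : ℝ → G → ℝ}
  [SigmaFinite μ] [μ.IsAddLeftInvariant] [μ.IsNegInvariant]

/-- The Duhamel integral `∫_s^t K(t-τ) * g(τ) dτ`, as an integral over space-time. -/
def duh (μ : Measure G) (K : ℝ → G → ℝ) (s : ℝ) (g : ℝ → G → 𝕜) (t : ℝ) (x : G) : 𝕜 :=
  ∫ z in Ioo s t ×ˢ univ, K (t - z.1) (x - z.2) • g z.1 z.2 ∂(volume.prod μ)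

/-- The absolute value of a kernel. -/
def absK (K : ℝ → G → ℝ) (t : ℝ) (x : G) : ℝ≥0∞ := ‖K t x‖ₑ

theorem measurable_duh_integrand (hK : Measurable (Function.uncurry K)) {g : ℝ → G → 𝕜}
    (hg : Measurable (Function.uncurry g)) :
    Measurable (fun w : (ℝ × G) × (ℝ × G) => K (w.1.1 - w.2.1) (w.1.2 - w.2.2) • g w.2.1 w.2.2) := by
  have h1 : Measurable (fun w : (ℝ × G) × (ℝ × G) => K (w.1.1 - w.2.1) (w.1.2 - w.2.2)) :=
    hK.comp (((measurable_fst.comp measurable_fst).sub (measurable_fst.comp measurable_snd)).prodMk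
      ((measurable_snd.comp measurable_fst).sub (measurable_snd.comp measurable_snd)))
  have h2 : Measurable (fun w : (ℝ × G) × (ℝ × G) => g w.2.1 w.2.2) := hg.comp measurable_snd
  exact h1.smul h2

theorem measurable_duh_integrand' (hK : Measurable (Function.uncurry K)) {g : ℝ → G → 𝕜}
    (hg : Measurable (Function.uncurry g)) (t : ℝ) (x : G) :
    Measurable (fun z : ℝ × G => K (t - z.1) (x - z.2) • g z.1 z.2) :=
  (measurable_duh_integrand hK hg).comp (measurable_const (a := (t, x)).prodMk measurable_id)

theorem measurable_duh (hK : Measurable (Function.uncurry K)) (s : ℝ) {g : ℝ → G → 𝕜}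
    (hg : Measurable (Function.uncurry g)) : Measurable (Function.uncurry (duh μ K s g)) := by
  have e : Function.uncurry (duh μ K s g) = fun w : ℝ × G => ∫ z : ℝ × G,
      (if s < z.1 ∧ z.1 < w.1 then K (w.1 - z.1) (w.2 - z.2) • g z.1 z.2 else 0)
        ∂(volume.prod μ) := by
    funext w
    simp only [Function.uncurry, duh]
    rw [← integral_indicator (measurableSet_Ioo.prod MeasurableSet.univ)]
    refine integral_congr_ae (Filter.Eventually.of_forall fun z => ?_)
    simp [indicator]
  rw [e]
  have hm : Measurable (fun w : (ℝ × G) × (ℝ × G) => (if s < w.2.1 ∧ w.2.1 < w.1.1 then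
      K (w.1.1 - w.2.1) (w.1.2 - w.2.2) • g w.2.1 w.2.2 else 0 : 𝕜)) := by
    refine Measurable.ite ?_ (measurable_duh_integrand hK hg) measurable_const
    have m1 : Measurable (fun w : (ℝ × G) × (ℝ × G) => w.2.1) := by fun_prop
    have m2 : Measurable (fun w : (ℝ × G) × (ℝ × G) => w.1.1) := by fun_prop
    exact (measurableSet_lt measurable_const m1).inter (measurableSet_lt m1 m2)
  exact (hm.stronglyMeasurable.integral_prod_right' (ν := volume.prod μ)).measurable

theorem lintegral_duh (hk : HeatBound μ ν c (absK K)) {g : ℝ → G → ℝ≥0∞}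
    (hg : Measurable (Function.uncurry g)) (s t : ℝ) (x : G) :
    ∫⁻ z in Ioo s t ×ˢ univ, ‖K (t - z.1) (x - z.2)‖ₑ * g z.1 z.2 ∂(volume.prod μ) =
      pduh μ (absK K) s g t x := by
  have h1 : Measurable (fun z : ℝ × G => absK K (t - z.1) (x - z.2)) :=
    hk.meas.comp (Measurable.prodMk (by fun_prop) (measurable_const.sub measurable_snd))
  have h2 : Measurable (fun z : ℝ × G => ‖K (t - z.1) (x - z.2)‖ₑ * g z.1 z.2) := h1.mul hg
  rw [← Measure.prod_restrict, Measure.restrict_univ, lintegral_prod _ h2.aemeasurable]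
  rfl

theorem enorm_duh_le (hk : HeatBound μ ν c (absK K)) {g : ℝ → G → 𝕜}
    (hg : Measurable (Function.uncurry g)) (s t : ℝ) (x : G) :
    ‖duh μ K s g t x‖ₑ ≤ pduh μ (absK K) s (fun τ y => ‖g τ y‖ₑ) t x := by
  rw [← lintegral_duh hk (meas_enorm hg)]
  refine (enorm_integral_le_lintegral_enorm _).trans_eq ?_
  simp_rw [enorm_smul]

theorem enorm_duh_sub_le (hk : HeatBound μ ν c (absK K)) (hK : Measurable (Function.uncurry K))
    {g g' : ℝ → G → 𝕜} (hg : Measurable (Function.uncurry g))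
    (hg' : Measurable (Function.uncurry g')) (s t : ℝ) (x : G) :
    ‖duh μ K s g t x - duh μ K s g' t x‖ₑ ≤
      pduh μ (absK K) s (fun τ y => ‖g τ y - g' τ y‖ₑ) t x := by
  rw [← lintegral_duh hk (meas_enorm_sub hg hg')]
  refine (enorm_integral_sub_le (measurable_duh_integrand' hK hg t x).aestronglyMeasurable
    (measurable_duh_integrand' hK hg' t x).aestronglyMeasurable).trans_eq ?_
  simp_rw [← smul_sub, enorm_smul]

theorem integrable_duh (hk : HeatBound μ ν c (absK K)) (hK : Measurable (Function.uncurry K))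
    {g : ℝ → G → 𝕜} (hg : Measurable (Function.uncurry g)) {s t : ℝ} {x : G}
    (h : pduh μ (absK K) s (fun τ y => ‖g τ y‖ₑ) t x < ∞) :
    IntegrableOn (fun z : ℝ × G => K (t - z.1) (x - z.2) • g z.1 z.2) (Ioo s t ×ˢ univ)
      (volume.prod μ) := by
  refine ⟨(measurable_duh_integrand' hK hg t x).aestronglyMeasurable, ?_⟩
  rw [← lintegral_duh hk (meas_enorm hg)] at h
  refine lt_of_eq_of_lt ?_ h
  simp_rw [enorm_smul]

theorem duh_congr {g g' : ℝ → G → 𝕜} {s t : ℝ}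
    (h : ∀ᵐ z ∂(volume.restrict (Ioo s t)).prod μ, g z.1 z.2 = g' z.1 z.2) (x : G) :
    duh μ K s g t x = duh μ K s g' t x := by
  unfold duh
  rw [← Measure.prod_restrict, Measure.restrict_univ]
  refine integral_congr_ae ?_
  filter_upwards [h] with z hz
  rw [hz]

variable {b ε : ℝ}

/-- The Picard iterates for `u = U₀ + ∫ K(t-τ) * f(u(τ)) dτ`. -/
def picard (μ : Measure G) (K : ℝ → G → ℝ) (b ε : ℝ) (U₀ : ℝ → G → 𝕜) : ℕ → ℝ → G → 𝕜
  | 0 => U₀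
  | j + 1 => fun t x => U₀ t x + duh μ K 0 (fun τ y => nonlin b ε (picard μ K b ε U₀ j τ y)) t x

theorem measurable_nonlin_comp (hb : 0 < b) {U : ℝ → G → 𝕜} (hU : Measurable (Function.uncurry U)) :
    Measurable (Function.uncurry fun τ y => nonlin b ε (U τ y)) :=
  (continuous_nonlin hb).measurable.comp hU

theorem measurable_picard (hb : 0 < b) (hK : Measurable (Function.uncurry K)) {U₀ : ℝ → G → 𝕜}
    (hU₀ : Measurable (Function.uncurry U₀)) :
    ∀ j, Measurable (Function.uncurry (picard μ K b ε U₀ j))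
  | 0 => hU₀
  | j + 1 => hU₀.add (measurable_duh hK 0
      (measurable_nonlin_comp hb (measurable_picard hb hK hU₀ j)))

/-- The Lipschitz bound of the nonlinearity, carried through the Duhamel integral. It serves the
iteration and both uniqueness proofs. -/
theorem picard_sub_le (hb : 0 < b) (hε : |ε| = 1) (hk : HeatBound μ ν c (absK K))
    (hK : Measurable (Function.uncurry K)) {u v : ℝ → G → 𝕜} (hu : Measurable (Function.uncurry u))
    (hv : Measurable (Function.uncurry v)) (s t : ℝ) (x : G) :
    ‖duh μ K s (fun τ y => nonlin b ε (u τ y)) t x -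
      duh μ K s (fun τ y => nonlin b ε (v τ y)) t x‖ₑ ≤
      ENNReal.ofReal (b + 2) *
        (pduh μ (absK K) s (fun τ y => ‖u τ y‖ₑ ^ b * ‖u τ y - v τ y‖ₑ) t x +
         pduh μ (absK K) s (fun τ y => ‖v τ y‖ₑ ^ b * ‖u τ y - v τ y‖ₑ) t x) := by
  refine (enorm_duh_sub_le hk hK (measurable_nonlin_comp hb hu)
    (measurable_nonlin_comp hb hv) s t x).trans ?_
  have hm1 : Measurable (Function.uncurry fun τ y => ‖u τ y‖ₑ ^ b * ‖u τ y - v τ y‖ₑ) :=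
    (hu.enorm.pow_const b).mul (hu.sub hv).enorm
  rw [← lintegral_duh hk (hm1), ← lintegral_duh hk (meas_rpow_mul b (meas_enorm hv) (meas_enorm_sub hu hv)),
    ← lintegral_duh hk (meas_enorm_sub (measurable_nonlin_comp hb hu) (measurable_nonlin_comp hb hv)),
    ← lintegral_add_left, ← lintegral_const_mul' _ _ ENNReal.ofReal_ne_top]
  · refine lintegral_mono fun z => ?_
    calc _ ≤ ‖K (t - z.1) (x - z.2)‖ₑ * (ENNReal.ofReal (b + 2) *
          (‖u z.1 z.2‖ₑ ^ b * ‖u z.1 z.2 - v z.1 z.2‖ₑ +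
            ‖v z.1 z.2‖ₑ ^ b * ‖u z.1 z.2 - v z.1 z.2‖ₑ)) := by
          gcongr; exact enorm_nonlin_sub_le hb hε _ _
      _ = _ := by ring
  · have h1 : Measurable (fun z : ℝ × G => absK K (t - z.1) (x - z.2)) :=
      hk.meas.comp (Measurable.prodMk (by fun_prop) (measurable_const.sub measurable_snd))
    exact h1.mul hm1

/-- Existence of a fixed point, from the multilinear estimate `hY`. -/
theorem exists_fixed_point (hb : 0 < b) (hε : |ε| = 1) (hk : HeatBound μ ν c (absK K))
    (hK : Measurable (Function.uncurry K)) {I : Set ℝ} (hI : MeasurableSet I)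
    (hsub : ∀ t ∈ I, Ioo 0 t ⊆ I) {p q : ℝ} (hp : 1 ≤ p) (hq : 1 ≤ q) {C m : ℝ≥0∞}
    (hY : ∀ U W : ℝ → G → ℝ≥0∞, Measurable (Function.uncurry U) → Measurable (Function.uncurry W) →
      mixed μ I q p (pduh μ (absK K) 0 (fun t x => U t x ^ b * W t x)) ≤
        C * (mixed μ I q p U ^ b * mixed μ I q p W))
    {U₀ : ℝ → G → 𝕜} (hU₀ : Measurable (Function.uncurry U₀)) (hm : m ≠ ∞) (hC : C ≠ ∞)
    (h0 : mixed μ I q p (fun t x => ‖U₀ t x‖ₑ) ≤ m)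
    (hsmall : ENNReal.ofReal (b + 2) * (C * (2 * m) ^ b) ≤ 1 / 4) :
    ∃ u : ℝ → G → 𝕜, Measurable (Function.uncurry u) ∧
      (∀ t ∈ I, ∀ x, u t x = U₀ t x + duh μ K 0 (fun τ y => nonlin b ε (u τ y)) t x) ∧
      mixed μ I q p (fun t x => ‖u t x‖ₑ) ≤ 3 * m := by
  have hp0 : 0 < p := by linarith
  have hq0 : 0 < q := by linarith
  set U := picard μ K b ε U₀ with hU
  have hUm : ∀ j, Measurable (Function.uncurry (U j)) := measurable_picard hb hK hU₀
  have hsmall1 : C * (2 * m) ^ b ≤ 1 / 4 := by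
    refine le_trans ?_ hsmall
    nth_rewrite 1 [← one_mul (C * (2 * m) ^ b)]
    gcongr
    rw [ENNReal.one_le_ofReal]; linarith
  have h4 : (1 / 4 : ℝ≥0∞) * 2 = 1 / 2 := by
    rw [show (4 : ℝ≥0∞) = 2 * 2 by norm_num, one_div, ENNReal.mul_inv (by simp) (by simp),
      mul_assoc, ENNReal.inv_mul_cancel (by simp) (by simp), mul_one, one_div]
  have hpow : ∀ z : ℝ≥0∞, z ^ (b + 1) = z ^ b * z := fun z => by
    rw [ENNReal.rpow_add_of_nonneg _ _ hb.le zero_le_one, ENNReal.rpow_one]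
  have hdu : ∀ j t x, ‖duh μ K 0 (fun τ y => nonlin b ε (U j τ y)) t x‖ₑ ≤
      pduh μ (absK K) 0 (fun τ y => ‖U j τ y‖ₑ ^ b * ‖U j τ y‖ₑ) t x := fun j t x => by
    refine (enorm_duh_le hk (measurable_nonlin_comp hb (hUm j)) 0 t x).trans_eq ?_
    simp_rw [enorm_nonlin hb hε, hpow]
  -- The iterates stay in the ball of radius 2m, because the nonlinear term adds at most (1/4)·2m.
  have hYU : ∀ j, mixed μ I q p (fun t x => ‖U j t x‖ₑ) ≤ 2 * m := by
    intro j
    induction j with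
    | zero => exact h0.trans (by rw [two_mul]; exact le_self_add)
    | succ j ih =>
      calc mixed μ I q p (fun t x => ‖U (j + 1) t x‖ₑ)
          ≤ mixed μ I q p (fun t x => ‖U₀ t x‖ₑ +
              pduh μ (absK K) 0 (fun τ y => ‖U j τ y‖ₑ ^ b * ‖U j τ y‖ₑ) t x) :=
            mixed_mono hI hq0 hp0 fun t _ x =>
              (enorm_add_le _ _).trans (add_le_add le_rfl (hdu j t x))
        _ ≤ m + C * ((2 * m) ^ b * (2 * m)) := by
            refine (mixed_add_le hq hp (meas_enorm hU₀) (measurable_pduh_uncurry hk 0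
              (meas_rpow_mul b (meas_enorm (hUm j)) (meas_enorm (hUm j))))).trans ?_
            gcongr
            refine (hY _ _ (meas_enorm (hUm j)) (meas_enorm (hUm j))).trans ?_
            gcongr
        _ = m + (C * (2 * m) ^ b) * 2 * m := by ring
        _ ≤ m + 1 / 4 * 2 * m := by gcongr
        _ ≤ m + 1 * m := by
            rw [h4]; gcongr; simp
        _ = 2 * m := by ring
  -- Consecutive differences shrink by a factor 1/2: the two Lipschitz terms contribute 1/4 each.
  let d : ℕ → ℝ → G → ℝ≥0∞ := fun j t x => ‖U (j + 1) t x - U j t x‖ₑ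
  have hdm : ∀ j, Measurable (Function.uncurry (d j)) := fun j => ((hUm (j + 1)).sub (hUm j)).enorm
  have hd0 : mixed μ I q p (d 0) ≤ m := by
    calc mixed μ I q p (d 0)
        ≤ mixed μ I q p (pduh μ (absK K) 0 (fun τ y => ‖U₀ τ y‖ₑ ^ b * ‖U₀ τ y‖ₑ)) := by
          refine mixed_mono hI hq0 hp0 fun t _ x => ?_
          have : U 1 t x - U 0 t x = duh μ K 0 (fun τ y => nonlin b ε (U 0 τ y)) t x := by
            simp [hU, picard]
          simp only [d, this]
          exact hdu 0 t x
      _ ≤ C * (m ^ b * m) := by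
          refine (hY _ _ (meas_enorm hU₀) (meas_enorm hU₀)).trans ?_
          gcongr
      _ ≤ C * ((2 * m) ^ b * m) := by
          gcongr
          rw [two_mul]; exact le_self_add
      _ = (C * (2 * m) ^ b) * m := by ring
      _ ≤ 1 * m := by
          gcongr
          refine hsmall1.trans ?_
          simp
      _ = m := one_mul m
  have hdsucc : ∀ j, mixed μ I q p (d (j + 1)) ≤ 1 / 2 * mixed μ I q p (d j) := by
    intro j
    have hm1 := measurable_pduh_uncurry hk 0 (meas_rpow_mul b (meas_enorm (hUm (j + 1))) (hdm j))
    have hm2 := measurable_pduh_uncurry hk 0 (meas_rpow_mul b (meas_enorm (hUm j)) (hdm j))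
    calc mixed μ I q p (d (j + 1))
        ≤ mixed μ I q p (fun t x => ENNReal.ofReal (b + 2) *
            (pduh μ (absK K) 0 (fun τ y => ‖U (j + 1) τ y‖ₑ ^ b * d j τ y) t x +
             pduh μ (absK K) 0 (fun τ y => ‖U j τ y‖ₑ ^ b * d j τ y) t x)) := by
          refine mixed_mono hI hq0 hp0 fun t _ x => ?_
          have : U (j + 2) t x - U (j + 1) t x =
              duh μ K 0 (fun τ y => nonlin b ε (U (j + 1) τ y)) t x -
              duh μ K 0 (fun τ y => nonlin b ε (U j τ y)) t x := by
            simp [hU, picard]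
          simp only [d, this]
          exact picard_sub_le hb hε hk hK (hUm (j + 1)) (hUm j) 0 t x
      _ ≤ ENNReal.ofReal (b + 2) * (C * ((2 * m) ^ b * mixed μ I q p (d j)) +
            C * ((2 * m) ^ b * mixed μ I q p (d j))) := by
          rw [mixed_const_mul hq0 hp0 ENNReal.ofReal_ne_top]
          gcongr
          refine (mixed_add_le hq hp hm1 hm2).trans ?_
          gcongr
          · refine (hY _ _ (meas_enorm (hUm (j + 1))) (hdm j)).trans ?_
            gcongr; exact hYU (j + 1)
          · refine (hY _ _ (meas_enorm (hUm j)) (hdm j)).trans ?_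
            gcongr; exact hYU j
      _ = (ENNReal.ofReal (b + 2) * (C * (2 * m) ^ b)) * 2 * mixed μ I q p (d j) := by ring
      _ ≤ 1 / 4 * 2 * mixed μ I q p (d j) := by gcongr
      _ = _ := by rw [h4]
  have hdj : ∀ j, mixed μ I q p (d j) ≤ (1 / 2) ^ j * m := by
    intro j
    induction j with
    | zero => simpa using hd0
    | succ j ih =>
      refine (hdsucc j).trans ?_
      rw [pow_succ', mul_assoc]; gcongr
  let D : ℝ → G → ℝ≥0∞ := fun t x => ∑' j, d j t x
  have hDm : Measurable (Function.uncurry D) := Measurable.tsum fun j => hdm j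
  have hYD : mixed μ I q p D ≤ 2 * m := by
    refine (mixed_tsum_le hq hp hdm).trans ((ENNReal.tsum_le_tsum hdj).trans_eq ?_)
    rw [ENNReal.tsum_mul_right, ENNReal.tsum_geometric, one_div, ENNReal.one_sub_inv_two, inv_inv]
  -- A common majorant of all iterates, with norm at most 3m. It permits dominated convergence
  -- inside the Duhamel integral.
  let H : ℝ → G → ℝ≥0∞ := fun t x => ‖U₀ t x‖ₑ + D t x
  have hHm : Measurable (Function.uncurry H) := hU₀.enorm.add hDm
  have hYH : mixed μ I q p H ≤ 3 * m := by
    refine (mixed_add_le hq hp (meas_enorm hU₀) hDm).trans ?_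
    calc _ ≤ m + 2 * m := add_le_add h0 hYD
      _ = 3 * m := by ring
  have hUH : ∀ j t x, ‖U j t x‖ₑ ≤ H t x := by
    intro j t x
    have h1 : ‖U j t x‖ₑ ≤ ‖U₀ t x‖ₑ + ∑ i ∈ Finset.range j, d i t x := by
      induction j with
      | zero => simp [hU, picard]
      | succ j ih =>
        rw [Finset.sum_range_succ, ← add_assoc]
        calc ‖U (j + 1) t x‖ₑ = ‖U j t x + (U (j + 1) t x - U j t x)‖ₑ := by rw [add_sub_cancel]
          _ ≤ ‖U j t x‖ₑ + d j t x := enorm_add_le _ _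
          _ ≤ _ := by gcongr
    exact h1.trans (add_le_add le_rfl (ENNReal.sum_le_tsum _))
  let N : ℝ → G → ℝ≥0∞ := pduh μ (absK K) 0 (fun t x => H t x ^ b * H t x)
  have hNm : Measurable (Function.uncurry N) :=
    measurable_pduh_uncurry hk 0 (meas_rpow_mul b hHm hHm)
  have hYN : mixed μ I q p N ≠ ∞ := by
    have h3m : (3 * m) ≠ ∞ := ENNReal.mul_ne_top (by simp) hm
    refine ne_top_of_le_ne_top (ENNReal.mul_ne_top hC (ENNReal.mul_ne_top
      (ENNReal.rpow_ne_top_of_nonneg hb.le h3m) h3m)) ((hY _ _ hHm hHm).trans ?_)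
    gcongr
  have aeD : ∀ᵐ z ∂((volume.restrict I).prod μ), D z.1 z.2 < ∞ :=
    mixed_ae_lt_top hq0 hp0 hDm (ne_top_of_le_ne_top (ENNReal.mul_ne_top (by simp) hm) hYD)
  have aeN : ∀ᵐ z ∂((volume.restrict I).prod μ), N z.1 z.2 < ∞ := mixed_ae_lt_top hq0 hp0 hNm hYN
  obtain ⟨V, hVm, hV⟩ := exists_stronglyMeasurable_limit_of_tendsto_ae
    (f := fun j => Function.uncurry (U j)) (μ := (volume.restrict I).prod μ)
    (fun j => (hUm j).aestronglyMeasurable) (by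
      filter_upwards [aeD] with z hz
      refine cauchySeq_tendsto_of_complete (cauchySeq_of_edist_le_of_tsum_ne_top (fun j => d j z.1 z.2)
        (fun j => ?_) hz.ne)
      rw [edist_comm, edist_eq_enorm_sub]; exact le_rfl)
  have hVm' : Measurable (Function.uncurry fun t x => V (t, x)) := hVm.measurable
  -- The limit V exists only almost everywhere. Redefining it by the right-hand side of the equation
  -- makes the equation true at every t in I and every x, since the Duhamel integral does not see
  -- null sets.
  let u : ℝ → G → 𝕜 := fun t x => U₀ t x + duh μ K 0 (fun τ y => nonlin b ε (V (τ, y))) t x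
  have hum : Measurable (Function.uncurry u) :=
    hU₀.add (measurable_duh hK 0 (measurable_nonlin_comp hb hVm'))
  have aeI : ∀ᵐ z ∂((volume.restrict I).prod μ), z.1 ∈ I := by
    rw [← Measure.restrict_univ (μ := μ), Measure.prod_restrict]
    filter_upwards [ae_restrict_mem (hI.prod MeasurableSet.univ)] with z hz using hz.1
  have hle : ∀ t ∈ I, (volume.restrict (Ioo 0 t)).prod μ ≪ (volume.restrict I).prod μ := fun t ht =>
    (Measure.absolutelyContinuous_of_le (Measure.restrict_mono (hsub t ht) le_rfl)).prod
      Measure.AbsolutelyContinuous.rfl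
  -- Wherever `N` is finite, the kernel times H^{b+1} is an integrable majorant, so the Picard
  -- recursion passes to the limit.
  have hVu : ∀ᵐ z ∂((volume.restrict I).prod μ), V z = u z.1 z.2 := by
    filter_upwards [hV, aeN, aeI] with z hz hzN hzI
    refine tendsto_nhds_unique hz ?_
    rw [← Filter.tendsto_add_atTop_iff_nat 1]
    refine tendsto_const_nhds.add ?_
    obtain ⟨t, x⟩ := z
    simp only at hzN hzI
    unfold duh
    have hlt := hzN
    rw [show N t x = _ from (lintegral_duh hk (meas_rpow_mul b hHm hHm) 0 t x).symm] at hlt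
    have hm1 : Measurable (fun z : ℝ × G => absK K (t - z.1) (x - z.2)) :=
      hk.meas.comp (Measurable.prodMk (by fun_prop) (measurable_const.sub measurable_snd))
    have hm2 : Measurable (fun z : ℝ × G => absK K (t - z.1) (x - z.2) *
        (H z.1 z.2 ^ b * H z.1 z.2)) :=
      hm1.mul (meas_rpow_mul b hHm hHm)
    refine tendsto_integral_of_dominated_convergence (fun z => (absK K (t - z.1) (x - z.2) *
        (H z.1 z.2 ^ b * H z.1 z.2)).toReal) (fun j => (measurable_duh_integrand' hK
        (measurable_nonlin_comp hb (hUm j)) t x).aestronglyMeasurable)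
        (integrable_toReal_of_lintegral_ne_top hm2.aemeasurable hlt.ne) (fun j => ?_) ?_
    · filter_upwards [ae_lt_top hm2 hlt.ne] with w hw
      rw [← toReal_enorm]
      refine ENNReal.toReal_mono hw.ne ?_
      rw [enorm_smul, enorm_nonlin hb hε, hpow]
      unfold absK
      gcongr <;> exact hUH j _ _
    · have h1 := (hle t hzI).ae_le hV
      rw [← Measure.restrict_univ (μ := μ), Measure.prod_restrict] at h1
      filter_upwards [h1] with w hw
      exact tendsto_const_nhds.smul (((continuous_nonlin hb).tendsto _).comp hw)
  refine ⟨u, hum, fun t ht x => ?_, ?_⟩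
  · change U₀ t x + _ = _
    congr 1
    refine duh_congr ?_ x
    filter_upwards [(hle t ht).ae_le hVu] with z hz
    rw [← hz]
  · refine le_trans (lpn_mono_ae hq0 ?_) hYH
    have h1 : ∀ᵐ z ∂((volume.restrict I).prod μ), ‖u z.1 z.2‖ₑ ≤ H z.1 z.2 := by
      filter_upwards [hV, hVu] with z hz hzu
      rw [← hzu]
      exact le_of_tendsto hz.enorm (Filter.Eventually.of_forall fun j => hUH j _ _)
    filter_upwards [(Measure.ae_prod_iff_ae_ae (measurableSet_le hum.enorm hHm)).1 h1] with t ht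
    exact lpn_mono_ae hp0 ht

end Duhamel

end FracHeat

namespace FracHeat

/-! ### The algebra of Fourier transforms of integrable functions. -/

section Wiener

variable {V : Type*} [NormedAddCommGroup V] [InnerProductSpace ℝ V] [FiniteDimensional ℝ V]
  [MeasurableSpace V] [BorelSpace V]

/-- `Q` is the Fourier transform of a function whose `L¹`-norm is at most `C`. -/
def IsFT (C : ℝ) (Q : V → ℂ) : Prop :=
  ∃ q : V → ℂ, Integrable q ∧ 𝓕 q = Q ∧ ∫ x, ‖q x‖ ≤ C

theorem IsFT.norm_le {C : ℝ} {Q : V → ℂ} (h : IsFT C Q) (ξ : V) : ‖Q ξ‖ ≤ C := by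
  obtain ⟨q, hq, rfl, h⟩ := h
  refine le_trans ?_ h
  rw [Real.fourier_eq]
  refine (norm_integral_le_integral_norm _).trans (le_of_eq ?_)
  simp

theorem SchwartzMap.exists_isFT (Φ : SchwartzMap V ℂ) : ∃ C, IsFT C Φ := by
  refine ⟨_, (𝓕⁻ Φ : SchwartzMap V ℂ), SchwartzMap.integrable _, ?_, le_rfl⟩
  rw [← SchwartzMap.fourier_coe]
  simp

/-- Convolution becomes multiplication, and the L¹-norm is submultiplicative under convolution. -/
theorem IsFT.mul {C D : ℝ} {P Q : V → ℂ} (hP : IsFT C P) (hQ : IsFT D Q) :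
    IsFT (C * D) (fun ξ => P ξ * Q ξ) := by
  obtain ⟨p, hp, rfl, hpC⟩ := hP
  obtain ⟨q, hq, rfl, hqD⟩ := hQ
  refine ⟨p ⋆[ContinuousLinearMap.mul ℂ ℂ] q,
    hp.integrable_convolution _ hq, ?_, ?_⟩
  · ext ξ
    exact Real.fourier_mul_convolution_eq hp hq ξ
  · have h1 : ∀ x, ‖(p ⋆[ContinuousLinearMap.mul ℂ ℂ] q) x‖ ≤
        ((fun x => ‖p x‖) ⋆[ContinuousLinearMap.mul ℝ ℝ] (fun x => ‖q x‖)) x := by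
      intro x
      refine (norm_integral_le_integral_norm _).trans (le_of_eq ?_)
      simp [convolution]
    calc _ ≤ ∫ x, ((fun x => ‖p x‖) ⋆[ContinuousLinearMap.mul ℝ ℝ] (fun x => ‖q x‖)) x :=
          integral_mono (hp.integrable_convolution _ hq).norm
            (hp.norm.integrable_convolution _ hq.norm) h1
      _ = (∫ x, ‖p x‖) * ∫ x, ‖q x‖ := by
          rw [integral_convolution _ hp.norm hq.norm]; rfl
      _ ≤ C * D := by
          gcongr
          exact (integral_nonneg fun x => norm_nonneg _).trans hpC

theorem IsFT.const_mul {C : ℝ} {Q : V → ℂ} (hQ : IsFT C Q) (a : ℂ) :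
    IsFT (‖a‖ * C) (fun ξ => a * Q ξ) := by
  obtain ⟨q, hq, rfl, hqD⟩ := hQ
  refine ⟨fun x => a * q x, hq.const_mul a, ?_, ?_⟩
  · ext ξ
    simp only [Real.fourier_eq, ← integral_const_mul]
    congr 1 with x
    simp only [Circle.smul_def, smul_eq_mul]
    ring
  · simp only [norm_mul, integral_const_mul]
    gcongr

theorem fourier_comp_inv_smul (q : V → ℂ) {l : ℝ} (hl : 0 < l) (ξ : V) :
    𝓕 (fun x => ((l ^ Module.finrank ℝ V)⁻¹ : ℝ) • q (l⁻¹ • x)) ξ = 𝓕 q (l • ξ) := by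
  have hld : 0 < l ^ Module.finrank ℝ V := by positivity
  simp only [Real.fourier_eq]
  have := Measure.integral_comp_inv_smul volume
    (fun y => Real.fourierChar (-inner ℝ y (l • ξ)) • q y) l
  rw [abs_of_pos hld] at this
  have h2 : ∀ x, Real.fourierChar (-inner ℝ x ξ) •
      ((l ^ Module.finrank ℝ V)⁻¹ : ℝ) • q (l⁻¹ • x) = ((l ^ Module.finrank ℝ V)⁻¹ : ℝ) •
        (Real.fourierChar (-inner ℝ (l⁻¹ • x) (l • ξ)) • q (l⁻¹ • x)) := by
    intro x
    rw [smul_comm]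
    congr 4
    simp only [inner_smul_left, inner_smul_right]
    simp
    field_simp
  simp only [h2]
  rw [integral_smul, this, smul_smul, inv_mul_cancel₀ hld.ne', one_smul]

/-- Dilations normalized in L¹ preserve the norm. That C does not change is what makes a sum over
dyadic scales converge. -/
theorem IsFT.comp_smul {C : ℝ} {Q : V → ℂ} (hQ : IsFT C Q) {l : ℝ} (hl : 0 < l) :
    IsFT C (fun ξ => Q (l • ξ)) := by
  obtain ⟨q, hq, rfl, hqD⟩ := hQ
  set d := Module.finrank ℝ V with hd
  have hld : 0 < l ^ d := by positivity
  refine ⟨fun x => ((l ^ d)⁻¹ : ℝ) • q (l⁻¹ • x),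
    ((hq.comp_smul (inv_pos.2 hl).ne').smul ((l ^ d)⁻¹ : ℝ)),
    funext fun ξ => fourier_comp_inv_smul q hl ξ, ?_⟩
  have := Measure.integral_comp_inv_smul volume (fun y => ‖q y‖) l
  rw [abs_of_pos hld, smul_eq_mul] at this
  refine le_trans (le_of_eq ?_) hqD
  simp only [norm_smul, Real.norm_of_nonneg (inv_nonneg.2 hld.le)]
  rw [integral_const_mul, this, ← mul_assoc, inv_mul_cancel₀ hld.ne', one_mul]

/-- The inverse transforms are summed in L¹ by completeness; convergence of the symbols is only
needed pointwise, to identify the sum. -/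
theorem IsFT.hasSum {C : ℕ → ℝ} {Q : ℕ → V → ℂ} {P : V → ℂ} (hQ : ∀ i, IsFT (C i) (Q i))
    (hC : Summable C) (hP : ∀ ξ, HasSum (fun i => Q i ξ) (P ξ)) : IsFT (∑' i, C i) P := by
  choose q hq hqQ hqC using hQ
  have hs : Summable fun i => ∫ x, ‖q i x‖ :=
    hC.of_nonneg_of_le (fun i => integral_nonneg fun x => norm_nonneg _) hqC
  have hl : ∫⁻ x, ∑' i, ‖q i x‖ₑ = ∑' i, ENNReal.ofReal (∫ x, ‖q i x‖) := by
    rw [lintegral_tsum fun i => (hq i).1.enorm]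
    congr 1 with i
    rw [ofReal_integral_norm_eq_lintegral_enorm (hq i)]
  have hfin : ∫⁻ x, ∑' i, ‖q i x‖ₑ ≤ ENNReal.ofReal (∑' i, C i) := by
    rw [hl, ENNReal.ofReal_tsum_of_nonneg (fun i => (integral_nonneg fun x => norm_nonneg _).trans
      (hqC i)) hC]
    exact ENNReal.tsum_le_tsum fun i => ENNReal.ofReal_le_ofReal (hqC i)
  have hae : ∀ᵐ x, Summable fun i => q i x := by
    have := ae_lt_top' (AEMeasurable.tsum fun i => (hq i).1.enorm)
      (hfin.trans_lt ENNReal.ofReal_lt_top).ne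
    filter_upwards [this] with x hx
    have : Summable fun i => ‖q i x‖₊ := ENNReal.tsum_coe_ne_top_iff_summable.1 hx.ne
    exact .of_norm (NNReal.summable_coe.2 this)
  have hm : AEStronglyMeasurable (fun x => ∑' i, q i x) volume := by
    refine aestronglyMeasurable_of_tendsto_ae Filter.atTop
      (f := fun (N : ℕ) x => ∑ i ∈ Finset.range N, q i x) (fun N => ?_) ?_
    · exact (integrable_finsetSum _ fun i _ => hq i).1
    · filter_upwards [hae] with x hx using hx.hasSum.tendsto_sum_nat
  have hle : ∫⁻ x, ‖∑' i, q i x‖ₑ ≤ ENNReal.ofReal (∑' i, C i) := by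
    refine le_trans (lintegral_mono fun x => ?_) hfin
    exact enorm_tsum_le_tsum_enorm
  have hint : Integrable (fun x => ∑' i, q i x) volume :=
    ⟨hm, hle.trans_lt ENNReal.ofReal_lt_top⟩
  refine ⟨_, hint, ?_, ?_⟩
  · ext ξ
    refine HasSum.unique ?_ (hP ξ)
    have := hasSum_integral_of_summable_integral_norm (μ := volume)
      (F := fun i x => Real.fourierChar (-inner ℝ x ξ) • q i x)
      (fun i => (Real.fourierIntegral_convergent_iff ξ).2 (hq i)) (by simpa using hs)
    simp only [← hqQ, Real.fourier_eq]
    have h2 : ∀ x, Real.fourierChar (-inner ℝ x ξ) • ∑' i, q i x =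
        ∑' i, Real.fourierChar (-inner ℝ x ξ) • q i x := fun x => by
      simp only [Circle.smul_def, smul_eq_mul, tsum_mul_left]
    simp only [h2]
    exact this
  · rw [← ENNReal.ofReal_le_ofReal_iff (tsum_nonneg fun i => (integral_nonneg fun x =>
      norm_nonneg _).trans (hqC i)), ofReal_integral_norm_eq_lintegral_enorm hint]
    exact hle

theorem IsFT.pow_succ {C : ℝ} {Q : V → ℂ} (hQ : IsFT C Q) (k : ℕ) :
    IsFT (C ^ (k + 1)) (fun ξ => Q ξ ^ (k + 1)) := by
  induction k with
  | zero => simpa using hQ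
  | succ k ih =>
    have := ih.mul hQ
    simpa only [_root_.pow_succ] using this

/-- The exponential series without its constant term, summed in the algebra. The constant 1 is
subtracted because it is not, in general, the transform of an integrable function. -/
theorem IsFT.exp_sub_one {C : ℝ} {Q : V → ℂ} (hQ : IsFT C Q) :
    IsFT (∑' k : ℕ, ‖(((k + 1).factorial : ℂ))⁻¹‖ * C ^ (k + 1))
      (fun ξ => Complex.exp (Q ξ) - 1) := by
  refine IsFT.hasSum (Q := fun k ξ => (((k + 1).factorial : ℂ))⁻¹ * Q ξ ^ (k + 1))
    (fun k => (hQ.pow_succ k).const_mul _) ?_ ?_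
  · have := (summable_nat_add_iff 1).2 (Real.summable_pow_div_factorial C)
    refine this.congr fun k => ?_
    simp [div_eq_inv_mul]
  · intro ξ
    have := NormedSpace.expSeries_div_hasSum_exp (𝔸 := ℂ) (Q ξ)
    rw [← Complex.exp_eq_exp_ℂ] at this
    have h2 := (hasSum_nat_add_iff' 1).2 this
    simp only [Finset.range_one, Finset.sum_singleton, pow_zero, Nat.factorial_zero, Nat.cast_one,
      div_one] at h2
    refine h2.congr_fun fun k => ?_
    rw [div_eq_inv_mul]

end Wiener

end FracHeat

namespace FracHeat

/-! ### The symbol exp(-|ξ|^{2α}) at infinity and at the origin. -/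

section Cutoff

open scoped ContDiff Topology

theorem rpow_mul_exp_neg_rpow_le {α : ℝ} (hα : 0 < α) (e : ℝ) :
    ∃ C, ∀ y : ℝ, 1 ≤ y → y ^ e * Real.exp (-y ^ α) ≤ C := by
  obtain ⟨N, hN⟩ := exists_nat_ge (e / α)
  refine ⟨N.factorial, fun y hy => ?_⟩
  have hy0 : 0 < y := by linarith
  have h1 : y ^ e ≤ (y ^ α) ^ N := by
    rw [← Real.rpow_natCast, ← Real.rpow_mul hy0.le]
    refine Real.rpow_le_rpow_of_exponent_le hy ?_
    rw [div_le_iff₀ hα] at hN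
    linarith
  have h2 := Real.pow_div_factorial_le_exp _ (Real.rpow_nonneg hy0.le α) N
  rw [div_le_iff₀ (by positivity)] at h2
  rw [Real.exp_neg, ← div_eq_mul_inv, div_le_iff₀ (Real.exp_pos _)]
  linarith

theorem contDiffAt_rpow_mul_exp_neg_rpow {α y : ℝ} (hy : 0 < y) (e : ℝ) {m : WithTop ℕ∞} :
    ContDiffAt ℝ m (fun y : ℝ => y ^ e * Real.exp (-y ^ α)) y := by
  refine ContDiffAt.mul (Real.contDiffAt_rpow_const_of_ne hy.ne') ?_
  exact (Real.contDiffAt_rpow_const_of_ne hy.ne').neg.exp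

/-- Differentiating y^e exp(-y^α) gives a combination of functions of the same form, with exponents
e - 1 and e + α - 1. The induction therefore runs over all real e at once. -/
theorem iteratedDeriv_rpow_mul_exp_neg_rpow_le {α : ℝ} (hα : 0 < α) (k m : ℕ) (e : ℝ) :
    ∃ C, ∀ y : ℝ, 1 ≤ y →
      y ^ k * ‖iteratedDeriv m (fun y : ℝ => y ^ e * Real.exp (-y ^ α)) y‖ ≤ C := by
  induction m generalizing e with
  | zero =>
    obtain ⟨C, hC⟩ := rpow_mul_exp_neg_rpow_le hα (k + e)
    refine ⟨C, fun y hy => ?_⟩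
    have hy0 : 0 < y := by linarith
    have h1 := hC y hy
    rw [Real.rpow_add hy0, Real.rpow_natCast] at h1
    rw [iteratedDeriv_zero, Real.norm_of_nonneg (by positivity), ← mul_assoc]
    exact h1
  | succ m ih =>
    obtain ⟨C, hC⟩ := ih (e - 1)
    obtain ⟨D, hD⟩ := ih (e + (α - 1))
    refine ⟨|e| * C + |α| * D, fun y hy => ?_⟩
    have hy0 : 0 < y := by linarith
    have h1 : deriv (fun y : ℝ => y ^ e * Real.exp (-y ^ α)) =ᶠ[𝓝 y]
        (fun y => e * (y ^ (e - 1) * Real.exp (-y ^ α)) -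
          α * (y ^ (e + (α - 1)) * Real.exp (-y ^ α))) := by
      filter_upwards [lt_mem_nhds hy0] with z hz
      have h2 := (Real.hasDerivAt_rpow_const (x := z) (p := e) (.inl hz.ne')).mul
        (Real.hasDerivAt_rpow_const (x := z) (p := α) (.inl hz.ne')).neg.exp
      have h3 := h2.deriv
      refine Eq.trans ?_ (h3.trans ?_)
      · rfl
      · rw [Real.rpow_add hz]
        simp only [Pi.neg_apply]
        ring
    rw [iteratedDeriv_succ', h1.iteratedDeriv_eq m, iteratedDeriv_fun_sub
      (contDiffAt_const.mul (contDiffAt_rpow_mul_exp_neg_rpow hy0 _))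
      (contDiffAt_const.mul (contDiffAt_rpow_mul_exp_neg_rpow hy0 _)),
      iteratedDeriv_const_mul_field, iteratedDeriv_const_mul_field]
    have h4 := hC y hy
    have h5 := hD y hy
    calc _ ≤ y ^ k * (|e| * ‖iteratedDeriv m (fun y : ℝ => y ^ (e - 1) * Real.exp (-y ^ α)) y‖ +
          |α| * ‖iteratedDeriv m (fun y : ℝ => y ^ (e + (α - 1)) * Real.exp (-y ^ α)) y‖) := by
          gcongr
          refine (norm_sub_le _ _).trans ?_
          simp only [norm_mul, Real.norm_eq_abs]
          exact le_rfl
      _ = |e| * (y ^ k * ‖iteratedDeriv m (fun y : ℝ => y ^ (e - 1) * Real.exp (-y ^ α)) y‖) +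
          |α| * (y ^ k *
            ‖iteratedDeriv m (fun y : ℝ => y ^ (e + (α - 1)) * Real.exp (-y ^ α)) y‖) := by ring
      _ ≤ _ := by gcongr

/-- A smooth function on the line, equal to `exp(-y^α)` for `y ≥ 2`. -/
def expCut (α y : ℝ) : ℝ :=
  Real.smoothTransition (y + 1) * Real.exp (-(Real.smoothTransition (y - 1) * y ^ α))

theorem contDiff_expCut (α : ℝ) : ContDiff ℝ ∞ (expCut α) := by
  have h1 : ContDiff ℝ ∞ fun y : ℝ => Real.smoothTransition (y - 1) * y ^ α := by
    rw [contDiff_iff_contDiffAt]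
    intro y
    rcases lt_or_ge y 1 with hy | hy
    · have : (fun y : ℝ => Real.smoothTransition (y - 1) * y ^ α) =ᶠ[𝓝 y] fun _ => 0 := by
        filter_upwards [gt_mem_nhds hy] with z hz
        rw [Real.smoothTransition.zero_of_nonpos (by linarith), zero_mul]
      exact contDiffAt_const.congr_of_eventuallyEq this
    · refine ContDiffAt.mul ?_ (Real.contDiffAt_rpow_const_of_ne (by linarith))
      exact (Real.smoothTransition.contDiff.comp (contDiff_id.sub contDiff_const)).contDiffAt
  exact (Real.smoothTransition.contDiff.comp (contDiff_id.add contDiff_const)).mul h1.neg.exp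

/-- The function vanishes far to the left, equals exp(-y^α) far to the right, and is smooth on the
compact interval between. -/
theorem expCut_decay {α : ℝ} (hα : 0 < α) (k m : ℕ) :
    ∃ C, ∀ y, ‖y‖ ^ k * ‖iteratedFDeriv ℝ m (expCut α) y‖ ≤ C := by
  simp only [norm_iteratedFDeriv_eq_norm_iteratedDeriv]
  obtain ⟨C, hC⟩ := iteratedDeriv_rpow_mul_exp_neg_rpow_le hα k m 0
  have hcont : Continuous fun y => ‖y‖ ^ k * ‖iteratedDeriv m (expCut α) y‖ :=
    (continuous_norm.pow k).mul ((contDiff_expCut α).continuous_iteratedDeriv m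
      (mod_cast le_top)).norm
  obtain ⟨D, hD⟩ := (isCompact_Icc (a := (-2 : ℝ)) (b := 3)).bddAbove_image hcont.continuousOn
  refine ⟨max (max C D) 0, fun y => ?_⟩
  rcases lt_or_ge y (-2) with hy | hy
  · have : expCut α =ᶠ[𝓝 y] fun _ => 0 := by
      filter_upwards [gt_mem_nhds hy] with z hz
      rw [expCut, Real.smoothTransition.zero_of_nonpos (by linarith), zero_mul]
    rw [this.iteratedDeriv_eq, iteratedDeriv_const]
    simp
  rcases le_or_gt y 3 with hy3 | hy3
  · exact ((hD (mem_image_of_mem _ ⟨hy, hy3⟩)).trans (le_max_right _ _)).trans (le_max_left _ _)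
  · have : expCut α =ᶠ[𝓝 y] fun y => y ^ (0 : ℝ) * Real.exp (-y ^ α) := by
      filter_upwards [lt_mem_nhds hy3] with z hz
      rw [expCut, Real.smoothTransition.one_of_one_le (by linarith),
        Real.smoothTransition.one_of_one_le (by linarith), Real.rpow_zero, one_mul, one_mul,
        one_mul]
    rw [this.iteratedDeriv_eq, Real.norm_of_nonneg (by linarith)]
    exact ((hC y (by linarith)).trans (le_max_left _ _)).trans (le_max_left _ _)

/-- `expCut` as a Schwartz function. -/
def expCutSchwartz {α : ℝ} (hα : 0 < α) : SchwartzMap ℝ ℂ where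
  toFun y := (expCut α y : ℂ)
  smooth' := Complex.ofRealCLM.contDiff.comp (contDiff_expCut α)
  decay' k m := by
    obtain ⟨C, hC⟩ := expCut_decay hα k m
    refine ⟨C, fun y => ?_⟩
    have := Complex.ofRealLI.norm_iteratedFDeriv_comp_left (f := expCut α) (x := y) (n := ∞)
      (contDiff_expCut α).contDiffAt (i := m) (mod_cast le_top)
    have h2 : (fun y => (expCut α y : ℂ)) = Complex.ofRealLI ∘ expCut α := rfl
    rw [h2, this]
    exact hC y

variable {V : Type*} [NormedAddCommGroup V] [InnerProductSpace ℝ V] [FiniteDimensional ℝ V]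
  [MeasurableSpace V] [BorelSpace V]

/-- `expCut` is composed with ‖ξ‖². The first transition factor of `expCut`, there to kill the
negative half-line, is 1 at arguments ≥ 0. The result carries the behaviour of the symbol at
infinity, with the singularity at the origin cut away. -/
theorem exists_schwartz_expCut {α : ℝ} (hα : 0 < α) :
    ∃ Φ : SchwartzMap V ℂ, ∀ ξ, Φ ξ =
      ((Real.exp (-(Real.smoothTransition (‖ξ‖ ^ 2 - 1) * (‖ξ‖ ^ 2) ^ α)) : ℝ) : ℂ) := by
  have hg : ∃ (k : ℕ) (C : ℝ), ∀ x : V, ‖x‖ ≤ C * (1 + ‖‖x‖ ^ 2‖) ^ k := by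
    refine ⟨1, 1, fun x => ?_⟩
    rw [Real.norm_of_nonneg (by positivity)]
    nlinarith [sq_nonneg (‖x‖ - 1), norm_nonneg x]
  refine ⟨SchwartzMap.compCLM ℂ (D := V) (Function.hasTemperateGrowth_norm_sq V) hg
    (expCutSchwartz hα), fun ξ => ?_⟩
  rw [SchwartzMap.compCLM_apply]
  change ((expCut α (‖ξ‖ ^ 2) : ℝ) : ℂ) = _
  rw [expCut, Real.smoothTransition.one_of_one_le (by nlinarith [norm_nonneg ξ]), one_mul]

/-- A smooth radial cutoff: `1` for `‖ξ‖ ≤ 1` and `0` for `‖ξ‖² ≥ 2`. -/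
def cut (ξ : V) : ℝ := 1 - Real.smoothTransition (‖ξ‖ ^ 2 - 1)

theorem contDiff_cut : ContDiff ℝ ∞ (cut : V → ℝ) :=
  contDiff_const.sub (Real.smoothTransition.contDiff.comp
    ((contDiff_norm_sq ℝ).sub contDiff_const))

theorem cut_of_le {ξ : V} (h : ‖ξ‖ ≤ 1) : cut ξ = 1 := by
  rw [cut, Real.smoothTransition.zero_of_nonpos (by nlinarith [norm_nonneg ξ]), sub_zero]

theorem cut_of_ge {ξ : V} (h : 2 ≤ ‖ξ‖) : cut ξ = 0 := by
  rw [cut, Real.smoothTransition.one_of_one_le (by nlinarith [norm_nonneg ξ]), sub_self]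

/-- A dyadic piece of `‖ξ‖^{2α}`. -/
def dyadic (α : ℝ) (ξ : V) : ℝ := (‖ξ‖ ^ 2) ^ α * (cut ξ - cut ((2 : ℝ) • ξ))

/-- Both cutoffs are 1 for ‖ξ‖ < 1/2, so the product vanishes around the origin, the only point
where the power may fail to be smooth. -/
theorem contDiff_dyadic (α : ℝ) : ContDiff ℝ ∞ (dyadic α : V → ℝ) := by
  rw [contDiff_iff_contDiffAt]
  intro ξ
  rcases lt_or_ge ‖ξ‖ (1 / 2) with h | h
  · have : dyadic α =ᶠ[𝓝 ξ] fun _ : V => 0 := by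
      filter_upwards [continuous_norm.continuousAt.eventually_lt continuousAt_const h] with z hz
      rw [dyadic, cut_of_le (by linarith), cut_of_le, sub_self, mul_zero]
      rw [norm_smul]; norm_num; linarith
    exact contDiffAt_const.congr_of_eventuallyEq this
  · refine ContDiffAt.mul ?_ (contDiff_cut.sub
      (contDiff_cut.comp (contDiff_const_smul _))).contDiffAt
    exact (contDiff_norm_sq ℝ).contDiffAt.rpow_const_of_ne (by positivity)

theorem hasCompactSupport_dyadic (α : ℝ) : HasCompactSupport (dyadic α : V → ℝ) := by
  refine HasCompactSupport.intro (isCompact_closedBall (0 : V) 2) fun ξ hξ => ?_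
  rw [mem_closedBall_zero_iff, not_le] at hξ
  rw [dyadic, cut_of_ge hξ.le, cut_of_ge, sub_self, mul_zero]
  rw [norm_smul]; norm_num; linarith

theorem exists_isFT_dyadic (α : ℝ) : ∃ C, IsFT C (fun ξ : V => ((dyadic α ξ : ℝ) : ℂ)) := by
  have h1 : HasCompactSupport (fun ξ : V => ((dyadic α ξ : ℝ) : ℂ)) :=
    (hasCompactSupport_dyadic α).comp_left Complex.ofReal_zero
  have h2 : ContDiff ℝ ∞ (fun ξ : V => ((dyadic α ξ : ℝ) : ℂ)) :=
    Complex.ofRealCLM.contDiff.comp (contDiff_dyadic α)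
  exact SchwartzMap.exists_isFT (h1.toSchwartzMap h2)

/-- The coefficients undo the homogeneity of the power, and the differences of cutoffs telescope. -/
theorem sum_dyadic {α : ℝ} (ξ : V) (N : ℕ) :
    ∑ i ∈ Finset.range N, (2 ^ (-(2 * α) * i) : ℝ) * dyadic α ((2 ^ i : ℝ) • ξ) =
      (‖ξ‖ ^ 2) ^ α * (cut ξ - cut ((2 ^ N : ℝ) • ξ)) := by
  induction N with
  | zero => simp
  | succ N ih =>
    rw [Finset.sum_range_succ, ih, dyadic, smul_smul, ← _root_.pow_succ']
    have : (2 ^ (-(2 * α) * N) : ℝ) * (‖(2 ^ N : ℝ) • ξ‖ ^ 2) ^ α = (‖ξ‖ ^ 2) ^ α := by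
      rw [norm_smul, mul_pow, Real.mul_rpow (by positivity) (by positivity), ← mul_assoc,
        Real.norm_of_nonneg (by positivity), ← Real.rpow_natCast, ← Real.rpow_natCast,
        ← Real.rpow_mul (by positivity), ← Real.rpow_mul (by positivity),
        ← Real.rpow_add (by positivity)]
      have : -(2 * α) * N + N * ((2 : ℕ) * α) = 0 := by push_cast; ring
      rw [this, Real.rpow_zero, one_mul]
    rw [← mul_assoc, this]
    ring

/-- Near the origin the power is a sum of dilates of one bump. Each dilate has the same L¹ bound C,
and the coefficients 2^{-2αi} are summable because α > 0. -/
theorem exists_isFT_cut_mul {α : ℝ} (hα : 0 < α) :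
    ∃ C, IsFT C (fun ξ : V => ((cut ξ * (‖ξ‖ ^ 2) ^ α : ℝ) : ℂ)) := by
  obtain ⟨C, hC⟩ := exists_isFT_dyadic (V := V) α
  have hlt : (2 : ℝ) ^ (-(2 * α)) < 1 :=
    Real.rpow_lt_one_of_one_lt_of_neg (by norm_num) (by linarith)
  have hpow : ∀ i : ℕ, (2 ^ (-(2 * α) * i) : ℝ) = (2 ^ (-(2 * α)) : ℝ) ^ i := fun i => by
    rw [Real.rpow_mul (by norm_num), Real.rpow_natCast]
  have hsum : Summable fun i : ℕ => (2 ^ (-(2 * α) * i) : ℝ) * C := by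
    simp only [hpow]
    exact (summable_geometric_of_lt_one (by positivity) hlt).mul_right C
  refine ⟨_, IsFT.hasSum (C := fun i : ℕ => (2 ^ (-(2 * α) * i) : ℝ) * C)
    (Q := fun (i : ℕ) (ξ : V) => ((2 ^ (-(2 * α) * i) : ℝ) : ℂ) *
      ((dyadic α ((2 ^ i : ℝ) • ξ) : ℝ) : ℂ)) (fun i => ?_) hsum fun ξ => ?_⟩
  · have := (hC.comp_smul (l := 2 ^ i) (by positivity)).const_mul ((2 ^ (-(2 * α) * i) : ℝ) : ℂ)
    rwa [Complex.norm_real, Real.norm_of_nonneg (by positivity)] at this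
  · have hs : Summable fun i : ℕ => (2 ^ (-(2 * α) * i) : ℝ) * dyadic α ((2 ^ i : ℝ) • ξ) := by
      refine Summable.of_norm_bounded hsum fun i => ?_
      rw [norm_mul, Real.norm_of_nonneg (by positivity)]
      gcongr
      simpa using hC.norm_le ((2 ^ i : ℝ) • ξ)
    have h1 := hs.hasSum.tendsto_sum_nat
    simp only [sum_dyadic] at h1
    have h2 : Filter.Tendsto (fun N : ℕ => (‖ξ‖ ^ 2) ^ α * (cut ξ - cut ((2 ^ N : ℝ) • ξ)))
        Filter.atTop (𝓝 (cut ξ * (‖ξ‖ ^ 2) ^ α)) := by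
      refine tendsto_const_nhds.congr' ?_
      rcases eq_or_ne ξ 0 with rfl | hξ
      · refine .of_forall fun N => ?_
        simp [Real.zero_rpow hα.ne']
      · have h3 : Filter.Tendsto (fun N : ℕ => (2 : ℝ) ^ N * ‖ξ‖) Filter.atTop Filter.atTop :=
          (tendsto_pow_atTop_atTop_of_one_lt (by norm_num)).atTop_mul_const (norm_pos_iff.2 hξ)
        filter_upwards [h3.eventually_ge_atTop 2] with N hN
        rw [cut_of_ge (ξ := (2 ^ N : ℝ) • ξ), sub_zero, mul_comm]
        rwa [norm_smul, Real.norm_of_nonneg (by positivity)]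
    have h4 := hs.hasSum
    rw [tendsto_nhds_unique h1 h2] at h4
    have h5 := Complex.hasSum_ofReal.2 h4
    simpa using h5

/-- The symbol `exp(-‖ξ‖^{2α})` is the Fourier transform of a continuous integrable function. -/
theorem exists_fourier_eq_exp {α : ℝ} (hα : 0 < α) :
    ∃ k : V → ℂ, Integrable k ∧ Continuous k ∧
      𝓕 k = fun ξ => ((Real.exp (-(‖ξ‖ ^ 2) ^ α) : ℝ) : ℂ) := by
  obtain ⟨Φ, hΦ⟩ := exists_schwartz_expCut (V := V) hα
  obtain ⟨C, hC⟩ := exists_isFT_cut_mul (V := V) hα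
  -- The transform of w is exp(-χ|ξ|^{2α}) - 1 with χ = `cut`. Hence s + s ⋆ w has transform Φ ·
  -- exp(-χ|ξ|^{2α}), which is the full symbol. It is continuous because s is bounded and continuous
  -- and w is integrable.
  obtain ⟨w, hw, hwQ, -⟩ := (hC.const_mul (-1)).exp_sub_one
  set s : SchwartzMap V ℂ := 𝓕⁻ Φ with hs
  have hsF : 𝓕 (s : V → ℂ) = Φ := by
    rw [← SchwartzMap.fourier_coe, hs]; simp
  have hconv : Integrable ((s : V → ℂ) ⋆[ContinuousLinearMap.mul ℂ ℂ] w) :=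
    s.integrable.integrable_convolution _ hw
  refine ⟨fun x => s x + ((s : V → ℂ) ⋆[ContinuousLinearMap.mul ℂ ℂ] w) x,
    s.integrable.add hconv, s.continuous.add ?_, ?_⟩
  · refine BddAbove.continuous_convolution_left_of_integrable _ ?_ s.continuous hw
    obtain ⟨D, hD⟩ := s.decay 0 0
    refine ⟨D, ?_⟩
    rintro _ ⟨x, rfl⟩
    simpa using hD.2 x
  · ext ξ
    have h1 : 𝓕 (fun x => s x + ((s : V → ℂ) ⋆[ContinuousLinearMap.mul ℂ ℂ] w) x) ξ =
        𝓕 (s : V → ℂ) ξ + 𝓕 ((s : V → ℂ) ⋆[ContinuousLinearMap.mul ℂ ℂ] w) ξ := by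
      simp only [Real.fourier_eq, smul_add]
      exact integral_add ((Real.fourierIntegral_convergent_iff ξ).2 s.integrable)
        ((Real.fourierIntegral_convergent_iff ξ).2 hconv)
    rw [h1, Real.fourier_mul_convolution_eq s.integrable hw, hsF, hwQ, hΦ]
    rw [← mul_one_add, add_sub_cancel]
    have h2 : (-1 : ℂ) * ((cut ξ * (‖ξ‖ ^ 2) ^ α : ℝ) : ℂ) =
        ((-(cut ξ * (‖ξ‖ ^ 2) ^ α) : ℝ) : ℂ) := by push_cast; ring
    rw [h2, ← Complex.ofReal_exp, ← Complex.ofReal_mul, ← Real.exp_add, cut]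
    congr 2
    ring

end Cutoff

end FracHeat

namespace FracHeat

/-! ### The kernel: integrability, scaling, semigroup law. -/

section Symbol

variable {n : ℕ} {α : ℝ}

/-- The symbol of `S_α(t)` in Mathlib's normalization of the Fourier transform. -/
def symbol (n : ℕ) (α t : ℝ) (ξ : EuclideanSpace ℝ (Fin n)) : ℂ :=
  ((Real.exp (-t * (2 * Real.pi * ‖ξ‖) ^ (2 * α)) : ℝ) : ℂ)

theorem continuous_symbol (hα : 0 < α) (t : ℝ) : Continuous (symbol n α t) := by
  refine Complex.continuous_ofReal.comp (Real.continuous_exp.comp (continuous_const.mul ?_))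
  exact (continuous_const.mul continuous_norm).rpow_const fun x => .inr (by linarith)

theorem measurable_symbol_uncurry :
    Measurable fun p : ℝ × EuclideanSpace ℝ (Fin n) => symbol n α p.1 p.2 := by
  unfold symbol
  fun_prop

/-- The dilation factor with `symbol t ξ = exp(-(‖l ξ‖²)^α)`. -/
theorem symbol_eq {t : ℝ} (ht : 0 < t) (hα : 0 < α) (ξ : EuclideanSpace ℝ (Fin n)) :
    symbol n α t ξ =
      ((Real.exp (-(‖(2 * Real.pi * t ^ (1 / (2 * α))) • ξ‖ ^ 2) ^ α) : ℝ) : ℂ) := by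
  have hpi := Real.pi_pos
  rw [symbol, norm_smul, Real.norm_of_nonneg (by positivity)]
  congr 3
  have h1 : ((2 * Real.pi * t ^ (1 / (2 * α)) * ‖ξ‖) ^ 2) ^ α =
      (t ^ (1 / (2 * α)) * (2 * Real.pi * ‖ξ‖)) ^ (2 * α) := by
    rw [Real.rpow_mul (by positivity), Real.rpow_two]
    congr 2; ring
  rw [h1, Real.mul_rpow (x := t ^ (1 / (2 * α))) (by positivity) (by positivity),
    ← Real.rpow_mul ht.le, one_div_mul_cancel (by positivity), Real.rpow_one]
  ring

theorem exists_kernel (hα : 0 < α) {t : ℝ} (ht : 0 < t) :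
    ∃ k : EuclideanSpace ℝ (Fin n) → ℂ, Integrable k ∧ Continuous k ∧ 𝓕 k = symbol n α t := by
  obtain ⟨k, hk, hkc, hkF⟩ := exists_fourier_eq_exp (V := EuclideanSpace ℝ (Fin n)) hα
  have hpi := Real.pi_pos
  set l := 2 * Real.pi * t ^ (1 / (2 * α)) with hl
  have hl0 : 0 < l := by positivity
  refine ⟨fun x => ((l ^ Module.finrank ℝ (EuclideanSpace ℝ (Fin n)))⁻¹ : ℝ) • k (l⁻¹ • x),
    (hk.comp_smul (inv_pos.2 hl0).ne').smul
      ((l ^ Module.finrank ℝ (EuclideanSpace ℝ (Fin n)))⁻¹ : ℝ),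
    (hkc.comp (continuous_const_smul l⁻¹)).const_smul
      ((l ^ Module.finrank ℝ (EuclideanSpace ℝ (Fin n)))⁻¹ : ℝ), ?_⟩
  ext ξ
  rw [fourier_comp_inv_smul k hl0, hkF, symbol_eq ht hα]

/-- The symbol is dominated by a dilate of the Schwartz function of `exists_schwartz_expCut`, since
the transition function is at most 1. -/
theorem integrable_symbol (hα : 0 < α) {t : ℝ} (ht : 0 < t) : Integrable (symbol n α t) := by
  have hpi := Real.pi_pos
  obtain ⟨Φ, hΦ⟩ := exists_schwartz_expCut (V := EuclideanSpace ℝ (Fin n)) hα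
  have h1 : Integrable fun ξ => Φ ((2 * Real.pi * t ^ (1 / (2 * α))) • ξ) :=
    Φ.integrable.comp_smul (by positivity)
  refine h1.mono (continuous_symbol hα t).aestronglyMeasurable (.of_forall fun ξ => ?_)
  rw [symbol_eq ht hα, hΦ, Complex.norm_real, Complex.norm_real, Real.norm_of_nonneg
    (Real.exp_pos _).le, Real.norm_of_nonneg (Real.exp_pos _).le, Real.exp_le_exp, neg_le_neg_iff]
  exact mul_le_of_le_one_left (by positivity) (Real.smoothTransition.le_one _)

theorem fourierInv_symbol_neg (t : ℝ) (x : EuclideanSpace ℝ (Fin n)) :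
    𝓕⁻ (symbol n α t) (-x) = 𝓕⁻ (symbol n α t) x := by
  rw [Real.fourierInv_eq_fourier_neg, neg_neg, Real.fourierInv_eq_fourier_comp_neg]
  have : (fun ξ => symbol n α t (-ξ)) = symbol n α t := by
    ext ξ
    simp [symbol]
  rw [this]

/-- The symbol is real and even, so its inverse transform is real and nothing is lost by the real
part in `kernel`. -/
theorem ofReal_kernel (t : ℝ) (x : EuclideanSpace ℝ (Fin n)) :
    (kernel n α t x : ℂ) = 𝓕⁻ (symbol n α t) x := by
  have h1 : (starRingEnd ℂ) (𝓕⁻ (symbol n α t) x) = 𝓕⁻ (symbol n α t) x := by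
    nth_rw 1 [← fourierInv_symbol_neg t x]
    rw [Real.fourierInv_eq_fourier_neg, Real.fourierInv_eq, Real.fourier_eq, neg_neg, ← integral_conj]
    congr 1 with ξ
    simp only [Circle.smul_def, smul_eq_mul, map_mul, symbol, Complex.conj_ofReal]
    congr 1
    rw [← Circle.coe_inv_eq_conj, AddChar.map_neg_eq_inv, inv_inv]
  exact Complex.conj_eq_iff_re.1 h1

theorem kernel_neg (t : ℝ) (x : EuclideanSpace ℝ (Fin n)) :
    kernel n α t (-x) = kernel n α t x := by
  have := ofReal_kernel (n := n) (α := α) t (-x)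
  rw [fourierInv_symbol_neg, ← ofReal_kernel] at this
  exact_mod_cast this

/-- Fourier inversion. Integrability, scaling and the semigroup law of the kernel are thereby read
off from symbols; continuity makes the identities hold at every point. -/
theorem eq_kernel_of_fourier (hα : 0 < α) {t : ℝ} (ht : 0 < t)
    {k : EuclideanSpace ℝ (Fin n) → ℂ} (hk : Integrable k) (hkc : Continuous k)
    (hkF : 𝓕 k = symbol n α t) (x : EuclideanSpace ℝ (Fin n)) : k x = kernel n α t x := by
  rw [ofReal_kernel, ← hkF, hkc.fourierInv_fourier_eq hk]
  rw [hkF]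
  exact integrable_symbol hα ht

theorem integrable_kernel (hα : 0 < α) {t : ℝ} (ht : 0 < t) :
    Integrable (kernel n α t) := by
  obtain ⟨k, hk, hkc, hkF⟩ := exists_kernel (n := n) hα ht
  refine hk.re.congr (.of_forall fun x => ?_)
  simp [eq_kernel_of_fourier hα ht hk hkc hkF]

theorem integrable_ofReal_kernel (hα : 0 < α) {t : ℝ} (ht : 0 < t) :
    Integrable (fun x => (kernel n α t x : ℂ)) :=
  (integrable_kernel hα ht).ofReal

theorem continuous_kernel (hα : 0 < α) {t : ℝ} (ht : 0 < t) :
    Continuous (kernel n α t) := by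
  obtain ⟨k, hk, hkc, hkF⟩ := exists_kernel (n := n) hα ht
  refine (Complex.continuous_re.comp hkc).congr fun x => ?_
  simp [eq_kernel_of_fourier hα ht hk hkc hkF]

theorem fourier_kernel (hα : 0 < α) {t : ℝ} (ht : 0 < t) :
    𝓕 (fun x => (kernel n α t x : ℂ)) = symbol n α t := by
  obtain ⟨k, hk, hkc, hkF⟩ := exists_kernel (n := n) hα ht
  have : (fun x => (kernel n α t x : ℂ)) = k :=
    funext fun x => (eq_kernel_of_fourier hα ht hk hkc hkF x).symm
  rw [this, hkF]

theorem integral_kernel (hα : 0 < α) {t : ℝ} (ht : 0 < t) :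
    ∫ x, kernel n α t x = 1 := by
  have h1 := congrFun (fourier_kernel (n := n) hα ht) 0
  rw [Real.fourier_eq] at h1
  simp only [inner_zero_right, neg_zero, AddChar.map_zero_eq_one, one_smul, integral_complex_ofReal,
    symbol, norm_zero, mul_zero] at h1
  rw [Real.zero_rpow (by positivity), mul_zero, Real.exp_zero] at h1
  exact_mod_cast h1

theorem measurable_kernel_uncurry :
    Measurable fun p : ℝ × EuclideanSpace ℝ (Fin n) => kernel n α p.1 p.2 := by
  have h1 : StronglyMeasurable fun p : (ℝ × EuclideanSpace ℝ (Fin n)) × EuclideanSpace ℝ (Fin n) =>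
      Real.fourierChar (inner ℝ p.2 p.1.2) • symbol n α p.1.1 p.2 := by
    have h3 : Measurable fun p : (ℝ × EuclideanSpace ℝ (Fin n)) × EuclideanSpace ℝ (Fin n) =>
      symbol n α p.1.1 p.2 := measurable_symbol_uncurry.comp
        ((measurable_fst.comp measurable_fst).prodMk measurable_snd)
    refine StronglyMeasurable.smul (Continuous.stronglyMeasurable ?_) h3.stronglyMeasurable
    have h4 : Continuous fun p : (ℝ × EuclideanSpace ℝ (Fin n)) × EuclideanSpace ℝ (Fin n) =>
      inner ℝ p.2 p.1.2 := by fun_prop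
    exact continuous_subtype_val.comp (Real.continuous_fourierChar.comp h4)
  have h2 := h1.integral_prod_right' (ν := volume)
  have h3 : (fun p : ℝ × EuclideanSpace ℝ (Fin n) => kernel n α p.1 p.2) = fun p =>
      (∫ ξ, Real.fourierChar (inner ℝ ξ p.2) • symbol n α p.1 ξ).re := by
    ext p
    rw [kernel, Real.fourierInv_eq]
    rfl
  rw [h3]
  exact Complex.measurable_re.comp h2.measurable

/-- Both sides are continuous and integrable with the same Fourier transform. -/
theorem kernel_scaling (hα : 0 < α) {t : ℝ} (ht : 0 < t) (x : EuclideanSpace ℝ (Fin n)) :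
    kernel n α t x = t ^ (-(n / (2 * α))) * kernel n α 1 ((t ^ (1 / (2 * α)))⁻¹ • x) := by
  set l := t ^ (1 / (2 * α)) with hl
  have hl0 : 0 < l := by positivity
  have hc := (continuous_kernel (n := n) hα one_pos)
  have hi := integrable_ofReal_kernel (n := n) hα one_pos
  have hln : (l ^ n)⁻¹ = t ^ (-(n / (2 * α))) := by
    rw [hl, ← Real.rpow_natCast, ← Real.rpow_mul ht.le, ← Real.rpow_neg ht.le]
    congr 1; ring
  have hF : 𝓕 (fun x : EuclideanSpace ℝ (Fin n) =>
      ((l ^ Module.finrank ℝ (EuclideanSpace ℝ (Fin n)))⁻¹ : ℝ) •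
        (kernel n α 1 (l⁻¹ • x) : ℂ)) = symbol n α t := by
    ext ξ
    rw [fourier_comp_inv_smul (fun x => (kernel n α 1 x : ℂ)) hl0, fourier_kernel hα one_pos,
      symbol_eq one_pos hα, symbol_eq ht hα, Real.one_rpow, mul_one, smul_smul]
  have h := eq_kernel_of_fourier hα ht ?_ ?_ hF x
  · rw [finrank_euclideanSpace_fin, hln, Complex.real_smul] at h
    exact_mod_cast h.symm
  · exact (hi.comp_smul (inv_pos.2 hl0).ne').smul
      ((l ^ Module.finrank ℝ (EuclideanSpace ℝ (Fin n)))⁻¹ : ℝ)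
  · exact (Complex.continuous_ofReal.comp (hc.comp (continuous_const_smul l⁻¹))).const_smul
      ((l ^ Module.finrank ℝ (EuclideanSpace ℝ (Fin n)))⁻¹ : ℝ)

theorem abs_kernel_le (t : ℝ) (x : EuclideanSpace ℝ (Fin n)) :
    ‖kernel n α t x‖ ≤ ∫ ξ, ‖symbol n α t ξ‖ := by
  rw [← Complex.norm_real, ofReal_kernel, Real.fourierInv_eq]
  refine (norm_integral_le_integral_norm _).trans (le_of_eq ?_)
  simp

theorem lintegral_kernel_scaling (hα : 0 < α) {t : ℝ} (ht : 0 < t) :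
    ∫⁻ x, ‖kernel n α t x‖ₑ = ∫⁻ x, ‖kernel n α 1 x‖ₑ := by
  have hl0 : 0 < t ^ (1 / (2 * α)) := by positivity
  rw [← ofReal_integral_norm_eq_lintegral_enorm (integrable_kernel hα ht),
    ← ofReal_integral_norm_eq_lintegral_enorm (integrable_kernel hα one_pos)]
  congr 1
  have := Measure.integral_comp_inv_smul volume (fun y => ‖kernel n α 1 y‖) (t ^ (1 / (2 * α)))
  rw [abs_of_pos (by positivity), smul_eq_mul, finrank_euclideanSpace_fin] at this
  have hln : (t ^ (1 / (2 * α))) ^ n * t ^ (-(n / (2 * α))) = 1 := by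
    rw [← Real.rpow_natCast, ← Real.rpow_mul ht.le, ← Real.rpow_add ht]
    convert Real.rpow_zero t using 2
    ring
  have h2 : ∀ x : EuclideanSpace ℝ (Fin n), ‖kernel n α t x‖ =
      t ^ (-(n / (2 * α))) * ‖kernel n α 1 ((t ^ (1 / (2 * α)))⁻¹ • x)‖ := fun x => by
    rw [kernel_scaling hα ht, norm_mul, Real.norm_of_nonneg (by positivity)]
  simp only [h2]
  rw [integral_const_mul, this, ← mul_assoc, mul_comm (t ^ _), hln, one_mul]

/-- Scaling reduces everything to t = 1: the mass does not depend on t, and the height is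
t^{-n/(2α)} times at most the integral of the symbol. -/
theorem exists_heatBound (hα : 0 < α) : ∃ c, c ≠ ∞ ∧
    HeatBound (volume : Measure (EuclideanSpace ℝ (Fin n))) (n / (2 * α)) c
      (absK (kernel n α)) := by
  set c₁ : ℝ≥0∞ := ∫⁻ x, ‖kernel n α 1 x‖ₑ
  set c₂ : ℝ≥0∞ := ENNReal.ofReal (∫ ξ, ‖symbol n α 1 ξ‖)
  have hc₁ : c₁ ≠ ∞ := (integrable_kernel hα one_pos).2.ne
  refine ⟨c₁ + c₂, ENNReal.add_ne_top.2 ⟨hc₁, ENNReal.ofReal_ne_top⟩, ?_⟩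
  refine ⟨?_, ENNReal.add_ne_top.2 ⟨hc₁, ENNReal.ofReal_ne_top⟩, ?_, ?_, ?_⟩
  · exact measurable_kernel_uncurry.enorm
  · intro t ht
    exact (lintegral_kernel_scaling hα ht).le.trans le_self_add
  · intro t ht x
    rw [absK, kernel_scaling hα ht, enorm_mul, mul_comm,
      Real.enorm_of_nonneg (r := t ^ (-(n / (2 * α)) : ℝ)) (by positivity),
      ← ENNReal.ofReal_rpow_of_pos ht]
    gcongr
    refine le_trans ?_ (le_add_self : c₂ ≤ c₁ + c₂)
    rw [← ofReal_norm]
    exact ENNReal.ofReal_le_ofReal (abs_kernel_le _ _)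
  · intro t x
    rw [absK, absK, kernel_neg]

/-- The semigroup property of the kernel. -/
theorem kernel_convolution (hα : 0 < α) {s t : ℝ} (hs : 0 < s) (ht : 0 < t)
    (x : EuclideanSpace ℝ (Fin n)) :
    ∫ y, kernel n α s y * kernel n α t (x - y) = kernel n α (s + t) x := by
  have hi := fun {t : ℝ} (ht : 0 < t) => integrable_ofReal_kernel (n := n) hα ht
  set k : EuclideanSpace ℝ (Fin n) → ℂ := (fun x => (kernel n α s x : ℂ))
    ⋆[ContinuousLinearMap.mul ℂ ℂ] (fun x => (kernel n α t x : ℂ)) with hk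
  have h1 : Integrable k := (hi hs).integrable_convolution _ (hi ht)
  have h2 : Continuous k := by
    refine BddAbove.continuous_convolution_right_of_integrable _ ?_ (hi hs)
      (Complex.continuous_ofReal.comp (continuous_kernel hα ht))
    refine ⟨∫ ξ, ‖symbol n α t ξ‖, ?_⟩
    rintro _ ⟨x, rfl⟩
    exact (Complex.norm_real _).le.trans (abs_kernel_le _ _)
  have h3 : 𝓕 k = symbol n α (s + t) := by
    ext ξ
    rw [hk, Real.fourier_mul_convolution_eq (hi hs) (hi ht)]
    have := congrFun (fourier_kernel (n := n) hα hs) ξ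
    have h' := congrFun (fourier_kernel (n := n) hα ht) ξ
    rw [this, h', symbol, symbol, symbol, ← Complex.ofReal_mul, ← Real.exp_add]
    congr 2; ring
  have h4 := eq_kernel_of_fourier hα (add_pos hs ht) h1 h2 h3 x
  rw [hk, convolution] at h4
  simp only [ContinuousLinearMap.mul_apply', ← Complex.ofReal_mul] at h4
  rw [integral_complex_ofReal] at h4
  exact_mod_cast h4

end Symbol

end FracHeat

namespace FracHeat

/-! ### Semigroup identities for convolutions and Duhamel integrals. -/

section Convolution

variable {𝕜 : Type*} [RCLike 𝕜]
  {G : Type*} [AddCommGroup G] [MeasurableSpace G] [MeasurableAdd₂ G] [MeasurableNeg G]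
  {μ : Measure G} {ν : ℝ} {c : ℝ≥0∞} {K : ℝ → G → ℝ}
  [SigmaFinite μ] [μ.IsAddLeftInvariant] [μ.IsNegInvariant]

/-- A convolution semigroup of signed kernels with the bounds of `HeatBound`. -/
structure HeatSemigroup (μ : Measure G) (ν : ℝ) (c : ℝ≥0∞) (K : ℝ → G → ℝ) : Prop where
  bound : HeatBound μ ν c (absK K)
  meas : Measurable (Function.uncurry K)
  conv : ∀ s t, 0 < s → 0 < t → ∀ x, ∫ y, K s y * K t (x - y) ∂μ = K (s + t) x

/-- The convolution `K t * φ`. -/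
def sconv (μ : Measure G) (K : ℝ → G → ℝ) (t : ℝ) (φ : G → 𝕜) (x : G) : 𝕜 :=
  ∫ y, K t (x - y) • φ y ∂μ

theorem enorm_sconv_le (t : ℝ) (φ : G → 𝕜) (x : G) :
    ‖sconv μ K t φ x‖ₑ ≤ pconv μ (absK K) t (fun y => ‖φ y‖ₑ) x := by
  refine (enorm_integral_le_lintegral_enorm _).trans_eq ?_
  simp_rw [enorm_smul]
  rfl

theorem sconv_congr {t : ℝ} {φ ψ : G → 𝕜} (h : φ =ᵐ[μ] ψ) : sconv μ K t φ = sconv μ K t ψ := by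
  ext x
  refine integral_congr_ae ?_
  filter_upwards [h] with y hy
  rw [hy]

theorem measurable_kernel_smul (hK : Measurable (Function.uncurry K)) {φ : G → 𝕜}
    (hφ : Measurable φ) (t : ℝ) (x : G) : Measurable fun y => K t (x - y) • φ y := by
  have h1 : Measurable fun y => K t (x - y) :=
    hK.comp (measurable_const.prodMk (measurable_const.sub measurable_id))
  exact h1.smul hφ

theorem measurable_sconv_uncurry (hK : Measurable (Function.uncurry K)) {φ : G → 𝕜}
    (hφ : Measurable φ) : Measurable (Function.uncurry fun t x => sconv μ K t φ x) := by
  have h1 : Measurable fun p : (ℝ × G) × G => K p.1.1 (p.1.2 - p.2) :=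
    hK.comp (Measurable.prodMk (by fun_prop)
      ((measurable_snd.comp measurable_fst).sub measurable_snd))
  have h2 : Measurable fun p : (ℝ × G) × G => K p.1.1 (p.1.2 - p.2) • φ p.2 :=
    h1.smul (hφ.comp measurable_snd)
  exact (h2.stronglyMeasurable.integral_prod_right' (ν := μ)).measurable

theorem integrable_sconv (hK : Measurable (Function.uncurry K)) {φ : G → 𝕜}
    (hφ : Measurable φ) {t : ℝ} {x : G}
    (h : pconv μ (absK K) t (fun y => ‖φ y‖ₑ) x < ∞) :
    Integrable (fun y => K t (x - y) • φ y) μ := by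
  refine ⟨(measurable_kernel_smul hK hφ t x).aestronglyMeasurable, lt_of_eq_of_lt ?_ h⟩
  simp_rw [enorm_smul]
  rfl

theorem HeatSemigroup.conv_sub (hS : HeatSemigroup μ ν c K) {s t : ℝ} (hs : 0 < s) (ht : 0 < t)
    (x z : G) : ∫ y, K t (x - y) * K s (y - z) ∂μ = K (t + s) (x - z) := by
  rw [add_comm, ← hS.conv s t hs ht (x - z),
    ← integral_sub_right_eq_self (fun y => K s y * K t (x - z - y)) z]
  congr 1 with y
  rw [mul_comm]
  congr 2
  abel

/-- Fubini's theorem and the semigroup law. The times σ and the points π are functions on an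
arbitrary space Z, so that the one statement serves the convolution itself (Z = G, constant time)
and the past of a Duhamel integral (Z space-time, σ = s - τ). -/
theorem integral_kernel_integral_kernel (hS : HeatSemigroup μ ν c K) {Z : Type*}
    [MeasurableSpace Z] {m : Measure Z} [SFinite m] {σ : Z → ℝ} {π : Z → G} {g : Z → 𝕜}
    (hσ : Measurable σ) (hπ : Measurable π) (hg : Measurable g) (hpos : ∀ᵐ z ∂m, 0 < σ z)
    {t : ℝ} (ht : 0 < t) (x : G)
    (h : ∫⁻ y, ‖K t (x - y)‖ₑ * ∫⁻ z, ‖K (σ z) (y - π z)‖ₑ * ‖g z‖ₑ ∂m ∂μ < ∞) :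
    ∫ y, K t (x - y) • ∫ z, K (σ z) (y - π z) • g z ∂m ∂μ =
      ∫ z, K (t + σ z) (x - π z) • g z ∂m := by
  have h1 : Measurable fun p : G × Z => K t (x - p.1) :=
    hS.meas.comp (measurable_const.prodMk (measurable_const.sub measurable_fst))
  have h2 : Measurable fun p : G × Z => K (σ p.2) (p.1 - π p.2) • g p.2 :=
    Measurable.smul (hS.meas.comp ((hσ.comp measurable_snd).prodMk
      (measurable_fst.sub (hπ.comp measurable_snd)))) (hg.comp measurable_snd)
  have h3 : Measurable fun p : G × Z => K t (x - p.1) • K (σ p.2) (p.1 - π p.2) • g p.2 :=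
    h1.smul h2
  have hint : Integrable (fun p : G × Z => K t (x - p.1) • K (σ p.2) (p.1 - π p.2) • g p.2)
      (μ.prod m) := by
    refine ⟨h3.aestronglyMeasurable, lt_of_eq_of_lt ?_ h⟩
    have : ∫⁻ p : G × Z, ‖K t (x - p.1) • K (σ p.2) (p.1 - π p.2) • g p.2‖ₑ ∂(μ.prod m) = _ :=
      lintegral_prod _ h3.enorm.aemeasurable
    rw [this]
    refine lintegral_congr fun y => ?_
    simp_rw [enorm_smul]
    rw [lintegral_const_mul]
    have h5 := (h2.comp (measurable_prodMk_left (x := y))).enorm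
    simpa only [Function.comp_def, enorm_smul] using h5
  have e1 : ∀ y, K t (x - y) • ∫ z, K (σ z) (y - π z) • g z ∂m =
      ∫ z, K t (x - y) • K (σ z) (y - π z) • g z ∂m := fun y => (integral_smul _ _).symm
  simp_rw [e1]
  rw [integral_integral_swap hint]
  refine integral_congr_ae ?_
  filter_upwards [hpos] with z hz
  have e2 : ∀ y, K t (x - y) • K (σ z) (y - π z) • g z =
      (K t (x - y) * K (σ z) (y - π z)) • g z := fun y => by rw [smul_smul]
  simp_rw [e2]
  rw [integral_smul_const, hS.conv_sub hz ht]

/-- The semigroup property. -/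
theorem sconv_sconv (hS : HeatSemigroup μ ν c K) {s t : ℝ} (hs : 0 < s) (ht : 0 < t) {a : ℝ}
    (ha : 1 ≤ a) {φ : G → 𝕜} (hφ : Measurable φ) (h : lpn μ a (fun y => ‖φ y‖ₑ) < ∞) (x : G) :
    sconv μ K t (sconv μ K s φ) x = sconv μ K (t + s) φ x := by
  refine integral_kernel_integral_kernel hS measurable_const measurable_id hφ
    (.of_forall fun _ => hs) ht x ?_
  have h1 := pconv_le_sup hS.bound ht ha (measurable_pconv hS.bound (t := s) hφ.enorm) x
  refine lt_of_le_of_lt h1 ?_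
  have h2 := lpn_pconv_le_self hS.bound hs ha hφ.enorm
  refine ENNReal.mul_lt_top (ENNReal.mul_lt_top hS.bound.ne_top.lt_top
    (ofReal_rpow_ne_top ht _).lt_top) (h2.trans_lt (ENNReal.mul_lt_top hS.bound.ne_top.lt_top h))

/-- The Duhamel integral as an iterated integral. -/
theorem duh_eq_integral_sconv (hS : HeatSemigroup μ ν c K) {g : ℝ → G → 𝕜}
    (hg : Measurable (Function.uncurry g)) {s t : ℝ} {x : G}
    (h : pduh μ (absK K) s (fun τ y => ‖g τ y‖ₑ) t x < ∞) :
    (∀ᵐ τ ∂(volume.restrict (Ioo s t)), Integrable (fun y => K (t - τ) (x - y) • g τ y) μ) ∧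
    IntegrableOn (fun τ => sconv μ K (t - τ) (g τ) x) (Ioo s t) ∧
      duh μ K s g t x = ∫ τ in Ioo s t, sconv μ K (t - τ) (g τ) x := by
  have h1 := integrable_duh hS.bound hS.meas hg h
  rw [IntegrableOn, ← Measure.prod_restrict, Measure.restrict_univ] at h1
  refine ⟨h1.prod_right_ae, h1.integral_prod_left, ?_⟩
  rw [duh, ← Measure.prod_restrict, Measure.restrict_univ, integral_prod _ h1]
  rfl

/-- Restarting the Duhamel integral at an intermediate time. -/
theorem duh_restart (hS : HeatSemigroup μ ν c K) {g : ℝ → G → 𝕜}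
    (hg : Measurable (Function.uncurry g)) {s₀ s t : ℝ} (hs : s₀ ≤ s) (hst : s < t) {a : ℝ}
    (ha : 1 ≤ a) (hfin : lpn μ a (pduh μ (absK K) s₀ (fun τ y => ‖g τ y‖ₑ) s) < ∞) {x : G}
    (h : pduh μ (absK K) s₀ (fun τ y => ‖g τ y‖ₑ) t x < ∞) :
    duh μ K s₀ g t x = sconv μ K (t - s) (duh μ K s₀ g s) x + duh μ K s g t x := by
  have h1 := integrable_duh hS.bound hS.meas hg h
  -- The semigroup carries the integral over (s₀, s), evaluated at time s, to the same integral with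
  -- the kernel of time t. It remains to add the integral over (s, t); the slice τ = s is null.
  have e1 : sconv μ K (t - s) (duh μ K s₀ g s) x =
      ∫ z in Ioo s₀ s ×ˢ univ, K (t - z.1) (x - z.2) • g z.1 z.2 ∂(volume.prod μ) := by
    have := integral_kernel_integral_kernel hS (m := (volume.prod μ).restrict (Ioo s₀ s ×ˢ univ))
      (σ := fun z : ℝ × G => s - z.1) (π := fun z => z.2) (g := fun z => g z.1 z.2) (by fun_prop)
      measurable_snd hg ?_ (sub_pos.2 hst) x ?_
    · refine this.trans ?_
      congr 1 with z
      rw [sub_add_sub_cancel]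
    · filter_upwards [ae_restrict_mem (measurableSet_Ioo.prod .univ)] with z hz
      exact sub_pos.2 hz.1.2
    · have h3 : ∀ y, ∫⁻ z in Ioo s₀ s ×ˢ univ, ‖K (s - z.1) (y - z.2)‖ₑ * ‖g z.1 z.2‖ₑ
          ∂(volume.prod μ) = pduh μ (absK K) s₀ (fun τ y => ‖g τ y‖ₑ) s y := fun y =>
        lintegral_duh hS.bound (meas_enorm hg) s₀ s y
      simp_rw [h3]
      refine lt_of_le_of_lt (pconv_le_sup hS.bound (sub_pos.2 hst) ha
        (measurable_pduh hS.bound s₀ (meas_enorm hg) s) x) ?_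
      exact ENNReal.mul_lt_top (ENNReal.mul_lt_top hS.bound.ne_top.lt_top
        (ofReal_rpow_ne_top (sub_pos.2 hst) _).lt_top) hfin
  have hU : (Ioo s₀ t ×ˢ univ : Set (ℝ × G)) =ᵐ[volume.prod μ]
      (Ioo s₀ s ×ˢ univ ∪ Ioo s t ×ˢ univ : Set (ℝ × G)) := by
    rw [← union_prod]
    refine Measure.set_prod_ae_eq ?_ Filter.EventuallyEq.rfl
    have h0 : ∀ᵐ τ : ℝ, τ ≠ s := by simp [ae_iff]
    filter_upwards [h0] with τ hτ
    refine propext ⟨fun hh => ?_, fun hh => ?_⟩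
    · rcases lt_or_gt_of_ne hτ with h | h
      · exact .inl ⟨hh.1, h⟩
      · exact .inr ⟨h, hh.2⟩
    · rcases hh with hh | hh
      · exact ⟨hh.1, hh.2.trans hst⟩
      · exact ⟨hs.trans_lt hh.1, hh.2⟩
  rw [e1, duh, duh, setIntegral_congr_set hU, setIntegral_union]
  · refine Set.disjoint_left.2 fun z hz hz' => ?_
    exact absurd hz.1.2 (not_lt.2 hz'.1.1.le)
  · exact measurableSet_Ioo.prod .univ
  · exact h1.mono_set (prod_mono (Ioo_subset_Ioo_right hst.le) le_rfl)
  · exact h1.mono_set (prod_mono (Ioo_subset_Ioo_left hs) le_rfl)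

end Convolution

section Euclidean

variable {𝕜 : Type*} [RCLike 𝕜] {n : ℕ} {α : ℝ}

theorem exists_heatSemigroup (hα : 0 < α) : ∃ c,
    HeatSemigroup (volume : Measure (EuclideanSpace ℝ (Fin n))) (n / (2 * α)) c (kernel n α) := by
  obtain ⟨c, -, hc⟩ := exists_heatBound (n := n) hα
  exact ⟨c, hc, measurable_kernel_uncurry, fun s t hs ht x => kernel_convolution hα hs ht x⟩

theorem semigroup_eq_sconv (t : ℝ) (g : EuclideanSpace ℝ (Fin n) → 𝕜) :
    semigroup n α t g = sconv volume (kernel n α) t g := by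
  ext x
  rw [semigroup, convolution_eq_swap]
  rfl

theorem convolutionExistsAt_kernel_iff (t : ℝ) (g : EuclideanSpace ℝ (Fin n) → 𝕜)
    (x : EuclideanSpace ℝ (Fin n)) :
    ConvolutionExistsAt (kernel n α t) g x (ContinuousLinearMap.lsmul ℝ ℝ) volume ↔
      Integrable fun y => kernel n α t (x - y) • g y := by
  rw [convolutionExistsAt_iff_integrable_swap]
  rfl

end Euclidean

end FracHeat

namespace FracHeat

/-! ### Strong continuity of the free evolution in L^r. -/

section HeatFlow

open Filter Topology

theorem eLpNorm_eq_lpn {β : Type*} [MeasurableSpace β] {μ : Measure β} {ε : Type*}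
    [TopologicalSpace ε] [ContinuousENorm ε] {a : ℝ} (ha : 0 < a) (f : β → ε) :
    eLpNorm f (ENNReal.ofReal a) μ = lpn μ a (fun x => ‖f x‖ₑ) := by
  rw [eLpNorm_eq_lintegral_rpow_enorm_toReal (ENNReal.ofReal_pos.2 ha).ne' ENNReal.ofReal_ne_top,
    ENNReal.toReal_ofReal ha.le]
  rfl

variable {𝕜 : Type*} [RCLike 𝕜] {n : ℕ} {α r : ℝ}

theorem tendsto_lpn_translate (hr : 1 ≤ r) {φ : EuclideanSpace ℝ (Fin n) → 𝕜}
    (hφ : MemLp φ (ENNReal.ofReal r)) (h₀ : EuclideanSpace ℝ (Fin n)) :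
    Tendsto (fun h => lpn volume r (fun x => ‖φ (x - h) - φ (x - h₀)‖ₑ)) (𝓝 h₀) (𝓝 0) := by
  have : Fact (1 ≤ ENNReal.ofReal r) := ⟨by simpa using hr⟩
  set T : EuclideanSpace ℝ (Fin n) →
      C(EuclideanSpace ℝ (Fin n), EuclideanSpace ℝ (Fin n)) :=
    fun h => ⟨fun x => x - h, by fun_prop⟩ with hT
  have hmp : ∀ h, MeasurePreserving (T h) volume volume := fun h =>
    measurePreserving_sub_right volume h
  have hTc : Continuous T := by
    refine ContinuousMap.continuous_of_continuous_uncurry _ ?_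
    exact continuous_snd.sub continuous_fst
  have h1 := (continuous_const (y := hφ.toLp φ)).compMeasurePreservingLp hTc hmp
    ENNReal.ofReal_ne_top
  have h2 := (h1.tendsto h₀)
  rw [tendsto_iff_edist_tendsto_0] at h2
  refine h2.congr fun h => ?_
  rw [Lp.toLp_compMeasurePreserving, Lp.toLp_compMeasurePreserving, Lp.edist_toLp_toLp,
    eLpNorm_eq_lpn (by linarith)]
  rfl

/-- The curve `t ↦ S(t) φ`, equal to `φ` for `t ≤ 0`. -/
def heatFlow (n : ℕ) (α : ℝ) (φ : EuclideanSpace ℝ (Fin n) → 𝕜) (t : ℝ)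
    (x : EuclideanSpace ℝ (Fin n)) : 𝕜 :=
  if 0 < t then sconv volume (kernel n α) t φ x else φ x

theorem measurable_heatFlow_uncurry {φ : EuclideanSpace ℝ (Fin n) → 𝕜} (hφ : Measurable φ) :
    Measurable (Function.uncurry (heatFlow n α φ)) := by
  refine Measurable.ite ?_ (measurable_sconv_uncurry measurable_kernel_uncurry hφ)
    (hφ.comp measurable_snd)
  exact measurableSet_lt measurable_const measurable_fst

/-- The substitution y = t^{1/(2α)} z puts all times on the fixed kernel K₁, so that time only
enters through translations of φ. For t ≤ 0 the formula says that K₁ has integral 1. -/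
theorem heatFlow_eq (hα : 0 < α) (φ : EuclideanSpace ℝ (Fin n) → 𝕜) (t : ℝ)
    (x : EuclideanSpace ℝ (Fin n)) :
    heatFlow n α φ t x =
      ∫ z, kernel n α 1 z • φ (x - (max t 0) ^ (1 / (2 * α)) • z) := by
  rcases le_or_gt t 0 with ht | ht
  · rw [heatFlow, if_neg (not_lt.2 ht), max_eq_right ht, Real.zero_rpow (by positivity)]
    simp only [zero_smul, sub_zero]
    rw [integral_smul_const, integral_kernel hα one_pos, one_smul]
  · rw [heatFlow, if_pos ht, max_eq_left ht.le, sconv]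
    have hl0 : 0 < t ^ (1 / (2 * α)) := by positivity
    have e1 : ∫ y, kernel n α t (x - y) • φ y = ∫ y, kernel n α t y • φ (x - y) := by
      rw [← integral_sub_left_eq_self _ volume x]
      simp
    have e2 := Measure.integral_comp_inv_smul volume
      (fun z => kernel n α 1 z • φ (x - (t ^ (1 / (2 * α))) • z)) (t ^ (1 / (2 * α)))
    have hln : t ^ (-(n / (2 * α))) * (t ^ (1 / (2 * α))) ^ n = 1 := by
      rw [← Real.rpow_natCast, ← Real.rpow_mul ht.le, ← Real.rpow_add ht]
      convert Real.rpow_zero t using 2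
      ring
    have e3 : ∀ y, kernel n α t y • φ (x - y) = t ^ (-(n / (2 * α))) •
        (kernel n α 1 ((t ^ (1 / (2 * α)))⁻¹ • y) •
          φ (x - (t ^ (1 / (2 * α))) • (t ^ (1 / (2 * α)))⁻¹ • y)) := fun y => by
      rw [kernel_scaling hα ht, smul_smul, smul_smul, mul_inv_cancel₀ hl0.ne', one_smul]
    rw [e1]
    simp_rw [e3]
    rw [integral_smul, e2, smul_smul, abs_of_pos (by positivity), finrank_euclideanSpace_fin,
      hln, one_smul]

/-- The dilation factor `t^{1/2α}` for `t ≥ 0`. -/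
def heatScale (α t : ℝ) : ℝ := (max t 0) ^ (1 / (2 * α))

theorem continuous_heatScale (hα : 0 < α) : Continuous (heatScale α) :=
  (continuous_id.max continuous_const).rpow_const fun x => .inr (by positivity)

theorem measurable_translate_sub {φ : EuclideanSpace ℝ (Fin n) → 𝕜} (hφ : Measurable φ) (a b : ℝ) :
    Measurable fun p : EuclideanSpace ℝ (Fin n) × EuclideanSpace ℝ (Fin n) =>
      ‖φ (p.2 - a • p.1) - φ (p.2 - b • p.1)‖ₑ := by
  have hm1 : ∀ a : ℝ, Measurable fun p : EuclideanSpace ℝ (Fin n) × EuclideanSpace ℝ (Fin n) =>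
      φ (p.2 - a • p.1) := fun a => hφ.comp (by fun_prop)
  exact ((hm1 a).sub (hm1 b)).enorm

theorem lpn_heatFlow_sub_le (hα : 0 < α) (hr : 1 ≤ r) {φ : EuclideanSpace ℝ (Fin n) → 𝕜}
    (hφm : Measurable φ) (t t₀ : ℝ) :
    lpn volume r (fun x => ‖heatFlow n α φ t x - heatFlow n α φ t₀ x‖ₑ) ≤
      ∫⁻ z, ‖kernel n α 1 z‖ₑ *
        lpn volume r (fun x => ‖φ (x - heatScale α t • z) - φ (x - heatScale α t₀ • z)‖ₑ) := by
  have hr0 : 0 < r := by linarith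
  have hkm : Measurable (kernel n α 1) := (continuous_kernel hα one_pos).measurable
  have h1 : ∀ x, ‖heatFlow n α φ t x - heatFlow n α φ t₀ x‖ₑ ≤
      ∫⁻ z, ‖kernel n α 1 z‖ₑ *
        ‖φ (x - heatScale α t • z) - φ (x - heatScale α t₀ • z)‖ₑ := fun x => by
    have hmm : ∀ a : ℝ, Measurable fun z => kernel n α 1 z • φ (x - a • z) := fun a =>
      hkm.smul (hφm.comp (by fun_prop))
    rw [heatFlow_eq hα, heatFlow_eq hα]
    refine (enorm_integral_sub_le (hmm _).aestronglyMeasurable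
      (hmm _).aestronglyMeasurable).trans_eq ?_
    simp_rw [← smul_sub, enorm_smul]
    rfl
  refine (lpn_mono hr0 h1).trans ?_
  have hm2 : Measurable (Function.uncurry fun z x => ‖kernel n α 1 z‖ₑ *
      ‖φ (x - heatScale α t • z) - φ (x - heatScale α t₀ • z)‖ₑ) :=
    (hkm.comp measurable_fst).enorm.mul (measurable_translate_sub hφm _ _)
  refine (lpn_lintegral_le hr hm2).trans (le_of_eq ?_)
  refine lintegral_congr fun z => ?_
  rw [lpn_const_mul hr0 enorm_ne_top]

theorem lpn_translate_sub_le (hr : 1 ≤ r) {φ : EuclideanSpace ℝ (Fin n) → 𝕜}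
    (hφm : Measurable φ) (a b : EuclideanSpace ℝ (Fin n)) :
    lpn volume r (fun x => ‖φ (x - a) - φ (x - b)‖ₑ) ≤
      lpn volume r (fun x => ‖φ x‖ₑ) + lpn volume r (fun x => ‖φ x‖ₑ) := by
  have hr0 : 0 < r := by linarith
  have h2 : ∀ a, lpn volume r (fun x => ‖φ (x - a)‖ₑ) = lpn volume r (fun x => ‖φ x‖ₑ) :=
    fun a => by
      unfold lpn
      rw [lintegral_sub_right_eq_self (fun x => ‖φ x‖ₑ ^ r)]
  have h3 : ∀ a, Measurable fun x => ‖φ (x - a)‖ₑ := fun a => (hφm.comp (by fun_prop)).enorm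
  refine (lpn_mono hr0 fun x => enorm_sub_le).trans ((lpn_add_le hr (h3 a) (h3 b)).trans ?_)
  rw [h2, h2]

/-- Translations are continuous in L^r, and the difference of two translates has norm at most 2‖φ‖.
Dominated convergence against the integrable kernel K₁ concludes. -/
theorem tendsto_heatFlow (hα : 0 < α) (hr : 1 ≤ r) {φ : EuclideanSpace ℝ (Fin n) → 𝕜}
    (hφm : Measurable φ) (hφ : lpn volume r (fun x => ‖φ x‖ₑ) < ∞) (t₀ : ℝ) :
    Tendsto (fun t => lpn volume r (fun x => ‖heatFlow n α φ t x - heatFlow n α φ t₀ x‖ₑ))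
      (𝓝 t₀) (𝓝 0) := by
  have hr0 : 0 < r := by linarith
  have hkm : Measurable (kernel n α 1) := (continuous_kernel hα one_pos).measurable
  have hlim : Tendsto (fun t => ∫⁻ z, ‖kernel n α 1 z‖ₑ *
      lpn volume r (fun x => ‖φ (x - heatScale α t • z) - φ (x - heatScale α t₀ • z)‖ₑ))
      (𝓝 t₀) (𝓝 (∫⁻ _ : EuclideanSpace ℝ (Fin n), 0)) := by
    refine tendsto_lintegral_filter_of_dominated_convergence
      (fun z => ‖kernel n α 1 z‖ₑ * (lpn volume r (fun x => ‖φ x‖ₑ) +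
        lpn volume r (fun x => ‖φ x‖ₑ))) (.of_forall fun t => ?_) (.of_forall fun t =>
        .of_forall fun z => ?_) ?_ (.of_forall fun z => ?_)
    · refine hkm.enorm.mul (measurable_lpn (μ := volume) (F := fun z x =>
        ‖φ (x - heatScale α t • z) - φ (x - heatScale α t₀ • z)‖ₑ) ?_)
      exact measurable_translate_sub hφm _ _
    · exact mul_le_mul_right (lpn_translate_sub_le hr hφm _ _) _
    · rw [lintegral_mul_const _ hkm.enorm]
      exact ENNReal.mul_ne_top (integrable_kernel hα one_pos).2.ne
        (ENNReal.add_ne_top.2 ⟨hφ.ne, hφ.ne⟩)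
    · have hmem : MemLp φ (ENNReal.ofReal r) :=
        ⟨hφm.aestronglyMeasurable, by rwa [eLpNorm_eq_lpn hr0]⟩
      have h4 : Tendsto (fun t => heatScale α t • z) (𝓝 t₀) (𝓝 (heatScale α t₀ • z)) :=
        ((continuous_heatScale hα).smul continuous_const).tendsto t₀
      have h5 := ENNReal.Tendsto.const_mul (a := ‖kernel n α 1 z‖ₑ)
        ((tendsto_lpn_translate hr hmem (heatScale α t₀ • z)).comp h4) (.inr enorm_ne_top)
      rw [mul_zero] at h5
      exact h5
  rw [lintegral_zero] at hlim
  exact tendsto_of_tendsto_of_tendsto_of_le_of_le tendsto_const_nhds hlim (fun _ => zero_le)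
    fun t => lpn_heatFlow_sub_le hα hr hφm t t₀

end HeatFlow

end FracHeat

namespace FracHeat

/-! ### Jointly measurable representatives and admissible exponents. -/

section Representative

open Filter Topology

variable {𝕜 : Type*} [RCLike 𝕜] {n : ℕ} {α r : ℝ}

theorem measurableSet_imp_dist_lt {X : Type*} [PseudoMetricSpace X] {I : Set ℝ}
    (hI : MeasurableSet I) {u : ℝ → X} (hu : ContinuousOn u I) (d : X) (δ : ℝ) :
    MeasurableSet {t | t ∈ I → dist (u t) d < δ} := by
  obtain ⟨O, hO, hOI⟩ := (continuousOn_iff'.1 ((continuous_id.dist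
    (continuous_const (y := d))).comp_continuousOn hu)) (Iio δ) isOpen_Iio
  have : {t | t ∈ I → dist (u t) d < δ} = Iᶜ ∪ O ∩ I := by
    rw [← hOI]
    ext t
    simp only [mem_ofPred_eq, mem_union, mem_compl_iff, mem_inter_iff, mem_preimage, mem_Iio]
    tauto
  rw [this]
  exact hI.compl.union (hO.measurableSet.inter hI)

/-- A curve that is continuous into `L^r` has a jointly measurable representative. -/
theorem exists_measurable_rep (hr : 1 ≤ r) [Fact (1 ≤ ENNReal.ofReal r)] {I : Set ℝ}
    (hI : MeasurableSet I)
    {u : ℝ → Lp 𝕜 (ENNReal.ofReal r) (volume : Measure (EuclideanSpace ℝ (Fin n)))}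
    (hu : ContinuousOn u I) :
    ∃ U : ℝ → EuclideanSpace ℝ (Fin n) → 𝕜, Measurable (Function.uncurry U) ∧
      ∀ t ∈ I, U t =ᵐ[volume] u t := by
  classical
  have hr0 : 0 < r := by linarith
  have : Fact (ENNReal.ofReal r ≠ ∞) := ⟨ENNReal.ofReal_ne_top⟩
  let d := TopologicalSpace.denseSeq
    (Lp 𝕜 (ENNReal.ofReal r) (volume : Measure (EuclideanSpace ℝ (Fin n))))
  -- The implication makes the condition void off I, so that a first index exists for every real t.
  have hex : ∀ (j : ℕ) (t : ℝ), ∃ k, t ∈ I → dist (u t) (d k) < (1 / 2 : ℝ) ^ j := fun j t => by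
    obtain ⟨k, hk⟩ := (TopologicalSpace.denseRange_denseSeq
      (Lp 𝕜 (ENNReal.ofReal r) (volume : Measure (EuclideanSpace ℝ (Fin n))))).exists_dist_lt (u t)
      (by positivity : 0 < (1 / 2 : ℝ) ^ j)
    exact ⟨k, fun _ => hk⟩
  -- The first member of a dense sequence within 2^{-j} of u(t): a measurable approximation with
  -- countably many values.
  set κ : ℕ → ℝ → ℕ := fun j t => Nat.find (hex j t) with hκ
  have hκm : ∀ j, Measurable (κ j) := fun j =>
    measurable_find _ fun k => measurableSet_imp_dist_lt hI hu (d k) _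
  have hdm : Measurable fun z : ℕ × EuclideanSpace ℝ (Fin n) => d z.1 z.2 :=
    measurable_from_prod_countable_right fun k => (Lp.stronglyMeasurable (d k)).measurable
  set V : ℕ → ℝ × EuclideanSpace ℝ (Fin n) → 𝕜 := fun j z => d (κ j z.1) z.2 with hV
  have hVm : ∀ j, Measurable (V j) := fun j =>
    hdm.comp (((hκm j).comp measurable_fst).prodMk measurable_snd)
  -- The errors are summable in L^r, hence summable at almost every x. This holds for each t in I,
  -- not just for almost every t.
  have hconv : ∀ t ∈ I, ∀ᵐ x, Tendsto (fun j => V j (t, x)) atTop (𝓝 (u t x)) := fun t ht => by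
    have hm : ∀ j, Measurable fun x => ‖d (κ j t) x - u t x‖ₑ := fun j =>
      ((Lp.stronglyMeasurable _).measurable.sub (Lp.stronglyMeasurable _).measurable).enorm
    have h1 : ∀ j, lpn volume r (fun x => ‖d (κ j t) x - u t x‖ₑ) ≤
        ENNReal.ofReal ((1 / 2) ^ j) := fun j => by
      rw [← eLpNorm_eq_lpn hr0 (fun x => d (κ j t) x - u t x)]
      have h2 : eLpNorm (fun x => d (κ j t) x - u t x) (ENNReal.ofReal r) volume =
          edist (d (κ j t)) (u t) := (Lp.edist_def _ _).symm
      rw [h2, edist_comm, edist_dist]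
      exact ENNReal.ofReal_le_ofReal (Nat.find_spec (hex j t) ht).le
    have h2 := (lpn_tsum_le (μ := volume) hr hm).trans (ENNReal.tsum_le_tsum h1)
    rw [← ENNReal.ofReal_tsum_of_nonneg (fun j => by positivity) summable_geometric_two] at h2
    have h3 := lpn_ae_lt_top hr0 (Measurable.tsum hm)
      (h2.trans_lt ENNReal.ofReal_lt_top).ne
    filter_upwards [h3] with x hx
    have h4 := ENNReal.tendsto_atTop_zero_of_tsum_ne_top hx.ne
    rw [tendsto_iff_edist_tendsto_0]
    refine h4.congr fun j => ?_
    rw [edist_eq_enorm_sub]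
  have hL : MeasurableSet {z | ∃ l, Tendsto (fun j => V j z) atTop (𝓝 l)} :=
    measurableSet_exists_tendsto hVm
  -- Setting the approximations to 0 off their measurable set of convergence makes them converge
  -- everywhere, so the limit is measurable without completing the measure.
  set W : ℕ → ℝ × EuclideanSpace ℝ (Fin n) → 𝕜 := fun j =>
    indicator {z | ∃ l, Tendsto (fun j => V j z) atTop (𝓝 l)} (V j) with hW
  have hWl : ∀ z, ∃ l, Tendsto (fun j => W j z) atTop (𝓝 l) := fun z => by
    by_cases hz : z ∈ {z | ∃ l, Tendsto (fun j => V j z) atTop (𝓝 l)}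
    · obtain ⟨l, hl⟩ := id hz
      exact ⟨l, hl.congr fun j => (indicator_of_mem hz _).symm⟩
    · exact ⟨0, tendsto_const_nhds.congr fun j => (indicator_of_notMem hz _).symm⟩
  choose L hL' using hWl
  refine ⟨fun t x => L (t, x), ?_, fun t ht => ?_⟩
  · exact measurable_of_tendsto_metrizable (fun j => (hVm j).indicator hL)
      (tendsto_pi_nhds.2 hL')
  · filter_upwards [hconv t ht] with x hx
    refine tendsto_nhds_unique (hL' (t, x)) (hx.congr fun j => ?_)
    exact (indicator_of_mem (s := {z | ∃ l, Tendsto (fun j => V j z) atTop (𝓝 l)})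
      ⟨_, hx⟩ (V j)).symm

theorem eLpNorm_rep {p : ℝ} (hp : 0 < p) {f : EuclideanSpace ℝ (Fin n) → 𝕜}
    {g : EuclideanSpace ℝ (Fin n) → 𝕜} (h : f =ᵐ[volume] g) :
    eLpNorm g (ENNReal.ofReal p) volume = lpn volume p (fun x => ‖f x‖ₑ) := by
  rw [← eLpNorm_congr_ae h, eLpNorm_eq_lpn hp]

theorem memLqLp_iff {p q : ℝ} (hp : 0 < p) (hq : 0 < q) {I : Set ℝ}
    {u : ℝ → Lp 𝕜 (ENNReal.ofReal r) (volume : Measure (EuclideanSpace ℝ (Fin n)))}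
    {U : ℝ → EuclideanSpace ℝ (Fin n) → 𝕜} (hU : Measurable (Function.uncurry U))
    (h : ∀ᵐ t ∂(volume.restrict I), U t =ᵐ[volume] u t) :
    MemLqLp (ENNReal.ofReal q) p I u ↔ mixed volume I q p (fun t x => ‖U t x‖ₑ) < ∞ := by
  have h1 : (fun t => eLpNorm (u t) (ENNReal.ofReal p) volume) =ᵐ[volume.restrict I]
      fun t => lpn volume p (fun x => ‖U t x‖ₑ) := by
    filter_upwards [h] with t ht
    exact eLpNorm_rep hp ht
  have hm : Measurable fun t => lpn volume p (fun x => ‖U t x‖ₑ) :=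
    measurable_lpn (meas_enorm hU)
  have e : eLpNorm (fun t => lpn volume p (fun x => ‖U t x‖ₑ)) (ENNReal.ofReal q)
      (volume.restrict I) = mixed volume I q p (fun t x => ‖U t x‖ₑ) := by
    rw [eLpNorm_eq_lpn hq]
    rfl
  rw [MemLqLp, memLp_congr_ae h1, MemLp, e]
  exact ⟨fun h => h.2, fun h => ⟨hm.aestronglyMeasurable, h⟩⟩

theorem memLqLp_top {p : ℝ} (hp : 0 < p) {I : Set ℝ} (hI : MeasurableSet I)
    {u : ℝ → Lp 𝕜 (ENNReal.ofReal r) (volume : Measure (EuclideanSpace ℝ (Fin n)))}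
    {U : ℝ → EuclideanSpace ℝ (Fin n) → 𝕜} (hU : Measurable (Function.uncurry U))
    (h : ∀ᵐ t ∂(volume.restrict I), U t =ᵐ[volume] u t) {B : ℝ≥0∞} (hB : B ≠ ∞)
    (hle : ∀ t ∈ I, lpn volume p (fun x => ‖U t x‖ₑ) ≤ B) :
    MemLqLp ∞ p I u := by
  have h1 : (fun t => eLpNorm (u t) (ENNReal.ofReal p) volume) =ᵐ[volume.restrict I]
      fun t => lpn volume p (fun x => ‖U t x‖ₑ) := by
    filter_upwards [h] with t ht
    exact eLpNorm_rep hp ht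
  have hm : Measurable fun t => lpn volume p (fun x => ‖U t x‖ₑ) :=
    measurable_lpn (meas_enorm hU)
  rw [MemLqLp, memLp_congr_ae h1]
  refine ⟨hm.aestronglyMeasurable, ?_⟩
  rw [eLpNorm_exponent_top]
  refine lt_of_le_of_lt (essSup_le_of_ae_le B ?_) hB.lt_top
  filter_upwards [ae_restrict_mem hI] with t ht
  exact hle t ht

/-- The upper bound on p, in both ranges of n, is equivalent to 1/q < 1/r. The condition r < q is
the form in which the space-time estimates use it. -/
theorem isAdmissible_iff (hn : 0 < (n : ℝ) / (2 * α)) (hα : 0 < α) {q : ℝ≥0∞} {p : ℝ} :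
    IsAdmissible n α q p r ↔ q⁻¹ = ENNReal.ofReal (n / (2 * α) * (1 / r - 1 / p)) ∧ 1 < r ∧
      r ≤ p ∧ n / (2 * α) * (1 / r - 1 / p) < 1 / r := by
  have hn0 : (0 : ℝ) < n := by
    by_contra h
    have : (n : ℝ) = 0 := le_antisymm (not_lt.1 h) (Nat.cast_nonneg n)
    simp [this] at hn
  unfold IsAdmissible
  refine and_congr_right fun _ => and_congr_right fun hr => and_congr_right fun hrp => ?_
  have hr0 : 0 < r := by linarith
  have hp0 : 0 < p := by linarith
  have e : n / (2 * α) * (1 / r - 1 / p) < 1 / r ↔ (n - 2 * α) * p < n * r := by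
    have : 1 / r - n / (2 * α) * (1 / r - 1 / p) =
        (n * r - (n - 2 * α) * p) / (2 * α * r * p) := by field_simp; ring
    rw [← sub_pos, this, div_pos_iff_of_pos_right (by positivity), sub_pos]
  rw [e]
  constructor
  · intro h
    rcases lt_or_ge (2 * α) n with h1 | h1
    · have := h h1
      rw [lt_div_iff₀ (by linarith)] at this
      linarith
    · have : (n - 2 * α) * p ≤ 0 := mul_nonpos_of_nonpos_of_nonneg (by linarith) hp0.le
      have : 0 < n * r := by positivity
      linarith
  · intro h h1
    rw [lt_div_iff₀ (by linarith)]
    linarith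

/-- The time exponent of an admissible triplet: either `p = r` and `q = ∞`, or `q` is finite. -/
theorem IsAdmissible.cases (hn : 0 < (n : ℝ) / (2 * α)) (hα : 0 < α) {q : ℝ≥0∞} {p : ℝ}
    (h : IsAdmissible n α q p r) : (p = r ∧ q = ∞) ∨
      (r < p ∧ ∃ q' : ℝ, q = ENNReal.ofReal q' ∧ r < q' ∧
        1 / q' = n / (2 * α) * (1 / r - 1 / p)) := by
  obtain ⟨h1, hr, hrp, h2⟩ := (isAdmissible_iff hn hα).1 h
  have hr0 : 0 < r := by linarith
  rcases hrp.eq_or_lt with rfl | hrp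
  · left
    simpa using h1
  · right
    have h3 : 0 < 1 / r - 1 / p := sub_pos.2 (one_div_lt_one_div_of_lt hr0 hrp)
    have h4 : 0 < n / (2 * α) * (1 / r - 1 / p) := by positivity
    refine ⟨hrp, (n / (2 * α) * (1 / r - 1 / p))⁻¹, ?_, ?_, by rw [one_div, inv_inv]⟩
    · rw [ENNReal.ofReal_inv_of_pos h4, ← h1, inv_inv]
    · rw [lt_inv_comm₀ hr0 h4, ← one_div r]
      exact h2

theorem isAdmissible_of_lt (hn : 0 < (n : ℝ) / (2 * α)) (hα : 0 < α) {p q : ℝ} (hr : 1 < r)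
    (hp : r ≤ p) (hq : r < q) (h : 1 / q = n / (2 * α) * (1 / r - 1 / p)) :
    IsAdmissible n α (ENNReal.ofReal q) p r := by
  have hr0 : 0 < r := by linarith
  rw [isAdmissible_iff hn hα, ← h]
  refine ⟨?_, hr, hp, one_div_lt_one_div_of_lt hr0 hq⟩
  rw [one_div, ENNReal.ofReal_inv_of_pos (by linarith)]

end Representative

end FracHeat

namespace FracHeat

/-! ### The auxiliary exponents and the bound in L^∞_t L^r_x. -/

section Exponents

/-- Exponents of an auxiliary space `L^q_t L^p_x` in which the equation is solved by iteration. -/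
structure Exponents (ν b r p q : ℝ) : Prop where
  one_lt : 1 < r
  rp : r < p
  rq : r < q
  bp : b + 1 < p
  bq : b + 1 < q
  pr : p < r * (b + 1)
  qr : q < r * (b + 1)
  eq : 1 / q = ν * (1 / r - 1 / p)

/-- In the coordinates X = 1/p, Y = 1/q, with R = 1/r and β = 1/(b+1), the line Y = ν(R - X) has to
meet the open square with sides (Rβ, min(β, R)). This amounts to two lower and two upper bounds for
X, and the four comparisons between them hold. The condition νb > 1 gives Rβ < R - Rβ/ν, and νb ≤ r
gives R - m/ν < m with m = min(β, R). -/
theorem exists_exponents {ν b r : ℝ} (hν : 0 < ν) (hb : 0 < b) (h1 : 1 < ν * b)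
    (hr : ν * b ≤ r) : ∃ p q, Exponents ν b r p q := by
  have hr1 : 1 < r := by linarith
  have hr0 : 0 < r := by linarith
  set R := 1 / r with hR
  have hR0 : 0 < R := by positivity
  have hR1 : R < 1 := by rw [hR, div_lt_one hr0]; exact hr1
  have hRr : R * (ν * b) ≤ 1 := by
    rw [hR, one_div, inv_mul_le_iff₀ hr0]; linarith
  set β := 1 / (b + 1) with hβ
  have hβ0 : 0 < β := by positivity
  have hβb : β * b = 1 - β := by rw [hβ]; field_simp; ring
  set m := min β R with hm
  have hm0 : 0 < m := lt_min hβ0 hR0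
  have hRβm : R * β < m := by
    refine lt_min (by nlinarith) ?_
    have : β < 1 := by nlinarith
    nlinarith
  have key : ∃ X, R * β < X ∧ R - m / ν < X ∧ X < m ∧ X < R - R * β / ν := by
    have i1 : R * β < R - R * β / ν := by
      rw [lt_sub_iff_add_lt, ← lt_sub_iff_add_lt', div_lt_iff₀ hν]
      have : R * (1 - β) = R * (β * b) := by rw [hβb]
      have h2 : 0 < R * β := by positivity
      nlinarith
    have i2 : R - m / ν < m := by
      rw [sub_lt_iff_lt_add, ← sub_lt_iff_lt_add', lt_div_iff₀ hν]
      rcases min_choice β R with h | h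
      · rw [hm, h]
        have h3 : R ≤ R * β + β * (R * b) := by
          have : R * (β * b) = R * (1 - β) := by rw [hβb]
          linarith
        have h4 : R * (ν * b) * β ≤ 1 * β := by gcongr
        have h5 : ν * R ≤ ν * (R * β + β * (R * b)) := by gcongr
        have h6 : ν * (R * β) < ν * β := by
          gcongr
          nlinarith
        nlinarith
      · rw [hm, h]; simp [hR0]
    have i3 : R - m / ν < R - R * β / ν := by gcongr
    obtain ⟨X, hX1, hX2⟩ := exists_between (max_lt (lt_min hRβm i1) (lt_min i2 i3))
    rw [max_lt_iff] at hX1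
    rw [lt_min_iff] at hX2
    exact ⟨X, hX1.1, hX1.2, hX2.1, hX2.2⟩
  obtain ⟨X, hX1, hX2, hX3, hX4⟩ := key
  have hX0 : 0 < X := (by positivity : 0 < R * β).trans hX1
  set Y := ν * (R - X) with hY
  have hY1 : R * β < Y := by
    rw [lt_sub_comm, div_lt_iff₀ hν] at hX4
    linarith
  have hY2 : Y < m := by
    rw [sub_lt_comm, lt_div_iff₀ hν] at hX2
    linarith
  have hY0 : 0 < Y := (by positivity : 0 < R * β).trans hY1
  have inv : ∀ Z, 0 < Z → R * β < Z → Z < m → r < 1 / Z ∧ b + 1 < 1 / Z ∧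
      1 / Z < r * (b + 1) := fun Z hZ0 hZ1 hZ2 => by
    refine ⟨?_, ?_, ?_⟩
    · rw [lt_one_div hr0 hZ0]; exact hZ2.trans_le (min_le_right _ _)
    · rw [lt_one_div (by positivity) hZ0]; exact hZ2.trans_le (min_le_left _ _)
    · rw [one_div_lt hZ0 (by positivity), ← one_div_mul_one_div]; exact hZ1
  obtain ⟨x1, x2, x3⟩ := inv X hX0 hX1 hX3
  obtain ⟨y1, y2, y3⟩ := inv Y hY0 hY1 hY2
  exact ⟨1 / X, 1 / Y, hr1, x1, y1, x2, y2, x3, y3, by rw [one_div_one_div, one_div_one_div]⟩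

variable {G : Type*} [AddCommGroup G] [MeasurableSpace G] [MeasurableAdd₂ G] [MeasurableNeg G]
  {μ : Measure G} {ν : ℝ} {c : ℝ≥0∞} {k : ℝ → G → ℝ≥0∞}
  [SigmaFinite μ] [μ.IsAddLeftInvariant] [μ.IsNegInvariant] {b r p q : ℝ}

theorem lpn_Ioo_le {Q Q' η : ℝ} (hQ : 0 < Q) (hQ' : 0 < Q') (hη : 0 ≤ η)
    (h : 1 / Q = 1 / Q' + η) {s t : ℝ} {f : ℝ → ℝ≥0∞} (hf : Measurable f) :
    lpn (volume.restrict (Ioo s t)) Q f ≤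
      ENNReal.ofReal (t - s) ^ η * lpn (volume.restrict (Ioo s t)) Q' f := by
  rcases hη.eq_or_lt with rfl | hη
  · have : Q = Q' := by
      rw [add_zero] at h
      simpa using h
    rw [this, ENNReal.rpow_zero, one_mul]
  · have h1 := lpn_mul_le (μ := volume.restrict (Ioo s t)) (a := Q) (p := Q') (q := 1 / η) hQ hQ'
      (by positivity) (by rw [one_div_one_div]; exact h) hf (measurable_const (a := (1 : ℝ≥0∞)))
    simp only [mul_one] at h1
    refine h1.trans (le_of_eq ?_)
    rw [mul_comm]
    congr 1
    simp [lpn]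

/-- The bound in `L^∞_t L^r_x` for the Duhamel term of the nonlinearity. -/
theorem lpn_pduh_rpow_le (hk : HeatBound μ ν c k) (hν : 0 < ν) (hb : 0 < b)
    (he : Exponents ν b r p q) (hη : ν * b ≤ r) :
    ∃ C : ℝ≥0∞, C ≠ ∞ ∧ ∀ (s t : ℝ) (A : ℝ≥0∞), ENNReal.ofReal (t - s) ^ (1 - ν * b / r) ≤ A →
      ∀ U : ℝ → G → ℝ≥0∞, Measurable (Function.uncurry U) →
      lpn μ r (pduh μ k s (fun τ y => U τ y ^ (b + 1)) t) ≤
        C * A * mixed μ (Ioo s t) q p U ^ (b + 1) := by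
  have hr0 : 0 < r := by linarith [he.one_lt]
  have hb1 : 0 < b + 1 := by linarith
  have hp0 : 0 < p := by linarith [he.bp]
  have hq0 : 0 < q := by linarith [he.bq]
  have hη0 : 0 ≤ 1 - ν * b / r := by rw [sub_nonneg, div_le_one hr0]; exact hη
  have har : p / (b + 1) < r := by rw [div_lt_iff₀ hb1]; exact he.pr
  have ha : 1 < p / (b + 1) := by rw [lt_div_iff₀ hb1]; linarith [he.bp]
  have hqr : q / (b + 1) < r := by rw [div_lt_iff₀ hb1]; exact he.qr
  -- The reciprocal of the time exponent demanded by the endpoint estimate. It exceeds that of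
  -- q/(b+1) by 1 - νb/r ≥ 0, which Hölder's inequality in time pays for with a power of the length.
  -- The bounds p, q < r(b+1) give the hypotheses of the endpoint estimate.
  set y := 1 - ν * (1 / (p / (b + 1)) - 1 / r) with hy
  have hyq : y = 1 / (q / (b + 1)) + (1 - ν * b / r) := by
    have e1 : 1 / (q / (b + 1)) = (b + 1) * (1 / q) := by field_simp
    have e2 : 1 / (p / (b + 1)) = (b + 1) * (1 / p) := by field_simp
    rw [hy, e1, e2, he.eq]
    ring
  have hy1 : y < 1 := by
    have h1 : 1 / r < 1 / (p / (b + 1)) := one_div_lt_one_div_of_lt (by linarith) har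
    have h2 : 0 < ν * (1 / (p / (b + 1)) - 1 / r) := mul_pos hν (sub_pos.2 h1)
    linarith
  have hyr : 1 / r < y := by
    have h1 : 1 / r < 1 / (q / (b + 1)) := one_div_lt_one_div_of_lt (by positivity) hqr
    linarith
  have hy0 : 0 < y := (by positivity : 0 < 1 / r).trans hyr
  obtain ⟨C, hC, hle⟩ := lpn_pduh_endpoint hk (r := r) (a := p / (b + 1)) (Q := 1 / y) hν ha har
    (by rw [lt_div_iff₀ hy0]; linarith) (by rwa [one_div_lt hy0 hr0]) (by rw [one_div_one_div])
  refine ⟨C, hC, fun s t A hA U hU => ?_⟩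
  have hUb : Measurable (Function.uncurry fun τ y => U τ y ^ (b + 1)) := hU.pow_const _
  refine (hle s t _ hUb).trans ?_
  rw [mul_assoc]
  gcongr
  refine (lpn_Ioo_le (Q' := q / (b + 1)) (η := 1 - ν * b / r) (by positivity) (by positivity) hη0
    (by rw [one_div_one_div]; exact hyq) (measurable_lpn hUb)).trans ?_
  have e := mixed_rpow_add_one (μ := μ) (I := Ioo s t) (p := p) (q := q) hb hp0 hq0 U
  unfold mixed at e ⊢
  rw [e]
  gcongr

/-- Absolute continuity of the time integral, available because q is finite. It provides smallness
on short intervals when the data are not small. -/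
theorem exists_mixed_lt {I : Set ℝ} {U : ℝ → G → ℝ≥0∞} (hq : 0 < q)
    (h : mixed μ I q p U ≠ ∞) {ε : ℝ≥0∞} (hε : ε ≠ 0) :
    ∃ δ : ℝ, 0 < δ ∧ ∀ J ⊆ I, MeasurableSet J → volume J ≤ ENNReal.ofReal δ →
      mixed μ J q p U < ε := by
  have h1 : ∫⁻ t in I, lpn μ p (U t) ^ q ≠ ∞ := by
    rw [← lpn_rpow_self hq]; exact ENNReal.rpow_ne_top_of_nonneg hq.le h
  wlog hεt : ε ≠ ∞ generalizing ε
  · obtain ⟨δ, hδ, H⟩ := this (ε := 1) one_ne_zero ENNReal.one_ne_top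
    refine ⟨δ, hδ, fun J hJ hJm hv => (H J hJ hJm hv).trans ?_⟩
    rw [not_ne_iff.1 hεt]; exact ENNReal.one_lt_top
  obtain ⟨δ, hδ, hlt⟩ := exists_pos_setLIntegral_lt_of_measure_lt h1
    (ε := ε ^ q) (by simp [hε, hεt])
  obtain ⟨δ', hδ'0, hδ'⟩ := ENNReal.lt_iff_exists_real_btwn.1 hδ
  rw [ENNReal.ofReal_pos] at hδ'
  refine ⟨δ', hδ'.1, fun J hJ hJm hv => ?_⟩
  have h2 : volume.restrict I J < δ :=
    (Measure.restrict_apply_le I J).trans_lt (hv.trans_lt hδ'.2)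
  have h3 := hlt J h2
  rw [Measure.restrict_restrict hJm, inter_eq_left.2 hJ, ← lpn_rpow_self hq] at h3
  exact (ENNReal.rpow_lt_rpow_iff hq).1 h3

end Exponents

end FracHeat

namespace FracHeat

/-! ### Mild solutions on space-time: restarting and continuity. -/

section Mild

open Filter Topology

variable {𝕜 : Type*} [RCLike 𝕜] {n : ℕ} {α b ε r p q : ℝ} {c : ℝ≥0∞} {I : Set ℝ}
  {φ : EuclideanSpace ℝ (Fin n) → 𝕜} {u : ℝ → EuclideanSpace ℝ (Fin n) → 𝕜}

/-- The Duhamel term of the absolute value of the nonlinearity. -/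
def absDuh (n : ℕ) (α b : ℝ) (s : ℝ) (u : ℝ → EuclideanSpace ℝ (Fin n) → 𝕜) :
    ℝ → EuclideanSpace ℝ (Fin n) → ℝ≥0∞ :=
  pduh volume (absK (kernel n α)) s fun τ y => ‖u τ y‖ₑ ^ (b + 1)

/-- The Duhamel term of the nonlinearity. -/
def nlDuh (n : ℕ) (α b ε : ℝ) (s : ℝ) (u : ℝ → EuclideanSpace ℝ (Fin n) → 𝕜) :
    ℝ → EuclideanSpace ℝ (Fin n) → 𝕜 :=
  duh volume (kernel n α) s fun τ y => nonlin b ε (u τ y)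

/-- Mild solutions, for jointly measurable functions on space-time. -/
structure FMild (n : ℕ) (α b ε : ℝ) (I : Set ℝ) (φ : EuclideanSpace ℝ (Fin n) → 𝕜)
    (u : ℝ → EuclideanSpace ℝ (Fin n) → 𝕜) : Prop where
  meas : Measurable (Function.uncurry u)
  fin : ∃ a, 1 ≤ a ∧ ∀ t ∈ I, lpn volume a (absDuh n α b 0 u t) < ∞
  eq : ∀ t ∈ I, ∀ᵐ x, u t x = heatFlow n α φ t x + nlDuh n α b ε 0 u t x

theorem absDuh_eq (hb : 0 < b) (hε : |ε| = 1) (s : ℝ) :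
    absDuh n α b s u = pduh volume (absK (kernel n α)) s fun τ y => ‖nonlin b ε (u τ y)‖ₑ := by
  unfold absDuh
  simp_rw [enorm_nonlin hb hε]

theorem nlDuh_self (s : ℝ) (x : EuclideanSpace ℝ (Fin n)) : nlDuh n α b ε s u s x = 0 := by
  simp [nlDuh, duh]

theorem measurable_absDuh (hS : HeatSemigroup volume (n / (2 * α)) c (kernel n α))
    (hu : Measurable (Function.uncurry u)) (s t : ℝ) : Measurable (absDuh n α b s u t) :=
  have h : Measurable (Function.uncurry fun τ y => ‖u τ y‖ₑ ^ (b + 1)) :=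
    (meas_enorm hu).pow_const _
  measurable_pduh hS.bound s h t

theorem measurable_nlDuh (hS : HeatSemigroup volume (n / (2 * α)) c (kernel n α)) (hb : 0 < b)
    (hu : Measurable (Function.uncurry u)) (s t : ℝ) : Measurable (nlDuh n α b ε s u t) :=
  (measurable_duh hS.meas s (measurable_nonlin_comp hb hu)).comp measurable_prodMk_left

theorem enorm_nlDuh_le (hS : HeatSemigroup volume (n / (2 * α)) c (kernel n α)) (hb : 0 < b)
    (hε : |ε| = 1) (hu : Measurable (Function.uncurry u)) (s t : ℝ)
    (x : EuclideanSpace ℝ (Fin n)) : ‖nlDuh n α b ε s u t x‖ₑ ≤ absDuh n α b s u t x := by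
  rw [absDuh_eq hb hε]
  exact enorm_duh_le hS.bound (measurable_nonlin_comp hb hu) s t x

theorem heatFlow_zero : heatFlow n α φ 0 = φ := by
  ext x
  rw [heatFlow, if_neg (lt_irrefl _)]

theorem heatFlow_of_pos {t : ℝ} (ht : 0 < t) :
    heatFlow n α φ t = sconv volume (kernel n α) t φ := by
  ext x
  rw [heatFlow, if_pos ht]

theorem lpn_heatFlow_le (hS : HeatSemigroup volume (n / (2 * α)) c (kernel n α)) (hr : 1 ≤ r)
    (hφ : Measurable φ) (t : ℝ) : lpn volume r (fun x => ‖heatFlow n α φ t x‖ₑ) ≤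
      (c + 1) * lpn volume r (fun x => ‖φ x‖ₑ) := by
  rcases le_or_gt t 0 with ht | ht
  · have : heatFlow n α φ t = φ := by
      ext x
      rw [heatFlow, if_neg (not_lt.2 ht)]
    rw [this]
    exact le_mul_of_one_le_left' le_add_self
  · rw [heatFlow_of_pos ht]
    refine (lpn_mono (by linarith) fun x => enorm_sconv_le t φ x).trans
      ((lpn_pconv_le_self hS.bound ht hr hφ.enorm).trans ?_)
    gcongr
    exact le_self_add

theorem ae_absDuh_lt_top (hS : HeatSemigroup volume (n / (2 * α)) c (kernel n α))
    (hu : Measurable (Function.uncurry u)) {a : ℝ} (ha : 1 ≤ a) {s t : ℝ}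
    (h : lpn volume a (absDuh n α b s u t) < ∞) : ∀ᵐ x, absDuh n α b s u t x < ∞ :=
  lpn_ae_lt_top (by linarith) (measurable_absDuh hS hu s t) h.ne

theorem integrable_kernel_smul (hS : HeatSemigroup volume (n / (2 * α)) c (kernel n α)) {a t : ℝ}
    (ht : 0 < t) (ha : 1 ≤ a) (hφ : Measurable φ) (h : lpn volume a (fun x => ‖φ x‖ₑ) < ∞)
    (x : EuclideanSpace ℝ (Fin n)) : Integrable fun y => kernel n α t (x - y) • φ y := by
  refine integrable_sconv hS.meas hφ ((pconv_le_sup hS.bound ht ha hφ.enorm x).trans_lt ?_)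
  exact ENNReal.mul_lt_top (ENNReal.mul_lt_top hS.bound.ne_top.lt_top
    (ofReal_rpow_ne_top ht _).lt_top) h

theorem sconv_add (hS : HeatSemigroup volume (n / (2 * α)) c (kernel n α)) {a a' t : ℝ}
    (ht : 0 < t) (ha : 1 ≤ a) (ha' : 1 ≤ a') {ψ : EuclideanSpace ℝ (Fin n) → 𝕜}
    (hφ : Measurable φ) (hψ : Measurable ψ)
    (h : lpn volume a (fun x => ‖φ x‖ₑ) < ∞) (h' : lpn volume a' (fun x => ‖ψ x‖ₑ) < ∞)
    (x : EuclideanSpace ℝ (Fin n)) :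
    sconv volume (kernel n α) t (fun y => φ y + ψ y) x =
      sconv volume (kernel n α) t φ x + sconv volume (kernel n α) t ψ x := by
  unfold sconv
  simp_rw [smul_add]
  exact integral_add (integrable_kernel_smul hS ht ha hφ h x)
    (integrable_kernel_smul hS ht ha' hψ h' x)

/-- The semigroup applied to the right-hand side of the integral equation. -/
theorem sconv_heatFlow_add_nlDuh (hS : HeatSemigroup volume (n / (2 * α)) c (kernel n α))
    (hb : 0 < b) (hε : |ε| = 1) (hr : 1 ≤ r) (hφm : Measurable φ)
    (hφ : lpn volume r (fun x => ‖φ x‖ₑ) < ∞) (hu : Measurable (Function.uncurry u)) {a : ℝ}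
    (ha : 1 ≤ a) {s t : ℝ} (hs : 0 ≤ s) (hst : s < t)
    (hs' : lpn volume a (absDuh n α b 0 u s) < ∞) {x : EuclideanSpace ℝ (Fin n)}
    (hx : absDuh n α b 0 u t x < ∞) :
    sconv volume (kernel n α) (t - s) (fun y => heatFlow n α φ s y + nlDuh n α b ε 0 u s y) x +
      nlDuh n α b ε s u t x = heatFlow n α φ t x + nlDuh n α b ε 0 u t x := by
  have hts : 0 < t - s := sub_pos.2 hst
  have h1 : lpn volume a (fun x => ‖nlDuh n α b ε 0 u s x‖ₑ) < ∞ :=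
    (lpn_mono (by linarith) fun x => enorm_nlDuh_le hS hb hε hu 0 s x).trans_lt hs'
  have h2 : lpn volume r (fun x => ‖heatFlow n α φ s x‖ₑ) < ∞ :=
    (lpn_heatFlow_le hS hr hφm s).trans_lt
      (ENNReal.mul_lt_top (ENNReal.add_lt_top.2 ⟨hS.bound.ne_top.lt_top, ENNReal.one_lt_top⟩) hφ)
  have hm : Measurable (heatFlow n α φ s) :=
    (measurable_heatFlow_uncurry hφm).comp measurable_prodMk_left
  rw [sconv_add hS hts hr ha hm
    (measurable_nlDuh hS hb hu 0 s) h2 h1]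
  rw [absDuh_eq hb hε] at hx hs'
  have h3 := duh_restart hS (measurable_nonlin_comp (ε := ε) hb hu) hs hst ha hs' hx
  have h4 : sconv volume (kernel n α) (t - s) (heatFlow n α φ s) x = heatFlow n α φ t x := by
    rw [heatFlow_of_pos (hs.trans_lt hst)]
    rcases hs.eq_or_lt with rfl | hs
    · rw [heatFlow_zero, sub_zero]
    · rw [heatFlow_of_pos hs, sconv_sconv hS hs hts hr hφm hφ, sub_add_cancel]
  rw [h4, add_assoc]
  congr 1
  exact h3.symm

/-- A mild solution is a mild solution after every intermediate time. -/
theorem FMild.restart (hS : HeatSemigroup volume (n / (2 * α)) c (kernel n α))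
    (hb : 0 < b) (hε : |ε| = 1) (hr : 1 ≤ r) (hφm : Measurable φ)
    (hφ : lpn volume r (fun x => ‖φ x‖ₑ) < ∞) (h : FMild n α b ε I φ u) {s t : ℝ} (hs : s ∈ I)
    (ht : t ∈ I) (hs0 : 0 ≤ s) (hst : s ≤ t) :
    ∀ᵐ x, u t x = heatFlow n α (u s) (t - s) x + nlDuh n α b ε s u t x := by
  rcases hst.eq_or_lt with rfl | hst
  · refine .of_forall fun x => ?_
    rw [sub_self, heatFlow_zero, nlDuh_self, add_zero]
  · obtain ⟨a, ha, hfin⟩ := h.fin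
    filter_upwards [h.eq t ht, ae_absDuh_lt_top hS h.meas ha (hfin t ht)] with x hx hx'
    rw [hx, heatFlow_of_pos (sub_pos.2 hst), sconv_congr (h.eq s hs),
      sconv_heatFlow_add_nlDuh hS hb hε hr hφm hφ h.meas ha hs0 hst (hfin s hs) hx']

/-- A qualitative bound, free of any scaling relation: Minkowski's inequality, the boundedness of
the semigroup on L^{p/(b+1)}, and Hölder's inequality on a bounded time interval. It makes the
Duhamel integrals converge absolutely almost everywhere. -/
theorem lpn_absDuh_lt_top (hS : HeatSemigroup volume (n / (2 * α)) c (kernel n α))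
    (hb : 0 < b) (hp : b + 1 ≤ p) (hq : b + 1 ≤ q)
    (hu : Measurable (Function.uncurry u)) {s t : ℝ}
    (h : mixed volume (Ioo s t) q p (fun t x => ‖u t x‖ₑ) < ∞) :
    lpn volume (p / (b + 1)) (absDuh n α b s u t) < ∞ := by
  have hb1 : 0 < b + 1 := by linarith
  have hp0 : 0 < p := by linarith
  have hq0 : 0 < q := by linarith
  have ha : 1 ≤ p / (b + 1) := by rwa [le_div_iff₀ hb1, one_mul]
  have hub : Measurable (Function.uncurry fun τ y => ‖u τ y‖ₑ ^ (b + 1)) :=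
    (meas_enorm hu).pow_const _
  have hL : Measurable fun τ => lpn volume p fun y => ‖u τ y‖ₑ := measurable_lpn (meas_enorm hu)
  have h1 : lpn volume (p / (b + 1)) (absDuh n α b s u t) ≤
      ∫⁻ τ in Ioo s t, c * lpn volume p (fun y => ‖u τ y‖ₑ) ^ (b + 1) := by
    refine (lpn_pduh_le hS.bound s t hub ha).trans ?_
    refine setLIntegral_mono (measurable_const.mul (hL.pow_const _)) fun τ hτ => ?_
    rw [← lpn_rpow_add_one hb hp0]
    exact lpn_pconv_le_self hS.bound (sub_pos.2 hτ.2) ha (hub.comp measurable_prodMk_left)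
  refine h1.trans_lt ?_
  rw [lintegral_const_mul _ (hL.pow_const _)]
  refine ENNReal.mul_lt_top hS.bound.ne_top.lt_top ?_
  rw [← lpn_rpow_self hb1]
  refine ENNReal.rpow_lt_top_of_nonneg hb1.le (ne_top_of_lt (b := ∞) ?_)
  rcases le_or_gt t s with hts | hts
  · rw [Ioo_eq_empty (not_lt.2 hts), Measure.restrict_empty]
    simp [lpn, hb1]
  refine (lpn_Ioo_le (Q' := q) (η := 1 / (b + 1) - 1 / q) hb1 hq0
    (sub_nonneg.2 (one_div_le_one_div_of_le hb1 hq)) (by ring) hL).trans_lt ?_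
  exact ENNReal.mul_lt_top (ofReal_rpow_ne_top (sub_pos.2 hts) _).lt_top h

theorem exists_pos_mul_rpow_le {D ε : ℝ≥0∞} (hD : D ≠ ∞) (hε : ε ≠ 0) {s : ℝ} (hs : 0 < s) :
    ∃ δ : ℝ≥0∞, δ ≠ 0 ∧ ∀ z ≤ δ, D * z ^ s ≤ ε := by
  refine ⟨(ε / (D + 1)) ^ (1 / s), ?_, fun z hz => ?_⟩
  · rw [Ne, ENNReal.rpow_eq_zero_iff_of_pos (by positivity), ENNReal.div_eq_zero_iff]
    simp [hε, hD]
  · calc D * z ^ s ≤ (D + 1) * ((ε / (D + 1)) ^ (1 / s)) ^ s := by gcongr; exact le_self_add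
      _ = (D + 1) * (ε / (D + 1)) := by
        rw [← ENNReal.rpow_mul, one_div_mul_cancel hs.ne', ENNReal.rpow_one]
      _ ≤ ε := ENNReal.mul_div_le

theorem FMild.lpn_le (hS : HeatSemigroup volume (n / (2 * α)) c (kernel n α))
    (hb : 0 < b) (hε : |ε| = 1) (hr : 1 ≤ r) (hφm : Measurable φ) (h : FMild n α b ε I φ u)
    {t : ℝ} (ht : t ∈ I) : lpn volume r (fun x => ‖u t x‖ₑ) ≤
      (c + 1) * lpn volume r (fun x => ‖φ x‖ₑ) + lpn volume r (absDuh n α b 0 u t) := by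
  have hm : Measurable (heatFlow n α φ t) :=
    (measurable_heatFlow_uncurry hφm).comp measurable_prodMk_left
  calc lpn volume r (fun x => ‖u t x‖ₑ) ≤
        lpn volume r (fun x => ‖heatFlow n α φ t x‖ₑ + absDuh n α b 0 u t x) := by
        refine lpn_mono_ae (by linarith) ?_
        filter_upwards [h.eq t ht] with x hx
        rw [hx]
        exact (enorm_add_le _ _).trans (by gcongr; exact enorm_nlDuh_le hS hb hε h.meas 0 t x)
    _ ≤ _ := (lpn_add_le hr hm.enorm (measurable_absDuh hS h.meas 0 t)).trans (by
        gcongr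
        exact lpn_heatFlow_le hS hr hφm t)

/-- Mild solutions in the auxiliary space are continuous into `L^r`. -/
theorem FMild.tendsto (hα : 0 < α) (hn : 0 < (n : ℝ) / (2 * α))
    (hS : HeatSemigroup volume (n / (2 * α)) c (kernel n α))
    (hb : 0 < b) (hε : |ε| = 1) (he : Exponents (n / (2 * α)) b r p q)
    (hη : n / (2 * α) * b ≤ r) (hφm : Measurable φ)
    (hφ : lpn volume r (fun x => ‖φ x‖ₑ) < ∞) (h : FMild n α b ε I φ u)
    (hI : I.OrdConnected) (h0 : 0 ∈ I) (hI0 : ∀ t ∈ I, 0 ≤ t) {A : ℝ≥0∞} (hA : A ≠ ∞)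
    (hAle : ∀ t ∈ I, ENNReal.ofReal t ^ (1 - n / (2 * α) * b / r) ≤ A)
    (hu : mixed volume I q p (fun t x => ‖u t x‖ₑ) < ∞)
    (hur : ∀ t ∈ I, lpn volume r (fun x => ‖u t x‖ₑ) < ∞) {t₀ : ℝ} (ht₀ : t₀ ∈ I) :
    Tendsto (fun t => lpn volume r (fun x => ‖u t x - u t₀ x‖ₑ)) (𝓝[I] t₀) (𝓝 0) := by
  have hr1 : 1 < r := he.one_lt
  have hr0 : 0 < r := by linarith
  have hη0 : 0 ≤ 1 - n / (2 * α) * b / r := by rw [sub_nonneg, div_le_one hr0]; exact hη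
  obtain ⟨C, hC, hle⟩ := lpn_pduh_rpow_le hS.bound hn hb he hη
  rw [ENNReal.tendsto_nhds_zero]
  intro e he0
  have he3 : e / 3 ≠ 0 := by simp [he0.ne']
  obtain ⟨δ₁, hδ₁, hsm⟩ := exists_pos_mul_rpow_le (ENNReal.mul_ne_top hC hA) he3
    (s := b + 1) (by linarith)
  obtain ⟨δ, hδ, hmix⟩ := exists_mixed_lt (by linarith [he.bq]) hu.ne hδ₁
  -- Restarting slightly before t₀ treats left and right limits together. For t near t₀, both u(t)
  -- and u(t₀) are free evolutions of u(s) plus Duhamel terms over intervals of length at most δ,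
  -- which are small.
  set s := max 0 (t₀ - δ / 3) with hs
  have ht₀0 := hI0 t₀ ht₀
  have hst₀ : s ≤ t₀ := max_le ht₀0 (by linarith)
  have hsI : s ∈ I := hI.out h0 ht₀ ⟨le_max_left _ _, hst₀⟩
  have hs0 : 0 ≤ s := le_max_left _ _
  have hD : ∀ t ∈ I, s ≤ t → t < t₀ + δ / 3 → lpn volume r (absDuh n α b s u t) ≤ e / 3 := by
    intro t ht hst htt
    have hsub : Ioo s t ⊆ I := (Ioo_subset_Icc_self).trans (hI.out hsI ht)
    have h1 : ENNReal.ofReal (t - s) ^ (1 - n / (2 * α) * b / r) ≤ A := by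
      refine le_trans ?_ (hAle t ht)
      gcongr
      linarith
    refine (hle s t A h1 _ (meas_enorm h.meas)).trans (hsm _ (hmix _ hsub measurableSet_Ioo ?_).le)
    rw [Real.volume_Ioo]
    refine ENNReal.ofReal_le_ofReal ?_
    have : t₀ - δ / 3 ≤ s := le_max_right _ _
    linarith
  have hus : Measurable (u s) := h.meas.comp measurable_prodMk_left
  have hflow := (tendsto_heatFlow hα hr1.le hus (hur s hsI) (t₀ - s)).comp
    ((continuous_sub_right s).tendsto t₀)
  have hev1 := (ENNReal.tendsto_nhds_zero.1 hflow) (e / 3) (pos_iff_ne_zero.2 he3)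
  have hev2 : ∀ᶠ t in 𝓝 t₀, t ∈ Ioo (t₀ - δ / 3) (t₀ + δ / 3) :=
    Ioo_mem_nhds (by linarith) (by linarith)
  filter_upwards [mem_nhdsWithin_of_mem_nhds hev1, mem_nhdsWithin_of_mem_nhds hev2,
    self_mem_nhdsWithin] with t hft ht2 htI
  have hst : s ≤ t := max_le (hI0 t htI) ht2.1.le
  have hmf : ∀ τ, Measurable (heatFlow n α (u s) τ) := fun τ =>
    (measurable_heatFlow_uncurry hus).comp measurable_prodMk_left
  calc lpn volume r (fun x => ‖u t x - u t₀ x‖ₑ) ≤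
      lpn volume r (fun x => ‖heatFlow n α (u s) (t - s) x - heatFlow n α (u s) (t₀ - s) x‖ₑ +
        (absDuh n α b s u t x + absDuh n α b s u t₀ x)) := by
        refine lpn_mono_ae hr0 ?_
        filter_upwards [h.restart hS hb hε hr1.le hφm hφ hsI htI hs0 hst,
          h.restart hS hb hε hr1.le hφm hφ hsI ht₀ hs0 hst₀] with x hx hx'
        rw [hx, hx', add_sub_add_comm]
        refine (enorm_add_le _ _).trans ?_
        gcongr
        refine enorm_sub_le.trans ?_
        gcongr <;> exact enorm_nlDuh_le hS hb hε h.meas _ _ x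
    _ ≤ lpn volume r (fun x =>
          ‖heatFlow n α (u s) (t - s) x - heatFlow n α (u s) (t₀ - s) x‖ₑ) +
        (lpn volume r (absDuh n α b s u t) + lpn volume r (absDuh n α b s u t₀)) := by
        have hm1 := measurable_absDuh (b := b) hS h.meas s t
        have hm2 := measurable_absDuh (b := b) hS h.meas s t₀
        refine (lpn_add_le hr1.le ((hmf _).sub (hmf _)).enorm (hm1.add hm2)).trans ?_
        exact add_le_add le_rfl (lpn_add_le hr1.le hm1 hm2)
    _ ≤ e / 3 + (e / 3 + e / 3) := by
        gcongr
        · exact hft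
        · exact hD t htI hst ht2.2
        · exact hD t₀ ht₀ hst₀ (by linarith)
    _ = e := by rw [← add_assoc, ENNReal.add_thirds]

end Mild

end FracHeat

namespace FracHeat

/-! ### Existence in the auxiliary space, and all admissible norms. -/

section Existence

open Filter Topology

variable {𝕜 : Type*} [RCLike 𝕜] {n : ℕ} {α b ε r p q : ℝ} {c : ℝ≥0∞} {I : Set ℝ}
  {φ : EuclideanSpace ℝ (Fin n) → 𝕜} {u : ℝ → EuclideanSpace ℝ (Fin n) → 𝕜}

theorem mixed_heatFlow_le (hn : 0 < (n : ℝ) / (2 * α))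
    (hS : HeatSemigroup volume (n / (2 * α)) c (kernel n α)) (hr : 1 < r) (hrp : r < p)
    (hrq : r < q) (h : 1 / q = n / (2 * α) * (1 / r - 1 / p)) :
    ∃ C : ℝ≥0∞, C ≠ ∞ ∧ ∀ φ : EuclideanSpace ℝ (Fin n) → 𝕜, Measurable φ →
      mixed volume (Ici 0) q p (fun t x => ‖heatFlow n α φ t x‖ₑ) ≤
        C * lpn volume r (fun x => ‖φ x‖ₑ) := by
  obtain ⟨C, hC, hle⟩ := lpn_lpn_pconv_le hS.bound hn hr hrp hrq h
  refine ⟨C, hC, fun φ hφ => le_trans ?_ (hle _ hφ.enorm)⟩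
  unfold mixed
  rw [restrict_Ioi_eq_restrict_Ici.symm]
  refine lpn_mono_ae (by linarith) ?_
  filter_upwards [ae_restrict_mem measurableSet_Ioi] with t ht
  rw [heatFlow_of_pos ht]
  exact lpn_mono (by linarith) fun x => enorm_sconv_le t φ x

/-- Translates the space-time formulation into the iterated integrals of `IsMildSolution`. Functions
may be replaced by almost everywhere equal ones at each time, so that classes in L^r are allowed. -/
theorem ae_integrable_and_duhamel (hS : HeatSemigroup volume (n / (2 * α)) c (kernel n α))
    (hb : 0 < b) (hε : |ε| = 1) (h : FMild n α b ε I φ u)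
    {ψ : EuclideanSpace ℝ (Fin n) → 𝕜} {v : ℝ → EuclideanSpace ℝ (Fin n) → 𝕜}
    (hψ : φ =ᵐ[volume] ψ) (hv : ∀ t ∈ I, u t =ᵐ[volume] v t) {t : ℝ} (ht : t ∈ I) (ht0 : 0 < t)
    (hsub : Ioo 0 t ⊆ I) : ∀ᵐ x, ((∀ᵐ τ ∂(volume.restrict (Ioo 0 t)),
        ConvolutionExistsAt (kernel n α (t - τ)) (fun y => nonlin b ε (v τ y)) x
          (ContinuousLinearMap.lsmul ℝ ℝ) volume) ∧
      IntegrableOn (fun τ => semigroup n α (t - τ) (fun y => nonlin b ε (v τ y)) x) (Ioo 0 t)) ∧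
      v t x = semigroup n α t ψ x +
        ∫ τ in Ioo 0 t, semigroup n α (t - τ) (fun y => nonlin b ε (v τ y)) x := by
  obtain ⟨a, ha, hfin⟩ := h.fin
  have hnl : ∀ τ ∈ Ioo 0 t, (fun y => nonlin b ε (u τ y)) =ᵐ[volume]
      fun y => nonlin b ε (v τ y) := fun τ hτ => by
    filter_upwards [hv τ (hsub hτ)] with y hy
    rw [hy]
  have hsg : ∀ τ ∈ Ioo 0 t, ∀ x, semigroup n α (t - τ) (fun y => nonlin b ε (v τ y)) x =
      sconv volume (kernel n α) (t - τ) (fun y => nonlin b ε (u τ y)) x := fun τ hτ x => by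
    rw [semigroup_eq_sconv, sconv_congr (hnl τ hτ)]
  filter_upwards [h.eq t ht, ae_absDuh_lt_top hS h.meas ha (hfin t ht), hv t ht]
    with x hx hx' hvx
  rw [absDuh_eq hb hε] at hx'
  obtain ⟨h1, h2, h3⟩ := duh_eq_integral_sconv hS (measurable_nonlin_comp (ε := ε) hb h.meas) hx'
  refine ⟨⟨?_, ?_⟩, ?_⟩
  · filter_upwards [h1, ae_restrict_mem measurableSet_Ioo] with τ h4 hτ
    rw [convolutionExistsAt_kernel_iff]
    refine h4.congr ?_
    filter_upwards [hnl τ hτ] with y hy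
    rw [hy]
  · exact h2.congr_fun (fun τ hτ => (hsg τ hτ x).symm) measurableSet_Ioo
  · rw [setIntegral_congr_fun measurableSet_Ioo fun τ hτ => hsg τ hτ x, ← h3, ← hvx, hx,
      semigroup_eq_sconv, ← sconv_congr hψ, heatFlow_of_pos ht0]
    rfl

/-- The fixed-point argument, for functions on space-time. -/
theorem exists_fmild (hn : 0 < (n : ℝ) / (2 * α))
    (hS : HeatSemigroup volume (n / (2 * α)) c (kernel n α))
    (hb : 0 < b) (hε : |ε| = 1) (he : Exponents (n / (2 * α)) b r p q) :
    ∃ m₀ : ℝ≥0∞, m₀ ≠ 0 ∧ ∀ I : Set ℝ, MeasurableSet I → I.OrdConnected → 0 ∈ I →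
      (∀ t ∈ I, 0 ≤ t) → ∀ A : ℝ≥0∞, A ≠ ∞ →
      (∀ t ∈ I, ∀ σ, 0 ≤ σ → σ ≤ t →
        ENNReal.ofReal σ ^ (1 - n / (2 * α) * b / r) ≤ A) →
      ∀ φ : EuclideanSpace ℝ (Fin n) → 𝕜, Measurable φ → lpn volume r (fun x => ‖φ x‖ₑ) < ∞ →
      A * mixed volume I q p (fun t x => ‖heatFlow n α φ t x‖ₑ) ^ b ≤ m₀ →
      ∃ u : ℝ → EuclideanSpace ℝ (Fin n) → 𝕜, FMild n α b ε I φ u ∧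
        (∀ t ∈ I, ∀ x, u t x = heatFlow n α φ t x + nlDuh n α b ε 0 u t x) ∧
        mixed volume I q p (fun t x => ‖u t x‖ₑ) < ∞ := by
  have hp1 : 1 ≤ p := by linarith [he.bp]
  have hq1 : 1 ≤ q := by linarith [he.bq]
  obtain ⟨C, hC, hY⟩ := mixed_pduh_rpow_mul_le hS.bound hb he.bp.le he.bq
  obtain ⟨Cl, hCl, hlin⟩ := mixed_heatFlow_le (𝕜 := 𝕜) hn hS he.one_lt he.rp he.rq he.eq
  set D := ENNReal.ofReal (b + 2) * C * 2 ^ b with hD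
  have hDt : D ≠ ∞ := by
    refine ENNReal.mul_ne_top (ENNReal.mul_ne_top ENNReal.ofReal_ne_top hC) ?_
    exact ENNReal.rpow_ne_top_of_nonneg hb.le (by simp)
  -- Along the line of admissible exponents the surplus power of time does not depend on p: it is 1
  -- - r₀/r.
  have hexp : 1 - n / (2 * α) * b / p - b / q = 1 - n / (2 * α) * b / r := by
    have : b / q = b * (1 / q) := by ring
    rw [this, he.eq]
    ring
  -- Chosen so that D · (A m^b) ≤ 1/4, the smallness required by the fixed-point argument; D + 1
  -- avoids dividing by zero.
  refine ⟨1 / 4 / (D + 1), ?_, fun I hI hIc h0 hI0 A hA hAle φ hφm hφ hsmall => ?_⟩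
  · rw [Ne, ENNReal.div_eq_zero_iff]
    simp [hDt]
  have hsub : ∀ t ∈ I, Ioo 0 t ⊆ I := fun t ht => Ioo_subset_Icc_self.trans (hIc.out h0 ht)
  set m := mixed volume I q p (fun t x => ‖heatFlow n α φ t x‖ₑ) with hm
  have hmt : m ≠ ∞ := by
    refine ne_top_of_le_ne_top (ENNReal.mul_ne_top hCl hφ.ne) (le_trans ?_ (hlin φ hφm))
    exact mixed_mono_set (fun t ht => hI0 t ht) (by linarith) _
  obtain ⟨u, hum, hueq, hu3⟩ := exists_fixed_point (μ := volume) (ε := ε) hb hε hS.bound hS.meas hI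
    hsub hp1 hq1 (C := C * A) (m := m) (fun U W hU hW => hY 0 I hI hsub A hA (fun t ht σ h1 h2 => by
      rw [hexp]; exact hAle t ht σ h1.le (by linarith)) U W hU hW)
    (measurable_heatFlow_uncurry hφm) hmt (ENNReal.mul_ne_top hC hA) le_rfl (by
      calc ENNReal.ofReal (b + 2) * (C * A * (2 * m) ^ b) = D * (A * m ^ b) := by
            rw [ENNReal.mul_rpow_of_nonneg _ _ hb.le, hD]; ring
        _ ≤ (D + 1) * (1 / 4 / (D + 1)) := by gcongr; exact le_self_add
        _ ≤ 1 / 4 := ENNReal.mul_div_le)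
  have hufin : mixed volume I q p (fun t x => ‖u t x‖ₑ) < ∞ :=
    hu3.trans_lt (ENNReal.mul_lt_top (by simp) hmt.lt_top)
  refine ⟨u, ⟨hum, ⟨p / (b + 1), ?_, fun t ht => ?_⟩, fun t ht => .of_forall (hueq t ht)⟩,
    hueq, hufin⟩
  · rw [le_div_iff₀ (by linarith), one_mul]; exact he.bp.le
  · exact lpn_absDuh_lt_top hS hb he.bp.le he.bq.le hum
      ((mixed_mono_set (hsub t ht) (by linarith) _).trans_lt hufin)

/-- Solutions in the auxiliary space lie in `L^q_t L^p_x` for every admissible triplet. -/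
theorem mixed_lt_top_of_fmild (hn : 0 < (n : ℝ) / (2 * α))
    (hS : HeatSemigroup volume (n / (2 * α)) c (kernel n α))
    (hb : 0 < b) (hε : |ε| = 1) (he : Exponents (n / (2 * α)) b r p q) (hI : MeasurableSet I)
    (hIc : I.OrdConnected) (h0 : 0 ∈ I) (hI0 : ∀ t ∈ I, 0 ≤ t) {A : ℝ≥0∞} (hA : A ≠ ∞)
    (hAle : ∀ t ∈ I, ∀ σ, 0 ≤ σ → σ ≤ t → ENNReal.ofReal σ ^ (1 - n / (2 * α) * b / r) ≤ A)
    (hφm : Measurable φ) (hφ : lpn volume r (fun x => ‖φ x‖ₑ) < ∞)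
    (hum : Measurable (Function.uncurry u))
    (hueq : ∀ t ∈ I, ∀ x, u t x = heatFlow n α φ t x + nlDuh n α b ε 0 u t x)
    (hu : mixed volume I q p (fun t x => ‖u t x‖ₑ) < ∞) {p' q' : ℝ} (hrp : r < p') (hrq : r < q')
    (h : 1 / q' = n / (2 * α) * (1 / r - 1 / p')) :
    mixed volume I q' p' (fun t x => ‖u t x‖ₑ) < ∞ := by
  have hr0 : 0 < r := by linarith [he.one_lt]
  have hb1 : 0 < b + 1 := by linarith
  have hp0 : 0 < p := by linarith [he.bp]
  have hq0 : 0 < q := by linarith [he.bq]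
  have hsub : ∀ t ∈ I, Ioo 0 t ⊆ I := fun t ht => Ioo_subset_Icc_self.trans (hIc.out h0 ht)
  have hp1 : 1 ≤ p' := by linarith [he.one_lt]
  have hq1 : 1 ≤ q' := by linarith [he.one_lt]
  obtain ⟨Cl, hCl, hlin⟩ := mixed_heatFlow_le (𝕜 := 𝕜) hn hS he.one_lt hrp hrq h
  have har : p / (b + 1) < r := by rw [div_lt_iff₀ hb1]; exact he.pr
  have hqr : q / (b + 1) < r := by rw [div_lt_iff₀ hb1]; exact he.qr
  have e1 : 1 / (q / (b + 1)) = (b + 1) * (1 / q) := by field_simp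
  have e2 : 1 / (p / (b + 1)) = (b + 1) * (1 / p) := by field_simp
  -- The source lies in L^{q/(b+1)}_t L^{p/(b+1)}_x, and κ' is what passing from q/(b+1) to q' in
  -- time requires. It is below 1 because q/(b+1) < r < q'. The surplus power of time is again 1 -
  -- r₀/r.
  obtain ⟨C, hC, hD⟩ := mixed_pduh_le hS.bound (a := p / (b + 1)) (p := p')
    (s₁ := q / (b + 1)) (q := q') (κ' := 1 + 1 / q' - 1 / (q / (b + 1)))
    (by rw [le_div_iff₀ hb1, one_mul]; exact he.bp.le) (by linarith)
    (by rw [lt_div_iff₀ hb1, one_mul]; exact he.bq) (by linarith) (by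
      have h1 : 1 / q' < 1 / r := one_div_lt_one_div_of_lt hr0 hrq
      have h2 : 1 / r < 1 / (q / (b + 1)) := one_div_lt_one_div_of_lt (by positivity) hqr
      linarith) (by ring)
  have hexp : 1 + 1 / q' - 1 / (q / (b + 1)) - n / (2 * α) * (1 / (p / (b + 1)) - 1 / p') =
      1 - n / (2 * α) * b / r := by
    rw [e1, e2, he.eq, h]
    ring
  have hub : Measurable (Function.uncurry fun τ y => ‖u τ y‖ₑ ^ (b + 1)) :=
    (meas_enorm hum).pow_const _
  have h3 := hD 0 I hI hsub A hA (fun t ht σ h1 h2 => by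
    rw [hexp]; exact hAle t ht σ h1.le (by linarith)) _ hub
  rw [mixed_rpow_add_one hb hp0 hq0] at h3
  have hm1 : Measurable (Function.uncurry fun t x => ‖heatFlow n α φ t x‖ₑ) :=
    (measurable_heatFlow_uncurry hφm).enorm
  have hm2 : Measurable (Function.uncurry (absDuh n α b 0 u)) :=
    measurable_pduh_uncurry hS.bound 0 hub
  calc mixed volume I q' p' (fun t x => ‖u t x‖ₑ) ≤
      mixed volume I q' p' (fun t x => ‖heatFlow n α φ t x‖ₑ + absDuh n α b 0 u t x) := by
        refine mixed_mono hI (by linarith) (by linarith) fun t ht x => ?_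
        rw [hueq t ht x]
        exact (enorm_add_le _ _).trans (by gcongr; exact enorm_nlDuh_le hS hb hε hum 0 t x)
    _ ≤ mixed volume I q' p' (fun t x => ‖heatFlow n α φ t x‖ₑ) +
        mixed volume I q' p' (absDuh n α b 0 u) := mixed_add_le hq1 hp1 hm1 hm2
    _ < ∞ := by
        refine ENNReal.add_lt_top.2 ⟨?_, h3.trans_lt ?_⟩
        · refine (mixed_mono_set (fun t ht => hI0 t ht) (by linarith) _).trans_lt
            ((hlin φ hφm).trans_lt (ENNReal.mul_lt_top hCl.lt_top hφ))
        · exact ENNReal.mul_lt_top (ENNReal.mul_lt_top hC.lt_top hA.lt_top)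
            (ENNReal.rpow_lt_top_of_nonneg hb1.le hu.ne)

end Existence

/-! ### Solutions as curves in L^r. -/

section Curve

open Filter Topology

variable {𝕜 : Type*} [RCLike 𝕜] {n : ℕ} {α b ε r p q : ℝ} {c : ℝ≥0∞}

theorem measurable_rep (f : Lp 𝕜 (ENNReal.ofReal r)
    (volume : Measure (EuclideanSpace ℝ (Fin n)))) : Measurable (f : EuclideanSpace ℝ (Fin n) → 𝕜) :=
  (Lp.stronglyMeasurable f).measurable

theorem lpn_rep (hr : 0 < r) (f : Lp 𝕜 (ENNReal.ofReal r)
    (volume : Measure (EuclideanSpace ℝ (Fin n)))) :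
    lpn volume r (fun x => ‖f x‖ₑ) = ENNReal.ofReal ‖f‖ := by
  rw [← eLpNorm_eq_lpn hr, Lp.norm_def, ENNReal.ofReal_toReal (Lp.eLpNorm_ne_top f)]

/-- Existence of mild solutions, with the smallness condition in terms of the free evolution. -/
theorem exists_isMildSolution (hα : 0 < α) (hn : 0 < (n : ℝ) / (2 * α))
    (hS : HeatSemigroup volume (n / (2 * α)) c (kernel n α))
    (hb : 0 < b) (hε : |ε| = 1) (he : Exponents (n / (2 * α)) b r p q)
    (hη : n / (2 * α) * b ≤ r) [Fact (1 ≤ ENNReal.ofReal r)] :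
    ∃ m₀ : ℝ≥0∞, m₀ ≠ 0 ∧ ∀ I : Set ℝ, MeasurableSet I → I.OrdConnected → 0 ∈ I →
      (∀ t ∈ I, 0 ≤ t) → ∀ A : ℝ≥0∞, A ≠ ∞ →
      (∀ t ∈ I, ∀ σ, 0 ≤ σ → σ ≤ t →
        ENNReal.ofReal σ ^ (1 - n / (2 * α) * b / r) ≤ A) →
      ∀ φ : Lp 𝕜 (ENNReal.ofReal r) (volume : Measure (EuclideanSpace ℝ (Fin n))),
      A * mixed volume I q p (fun t x => ‖heatFlow n α φ t x‖ₑ) ^ b ≤ m₀ →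
      ∃ u, IsMildSolution α b ε I φ u ∧
        (∀ (q' : ℝ≥0∞) (p' : ℝ), IsAdmissible n α q' p' r → MemX q' p' I u) ∧
        ∃ B : ℝ, ∀ t ∈ I, ‖u t‖ ≤ B := by
  have hr1 : 1 < r := he.one_lt
  have hr0 : 0 < r := by linarith
  have hq0 : 0 < q := by linarith [he.rq]
  have hp0 : 0 < p := by linarith [he.rp]
  obtain ⟨m₀, hm₀, H⟩ := exists_fmild (𝕜 := 𝕜) hn hS hb hε he
  obtain ⟨C, hC, hle⟩ := lpn_pduh_rpow_le hS.bound hn hb he hη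
  refine ⟨m₀, hm₀, fun I hI hIc h0 hI0 A hA hAle φ hsmall => ?_⟩
  have hφ : lpn volume r (fun x => ‖φ x‖ₑ) < ∞ := by
    rw [lpn_rep hr0]; exact ENNReal.ofReal_lt_top
  have hsub : ∀ t ∈ I, Ioo 0 t ⊆ I := fun t ht => Ioo_subset_Icc_self.trans (hIc.out h0 ht)
  obtain ⟨u, hF, hueq, hu⟩ := H I hI hIc h0 hI0 A hA hAle φ (measurable_rep φ) hφ hsmall
  set B : ℝ≥0∞ := (c + 1) * lpn volume r (fun x => ‖φ x‖ₑ) +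
    C * A * mixed volume I q p (fun t x => ‖u t x‖ₑ) ^ (b + 1) with hB
  have hBt : B ≠ ∞ := by
    refine ENNReal.add_ne_top.2 ⟨ENNReal.mul_ne_top (ENNReal.add_ne_top.2
      ⟨hS.bound.ne_top, ENNReal.one_ne_top⟩) hφ.ne, ENNReal.mul_ne_top (ENNReal.mul_ne_top hC hA)
      (ENNReal.rpow_ne_top_of_nonneg (by linarith) hu.ne)⟩
  have hur : ∀ t ∈ I, lpn volume r (fun x => ‖u t x‖ₑ) ≤ B := fun t ht => by
    refine (hF.lpn_le hS hb hε hr1.le (measurable_rep φ) ht).trans ?_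
    rw [hB]
    gcongr
    refine (hle 0 t A (hAle t ht _ (by linarith [hI0 t ht]) (by linarith)) _
      (meas_enorm hF.meas)).trans ?_
    gcongr
    exact mixed_mono_set (hsub t ht) hq0 _
  have hmem : ∀ t ∈ I, MemLp (u t) (ENNReal.ofReal r) volume := fun t ht =>
    ⟨(hF.meas.comp measurable_prodMk_left).aestronglyMeasurable, by
      rw [eLpNorm_eq_lpn hr0]; exact (hur t ht).trans_lt hBt.lt_top⟩
  classical
  -- Off I the function u(t) need not be in L^r; the value 0 there is never used.
  set v : ℝ → Lp 𝕜 (ENNReal.ofReal r) (volume : Measure (EuclideanSpace ℝ (Fin n))) := fun t =>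
    if h : MemLp (u t) (ENNReal.ofReal r) volume then h.toLp (u t) else 0 with hv
  have hvt : ∀ t (ht : t ∈ I), v t = (hmem t ht).toLp (u t) := fun t ht => by
    simp only [hv, dif_pos (hmem t ht)]
  have huv : ∀ t ∈ I, u t =ᵐ[volume] v t := fun t ht => by
    rw [hvt t ht]
    exact (hmem t ht).coeFn_toLp.symm
  have huv' : ∀ J ⊆ I, MeasurableSet J → ∀ᵐ t ∂(volume.restrict J), u t =ᵐ[volume] v t :=
    fun J hJ hJm => by
      filter_upwards [ae_restrict_mem hJm] with t ht using huv t (hJ ht)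
  have hcont : ContinuousOn v I := fun t₀ ht₀ => by
    rw [ContinuousWithinAt, tendsto_iff_edist_tendsto_0]
    refine (hF.tendsto hα hn hS hb hε he hη (measurable_rep φ) hφ hIc h0 hI0 hA (fun t ht =>
      hAle t ht t (hI0 t ht) le_rfl) hu (fun t ht => (hur t ht).trans_lt hBt.lt_top) ht₀).congr' ?_
    filter_upwards [self_mem_nhdsWithin] with t ht
    rw [hvt t ht, hvt t₀ ht₀, Lp.edist_toLp_toLp, eLpNorm_eq_lpn hr0]
    rfl
  refine ⟨v, ⟨⟨ENNReal.ofReal q, p, isAdmissible_of_lt hn hα hr1 he.rp.le he.rq he.eq, he.bp,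
    fun T hT => ?_⟩, ?_, fun t ht ht0 => ?_, fun t ht ht0 => ?_⟩, fun q' p' hadm => ⟨hcont, ?_⟩,
    B.toReal, fun t ht => ?_⟩
  · have hs : Ico 0 T ⊆ I := Ico_subset_Icc_self.trans (hIc.out h0 hT)
    rw [memLqLp_iff hp0 hq0 hF.meas (huv' _ hs measurableSet_Ico)]
    exact (mixed_mono_set hs hq0 _).trans_lt hu
  · refine Lp.ext ?_
    refine (huv 0 h0).symm.trans (.of_forall fun x => ?_)
    rw [hueq 0 h0, heatFlow_zero, nlDuh_self, add_zero]
  · filter_upwards [ae_integrable_and_duhamel hS hb hε hF .rfl huv ht ht0 (hsub t ht)] with x hx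
    exact hx.1
  · filter_upwards [ae_integrable_and_duhamel hS hb hε hF .rfl huv ht ht0 (hsub t ht)] with x hx
    exact hx.2
  · rcases hadm.cases hn hα with ⟨rfl, rfl⟩ | ⟨hrp, q'', rfl, hrq, heq⟩
    · exact memLqLp_top hr0 hI hF.meas (huv' I le_rfl hI) hBt hur
    · rw [memLqLp_iff (by linarith) (by linarith) hF.meas (huv' I le_rfl hI)]
      exact mixed_lt_top_of_fmild hn hS hb hε he hI hIc h0 hI0 hA hAle (measurable_rep φ) hφ hF.meas
        hueq hu hrp hrq heq
  · rw [← ENNReal.ofReal_le_iff_le_toReal hBt, ← lpn_rep hr0]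
    refine le_trans (le_of_eq ?_) (hur t ht)
    refine lpn_congr_ae ?_
    filter_upwards [huv t ht] with x hx
    rw [hx]

end Curve

end FracHeat

namespace FracHeat

/-! ### Local existence, its critical case, and global existence for small data. -/

section LocalGlobal

open Filter Topology

variable {𝕜 : Type*} [RCLike 𝕜] {n : ℕ} {α b ε r : ℝ}

theorem exists_pos_mul_ofReal_le {D ε : ℝ≥0∞} (hD : D ≠ ∞) (hε : ε ≠ 0) :
    ∃ κ : ℝ, 0 < κ ∧ D * ENNReal.ofReal κ ≤ ε := by
  obtain ⟨δ, hδ, h⟩ := exists_pos_mul_rpow_le hD hε one_pos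
  have h1 : min δ 1 ≠ ∞ := ne_top_of_le_ne_top ENNReal.one_ne_top (min_le_right _ _)
  refine ⟨(min δ 1).toReal, ENNReal.toReal_pos (by simp [hδ]) h1, ?_⟩
  rw [ENNReal.ofReal_toReal h1]
  simpa using h _ (min_le_left δ 1)

/-- Existence up to time `T` if `T^{1 - r₀/r} ‖φ‖^b` is small. -/
theorem exists_isMildSolution_of_small (hα : 0 < α) (hn : 0 < (n : ℝ) / (2 * α))
    (hb : 0 < b) (hε : |ε| = 1) (h1 : 1 < n / (2 * α) * b) (hη : n / (2 * α) * b ≤ r)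
    [Fact (1 ≤ ENNReal.ofReal r)] :
    ∃ κ : ℝ, 0 < κ ∧ ∀ T > 0,
      ∀ φ : Lp 𝕜 (ENNReal.ofReal r) (volume : Measure (EuclideanSpace ℝ (Fin n))),
      T ^ (1 - n / (2 * α) * b / r) * ‖φ‖ ^ b ≤ κ →
      ∃ u, IsMildSolution α b ε (Ico 0 T) φ u ∧
        ∀ (q' : ℝ≥0∞) (p' : ℝ), IsAdmissible n α q' p' r → MemX q' p' (Ico 0 T) u := by
  obtain ⟨c, hS⟩ := exists_heatSemigroup (n := n) hα
  obtain ⟨p, q, he⟩ := exists_exponents hn hb h1 hη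
  have hr0 : 0 < r := by linarith [he.one_lt]
  have hη0 : 0 ≤ 1 - n / (2 * α) * b / r := by rw [sub_nonneg, div_le_one hr0]; exact hη
  obtain ⟨m₀, hm₀, H⟩ := exists_isMildSolution (𝕜 := 𝕜) hα hn hS hb hε he hη
  obtain ⟨C, hC, hlin⟩ := mixed_heatFlow_le (𝕜 := 𝕜) hn hS he.one_lt he.rp he.rq he.eq
  obtain ⟨κ, hκ, hκm⟩ := exists_pos_mul_ofReal_le
    (ENNReal.rpow_ne_top_of_nonneg hb.le hC : C ^ b ≠ ∞) hm₀
  refine ⟨κ, hκ, fun T hT φ hsmall => ?_⟩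
  obtain ⟨u, hu1, hu2, -⟩ := H (Ico 0 T) measurableSet_Ico ordConnected_Ico ⟨le_rfl, hT⟩
    (fun t ht => ht.1) (ENNReal.ofReal T ^ (1 - n / (2 * α) * b / r)) (ofReal_rpow_ne_top hT _)
    (fun t ht σ h0 hσ => by gcongr; linarith [ht.2]) φ (by
      have h3 : mixed volume (Ico 0 T) q p (fun t x => ‖heatFlow n α φ t x‖ₑ) ≤
          C * ENNReal.ofReal ‖φ‖ := by
        rw [← lpn_rep hr0]
        exact (mixed_mono_set Ico_subset_Ici_self (by linarith [he.rq]) _).trans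
          (hlin φ (measurable_rep φ))
      calc _ ≤ ENNReal.ofReal T ^ (1 - n / (2 * α) * b / r) * (C * ENNReal.ofReal ‖φ‖) ^ b := by
            gcongr
        _ = C ^ b * ENNReal.ofReal (T ^ (1 - n / (2 * α) * b / r) * ‖φ‖ ^ b) := by
            rw [ENNReal.mul_rpow_of_nonneg _ _ hb.le, ENNReal.ofReal_mul (by positivity),
              ENNReal.ofReal_rpow_of_pos hT, ENNReal.ofReal_rpow_of_nonneg (norm_nonneg _) hb.le]
            ring
        _ ≤ C ^ b * ENNReal.ofReal κ := by gcongr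
        _ ≤ m₀ := hκm)
  exact ⟨u, hu1, hu2⟩

/-- Local existence in the critical case. -/
theorem exists_isMildSolution_critical (hα : 0 < α) (hn : 0 < (n : ℝ) / (2 * α))
    (hb : 0 < b) (hε : |ε| = 1) (h1 : 1 < n / (2 * α) * b) (hη : n / (2 * α) * b = r)
    [Fact (1 ≤ ENNReal.ofReal r)]
    (φ : Lp 𝕜 (ENNReal.ofReal r) (volume : Measure (EuclideanSpace ℝ (Fin n)))) :
    ∃ T > 0, ∃ u, IsMildSolution α b ε (Ico 0 T) φ u ∧
        ∀ (q' : ℝ≥0∞) (p' : ℝ), IsAdmissible n α q' p' r → MemX q' p' (Ico 0 T) u := by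
  obtain ⟨c, hS⟩ := exists_heatSemigroup (n := n) hα
  obtain ⟨p, q, he⟩ := exists_exponents hn hb h1 hη.le
  have hr0 : 0 < r := by linarith [he.one_lt]
  have hq0 : 0 < q := by linarith [he.rq]
  have hη0 : 1 - n / (2 * α) * b / r = 0 := by rw [hη, div_self hr0.ne', sub_self]
  obtain ⟨m₀, hm₀, H⟩ := exists_isMildSolution (𝕜 := 𝕜) hα hn hS hb hε he hη.le
  obtain ⟨C, hC, hlin⟩ := mixed_heatFlow_le (𝕜 := 𝕜) hn hS he.one_lt he.rp he.rq he.eq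
  have hfin : mixed volume (Ici 0) q p (fun t x => ‖heatFlow n α φ t x‖ₑ) ≠ ∞ := by
    refine ne_top_of_le_ne_top (ENNReal.mul_ne_top hC ?_) (hlin φ (measurable_rep φ))
    rw [lpn_rep hr0]
    exact ENNReal.ofReal_ne_top
  obtain ⟨δ, hδ, hδm⟩ := exists_pos_mul_rpow_le ENNReal.one_ne_top hm₀ hb
  -- The free evolution has finite norm on the whole half-line, hence small norm on a short
  -- interval. The length depends on φ itself and not only on its norm. The time factor is A = 1,
  -- since its exponent is 0.
  obtain ⟨T, hT, hmix⟩ := exists_mixed_lt hq0 hfin hδ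
  obtain ⟨u, hu1, hu2, -⟩ := H (Ico 0 T) measurableSet_Ico ordConnected_Ico ⟨le_rfl, hT⟩
    (fun t ht => ht.1) 1 ENNReal.one_ne_top
    (fun t ht σ h0 hσ => by rw [hη0, ENNReal.rpow_zero]) φ
    (hδm _ (hmix _ Ico_subset_Ici_self measurableSet_Ico (by rw [Real.volume_Ico, sub_zero])).le)
  exact ⟨T, hT, u, hu1, hu2⟩

/-- Global existence for small data in the critical case. -/
theorem exists_isMildSolution_global (hα : 0 < α) (hn : 0 < (n : ℝ) / (2 * α))
    (hb : 0 < b) (hε : |ε| = 1) (h1 : 1 < n / (2 * α) * b) (hη : n / (2 * α) * b = r)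
    [Fact (1 ≤ ENNReal.ofReal r)] :
    ∃ δ > 0, ∀ φ : Lp 𝕜 (ENNReal.ofReal r) (volume : Measure (EuclideanSpace ℝ (Fin n))),
      ‖φ‖ ≤ δ → ∃ u, IsMildSolution α b ε (Ici 0) φ u ∧
        (∀ (q' : ℝ≥0∞) (p' : ℝ), IsAdmissible n α q' p' r → MemX q' p' (Ici 0) u) ∧
        ∃ B : ℝ, ∀ t ≥ 0, ‖u t‖ ≤ B := by
  obtain ⟨c, hS⟩ := exists_heatSemigroup (n := n) hα
  obtain ⟨p, q, he⟩ := exists_exponents hn hb h1 hη.le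
  have hr0 : 0 < r := by linarith [he.one_lt]
  have hη0 : 1 - n / (2 * α) * b / r = 0 := by rw [hη, div_self hr0.ne', sub_self]
  obtain ⟨m₀, hm₀, H⟩ := exists_isMildSolution (𝕜 := 𝕜) hα hn hS hb hε he hη.le
  obtain ⟨C, hC, hlin⟩ := mixed_heatFlow_le (𝕜 := 𝕜) hn hS he.one_lt he.rp he.rq he.eq
  obtain ⟨δ', hδ', hδm⟩ := exists_pos_mul_rpow_le ENNReal.one_ne_top hm₀ hb
  obtain ⟨δ, hδ, hδle⟩ := exists_pos_mul_ofReal_le hC hδ'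
  refine ⟨δ, hδ, fun φ hφ => H (Ici 0) measurableSet_Ici ordConnected_Ici self_mem_Ici
    (fun t ht => ht) 1 ENNReal.one_ne_top
    (fun t ht σ h0 hσ => by rw [hη0, ENNReal.rpow_zero]) φ (hδm _ ?_)⟩
  refine (hlin φ (measurable_rep φ)).trans (le_trans ?_ hδle)
  rw [lpn_rep hr0]
  gcongr

end LocalGlobal

end FracHeat

namespace FracHeat

/-! ### A common space for two solutions. -/

section Regularity

open Filter Topology

variable {𝕜 : Type*} [RCLike 𝕜] {n : ℕ} {α b ε r p q : ℝ} {c : ℝ≥0∞} {I : Set ℝ}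
  {U V : ℝ → EuclideanSpace ℝ (Fin n) → 𝕜}

/-- Lower space exponents slightly above `b + 1` come with a time exponent above `b + 1`. -/
theorem exists_exponents_near {ν : ℝ} (hν : 0 < ν) (hb : 0 < b) (hr : 1 < r) (hη : ν * b ≤ r)
    (hrb : r ≤ b + 1) {p₁ : ℝ} (hp₁ : b + 1 < p₁) :
    ∃ P Q, b + 1 < P ∧ P ≤ p₁ ∧ b + 1 < Q ∧ 1 / Q = ν * (1 / r - 1 / P) := by
  have hr0 : 0 < r := by linarith
  have hb1 : 0 < b + 1 := by linarith
  have h1 : ν * (1 / r - 1 / (b + 1)) < 1 / (b + 1) := by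
    have h2 : ν * (1 / r - 1 / (b + 1)) = ν * (b + 1 - r) / (r * (b + 1)) := by field_simp
    rw [h2, div_lt_div_iff₀ (by positivity) hb1]
    have h3 : ν * (b + 1 - r) * b ≤ r * (b + 1 - r) := by
      have := mul_le_mul_of_nonneg_right hη (sub_nonneg.2 hrb)
      nlinarith
    have h4 : ν * (b + 1 - r) < r := by
      have h5 : r * (b + 1 - r) < r * b := by
        apply mul_lt_mul_of_pos_left _ hr0; linarith
      exact lt_of_mul_lt_mul_right (h3.trans_lt h5) hb.le
    nlinarith
  have hcont : ContinuousAt (fun P : ℝ => ν * (1 / r - 1 / P)) (b + 1) := by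
    refine continuousAt_const.mul (continuousAt_const.sub ?_)
    exact continuousAt_const.div continuousAt_id hb1.ne'
  have hev := (hcont.eventually_lt continuousAt_const h1).filter_mono
    (nhdsWithin_le_nhds (s := Ioi (b + 1)))
  obtain ⟨P, hP1, hP2, hP3⟩ := (hev.and (Ioc_mem_nhdsGT hp₁)).exists
  have hrP : r < P := by linarith
  have hy : 0 < ν * (1 / r - 1 / P) :=
    mul_pos hν (sub_pos.2 (one_div_lt_one_div_of_lt hr0 hrP))
  exact ⟨P, 1 / (ν * (1 / r - 1 / P)), hP2, hP3, (lt_one_div hb1 hy).2 hP1, one_div_one_div _⟩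

/-- Interpolation with L^∞_t L^r_x along the admissible line: one weight s = q'/q gives both 1/p =
s/p' + (1-s)/r and 1/q = s/q'. It brings two solutions with different exponents to the same pair. -/
theorem mixed_interpolate {ν : ℝ} (hν : 0 < ν) (hr : 1 < r) (hU : Measurable (Function.uncurry U))
    (hI : MeasurableSet I) {p' q' : ℝ} (hq : 0 < q) (hq' : 0 < q') (hrp : r < p) (hpp : p ≤ p')
    (h : 1 / q = ν * (1 / r - 1 / p)) (h' : 1 / q' = ν * (1 / r - 1 / p')) {B : ℝ≥0∞}
    (hB : B ≠ ∞) (hUB : ∀ t ∈ I, lpn volume r (fun x => ‖U t x‖ₑ) ≤ B)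
    (hfin : mixed volume I q' p' (fun t x => ‖U t x‖ₑ) < ∞) :
    mixed volume I q p (fun t x => ‖U t x‖ₑ) < ∞ := by
  have hr0 : 0 < r := by linarith
  have hp0 : 0 < p := by linarith
  rcases hpp.eq_or_lt with rfl | hpp
  · have : q = q' := by
      rw [← h'] at h
      simpa using h
    rwa [this]
  have hp'0 : 0 < p' := by linarith
  set s := q' / q with hs
  have i1 : 1 / p' < 1 / p := one_div_lt_one_div_of_lt hp0 hpp
  have i2 : 1 / p < 1 / r := one_div_lt_one_div_of_lt hr0 hrp
  have e1 : s * (1 / q') = 1 / q := by rw [hs]; field_simp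
  have hs0 : 0 < s := by positivity
  have e2 : s * (1 / r - 1 / p') = 1 / r - 1 / p := by
    rw [h, h'] at e1
    have : ν * (s * (1 / r - 1 / p')) = ν * (1 / r - 1 / p) := by linarith
    exact mul_left_cancel₀ hν.ne' this
  have hs1 : s < 1 := by
    by_contra hcon
    have : 1 / r - 1 / p' ≤ s * (1 / r - 1 / p') :=
      le_mul_of_one_le_left (by linarith) (not_lt.1 hcon)
    linarith
  have hint : 1 / p = s / p' + (1 - s) / r := by
    have : s / p' + (1 - s) / r = 1 / r - s * (1 / r - 1 / p') := by ring
    rw [this, e2]; ring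
  have hm : Measurable fun t => lpn volume p' fun x => ‖U t x‖ₑ := measurable_lpn (meas_enorm hU)
  have hBs : B ^ (1 - s) ≠ ∞ := ENNReal.rpow_ne_top_of_nonneg (by linarith) hB
  calc mixed volume I q p (fun t x => ‖U t x‖ₑ) ≤ lpn (volume.restrict I) q
        (fun t => B ^ (1 - s) * lpn volume p' (fun x => ‖U t x‖ₑ) ^ s) := by
        refine lpn_mono_ae hq ?_
        filter_upwards [ae_restrict_mem hI] with t ht
        have hUt : Measurable (fun x => ‖U t x‖ₑ) :=
          (hU.comp (measurable_prodMk_left (x := t))).enorm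
        refine (lpn_interpolate hp0 hp'0 hr0 hs0 hs1 hint hUt).trans ?_
        rw [mul_comm]
        exact mul_le_mul_left (ENNReal.rpow_le_rpow (hUB t ht) (by linarith)) _
    _ = B ^ (1 - s) * mixed volume I q' p' (fun t x => ‖U t x‖ₑ) ^ s := by
        have hqs : q * s = q' := by rw [hs]; field_simp
        rw [lpn_const_mul hq hBs, lpn_rpow hq hs0, hqs]
        rfl
    _ < ∞ := ENNReal.mul_lt_top hBs.lt_top (ENNReal.rpow_lt_top_of_nonneg hs0.le hfin.ne)

theorem mixed_const_lt_top (hI : MeasurableSet I)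
    (hIv : volume I < ∞) (hq : 0 < q) {B : ℝ≥0∞}
    (hB : B ≠ ∞) (hUB : ∀ t ∈ I, lpn volume r (fun x => ‖U t x‖ₑ) ≤ B) :
    mixed volume I q r (fun t x => ‖U t x‖ₑ) < ∞ := by
  have h1 : mixed volume I q r (fun t x => ‖U t x‖ₑ) ≤ lpn (volume.restrict I) q (fun _ => B) := by
    refine lpn_mono_ae hq ?_
    filter_upwards [ae_restrict_mem hI] with t ht using hUB t ht
  refine h1.trans_lt ?_
  rw [lpn, lintegral_const, Measure.restrict_apply_univ]
  exact ENNReal.rpow_lt_top_of_nonneg (by positivity)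
    (ENNReal.mul_ne_top (ENNReal.rpow_ne_top_of_nonneg hq.le hB) hIv.ne)

variable [Fact (1 ≤ ENNReal.ofReal r)] {T : ℝ}
  {φ : Lp 𝕜 (ENNReal.ofReal r) (volume : Measure (EuclideanSpace ℝ (Fin n)))}
  {u v : ℝ → Lp 𝕜 (ENNReal.ofReal r) (volume : Measure (EuclideanSpace ℝ (Fin n)))}

theorem exists_lpn_le_of_continuousOn (hr : 0 < r) (hu : ContinuousOn u (Ico 0 T))
    (hUu : ∀ t ∈ Ico 0 T, U t =ᵐ[volume] u t) {t₁ : ℝ} (ht₁ : t₁ ∈ Ico 0 T) :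
    ∃ B : ℝ≥0∞, B ≠ ∞ ∧ ∀ t ∈ Icc 0 t₁, lpn volume r (fun x => ‖U t x‖ₑ) ≤ B := by
  have hsub : Icc 0 t₁ ⊆ Ico 0 T := Icc_subset_Ico_right ht₁.2
  obtain ⟨B, hB⟩ := isCompact_Icc.exists_bound_of_continuousOn (hu.mono hsub)
  refine ⟨ENNReal.ofReal B, ENNReal.ofReal_ne_top, fun t ht => ?_⟩
  have : lpn volume r (fun x => ‖U t x‖ₑ) = lpn volume r (fun x => ‖u t x‖ₑ) := by
    refine lpn_congr_ae ?_
    filter_upwards [hUu t (hsub ht)] with x hx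
    rw [hx]
  rw [this, lpn_rep hr]
  exact ENNReal.ofReal_le_ofReal (hB t ht)

/-- Two curves with the regularity of mild solutions lie in a common space in which the nonlinear estimate holds. -/
theorem exists_common_exponents (hα : 0 < α) (hn : 0 < (n : ℝ) / (2 * α)) (hb : 0 < b)
    (h1 : 1 < n / (2 * α) * b) (hη : n / (2 * α) * b ≤ r)
    (hu : ∃ (q' : ℝ≥0∞) (p' : ℝ), IsAdmissible n α q' p' r ∧ b + 1 < p' ∧
      ∀ t ∈ Ico 0 T, MemLqLp q' p' (Ico 0 t) u)
    (hv : ∃ (q' : ℝ≥0∞) (p' : ℝ), IsAdmissible n α q' p' r ∧ b + 1 < p' ∧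
      ∀ t ∈ Ico 0 T, MemLqLp q' p' (Ico 0 t) v)
    (huc : ContinuousOn u (Ico 0 T)) (hvc : ContinuousOn v (Ico 0 T))
    (hU : Measurable (Function.uncurry U)) (hV : Measurable (Function.uncurry V))
    (hUu : ∀ t ∈ Ico 0 T, U t =ᵐ[volume] u t) (hVv : ∀ t ∈ Ico 0 T, V t =ᵐ[volume] v t) :
    ∃ P Q, b + 1 ≤ P ∧ b + 1 < Q ∧
      (∀ t ∈ Ico 0 T, mixed volume (Ico 0 t) Q P (fun t x => ‖U t x‖ₑ) < ∞ ∧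
        mixed volume (Ico 0 t) Q P (fun t x => ‖V t x‖ₑ) < ∞) ∧
      (n / (2 * α) * b < r ∨ r ≤ b + 1 → 0 ≤ 1 - n / (2 * α) * b / P - b / Q) := by
  have hr1 : 1 < r := by linarith
  have hr0 : 0 < r := by linarith
  have hsub : ∀ t ∈ Ico 0 T, Ico 0 t ⊆ Ico 0 T := fun t ht => Ico_subset_Ico_right ht.2.le
  rcases le_or_gt r (b + 1) with hrb | hrb
  · obtain ⟨q₁, p₁, had₁, hp₁, hreg₁⟩ := hu
    obtain ⟨q₂, p₂, had₂, hp₂, hreg₂⟩ := hv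
    -- For r ≤ b + 1 each solution is interpolated down from its own exponent to one P slightly
    -- above b + 1, where Q > b + 1 is also guaranteed.
    obtain ⟨P, Q, hP, hPp, hQ, hPQ⟩ := exists_exponents_near hn hb hr1 hη hrb (lt_min hp₁ hp₂)
    rw [le_min_iff] at hPp
    have key : ∀ {U : ℝ → EuclideanSpace ℝ (Fin n) → 𝕜}
        {u : ℝ → Lp 𝕜 (ENNReal.ofReal r) (volume : Measure (EuclideanSpace ℝ (Fin n)))}
        {q₁ : ℝ≥0∞} {p₁ : ℝ}, Measurable (Function.uncurry U) → ContinuousOn u (Ico 0 T) →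
        (∀ t ∈ Ico 0 T, U t =ᵐ[volume] u t) → IsAdmissible n α q₁ p₁ r → b + 1 < p₁ → P ≤ p₁ →
        (∀ T' ∈ Ico 0 T, MemLqLp q₁ p₁ (Ico 0 T') u) → ∀ t ∈ Ico 0 T,
        mixed volume (Ico 0 t) Q P (fun t x => ‖U t x‖ₑ) < ∞ := by
      intro U u q₁ p₁ hU huc hUu had hp₁ hPp₁ hreg t ht
      obtain ⟨B, hB, hUB⟩ := exists_lpn_le_of_continuousOn hr0 huc hUu ht
      rcases had.cases hn hα with ⟨rfl, -⟩ | ⟨hrp, q', rfl, hrq, heq⟩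
      · linarith
      · have hm := hreg t ht
        rw [memLqLp_iff (by linarith) (by linarith) hU (by
          filter_upwards [ae_restrict_mem measurableSet_Ico] with τ hτ
          exact hUu τ (hsub t ht hτ))] at hm
        exact mixed_interpolate hn hr1 hU measurableSet_Ico (by linarith) (by linarith)
          (by linarith) hPp₁ hPQ heq hB (fun τ hτ => hUB τ (Ico_subset_Icc_self hτ)) hm
    refine ⟨P, Q, hP.le, hQ, fun t ht => ⟨key hU huc hUu had₁ hp₁ hPp.1 hreg₁ t ht,
      key hV hvc hVv had₂ hp₂ hPp.2 hreg₂ t ht⟩, fun _ => ?_⟩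
    have : b / Q = b * (1 / Q) := by ring
    rw [this, hPQ]
    have h2 : 1 - n / (2 * α) * b / P - b * (n / (2 * α) * (1 / r - 1 / P)) =
        1 - n / (2 * α) * b / r := by ring
    rw [h2, sub_nonneg, div_le_one hr0]
    exact hη
  · have key : ∀ {U : ℝ → EuclideanSpace ℝ (Fin n) → 𝕜}
        {u : ℝ → Lp 𝕜 (ENNReal.ofReal r) (volume : Measure (EuclideanSpace ℝ (Fin n)))},
        ContinuousOn u (Ico 0 T) → (∀ t ∈ Ico 0 T, U t =ᵐ[volume] u t) → ∀ Q : ℝ, 0 < Q → ∀ t ∈ Ico 0 T,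
        mixed volume (Ico 0 t) Q r (fun t x => ‖U t x‖ₑ) < ∞ := by
      intro U u huc hUu Q hQ t ht
      obtain ⟨B, hB, hUB⟩ := exists_lpn_le_of_continuousOn hr0 huc hUu ht
      exact mixed_const_lt_top measurableSet_Ico (by simp) hQ hB
        fun τ hτ => hUB τ (Ico_subset_Icc_self hτ)
    -- For r > b + 1 the space L^r itself serves, with any finite Q on bounded intervals. If r > r₀,
    -- a large Q leaves a nonnegative power of time. If r = r₀, the power is negative for every Q;
    -- the implication is then void, and uniqueness needs the weak spaces.
    have hQ : ∃ Q, b + 1 < Q ∧ (n / (2 * α) * b < r ∨ r ≤ b + 1 →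
        0 ≤ 1 - n / (2 * α) * b / r - b / Q) := by
      rcases hη.eq_or_lt with h | h
      · exact ⟨b + 2, by linarith, fun hh => by rcases hh with hh | hh <;> linarith⟩
      · have hη0 : 0 < 1 - n / (2 * α) * b / r := by rw [sub_pos, div_lt_one hr0]; exact h
        refine ⟨max (b + 2) (b / (1 - n / (2 * α) * b / r)),
          lt_max_of_lt_left (by linarith), fun _ => ?_⟩
        rw [sub_nonneg, div_le_comm₀ (by positivity) hη0]
        exact le_max_right _ _
    obtain ⟨Q, hQ1, hQ2⟩ := hQ
    exact ⟨r, Q, hrb.le, hQ1, fun t ht => ⟨key huc hUu Q (by linarith) t ht,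
      key hvc hVv Q (by linarith) t ht⟩, hQ2⟩

/-- The integral equation for a jointly measurable representative. -/
theorem IsMildSolution.ae_eq (hS : HeatSemigroup volume (n / (2 * α)) c (kernel n α)) (hb : 0 < b)
    (hε : |ε| = 1) (hu : IsMildSolution α b ε I φ u) (hU : Measurable (Function.uncurry U)) {t : ℝ}
    (ht : t ∈ I) (ht0 : 0 ≤ t) (hUu : ∀ τ ∈ Icc 0 t, U τ =ᵐ[volume] u τ) {a : ℝ} (ha : 1 ≤ a)
    (hD : lpn volume a (absDuh n α b 0 U t) < ∞) :
    ∀ᵐ x, U t x = heatFlow n α φ t x + nlDuh n α b ε 0 U t x := by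
  rcases ht0.eq_or_lt with rfl | ht0
  · filter_upwards [hUu 0 ⟨le_rfl, le_rfl⟩] with x hx
    rw [hx, hu.initial, heatFlow_zero, nlDuh_self, add_zero]
  · filter_upwards [hu.duhamel t ht ht0, ae_absDuh_lt_top hS hU ha hD, hUu t ⟨ht0.le, le_rfl⟩]
      with x hx hx' hUx
    rw [absDuh_eq hb hε] at hx'
    obtain ⟨-, -, h3⟩ := duh_eq_integral_sconv hS (measurable_nonlin_comp (ε := ε) hb hU) hx'
    have h4 : nlDuh n α b ε 0 U t x =
        ∫ τ in Ioo 0 t, semigroup n α (t - τ) (fun y => nonlin b ε (u τ y)) x := by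
      refine h3.trans (setIntegral_congr_fun measurableSet_Ioo fun τ hτ => ?_)
      rw [semigroup_eq_sconv]
      refine congrFun (sconv_congr ?_) x
      filter_upwards [hUu τ ⟨hτ.1.le, hτ.2.le⟩] with y hy
      rw [hy]
    rw [hUx, hx, semigroup_eq_sconv, heatFlow_of_pos ht0, h4]

/-- A mild solution, as a function on space-time. -/
theorem IsMildSolution.fmild (hS : HeatSemigroup volume (n / (2 * α)) c (kernel n α)) (hb : 0 < b)
    (hε : |ε| = 1) (hu : IsMildSolution α b ε (Ico 0 T) φ u) (hU : Measurable (Function.uncurry U))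
    (hUu : ∀ t ∈ Ico 0 T, U t =ᵐ[volume] u t) (hp : b + 1 ≤ p) (hq : b + 1 < q)
    (hfin : ∀ t ∈ Ico 0 T, mixed volume (Ico 0 t) q p (fun t x => ‖U t x‖ₑ) < ∞) :
    FMild n α b ε (Ico 0 T) φ U := by
  have ha : 1 ≤ p / (b + 1) := by rwa [le_div_iff₀ (by linarith), one_mul]
  have hD : ∀ t ∈ Ico 0 T, lpn volume (p / (b + 1)) (absDuh n α b 0 U t) < ∞ := fun t ht =>
    lpn_absDuh_lt_top hS hb hp hq.le hU
      ((mixed_mono_set Ioo_subset_Ico_self (by linarith) _).trans_lt (hfin t ht))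
  exact ⟨hU, ⟨_, ha, hD⟩, fun t ht => hu.ae_eq hS hb hε hU ht ht.1
    (fun τ hτ => hUu τ ⟨hτ.1, hτ.2.trans_lt ht.2⟩) ha (hD t ht)⟩

end Regularity

end FracHeat

namespace FracHeat

/-! ### Local uniqueness by contraction in mixed norms. -/

section LocalUniqueness

open Filter Topology

variable {𝕜 : Type*} [RCLike 𝕜] {n : ℕ} {α b ε r p q : ℝ} {c : ℝ≥0∞} {I : Set ℝ}
  {φ : EuclideanSpace ℝ (Fin n) → 𝕜} {U V : ℝ → EuclideanSpace ℝ (Fin n) → 𝕜}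

/-- Restarting both equations at the time of agreement s cancels the free evolutions. -/
theorem FMild.sub_le (hS : HeatSemigroup volume (n / (2 * α)) c (kernel n α))
    (hb : 0 < b) (hε : |ε| = 1) (hr : 1 ≤ r) (hφm : Measurable φ)
    (hφ : lpn volume r (fun x => ‖φ x‖ₑ) < ∞) (hU : FMild n α b ε I φ U)
    (hV : FMild n α b ε I φ V) {s t : ℝ} (hs : s ∈ I) (ht : t ∈ I) (hs0 : 0 ≤ s) (hst : s < t)
    (hUV : U s =ᵐ[volume] V s) :
    ∀ᵐ x, ‖U t x - V t x‖ₑ ≤ ENNReal.ofReal (b + 2) *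
      (pduh volume (absK (kernel n α)) s (fun τ y => ‖U τ y‖ₑ ^ b * ‖U τ y - V τ y‖ₑ) t x +
       pduh volume (absK (kernel n α)) s (fun τ y => ‖V τ y‖ₑ ^ b * ‖U τ y - V τ y‖ₑ) t x) := by
  filter_upwards [hU.restart hS hb hε hr hφm hφ hs ht hs0 hst.le,
    hV.restart hS hb hε hr hφm hφ hs ht hs0 hst.le] with x hx hx'
  have h1 : heatFlow n α (U s) (t - s) = heatFlow n α (V s) (t - s) := by
    rw [heatFlow_of_pos (sub_pos.2 hst), heatFlow_of_pos (sub_pos.2 hst), sconv_congr hUV]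
  have h2 : U t x - V t x = nlDuh n α b ε s U t x - nlDuh n α b ε s V t x := by
    rw [hx, hx', h1]
    ring
  rw [h2]
  exact picard_sub_le hb hε hS.bound hS.meas hU.meas hV.meas s t x

theorem eq_zero_of_le_half {w : ℝ≥0∞} (hw : w ≠ ∞) (h : w ≤ w / 2) : w = 0 := by
  by_contra h0
  exact absurd h (not_le.2 (ENNReal.half_lt_self h0 hw))

/-- Local uniqueness in a space in which the nonlinear estimate holds. -/
theorem FMild.exists_ae_eq (hS : HeatSemigroup volume (n / (2 * α)) c (kernel n α))
    (hb : 0 < b) (hε : |ε| = 1) (hr : 1 ≤ r) (hφm : Measurable φ)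
    (hφ : lpn volume r (fun x => ‖φ x‖ₑ) < ∞) {T : ℝ} (hU : FMild n α b ε (Ico 0 T) φ U)
    (hV : FMild n α b ε (Ico 0 T) φ V) (hp : b + 1 ≤ p) (hq : b + 1 < q)
    (hη : 0 ≤ 1 - n / (2 * α) * b / p - b / q)
    (hfin : ∀ t ∈ Ico 0 T, mixed volume (Ico 0 t) q p (fun t x => ‖U t x‖ₑ) < ∞ ∧
        mixed volume (Ico 0 t) q p (fun t x => ‖V t x‖ₑ) < ∞)
    {t₀ : ℝ} (ht₀ : t₀ ∈ Ico 0 T) (hUV : U t₀ =ᵐ[volume] V t₀) :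
    ∃ t₁ ∈ Ioo t₀ T, ∀ᵐ t ∂(volume.restrict (Ioo t₀ t₁)), U t =ᵐ[volume] V t := by
  have hp1 : 1 ≤ p := by linarith
  have hq1 : 1 ≤ q := by linarith
  have hp0 : 0 < p := by linarith
  have hq0 : 0 < q := by linarith
  have hT : 0 < T := ht₀.1.trans_lt ht₀.2
  obtain ⟨C, hC, hY⟩ := mixed_pduh_rpow_mul_le hS.bound hb hp hq
  set A : ℝ≥0∞ := ENNReal.ofReal T ^ (1 - n / (2 * α) * b / p - b / q) with hA
  have hAt : A ≠ ∞ := ofReal_rpow_ne_top hT _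
  set D := ENNReal.ofReal (b + 2) * (C * A) with hD
  have hDt : D ≠ ∞ := ENNReal.mul_ne_top ENNReal.ofReal_ne_top (ENNReal.mul_ne_top hC hAt)
  obtain ⟨δ, hδ, hsm⟩ := exists_pos_mul_rpow_le hDt (ε := 1 / 4) (by simp) hb
  -- Finiteness of the norms is known only up to times smaller than T, so the work is done before
  -- the midpoint.
  set t₂ := (t₀ + T) / 2 with ht₂
  have ht₂I : t₂ ∈ Ico 0 T := ⟨by linarith [ht₀.1, ht₀.2], by linarith [ht₀.2]⟩
  have hsub : Ioo t₀ t₂ ⊆ Ico 0 t₂ := fun t ht => ⟨ht₀.1.trans ht.1.le, ht.2⟩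
  have hfU := (mixed_mono_set hsub hq0 _).trans_lt (hfin t₂ ht₂I).1
  have hfV := (mixed_mono_set hsub hq0 _).trans_lt (hfin t₂ ht₂I).2
  obtain ⟨δ₁, hδ₁, hsU⟩ := exists_mixed_lt hq0 hfU.ne hδ
  obtain ⟨δ₂, hδ₂, hsV⟩ := exists_mixed_lt hq0 hfV.ne hδ
  set t₁ := min t₂ (t₀ + min δ₁ δ₂) with ht₁
  have ht₀₁ : t₀ < t₁ := lt_min (by linarith [ht₀.2]) (by linarith [lt_min hδ₁ hδ₂])
  have ht₁₂ : t₁ ≤ t₂ := min_le_left _ _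
  set J := Ioo t₀ t₁ with hJ
  have hJs : J ⊆ Ioo t₀ t₂ := Ioo_subset_Ioo_right ht₁₂
  have hJI : J ⊆ Ico 0 T := fun t ht => ⟨ht₀.1.trans ht.1.le, (ht.2.trans_le ht₁₂).trans ht₂I.2⟩
  have hvol : volume J = ENNReal.ofReal (t₁ - t₀) := Real.volume_Ioo
  have hlen : t₁ - t₀ ≤ min δ₁ δ₂ := by linarith [min_le_right t₂ (t₀ + min δ₁ δ₂)]
  have hx := hsU J hJs measurableSet_Ioo
    (by rw [hvol]; exact ENNReal.ofReal_le_ofReal (hlen.trans (min_le_left _ _)))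
  have hy := hsV J hJs measurableSet_Ioo
    (by rw [hvol]; exact ENNReal.ofReal_le_ofReal (hlen.trans (min_le_right _ _)))
  have hUm := meas_enorm hU.meas
  have hVm := meas_enorm hV.meas
  have hWm := meas_enorm_sub hU.meas hV.meas
  -- On J both solutions have norm below δ, which gives w ≤ w/2. Since w is finite, it is 0.
  set w := mixed volume J q p (fun t x => ‖U t x - V t x‖ₑ) with hw
  have hwt : w ≠ ∞ := by
    refine ne_top_of_le_ne_top ?_ (le_trans (mixed_mono measurableSet_Ioo hq0 hp0
      fun t _ x => enorm_sub_le) (mixed_add_le hq1 hp1 hUm hVm))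
    exact ENNReal.add_ne_top.2
      ⟨((mixed_mono_set hJs hq0 _).trans_lt hfU).ne, ((mixed_mono_set hJs hq0 _).trans_lt hfV).ne⟩
  have hmul : ∀ {F : ℝ → EuclideanSpace ℝ (Fin n) → ℝ≥0∞}, Measurable (Function.uncurry F) →
      mixed volume J q p F < δ → ENNReal.ofReal (b + 2) *
        mixed volume J q p (pduh volume (absK (kernel n α)) t₀
          (fun τ y => F τ y ^ b * ‖U τ y - V τ y‖ₑ)) ≤ w / 4 := by
    intro F hF hlt
    have h1 := hY t₀ J measurableSet_Ioo (fun t ht => Ioo_subset_Ioo_right ht.2.le) A hAt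
      (fun t ht σ h0 hσ => by
        refine ENNReal.rpow_le_rpow (ENNReal.ofReal_le_ofReal ?_) hη
        linarith [(hJI ht).2, ht₀.1]) F _ hF hWm
    calc _ ≤ ENNReal.ofReal (b + 2) * (C * A * (mixed volume J q p F ^ b * w)) := by gcongr
      _ = D * mixed volume J q p F ^ b * w := by rw [hD]; ring
      _ ≤ 1 / 4 * w := by gcongr; exact hsm _ hlt.le
      _ = w / 4 := by rw [one_div, ENNReal.div_eq_inv_mul]
  have hm1 : Measurable (Function.uncurry (pduh volume (absK (kernel n α)) t₀
      (fun τ y => ‖U τ y‖ₑ ^ b * ‖U τ y - V τ y‖ₑ))) :=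
    measurable_pduh_uncurry hS.bound t₀ (meas_rpow_mul b hUm hWm)
  have hm2 : Measurable (Function.uncurry (pduh volume (absK (kernel n α)) t₀
      (fun τ y => ‖V τ y‖ₑ ^ b * ‖U τ y - V τ y‖ₑ))) :=
    measurable_pduh_uncurry hS.bound t₀ (meas_rpow_mul b hVm hWm)
  have hle : w ≤ w / 2 := by
    calc w ≤ mixed volume J q p (fun t x => ENNReal.ofReal (b + 2) *
          (pduh volume (absK (kernel n α)) t₀ (fun τ y => ‖U τ y‖ₑ ^ b * ‖U τ y - V τ y‖ₑ) t x +
           pduh volume (absK (kernel n α)) t₀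
            (fun τ y => ‖V τ y‖ₑ ^ b * ‖U τ y - V τ y‖ₑ) t x)) := by
          refine lpn_mono_ae hq0 ?_
          filter_upwards [ae_restrict_mem measurableSet_Ioo] with t ht
          exact lpn_mono_ae hp0
            (hU.sub_le hS hb hε hr hφm hφ hV ht₀ (hJI ht) ht₀.1 ht.1 hUV)
      _ ≤ ENNReal.ofReal (b + 2) * (_ + _) := by
          rw [mixed_const_mul hq0 hp0 ENNReal.ofReal_ne_top]
          gcongr
          exact mixed_add_le hq1 hp1 hm1 hm2
      _ ≤ w / 4 + w / 4 := by
          rw [mul_add]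
          exact add_le_add (hmul hUm hx) (hmul hVm hy)
      _ = w / 2 := by
          rw [← two_mul, ENNReal.div_eq_inv_mul, ENNReal.div_eq_inv_mul, ← mul_assoc]
          congr 1
          rw [show (4 : ℝ≥0∞) = 2 * 2 by norm_num, ENNReal.mul_inv (by simp) (by simp), ← mul_assoc,
            ENNReal.mul_inv_cancel (by simp) (by simp), one_mul]
  have hw0 : w = 0 := eq_zero_of_le_half hwt hle
  refine ⟨t₁, ⟨ht₀₁, ht₁₂.trans_lt ht₂I.2⟩, ?_⟩
  filter_upwards [lpn_eq_zero hq0 (measurable_lpn hWm) hw0] with t ht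
  have hWt : Measurable fun x => ‖U t x - V t x‖ₑ := hWm.comp (measurable_prodMk_left (x := t))
  filter_upwards [lpn_eq_zero hp0 hWt ht] with x hx
  rwa [enorm_eq_zero, sub_eq_zero] at hx

end LocalUniqueness

end FracHeat

namespace FracHeat

/-! ### Weak Lebesgue spaces. -/

section WeakBound

variable {G : Type*} [MeasurableSpace G] {μ : Measure G} {θ : ℝ} {N : ℝ≥0∞} {w h : G → ℝ≥0∞}

/-- The weak Lebesgue bound `∫_E w ≤ N |E|^θ`, of the space `L^{1/(1-θ),∞}`. -/
def WeakBound (μ : Measure G) (θ : ℝ) (N : ℝ≥0∞) (w : G → ℝ≥0∞) : Prop :=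
  ∀ E, MeasurableSet E → μ E ≠ ∞ → ∫⁻ x in E, w x ∂μ ≤ N * μ E ^ θ

/-- The layer-cake formula for h with respect to the measure of density w. -/
theorem lintegral_mul_layer [SFinite μ] (hh : Measurable h) (hw : Measurable w) :
    ∫⁻ x, h x * w x ∂μ =
      ∫⁻ l in Ioi (0 : ℝ), ∫⁻ x in {x | ENNReal.ofReal l < h x}, w x ∂μ := by
  have h1 := lintegral_rpow_layer (μ := μ.withDensity w) hh one_pos
  simp only [ENNReal.rpow_one, ENNReal.ofReal_one, one_mul, sub_self, ENNReal.rpow_zero] at h1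
  rw [lintegral_withDensity_eq_lintegral_mul _ hw hh] at h1
  simp_rw [mul_comm (h _)]
  refine h1.trans (lintegral_congr fun l => ?_)
  exact withDensity_apply _ (measurableSet_lt measurable_const hh)

/-- The integral of the minimum of a constant and a power. -/
theorem lintegral_Ioi_min_le {σ : ℝ} (hσ : 1 < σ) {A B : ℝ≥0∞} (hA : A ≠ ∞) (hB : B ≠ ∞)
    {f : ℝ → ℝ≥0∞} (hfA : ∀ l, 0 < l → f l ≤ A)
    (hfB : ∀ l, 0 < l → f l ≤ B * ENNReal.ofReal l ^ (-σ)) :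
    ∫⁻ l in Ioi (0 : ℝ), f l ≤
      ENNReal.ofReal (1 + 1 / (σ - 1)) * (A ^ (1 - 1 / σ) * B ^ (1 / σ)) := by
  have hσ0 : 0 < σ := by linarith
  have hzero : (∀ l, 0 < l → f l ≤ 0) → ∫⁻ l in Ioi (0 : ℝ), f l ≤
      ENNReal.ofReal (1 + 1 / (σ - 1)) * (A ^ (1 - 1 / σ) * B ^ (1 / σ)) := by
    intro h
    refine (setLIntegral_mono' (g := fun _ => 0) measurableSet_Ioi fun l hl => h l hl).trans ?_
    simp
  rcases eq_or_ne A 0 with rfl | hA0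
  · exact hzero hfA
  rcases eq_or_ne B 0 with rfl | hB0
  · exact hzero fun l hl => (hfB l hl).trans (by simp)
  -- The point where the two bounds cross; each side of it contributes a multiple of A L.
  set L := (B / A) ^ (1 / σ) with hL
  have hBA0 : B / A ≠ 0 := (ENNReal.div_pos hB0 hA).ne'
  have hBAt : B / A ≠ ∞ := ENNReal.div_ne_top hB hA0
  have hL0 : L ≠ 0 := by simp [hL, ENNReal.rpow_eq_zero_iff, hBA0, hBAt]
  have hLt : L ≠ ∞ := ENNReal.rpow_ne_top_of_nonneg (by positivity) hBAt
  have hBL : B = A * L ^ σ := by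
    rw [hL, ← ENNReal.rpow_mul, one_div_mul_cancel hσ0.ne', ENNReal.rpow_one,
      ENNReal.mul_div_cancel hA0 hA]
  have hY : 0 < L.toReal := ENNReal.toReal_pos hL0 hLt
  have hYL : ENNReal.ofReal L.toReal = L := ENNReal.ofReal_toReal hLt
  have hR : A ^ (1 - 1 / σ) * B ^ (1 / σ) = A * L := by
    rw [hBL, ENNReal.mul_rpow_of_nonneg _ _ (by positivity), ← ENNReal.rpow_mul, ← mul_assoc,
      ← ENNReal.rpow_add _ _ hA0 hA, sub_add_cancel, mul_one_div_cancel hσ0.ne',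
      ENNReal.rpow_one, ENNReal.rpow_one]
  have hBL' : B * L ^ (-(σ - 1)) = A * L := by
    rw [hBL, mul_assoc, ← ENNReal.rpow_add _ _ hL0 hLt, show σ + -(σ - 1) = 1 by ring,
      ENNReal.rpow_one]
  rw [hR, ← Ioc_union_Ioi_eq_Ioi hY.le]
  refine (lintegral_union_le _ _ _).trans ?_
  have h1 : ∫⁻ l in Ioc 0 L.toReal, f l ≤ A * L := by
    refine (setLIntegral_mono' measurableSet_Ioc fun l hl => hfA l hl.1).trans ?_
    rw [setLIntegral_const, Real.volume_Ioc, sub_zero, hYL]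
  have h2 : ∫⁻ l in Ioi L.toReal, f l ≤ ENNReal.ofReal (1 / (σ - 1)) * (A * L) := by
    refine (setLIntegral_mono' measurableSet_Ioi fun l hl => hfB l (hY.trans hl)).trans ?_
    rw [lintegral_const_mul' _ _ hB]
    have := lintegral_Ioi_rpow (q := σ - 1) (by linarith) hY
    rw [show -(σ - 1) - 1 = -σ by ring] at this
    rw [this, hYL, ← hBL']
    exact (by ring : _ = _).le
  refine (add_le_add h1 h2).trans ?_
  rw [ENNReal.ofReal_add one_pos.le (by have := sub_pos.2 hσ; positivity), ENNReal.ofReal_one,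
    add_mul, one_mul]

/-- The set {h > l} has measure at most m/l and is empty for l ≥ H. By layers the integral is at
most that of N (m/l)^θ over (0, H), which converges because θ < 1. -/
theorem WeakBound.lintegral_mul_le [SFinite μ] (hw : WeakBound μ θ N w) (hN : N ≠ ∞) (hθ : 0 < θ)
    (hθ1 : θ < 1) (hwm : Measurable w) (hh : Measurable h) {H m : ℝ≥0∞} (hH : H ≠ ∞) (hm : m ≠ ∞)
    (hhH : ∀ x, h x ≤ H) (hhm : ∫⁻ x, h x ∂μ ≤ m) :
    ∫⁻ x, h x * w x ∂μ ≤ ENNReal.ofReal (1 / (1 - θ)) * (N * m ^ θ * H ^ (1 - θ)) := by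
  rcases eq_or_ne H 0 with rfl | hH0
  · have : ∀ x, h x = 0 := fun x => le_antisymm (hhH x) bot_le
    simp [this]
  have hY : 0 < H.toReal := ENNReal.toReal_pos hH0 hH
  rw [lintegral_mul_layer hh hwm]
  have hpt : ∀ l ∈ Ioi (0 : ℝ), ∫⁻ x in {x | ENNReal.ofReal l < h x}, w x ∂μ ≤
      (Ioo 0 H.toReal).indicator (fun l => N * m ^ θ * ENNReal.ofReal l ^ ((1 - θ) - 1)) l := by
    intro l hl
    have hl0 : (0 : ℝ) < l := hl
    by_cases hlH : l < H.toReal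
    · rw [indicator_of_mem (show l ∈ Ioo 0 H.toReal from ⟨hl0, hlH⟩)]
      set E := {x | ENNReal.ofReal l < h x} with hE
      have hl' : ENNReal.ofReal l ≠ 0 := (ENNReal.ofReal_pos.2 hl0).ne'
      have hmE : μ E ≤ m * ENNReal.ofReal l ^ (-1 : ℝ) := by
        rw [ENNReal.rpow_neg_one, ← div_eq_mul_inv,
          ENNReal.le_div_iff_mul_le (Or.inl hl') (Or.inl ENNReal.ofReal_ne_top), mul_comm]
        refine le_trans ?_ ((mul_meas_ge_le_lintegral hh (ENNReal.ofReal l)).trans hhm)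
        gcongr
        intro x hx
        exact (show ENNReal.ofReal l < h x from hx).le
      have hEt : μ E ≠ ∞ := ne_top_of_le_ne_top
        (ENNReal.mul_ne_top hm (by simp [ENNReal.rpow_neg_one, hl0])) hmE
      refine (hw E (measurableSet_lt measurable_const hh) hEt).trans ?_
      rw [mul_assoc]
      refine mul_le_mul_right ((ENNReal.rpow_le_rpow hmE hθ.le).trans_eq ?_) N
      rw [ENNReal.mul_rpow_of_nonneg _ _ hθ.le, ← ENNReal.rpow_mul]
      congr 2
      ring
    · rw [indicator_of_notMem (fun h => hlH h.2)]
      have : {x | ENNReal.ofReal l < h x} = ∅ := by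
        refine eq_empty_of_forall_notMem fun x hx => ?_
        refine absurd (lt_of_lt_of_le hx (hhH x)) (not_lt.2 ?_)
        rw [← ENNReal.ofReal_toReal hH]
        exact ENNReal.ofReal_le_ofReal (not_lt.1 hlH)
      rw [this]
      simp
  refine (setLIntegral_mono' measurableSet_Ioi hpt).trans ?_
  refine (setLIntegral_le_lintegral _ _).trans ?_
  rw [lintegral_indicator measurableSet_Ioo, lintegral_const_mul' _ _
    (ENNReal.mul_ne_top hN (ENNReal.rpow_ne_top_of_nonneg hθ.le hm)),
    lintegral_Ioo_rpow (by linarith) hY, ENNReal.ofReal_toReal hH]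
  exact (by ring : _ = _).le

/-- Hölder's inequality for weak Lebesgue bounds. -/
theorem WeakBound.mul [SFinite μ] (hw : WeakBound μ θ N w) (hN : N ≠ ∞) (hwm : Measurable w)
    (hθ : 0 < θ) {ν : ℝ} (hν : 0 < ν) (hνθ : 1 < ν * θ) {a : G → ℝ≥0∞} (ha : Measurable a)
    {δ : ℝ≥0∞} (hδ : δ ≠ ∞) (haδ : lpn μ ν a ≤ δ) :
    WeakBound μ (θ - 1 / ν) (ENNReal.ofReal (1 + 1 / (ν * θ - 1)) * N * δ)
      (fun x => a x * w x) := by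
  intro E hE hEt
  rw [lintegral_mul_layer (μ := μ.restrict E) ha hwm]
  have hlev : ∀ l : ℝ, MeasurableSet {x | ENNReal.ofReal l < a x} := fun l =>
    measurableSet_lt measurable_const ha
  have hI : ∫⁻ x, a x ^ ν ∂μ ≤ δ ^ ν := by
    rw [← lpn_rpow_self hν]
    exact ENNReal.rpow_le_rpow haδ hν.le
  -- The part of {a > l} in E has measure at most |E| and at most (δ/l)^ν. The first bound serves
  -- small l and the second large l, where νθ > 1 makes the integral converge.
  have hmain : ∀ l : ℝ, 0 < l → ∫⁻ x in {x | ENNReal.ofReal l < a x}, w x ∂(μ.restrict E) ≤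
      N * μ ({x | ENNReal.ofReal l < a x} ∩ E) ^ θ := by
    intro l _
    rw [Measure.restrict_restrict (hlev l)]
    exact hw _ ((hlev l).inter hE) (ne_top_of_le_ne_top hEt (measure_mono inter_subset_right))
  have h1 : ∀ l : ℝ, 0 < l → ∫⁻ x in {x | ENNReal.ofReal l < a x}, w x ∂(μ.restrict E) ≤
      N * μ E ^ θ := fun l hl => (hmain l hl).trans (by
        gcongr
        exact inter_subset_right)
  have h2 : ∀ l : ℝ, 0 < l → ∫⁻ x in {x | ENNReal.ofReal l < a x}, w x ∂(μ.restrict E) ≤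
      N * δ ^ (ν * θ) * ENNReal.ofReal l ^ (-(ν * θ)) := by
    intro l hl
    have hl' : ENNReal.ofReal l ^ ν ≠ 0 := by
      simp [ENNReal.rpow_eq_zero_iff, hl, not_lt.2 hν.le]
    have hmE : μ {x | ENNReal.ofReal l < a x} ≤ δ ^ ν * ENNReal.ofReal l ^ (-ν) := by
      rw [ENNReal.rpow_neg, ← div_eq_mul_inv, ENNReal.le_div_iff_mul_le (Or.inl hl')
        (Or.inl (ENNReal.rpow_ne_top_of_nonneg hν.le ENNReal.ofReal_ne_top)), mul_comm]
      refine le_trans ?_ ((mul_meas_ge_le_lintegral (ha.pow_const ν)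
        (ENNReal.ofReal l ^ ν)).trans hI)
      exact mul_le_mul_right (measure_mono fun x (hx : ENNReal.ofReal l < a x) =>
        show ENNReal.ofReal l ^ ν ≤ a x ^ ν from ENNReal.rpow_le_rpow hx.le hν.le) _
    refine (hmain l hl).trans ?_
    rw [mul_assoc]
    refine mul_le_mul_right ((ENNReal.rpow_le_rpow
      ((measure_mono inter_subset_left).trans hmE) hθ.le).trans_eq ?_) N
    rw [ENNReal.mul_rpow_of_nonneg _ _ hθ.le, ← ENNReal.rpow_mul, ← ENNReal.rpow_mul]
    congr 2
    ring
  refine (lintegral_Ioi_min_le hνθ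
    (ENNReal.mul_ne_top hN (ENNReal.rpow_ne_top_of_nonneg hθ.le hEt))
    (ENNReal.mul_ne_top hN (ENNReal.rpow_ne_top_of_nonneg (by positivity) hδ)) h1 h2).trans_eq ?_
  have e0 : 0 ≤ 1 - 1 / (ν * θ) := by
    rw [sub_nonneg, div_le_one (by positivity)]; exact hνθ.le
  have e1 : 0 ≤ 1 / (ν * θ) := by positivity
  rw [ENNReal.mul_rpow_of_nonneg _ _ e0, ENNReal.mul_rpow_of_nonneg _ _ e1, ← ENNReal.rpow_mul,
    ← ENNReal.rpow_mul, mul_one_div_cancel (by positivity), ENNReal.rpow_one,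
    show θ * (1 - 1 / (ν * θ)) = θ - 1 / ν by field_simp]
  have e2 : N ^ (1 - 1 / (ν * θ)) * N ^ (1 / (ν * θ)) = N := by
    rw [← ENNReal.rpow_add_of_nonneg _ _ e0 e1, sub_add_cancel, ENNReal.rpow_one]
  calc _ = ENNReal.ofReal (1 + 1 / (ν * θ - 1)) *
        (N ^ (1 - 1 / (ν * θ)) * N ^ (1 / (ν * θ))) * δ * μ E ^ (θ - 1 / ν) := by ring
    _ = _ := by rw [e2]

/-- Hölder's inequality against the indicator of E. -/
theorem weakBound_of_lpn_le {r : ℝ} (hr : 1 < r) (hw : Measurable w) (h : lpn μ r w ≤ N) :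
    WeakBound μ (1 - 1 / r) N w := by
  intro E hE _
  have hr0 : 0 < r := by linarith
  have h1 := lintegral_mul_le_lpn (μ := μ) (Real.HolderConjugate.conjExponent hr) hw
    (measurable_one.indicator hE)
  have e1 : ∫⁻ x, w x * E.indicator 1 x ∂μ = ∫⁻ x in E, w x ∂μ := by
    rw [← lintegral_indicator hE]
    refine lintegral_congr fun x => ?_
    by_cases hx : x ∈ E <;> simp [hx]
  have e2 : lpn μ r.conjExponent (E.indicator 1) = μ E ^ (1 - 1 / r) := by
    have hc := (Real.HolderConjugate.conjExponent hr)
    have h2 : ∀ x, (E.indicator (1 : G → ℝ≥0∞) x) ^ r.conjExponent = E.indicator 1 x := by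
      intro x
      by_cases hx : x ∈ E
      · simp [hx]
      · simp [hx, hc.symm.pos]
    unfold lpn
    simp_rw [h2]
    rw [lintegral_indicator_one hE]
    congr 1
    rw [Real.conjExponent]
    field_simp
  rw [e1, e2] at h1
  exact h1.trans (by gcongr)

end WeakBound

/-! ### The Duhamel integral in weak Lebesgue spaces. -/

section WeakDuhamel

variable {G : Type*} [AddCommGroup G] [MeasurableSpace G] [MeasurableAdd₂ G] [MeasurableNeg G]
  {μ : Measure G} {ν θ : ℝ} {c N : ℝ≥0∞} {k : ℝ → G → ℝ≥0∞}
  [SigmaFinite μ] [μ.IsAddLeftInvariant] [μ.IsNegInvariant] {s t : ℝ} {w a : ℝ → G → ℝ≥0∞}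

/-- By symmetry the kernel acts on the indicator of E instead of on g. The convolved indicator has
explicit bounds: at most c, at most c|E| times a power of time, and mass at most c|E|. -/
theorem setLIntegral_pduh (hk : HeatBound μ ν c k) {g : ℝ → G → ℝ≥0∞}
    (hg : Measurable (Function.uncurry g)) {E : Set G} (hE : MeasurableSet E) :
    ∫⁻ x in E, pduh μ k s g t x ∂μ =
      ∫⁻ τ in Ioo s t, (∫⁻ x, pconv μ k (t - τ) (E.indicator 1) x * g τ x ∂μ) := by
  unfold pduh
  have hm := measurable_pconv_sub hk hg t
  rw [lintegral_lintegral_swap (f := fun x τ => pconv μ k (t - τ) (g τ) x)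
    (hm.comp measurable_swap).aemeasurable]
  refine lintegral_congr fun τ => ?_
  have hgτ : Measurable (g τ) := hg.comp (measurable_prodMk_left (x := τ))
  simp_rw [mul_comm _ (g τ _)]
  rw [← lintegral_pconv_mul hk hgτ (measurable_one.indicator hE), ← lintegral_indicator hE]
  refine lintegral_congr fun x => ?_
  by_cases hx : x ∈ E <;> simp [hx]

theorem pconv_indicator_le (hk : HeatBound μ ν c k) (ht : 0 < t) {E : Set G}
    (hE : MeasurableSet E) (x : G) : pconv μ k t (E.indicator 1) x ≤ c ∧
      pconv μ k t (E.indicator 1) x ≤ c * μ E * ENNReal.ofReal t ^ (-ν) := by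
  constructor
  · refine le_trans (lintegral_mono fun y => ?_) (hk.lintegral_sub_left ht x)
    refine mul_le_of_le_one_right bot_le ?_
    exact indicator_le_self' (fun _ _ => bot_le) y
  · refine (pconv_le_sup hk ht le_rfl (measurable_one.indicator hE) x).trans_eq ?_
    rw [lpn_one, lintegral_indicator_one hE, div_one]
    ring

theorem lintegral_pconv_indicator_le (hk : HeatBound μ ν c k) (ht : 0 < t) {E : Set G}
    (hE : MeasurableSet E) : ∫⁻ x, pconv μ k t (E.indicator 1) x ∂μ ≤ c * μ E := by
  refine (lintegral_pconv_le hk ht (measurable_one.indicator hE)).trans_eq ?_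
  rw [lintegral_indicator_one hE]

/-- Only the mass of the kernel is used. The factor t - s makes the bounded part of a potential
harmless on short intervals. -/
theorem WeakBound.pduh (hk : HeatBound μ ν c k) (hθ : 0 < θ) (hθ1 : θ < 1) (hN : N ≠ ∞)
    (hwm : Measurable (Function.uncurry w)) (hw : ∀ τ ∈ Ioo s t, WeakBound μ θ N (w τ)) :
    WeakBound μ θ (ENNReal.ofReal (t - s) * (ENNReal.ofReal (1 / (1 - θ)) * c) * N)
      (pduh μ k s w t) := by
  intro E hE hEt
  rw [setLIntegral_pduh hk hwm hE]
  have hcE : c * μ E ≠ ∞ := ENNReal.mul_ne_top hk.ne_top hEt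
  calc _ ≤ ∫⁻ _ in Ioo s t,
        ENNReal.ofReal (1 / (1 - θ)) * (N * (c * μ E) ^ θ * c ^ (1 - θ)) := by
        refine setLIntegral_mono' measurableSet_Ioo fun τ hτ => ?_
        have h0 : 0 < t - τ := sub_pos.2 hτ.2
        exact (hw τ hτ).lintegral_mul_le hN hθ hθ1 (hwm.comp (measurable_prodMk_left (x := τ)))
          (measurable_pconv hk (measurable_one.indicator hE)) hk.ne_top hcE
          (fun x => (pconv_indicator_le hk h0 hE x).1) (lintegral_pconv_indicator_le hk h0 hE)
    _ = _ := by
        have e : c ^ θ * c ^ (1 - θ) = c := by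
          rw [← ENNReal.rpow_add_of_nonneg _ _ hθ.le (by linarith), add_sub_cancel,
            ENNReal.rpow_one]
        rw [setLIntegral_const, Real.volume_Ioo, ENNReal.mul_rpow_of_nonneg _ _ hθ.le]
        calc _ = ENNReal.ofReal (t - s) * (ENNReal.ofReal (1 / (1 - θ)) *
              (c ^ θ * c ^ (1 - θ))) * N * μ E ^ θ := by ring
          _ = _ := by rw [e]

/-- The endpoint nonlinear estimate in weak Lebesgue spaces. -/
theorem exists_weakBound_pduh_mul (hk : HeatBound μ ν c k) (hν : 0 < ν) (hθ : 0 < θ)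
    (hθ1 : θ < 1) (hνθ : 1 < ν * θ) :
    ∃ C : ℝ≥0∞, C ≠ ∞ ∧ ∀ (s t : ℝ) (w a : ℝ → G → ℝ≥0∞) (N δ : ℝ≥0∞), N ≠ ∞ → δ ≠ ∞ →
      Measurable (Function.uncurry w) → Measurable (Function.uncurry a) →
      (∀ τ ∈ Ioo s t, WeakBound μ θ N (w τ)) → (∀ τ ∈ Ioo s t, lpn μ ν (a τ) ≤ δ) →
      WeakBound μ θ (C * δ * N) (FracHeat.pduh μ k s (fun τ x => a τ x * w τ x) t) := by
  -- Multiplying w by a function in L^ν lowers its weak exponent from θ to θ - 1/ν, and γ is the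
  -- complement of that exponent.
  set γ := 1 - θ + 1 / ν with hγ
  have hν1 : 0 < 1 / ν := by positivity
  have hθ' : 0 < θ - 1 / ν := by
    rw [sub_pos, div_lt_iff₀ hν, mul_comm]; exact hνθ
  have hγ0 : 0 < γ := by linarith
  have hνγ : ν * γ = ν * (1 - θ) + 1 := by rw [hγ]; field_simp
  have hνγ1 : 1 < ν * γ := by
    rw [hνγ]
    have := mul_pos hν (sub_pos.2 hθ1)
    linarith
  set C₁ := ENNReal.ofReal (1 + 1 / (ν * θ - 1))
  set C₂ := ENNReal.ofReal (1 / (1 - (θ - 1 / ν)))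
  set C₃ := ENNReal.ofReal (1 + 1 / (ν * γ - 1))
  refine ⟨C₁ * C₂ * C₃ * c, ENNReal.mul_ne_top (ENNReal.mul_ne_top (ENNReal.mul_ne_top
    ENNReal.ofReal_ne_top ENNReal.ofReal_ne_top) ENNReal.ofReal_ne_top) hk.ne_top, ?_⟩
  intro s t w a N δ hN hδ hwm ham hw ha E hE hEt
  have hcE : c * μ E ≠ ∞ := ENNReal.mul_ne_top hk.ne_top hEt
  have hawm : Measurable (Function.uncurry fun τ x => a τ x * w τ x) := ham.mul hwm
  rw [setLIntegral_pduh hk hawm hE]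
  set N₁ := C₁ * N * δ with hN₁
  have hN₁t : N₁ ≠ ∞ := ENNReal.mul_ne_top (ENNReal.mul_ne_top ENNReal.ofReal_ne_top hN) hδ
  set K := C₂ * (N₁ * (c * μ E) ^ (θ - 1 / ν)) with hK
  have hKt : K ≠ ∞ := ENNReal.mul_ne_top ENNReal.ofReal_ne_top
    (ENNReal.mul_ne_top hN₁t (ENNReal.rpow_ne_top_of_nonneg hθ'.le hcE))
  -- A majorant in the elapsed time σ alone. A strong L^r estimate would meet the divergent integral
  -- of σ^{-1}. Here the minimum is constant for small σ and decays like σ^{-νγ} with νγ > 1, so the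
  -- integral over all σ is finite. It is proportional to |E|^{1/ν}, which restores the exponent θ.
  set F : ℝ → ℝ≥0∞ := fun σ => K * (min c (c * μ E * ENNReal.ofReal σ ^ (-ν))) ^ γ with hF
  have h1 : ∀ τ ∈ Ioo s t, (∫⁻ x, pconv μ k (t - τ) (E.indicator 1) x * (a τ x * w τ x) ∂μ) ≤
      (Ioi 0).indicator F (t - τ) := by
    intro τ hτ
    have h0 : 0 < t - τ := sub_pos.2 hτ.2
    have hwτ : Measurable (w τ) := hwm.comp (measurable_prodMk_left (x := τ))
    have haτ : Measurable (a τ) := ham.comp (measurable_prodMk_left (x := τ))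
    rw [indicator_of_mem (show t - τ ∈ Ioi 0 from h0)]
    refine (((hw τ hτ).mul hN hwτ hθ hν hνθ haτ hδ (ha τ hτ)).lintegral_mul_le hN₁t hθ'
      (by linarith) (haτ.mul hwτ) (measurable_pconv hk (measurable_one.indicator hE))
      (H := min c (c * μ E * ENNReal.ofReal (t - τ) ^ (-ν)))
      (ne_top_of_le_ne_top hk.ne_top (min_le_left _ _)) hcE
      (fun x => le_min (pconv_indicator_le hk h0 hE x).1 (pconv_indicator_le hk h0 hE x).2)
      (lintegral_pconv_indicator_le hk h0 hE)).trans_eq ?_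
    rw [show 1 - (θ - 1 / ν) = γ by rw [hγ]; ring, hF, hK]
    simp only [C₂]
    rw [show 1 - (θ - 1 / ν) = γ by rw [hγ]; ring]
    ring
  have hA : K * c ^ γ ≠ ∞ := ENNReal.mul_ne_top hKt (ENNReal.rpow_ne_top_of_nonneg hγ0.le hk.ne_top)
  have hB : K * c ^ γ * μ E ^ γ ≠ ∞ :=
    ENNReal.mul_ne_top hA (ENNReal.rpow_ne_top_of_nonneg hγ0.le hEt)
  have h2 := lintegral_Ioi_min_le hνγ1 hA hB (f := F)
    (fun l _ => mul_le_mul_right (ENNReal.rpow_le_rpow (min_le_left _ _) hγ0.le) K)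
    (fun l _ => by
      refine (mul_le_mul_right (ENNReal.rpow_le_rpow (min_le_right _ _) hγ0.le) K).trans_eq ?_
      rw [ENNReal.mul_rpow_of_nonneg _ _ hγ0.le, ENNReal.mul_rpow_of_nonneg _ _ hγ0.le,
        ← ENNReal.rpow_mul, neg_mul]
      ring)
  have e0 : 0 ≤ 1 - 1 / (ν * γ) := by
    rw [sub_nonneg, div_le_one (by positivity)]; exact hνγ1.le
  have e1 : 0 ≤ 1 / (ν * γ) := by positivity
  have e2 : (K * c ^ γ) ^ (1 - 1 / (ν * γ)) * (K * c ^ γ * μ E ^ γ) ^ (1 / (ν * γ)) =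
      K * c ^ γ * μ E ^ (1 / ν) := by
    rw [ENNReal.mul_rpow_of_nonneg _ (μ E ^ γ) e1, ← mul_assoc,
      ← ENNReal.rpow_add_of_nonneg _ _ e0 e1, sub_add_cancel, ENNReal.rpow_one,
      ← ENNReal.rpow_mul]
    congr 2
    field_simp
  calc _ ≤ ∫⁻ τ in Ioo s t, (Ioi 0).indicator F (t - τ) :=
        setLIntegral_mono' measurableSet_Ioo h1
    _ ≤ ∫⁻ τ, (Ioi 0).indicator F (t - τ) := setLIntegral_le_lintegral _ _
    _ = ∫⁻ σ in Ioi 0, F σ := by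
        rw [lintegral_sub_left_eq_self, lintegral_indicator measurableSet_Ioi]
    _ ≤ C₃ * (K * c ^ γ * μ E ^ (1 / ν)) := by rw [← e2]; exact h2
    _ = C₁ * C₂ * C₃ * (c ^ (θ - 1 / ν) * c ^ γ) * δ * N *
        (μ E ^ (θ - 1 / ν) * μ E ^ (1 / ν)) := by
        rw [hK, ENNReal.mul_rpow_of_nonneg _ _ hθ'.le, hN₁]
        ring
    _ = _ := by
        rw [← ENNReal.rpow_add_of_nonneg _ _ hθ'.le hγ0.le,
          ← ENNReal.rpow_add_of_nonneg _ _ hθ'.le hν1.le, sub_add_cancel,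
          show θ - 1 / ν + γ = 1 by rw [hγ]; ring, ENNReal.rpow_one]

end WeakDuhamel

end FracHeat

namespace FracHeat

/-! ### Calculus of weak bounds and the nonlinear estimate. -/

section WeakBoundAlgebra

variable {G : Type*} [MeasurableSpace G] {μ : Measure G} {θ : ℝ} {N N' : ℝ≥0∞}
  {w w' : G → ℝ≥0∞}

theorem WeakBound.mono_ae (h : WeakBound μ θ N w) (hw : ∀ᵐ x ∂μ, w' x ≤ w x) (hN : N ≤ N') :
    WeakBound μ θ N' w' := fun E hE hEt =>
  (lintegral_mono_ae (ae_restrict_of_ae hw)).trans ((h E hE hEt).trans (mul_le_mul_left hN _))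

theorem WeakBound.add (h : WeakBound μ θ N w) (h' : WeakBound μ θ N' w') (hw : Measurable w) :
    WeakBound μ θ (N + N') (fun x => w x + w' x) := fun E hE hEt => by
  rw [lintegral_add_left hw, add_mul]
  exact add_le_add (h E hE hEt) (h' E hE hEt)

theorem WeakBound.const_mul (h : WeakBound μ θ N w) (hw : Measurable w) (C : ℝ≥0∞) :
    WeakBound μ θ (C * N) (fun x => C * w x) := fun E hE hEt => by
  rw [lintegral_const_mul _ hw, mul_assoc]
  exact mul_le_mul_right (h E hE hEt) C

/-- Letting j grow, the integral of w over each set of finite measure is 0. -/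
theorem ae_eq_zero_of_weakBound [SigmaFinite μ] (hθ : 0 < θ) (hN : N ≠ ∞) (hw : Measurable w)
    (h : ∀ j : ℕ, WeakBound μ θ (N * 2⁻¹ ^ j) w) : w =ᵐ[μ] 0 := by
  refine ae_eq_of_forall_setLIntegral_eq_of_sigmaFinite hw measurable_const fun E hE hEt => ?_
  simp only [Pi.zero_apply, lintegral_zero]
  have hlim : Filter.Tendsto (fun j : ℕ => N * 2⁻¹ ^ j * μ E ^ θ) Filter.atTop (nhds 0) := by
    have h1 : Filter.Tendsto (fun j : ℕ => (2⁻¹ : ℝ≥0∞) ^ j) Filter.atTop (nhds 0) :=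
      ENNReal.tendsto_pow_atTop_nhds_zero_iff.2 (by simp)
    have h2 := ENNReal.Tendsto.mul_const (b := μ E ^ θ)
      (ENNReal.Tendsto.const_mul (a := N) h1 (Or.inr hN))
      (Or.inr (ENNReal.rpow_ne_top_of_nonneg hθ.le hEt.ne))
    simpa using h2
  exact le_antisymm (ge_of_tendsto' hlim fun j => h j E hE hEt.ne) bot_le

end WeakBoundAlgebra

theorem add_rpow_le_two_rpow {b : ℝ} (hb : 0 < b) (x y : ℝ≥0∞) :
    (x + y) ^ b ≤ 2 ^ b * (x ^ b + y ^ b) := by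
  have h : ∀ z : ℝ≥0∞, x + y ≤ 2 * z → z ^ b ≤ x ^ b + y ^ b →
      (x + y) ^ b ≤ 2 ^ b * (x ^ b + y ^ b) := fun z h1 h2 => by
    refine (ENNReal.rpow_le_rpow h1 hb.le).trans ?_
    rw [ENNReal.mul_rpow_of_nonneg _ _ hb.le]
    exact mul_le_mul_right h2 _
  rcases le_total x y with hxy | hxy
  · exact h y (by rw [two_mul]; exact add_le_add hxy le_rfl) le_add_self
  · exact h x (by rw [two_mul]; exact add_le_add le_rfl hxy) le_self_add

section WeakNonlinear

variable {G : Type*} [AddCommGroup G] [MeasurableSpace G] [MeasurableAdd₂ G] [MeasurableNeg G]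
  {μ : Measure G} {ν θ b : ℝ} {c : ℝ≥0∞} {k : ℝ → G → ℝ≥0∞}
  [SigmaFinite μ] [μ.IsAddLeftInvariant] [μ.IsNegInvariant]

theorem pduh_add (hk : HeatBound μ ν c k) {s t : ℝ} {g h : ℝ → G → ℝ≥0∞}
    (hg : Measurable (Function.uncurry g)) (x : G) :
    pduh μ k s (fun τ y => g τ y + h τ y) t x = pduh μ k s g t x + pduh μ k s h t x := by
  have hm := measurable_pconv_sub hk hg t
  have hm' : Measurable fun τ => pconv μ k (t - τ) (g τ) x :=
    hm.comp (measurable_id.prodMk measurable_const)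
  unfold pduh
  rw [← lintegral_add_left hm']
  refine lintegral_congr fun τ => ?_
  have hgτ : Measurable (g τ) := hg.comp (measurable_prodMk_left (x := τ))
  have hkg : Measurable fun y => k (t - τ) (x - y) * g τ y := (hk.meas_sub_left _ _).mul hgτ
  unfold pconv
  rw [← lintegral_add_left hkg]
  simp_rw [mul_add]

theorem pduh_const_mul {s t : ℝ} {C : ℝ≥0∞} (hC : C ≠ ∞) (g : ℝ → G → ℝ≥0∞) (x : G) :
    pduh μ k s (fun τ y => C * g τ y) t x = C * pduh μ k s g t x := by
  unfold pduh pconv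
  rw [← lintegral_const_mul' _ _ hC]
  refine lintegral_congr fun τ => ?_
  rw [← lintegral_const_mul' _ _ hC]
  refine lintegral_congr fun y => ?_
  ring

/-- The nonlinear estimate in weak Lebesgue spaces, for potentials that are small up to a bounded
part. -/
theorem exists_weakBound_pduh_rpow_mul (hk : HeatBound μ ν c k) (hν : 0 < ν) (hb : 0 < b)
    (hθ : 0 < θ) (hθ1 : θ < 1) (hνθ : 1 < ν * θ) :
    ∃ C C' : ℝ≥0∞, C ≠ ∞ ∧ C' ≠ ∞ ∧ ∀ (s t : ℝ) (F w a : ℝ → G → ℝ≥0∞) (N δ R : ℝ≥0∞),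
      N ≠ ∞ → δ ≠ ∞ → R ≠ ∞ → Measurable (Function.uncurry w) → Measurable (Function.uncurry a) →
      (∀ τ ∈ Ioo s t, WeakBound μ θ N (w τ)) → (∀ τ ∈ Ioo s t, lpn μ (ν * b) (a τ) ≤ δ) →
      (∀ τ ∈ Ioo s t, ∀ x, F τ x ≤ a τ x + R) →
      WeakBound μ θ ((C * δ ^ b + C' * R ^ b * ENNReal.ofReal (t - s)) * N)
        (pduh μ k s (fun τ x => F τ x ^ b * w τ x) t) := by
  obtain ⟨C, hC, hmain⟩ := exists_weakBound_pduh_mul hk hν hθ hθ1 hνθ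
  have h2t : (2 : ℝ≥0∞) ^ b ≠ ∞ := ENNReal.rpow_ne_top_of_nonneg hb.le ENNReal.ofNat_ne_top
  refine ⟨2 ^ b * C, 2 ^ b * (ENNReal.ofReal (1 / (1 - θ)) * c), ENNReal.mul_ne_top h2t hC,
    ENNReal.mul_ne_top h2t (ENNReal.mul_ne_top ENNReal.ofReal_ne_top hk.ne_top), ?_⟩
  intro s t F w a N δ R hN hδ hR hwm ham hw ha hF
  have hRb : R ^ b ≠ ∞ := ENNReal.rpow_ne_top_of_nonneg hb.le hR
  have hab : Measurable (Function.uncurry fun τ x => a τ x ^ b) := ham.pow_const b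
  have habw : Measurable (Function.uncurry fun τ x => a τ x ^ b * w τ x) := hab.mul hwm
  have h1 := hmain s t w (fun τ x => a τ x ^ b) N (δ ^ b) hN
    (ENNReal.rpow_ne_top_of_nonneg hb.le hδ) hwm hab hw (fun τ hτ => by
      rw [lpn_rpow hν hb]
      exact ENNReal.rpow_le_rpow (ha τ hτ) hb.le)
  have h2 := (WeakBound.pduh hk hθ hθ1 hN hwm hw).const_mul (measurable_pduh hk s hwm t) (R ^ b)
  have hm1 := measurable_pduh hk s habw t
  have hm2 := measurable_pduh hk s hwm t
  refine ((h1.add h2 hm1).const_mul (hm1.add (hm2.const_mul _)) (2 ^ b)).mono_ae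
    (.of_forall fun x => ?_) (by ring : _ = _).le
  rw [← pduh_const_mul hRb, ← pduh_add hk habw, ← pduh_const_mul h2t]
  refine pduh_mono (fun τ hτ y => ?_) x
  rw [← add_mul, ← mul_assoc]
  exact mul_le_mul_left ((ENNReal.rpow_le_rpow (hF τ hτ y) hb.le).trans
    (add_rpow_le_two_rpow hb _ _)) _

end WeakNonlinear

/-! ### Local uniqueness in the critical space. -/

section CriticalUniqueness

open Filter Topology

variable {𝕜 : Type*} [RCLike 𝕜] {n : ℕ} {α b ε r : ℝ} {c : ℝ≥0∞}
  {φ : EuclideanSpace ℝ (Fin n) → 𝕜} {U V : ℝ → EuclideanSpace ℝ (Fin n) → 𝕜}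

/-- The function is cut at a large height: the part above it is small in L^r, the rest is bounded by
R. -/
theorem exists_lpn_tail_le {β : Type*} [MeasurableSpace β] {μ : Measure β} {f : β → 𝕜}
    (hf : Measurable f) (hr : 1 ≤ r) (h : lpn μ r (fun x => ‖f x‖ₑ) < ∞) {δ : ℝ≥0∞}
    (hδ : δ ≠ 0) : ∃ R : ℝ≥0∞, R ≠ ∞ ∧ ∃ g : β → ℝ≥0∞, Measurable g ∧ lpn μ r g ≤ δ ∧
      ∀ x, ‖f x‖ₑ ≤ g x + R := by
  have hr0 : 0 < r := by linarith
  have hmem : MemLp f (ENNReal.ofReal r) μ := ⟨hf.aestronglyMeasurable, by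
    rwa [eLpNorm_eq_lpn hr0]⟩
  have hδ' : min δ 1 ≠ ∞ := ne_top_of_le_ne_top ENNReal.one_ne_top (min_le_right _ _)
  have hδ0 : 0 < (min δ 1).toReal :=
    ENNReal.toReal_pos (lt_min (pos_iff_ne_zero.2 hδ) one_pos).ne' hδ'
  obtain ⟨M, hM, hle⟩ := hmem.eLpNorm_indicator_norm_ge_pos_le hf.stronglyMeasurable hδ0
  rw [eLpNorm_eq_lpn hr0, ENNReal.ofReal_toReal hδ'] at hle
  have hs : MeasurableSet {x | M ≤ ‖f x‖₊} :=
    measurableSet_le measurable_const hf.norm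
  refine ⟨ENNReal.ofReal M, ENNReal.ofReal_ne_top, _, (hf.indicator hs).enorm,
    hle.trans (min_le_left _ _), fun x => ?_⟩
  by_cases hx : x ∈ {x | M ≤ (‖f x‖₊ : ℝ)}
  · rw [indicator_of_mem hx]
    exact le_self_add
  · refine le_trans ?_ le_add_self
    rw [← ofReal_norm]
    refine ENNReal.ofReal_le_ofReal ?_
    have : ¬ M ≤ (‖f x‖₊ : ℝ) := hx
    exact (not_le.1 this).le

/-- Local uniqueness of solutions that are merely continuous into the critical space `L^r`. -/
theorem FMild.exists_ae_eq_critical (hS : HeatSemigroup volume (n / (2 * α)) c (kernel n α))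
    (hn : 0 < (n : ℝ) / (2 * α)) (hb : 0 < b) (hε : |ε| = 1) (hr : r = n / (2 * α) * b)
    (hrb : b + 1 < r) (hφm : Measurable φ) (hφ : lpn volume r (fun x => ‖φ x‖ₑ) < ∞) {T : ℝ}
    (hU : FMild n α b ε (Ico 0 T) φ U) (hV : FMild n α b ε (Ico 0 T) φ V)
    {t₀ : ℝ} (ht₀ : t₀ ∈ Ico 0 T) (hUV : U t₀ =ᵐ[volume] V t₀)
    (hUr : lpn volume r (fun x => ‖U t₀ x‖ₑ) < ∞)
    (hUc : Tendsto (fun t => lpn volume r (fun x => ‖U t x - U t₀ x‖ₑ)) (𝓝[>] t₀) (𝓝 0))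
    (hVc : Tendsto (fun t => lpn volume r (fun x => ‖V t x - V t₀ x‖ₑ)) (𝓝[>] t₀) (𝓝 0)) :
    ∃ t₁ ∈ Ioo t₀ T, ∀ t ∈ Ioo t₀ t₁, U t =ᵐ[volume] V t := by
  set ν := (n : ℝ) / (2 * α) with hν
  have hr1 : 1 < r := by linarith
  have hr0 : 0 < r := by linarith
  -- The exponent of weak L^r. Since ν = r/b, the condition νθ > 1 says r > b + 1.
  set θ := 1 - 1 / r with hθd
  have hθ : 0 < θ := by rw [hθd, sub_pos, div_lt_one hr0]; exact hr1
  have hθ1 : θ < 1 := by rw [hθd]; have : 0 < 1 / r := by positivity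
                         linarith
  have hνθ : 1 < ν * θ := by
    have h1 : ν * θ = (r - 1) / b := by rw [hθd, hr]; field_simp
    rw [h1, lt_div_iff₀ hb]; linarith
  obtain ⟨C, C', hC, hC', hest⟩ :=
    exists_weakBound_pduh_rpow_mul (b := b) hS.bound hn hb hθ hθ1 hνθ
  set D := ENNReal.ofReal (b + 2) with hD
  have h8 : (1 / 8 : ℝ≥0∞) ≠ 0 := by simp
  obtain ⟨δ', hδ'0, hδ'⟩ := exists_pos_mul_rpow_le
    (ENNReal.mul_ne_top (ENNReal.ofReal_ne_top (r := b + 2)) hC) h8 hb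
  set δ := min δ' 1 with hδd
  have hδt : δ ≠ ∞ := ne_top_of_le_ne_top ENNReal.one_ne_top (min_le_right _ _)
  have hδ0 : δ ≠ 0 := (lt_min (pos_iff_ne_zero.2 hδ'0) one_pos).ne'
  have hδ2 : δ / 2 ≠ 0 := by simp [hδ0]
  have hUm := meas_enorm hU.meas
  have hVm := meas_enorm hV.meas
  have hWm := meas_enorm_sub hU.meas hV.meas
  have hUt : ∀ t, Measurable (U t) := fun t => hU.meas.comp measurable_prodMk_left
  have hVt : ∀ t, Measurable (V t) := fun t => hV.meas.comp measurable_prodMk_left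
  have hVr : lpn volume r (fun x => ‖V t₀ x‖ₑ) < ∞ := by
    refine lt_of_eq_of_lt (lpn_congr_ae ?_) hUr
    filter_upwards [hUV] with x hx
    rw [hx]
  obtain ⟨R₁, hR₁, g₁, hg₁m, hg₁, hg₁R⟩ := exists_lpn_tail_le (hUt t₀) hr1.le hUr hδ2
  obtain ⟨R₂, hR₂, g₂, hg₂m, hg₂, hg₂R⟩ := exists_lpn_tail_le (hVt t₀) hr1.le hVr hδ2
  set R := R₁ + R₂ with hR
  have hRt : R ≠ ∞ := ENNReal.add_ne_top.2 ⟨hR₁, hR₂⟩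
  obtain ⟨δ₃, hδ₃0, hδ₃⟩ := exists_pos_mul_rpow_le (s := 1)
    (ENNReal.mul_ne_top (ENNReal.ofReal_ne_top (r := b + 2)) (ENNReal.mul_ne_top hC'
      (ENNReal.rpow_ne_top_of_nonneg hb.le hRt))) h8 one_pos
  have hev : ∀ᶠ t in 𝓝[>] t₀, lpn volume r (fun x => ‖U t x - U t₀ x‖ₑ) ≤ δ / 2 ∧
      lpn volume r (fun x => ‖V t x - V t₀ x‖ₑ) ≤ δ / 2 ∧ ENNReal.ofReal (t - t₀) ≤ δ₃ ∧
      t < T := by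
    refine ((ENNReal.tendsto_nhds_zero.1 hUc _ (pos_iff_ne_zero.2 hδ2)).and
      ((ENNReal.tendsto_nhds_zero.1 hVc _ (pos_iff_ne_zero.2 hδ2)).and (.and ?_ ?_)))
    · have h1 : Tendsto (fun t : ℝ => ENNReal.ofReal (t - t₀)) (𝓝[>] t₀) (𝓝 0) := by
        have h2 : Continuous fun t : ℝ => ENNReal.ofReal (t - t₀) :=
          ENNReal.continuous_ofReal.comp (continuous_sub_right t₀)
        have h3 := h2.tendsto t₀
        rw [sub_self, ENNReal.ofReal_zero] at h3
        exact h3.mono_left nhdsWithin_le_nhds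
      exact ENNReal.tendsto_nhds_zero.1 h1 _ (pos_iff_ne_zero.2 hδ₃0)
    · exact nhdsWithin_le_nhds (Iio_mem_nhds ht₀.2)
  obtain ⟨t₁, ht₁, hsub⟩ := (mem_nhdsGT_iff_exists_Ioo_subset).1 hev
  set t₂ := (t₀ + t₁) / 2 with ht₂
  have ht₀₁ : t₀ < t₁ := ht₁
  have ht₂I : t₂ ∈ Ioo t₀ t₁ := ⟨by linarith, by linarith⟩
  have hJ : ∀ t ∈ Ioo t₀ t₂, t ∈ Ioo t₀ t₁ := fun t ht => ⟨ht.1, ht.2.trans ht₂I.2⟩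
  refine ⟨t₂, ⟨ht₂I.1, (hsub ht₂I).2.2.2⟩, ?_⟩
  -- One application of the equation halves any uniform weak bound for U - V. Iterating this on the
  -- interval replaces the absorption of a best constant.
  have hhalf : ∀ N : ℝ≥0∞, N ≠ ∞ →
      (∀ t ∈ Ioo t₀ t₂, WeakBound volume θ N (fun x => ‖U t x - V t x‖ₑ)) →
      ∀ t ∈ Ioo t₀ t₂, WeakBound volume θ (N * 2⁻¹) (fun x => ‖U t x - V t x‖ₑ) := by
    intro N hN hP t ht
    have htsub : ∀ τ ∈ Ioo t₀ t, τ ∈ Ioo t₀ t₂ := fun τ hτ => ⟨hτ.1, hτ.2.trans ht.2⟩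
    have key : ∀ {Z : ℝ → EuclideanSpace ℝ (Fin n) → 𝕜} {g : EuclideanSpace ℝ (Fin n) → ℝ≥0∞}
        {R' : ℝ≥0∞}, Measurable (Function.uncurry Z) → Measurable g → lpn volume r g ≤ δ / 2 →
        R' ≤ R → (∀ x, ‖Z t₀ x‖ₑ ≤ g x + R') →
        (∀ τ ∈ Ioo t₀ t₂, lpn volume r (fun x => ‖Z τ x - Z t₀ x‖ₑ) ≤ δ / 2) →
        WeakBound volume θ (D * ((C * δ ^ b + C' * R ^ b * ENNReal.ofReal (t - t₀)) * N))
          (fun x => D * pduh volume (absK (kernel n α)) t₀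
            (fun τ y => ‖Z τ y‖ₑ ^ b * ‖U τ y - V τ y‖ₑ) t x) := by
      intro Z g R' hZ hg hgδ hR' hgR hZδ
      -- The size of Z(τ) is at most |Z(τ) - Z(t₀)| plus the tail of Z(t₀) plus R. The first two are
      -- small in L^r, by continuity and by the choice of the cut; R is paid for by the short time.
      have hZ0 : Measurable (Z t₀) := hZ.comp measurable_prodMk_left
      have ham : Measurable (Function.uncurry fun τ x => ‖Z τ x - Z t₀ x‖ₑ + g x) :=
        (hZ.sub (hZ0.comp measurable_snd)).enorm.add (hg.comp measurable_snd)
      refine (hest t₀ t (fun τ y => ‖Z τ y‖ₑ) (fun τ y => ‖U τ y - V τ y‖ₑ)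
        (fun τ x => ‖Z τ x - Z t₀ x‖ₑ + g x) N δ R hN hδt hRt hWm ham
        (fun τ hτ => hP τ (htsub τ hτ)) (fun τ hτ => ?_) fun τ _ x => ?_).const_mul
          (measurable_pduh hS.bound t₀ (meas_rpow_mul b (meas_enorm hZ) hWm) t) D
      · rw [← hr]
        have hZτ : Measurable fun x => ‖Z τ x - Z t₀ x‖ₑ :=
          ((hZ.comp (measurable_prodMk_left (x := τ))).sub hZ0).enorm
        refine (lpn_add_le hr1.le hZτ hg).trans ?_
        refine (add_le_add (hZδ τ (htsub τ hτ)) hgδ).trans_eq (ENNReal.add_halves δ)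
      · calc ‖Z τ x‖ₑ = ‖(Z τ x - Z t₀ x) + Z t₀ x‖ₑ := by rw [sub_add_cancel]
          _ ≤ ‖Z τ x - Z t₀ x‖ₑ + ‖Z t₀ x‖ₑ := enorm_add_le _ _
          _ ≤ ‖Z τ x - Z t₀ x‖ₑ + (g x + R) :=
            add_le_add le_rfl ((hgR x).trans (add_le_add le_rfl hR'))
          _ = _ := (add_assoc _ _ _).symm
    have k1 := key hU.meas hg₁m hg₁ (R' := R₁) le_self_add hg₁R
      fun τ hτ => (hsub (hJ τ hτ)).1
    have k2 := key hV.meas hg₂m hg₂ (R' := R₂) le_add_self hg₂R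
      fun τ hτ => (hsub (hJ τ hτ)).2.1
    have hm1 : Measurable (pduh volume (absK (kernel n α)) t₀
        (fun τ y => ‖U τ y‖ₑ ^ b * ‖U τ y - V τ y‖ₑ) t) :=
      measurable_pduh hS.bound t₀ (meas_rpow_mul b hUm hWm) t
    have htI : t ∈ Ico 0 T := ⟨ht₀.1.trans ht.1.le, (hsub (hJ t ht)).2.2.2⟩
    refine (k1.add k2 (hm1.const_mul D)).mono_ae ?_ ?_
    · filter_upwards [hU.sub_le hS hb hε hr1.le hφm hφ hV ht₀ htI ht₀.1 ht.1 hUV] with x hx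
      rwa [mul_add] at hx
    -- One eighth comes from the small part and one from the bounded part of the potential, for U
    -- and again for V; the sum is 1/2.
    · have hle : D * (C * δ ^ b + C' * R ^ b * ENNReal.ofReal (t - t₀)) ≤ 1 / 8 + 1 / 8 := by
        rw [mul_add]
        refine add_le_add ?_ ?_
        · rw [← mul_assoc]
          exact hδ' δ (min_le_left _ _)
        · rw [← mul_assoc]
          have := hδ₃ _ (hsub (hJ t ht)).2.2.1
          rwa [ENNReal.rpow_one] at this
      have h4 : (1 / 8 + 1 / 8 + (1 / 8 + 1 / 8) : ℝ≥0∞) = 2⁻¹ := by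
        rw [← ENNReal.toReal_eq_toReal_iff' (by simp) (by simp)]
        rw [ENNReal.toReal_add (by simp) (by simp), ENNReal.toReal_add (by simp) (by simp)]
        norm_num
      calc _ = (D * (C * δ ^ b + C' * R ^ b * ENNReal.ofReal (t - t₀)) +
            D * (C * δ ^ b + C' * R ^ b * ENNReal.ofReal (t - t₀))) * N := by ring
        _ ≤ (1 / 8 + 1 / 8 + (1 / 8 + 1 / 8)) * N := by gcongr
        _ = N * 2⁻¹ := by rw [h4, mul_comm]
  have hbase : ∀ t ∈ Ioo t₀ t₂, WeakBound volume θ δ (fun x => ‖U t x - V t x‖ₑ) := by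
    intro t ht
    have hWt : Measurable fun x => ‖U t x - V t x‖ₑ := ((hUt t).sub (hVt t)).enorm
    refine weakBound_of_lpn_le hr1 hWt ?_
    have h1 : lpn volume r (fun x => ‖U t x - V t x‖ₑ) ≤
        lpn volume r (fun x => ‖U t x - U t₀ x‖ₑ + ‖V t x - V t₀ x‖ₑ) := by
      refine lpn_mono_ae hr0 ?_
      filter_upwards [hUV] with x hx
      have : U t x - V t x = (U t x - U t₀ x) - (V t x - V t₀ x) := by rw [hx]; ring
      rw [this]
      exact enorm_sub_le
    refine h1.trans ((lpn_add_le hr1.le ((hUt t).sub (hUt t₀)).enorm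
      ((hVt t).sub (hVt t₀)).enorm).trans ?_)
    exact (add_le_add (hsub (hJ t ht)).1 (hsub (hJ t ht)).2.1).trans_eq (ENNReal.add_halves δ)
  have hall : ∀ j : ℕ, ∀ t ∈ Ioo t₀ t₂,
      WeakBound volume θ (δ * 2⁻¹ ^ j) (fun x => ‖U t x - V t x‖ₑ) := by
    intro j
    induction j with
    | zero => simpa using hbase
    | succ j ih =>
      rw [pow_succ, ← mul_assoc]
      exact hhalf _ (ENNReal.mul_ne_top hδt (ENNReal.pow_ne_top (by simp))) ih
  intro t ht
  have hWt : Measurable fun x => ‖U t x - V t x‖ₑ := ((hUt t).sub (hVt t)).enorm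
  filter_upwards [ae_eq_zero_of_weakBound hθ hδt hWt fun j => hall j t ht] with x hx
  simpa [sub_eq_zero] using hx

end CriticalUniqueness

end FracHeat

namespace FracHeat

/-! ### Uniqueness on the whole interval. -/

section Uniqueness

open Filter Topology

variable {𝕜 : Type*} [RCLike 𝕜] {n : ℕ} {α b ε r : ℝ} {c : ℝ≥0∞}
  {U V : ℝ → EuclideanSpace ℝ (Fin n) → 𝕜} [Fact (1 ≤ ENNReal.ofReal r)] {T : ℝ}
  {φ : Lp 𝕜 (ENNReal.ofReal r) (volume : Measure (EuclideanSpace ℝ (Fin n)))}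
  {u v : ℝ → Lp 𝕜 (ENNReal.ofReal r) (volume : Measure (EuclideanSpace ℝ (Fin n)))}

theorem lpn_congr_enorm {p : ℝ} {f g : EuclideanSpace ℝ (Fin n) → 𝕜} (h : f =ᵐ[volume] g) :
    lpn volume p (fun x => ‖f x‖ₑ) = lpn volume p (fun x => ‖g x‖ₑ) :=
  lpn_congr_ae (h.mono fun x hx => by rw [hx])

theorem tendsto_lpn_sub (hr : 0 < r) (hu : ContinuousOn u (Ico 0 T))
    (hUu : ∀ t ∈ Ico 0 T, U t =ᵐ[volume] u t) {t₀ : ℝ} (ht₀ : t₀ ∈ Ico 0 T) :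
    Tendsto (fun t => lpn volume r (fun x => ‖U t x - U t₀ x‖ₑ)) (𝓝[>] t₀) (𝓝 0) := by
  have h1 : Tendsto u (𝓝[>] t₀) (𝓝 (u t₀)) := by
    refine (hu t₀ ht₀).mono_left (nhdsWithin_le_iff.2 ?_)
    exact mem_of_superset (Ioo_mem_nhdsGT ht₀.2) fun t ht => ⟨ht₀.1.trans ht.1.le, ht.2⟩
  have h2 : Tendsto (fun t => ENNReal.ofReal ‖u t - u t₀‖) (𝓝[>] t₀) (𝓝 0) := by
    rw [← ENNReal.ofReal_zero]
    exact ENNReal.tendsto_ofReal (tendsto_iff_norm_sub_tendsto_zero.1 h1)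
  refine h2.congr' ?_
  filter_upwards [Ioo_mem_nhdsGT ht₀.2] with t ht
  rw [← lpn_rep hr]
  refine lpn_congr_enorm ?_
  filter_upwards [hUu t ⟨ht₀.1.trans ht.1.le, ht.2⟩, hUu t₀ ht₀, Lp.coeFn_sub (u t) (u t₀)]
    with x h1 h2 h3
  rw [h3, Pi.sub_apply, h1, h2]

/-- The two local arguments cover all cases: mixed norms if r > r₀ or r ≤ b + 1, weak spaces if r =
r₀ > b + 1. The first yields agreement at almost every time, which continuity extends to all times.
-/
theorem exists_eqOn_Ioo (hα : 0 < α) (hn : 0 < (n : ℝ) / (2 * α)) (hb : 0 < b) (hε : |ε| = 1)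
    (h1 : 1 < n / (2 * α) * b) (hη : n / (2 * α) * b ≤ r)
    (hu : IsMildSolution α b ε (Ico 0 T) φ u) (hv : IsMildSolution α b ε (Ico 0 T) φ v)
    (huc : ContinuousOn u (Ico 0 T)) (hvc : ContinuousOn v (Ico 0 T)) {t₀ : ℝ}
    (ht₀ : t₀ ∈ Ico 0 T) (huv : u t₀ = v t₀) : ∃ t₁ ∈ Ioo t₀ T, EqOn u v (Ioo t₀ t₁) := by
  have hr1 : 1 < r := by linarith
  have hr0 : 0 < r := by linarith
  obtain ⟨c, hS⟩ := exists_heatSemigroup (n := n) hα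
  obtain ⟨U, hU, hUu⟩ := exists_measurable_rep hr1.le measurableSet_Ico huc
  obtain ⟨V, hV, hVv⟩ := exists_measurable_rep hr1.le measurableSet_Ico hvc
  obtain ⟨P, Q, hP, hQ, hfin, hPQ⟩ :=
    exists_common_exponents hα hn hb h1 hη hu.regular hv.regular huc hvc hU hV hUu hVv
  have hUf := hu.fmild hS hb hε hU hUu hP hQ fun t ht => (hfin t ht).1
  have hVf := hv.fmild hS hb hε hV hVv hP hQ fun t ht => (hfin t ht).2
  have hφ : lpn volume r (fun x => ‖φ x‖ₑ) < ∞ := by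
    rw [lpn_rep hr0]; exact ENNReal.ofReal_lt_top
  have hUV : U t₀ =ᵐ[volume] V t₀ := by
    filter_upwards [hUu t₀ ht₀, hVv t₀ ht₀] with x hx hx'
    rw [hx, hx', huv]
  have hback : ∀ t ∈ Ico 0 T, U t =ᵐ[volume] V t → u t = v t := fun t ht h =>
    Lp.ext ((hUu t ht).symm.trans (h.trans (hVv t ht)))
  have hsub : ∀ t₁ ∈ Ioo t₀ T, Ioo t₀ t₁ ⊆ Ico 0 T := fun t₁ ht₁ t ht =>
    ⟨ht₀.1.trans ht.1.le, ht.2.trans ht₁.2⟩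
  by_cases hcase : n / (2 * α) * b < r ∨ r ≤ b + 1
  · obtain ⟨t₁, ht₁, hae⟩ := hUf.exists_ae_eq hS hb hε hr1.le (measurable_rep φ) hφ hVf hP hQ
      (hPQ hcase) hfin ht₀ hUV
    refine ⟨t₁, ht₁, Measure.eqOn_open_of_ae_eq (μ := volume) ?_ isOpen_Ioo
      (huc.mono (hsub t₁ ht₁)) (hvc.mono (hsub t₁ ht₁))⟩
    filter_upwards [hae, ae_restrict_mem measurableSet_Ioo] with t ht htI
    exact hback t (hsub t₁ ht₁ htI) ht
  · rw [not_or, not_lt, not_le] at hcase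
    have hUr : lpn volume r (fun x => ‖U t₀ x‖ₑ) < ∞ := by
      rw [lpn_congr_enorm (hUu t₀ ht₀), lpn_rep hr0]
      exact ENNReal.ofReal_lt_top
    obtain ⟨t₁, ht₁, heq⟩ := hUf.exists_ae_eq_critical hS hn hb hε (le_antisymm hcase.1 hη)
      hcase.2 (measurable_rep φ) hφ hVf ht₀ hUV hUr (tendsto_lpn_sub hr0 huc hUu ht₀)
      (tendsto_lpn_sub hr0 hvc hVv ht₀)
    exact ⟨t₁, ht₁, fun t ht => hback t (hsub t₁ ht₁ ht) (heq t ht)⟩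

/-- Uniqueness of mild solutions in `C([0, T); L^r)`. -/
theorem IsMildSolution.unique (hα : 0 < α) (hn : 0 < (n : ℝ) / (2 * α)) (hb : 0 < b)
    (hε : |ε| = 1) (h1 : 1 < n / (2 * α) * b) (hη : n / (2 * α) * b ≤ r)
    (hu : IsMildSolution α b ε (Ico 0 T) φ u) (hv : IsMildSolution α b ε (Ico 0 T) φ v)
    (huc : ContinuousOn u (Ico 0 T)) (hvc : ContinuousOn v (Ico 0 T)) :
    ∀ t ∈ Ico 0 T, u t = v t := by
  intro t ht
  have hsub : Icc 0 t ⊆ Ico 0 T := Icc_subset_Ico_right ht.2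
  -- The set of agreement is closed in [0, t], contains 0, and contains times just after each of its
  -- points; it is therefore everything.
  have hcl : IsClosed ({τ | u τ = v τ} ∩ Icc 0 t) := by
    have h2 := ((huc.mono hsub).sub (hvc.mono hsub)).preimage_isClosed_of_isClosed isClosed_Icc
      (isClosed_singleton (x := 0))
    convert h2 using 1
    ext τ
    simp [and_comm, sub_eq_zero]
  refine hcl.Icc_subset_of_forall_exists_gt (show u 0 = v 0 by rw [hu.initial, hv.initial])
    (fun τ hτ y hy => ?_) ⟨ht.1, le_rfl⟩
  obtain ⟨t₁, ht₁, heq⟩ := exists_eqOn_Ioo hα hn hb hε h1 hη hu hv huc hvc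
    (hsub ⟨hτ.2.1, hτ.2.2.le⟩) hτ.1
  have hm : τ < min y t₁ := lt_min hy ht₁.1
  refine ⟨(τ + min y t₁) / 2, heq ⟨by linarith, ?_⟩, by linarith, ?_⟩
  · linarith [min_le_right y t₁]
  · linarith [min_le_left y t₁]

end Uniqueness

end FracHeat

namespace FracHeat

/-! ### Time shifts, gluing of solutions, and maximality. -/

section Shift

variable {G : Type*} [AddCommGroup G] [MeasurableSpace G] [MeasurableAdd₂ G] [MeasurableNeg G]
  {μ : Measure G} [SigmaFinite μ]

theorem pduh_shift (k : ℝ → G → ℝ≥0∞) (g : ℝ → G → ℝ≥0∞) (s t : ℝ) (x : G) :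
    pduh μ k 0 (fun τ => g (s + τ)) t x = pduh μ k s g (s + t) x := by
  symm
  unfold pduh
  rw [← lintegral_indicator measurableSet_Ioo, ← lintegral_indicator measurableSet_Ioo,
    ← lintegral_add_left_eq_self (μ := volume) _ s]
  refine lintegral_congr fun τ => ?_
  have h : s + τ ∈ Ioo s (s + t) ↔ τ ∈ Ioo 0 t := by simp
  by_cases hτ : τ ∈ Ioo 0 t
  · rw [indicator_of_mem hτ, indicator_of_mem (h.2 hτ), add_sub_add_left_eq_sub]
  · rw [indicator_of_notMem hτ, indicator_of_notMem (mt h.1 hτ)]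

theorem duh_shift {𝕜 : Type*} [RCLike 𝕜] (K : ℝ → G → ℝ) (g : ℝ → G → 𝕜) (s t : ℝ) (x : G) :
    duh μ K 0 (fun τ => g (s + τ)) t x = duh μ K s g (s + t) x := by
  have hp : MeasurePreserving (fun z : ℝ × G => (s + z.1, z.2))
      ((volume : Measure ℝ).prod μ) ((volume : Measure ℝ).prod μ) :=
    (measurePreserving_add_left volume s).prod (MeasurePreserving.id μ)
  have he : MeasurableEmbedding (fun z : ℝ × G => (s + z.1, z.2)) :=
    ((MeasurableEquiv.addLeft s).prodCongr (MeasurableEquiv.refl G)).measurableEmbedding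
  symm
  unfold duh
  rw [← hp.setIntegral_preimage_emb he]
  have h : (fun z : ℝ × G => (s + z.1, z.2)) ⁻¹' (Ioo s (s + t) ×ˢ univ) = Ioo 0 t ×ˢ univ := by
    ext z
    simp
  rw [h]
  simp only [add_sub_add_left_eq_sub]

end Shift

section Glue

open Filter Topology

variable {𝕜 : Type*} [RCLike 𝕜] {n : ℕ} {r : ℝ}
  {u v w : ℝ → Lp 𝕜 (ENNReal.ofReal r) (volume : Measure (EuclideanSpace ℝ (Fin n)))}

theorem MemLqLp.congr {q : ℝ≥0∞} {p : ℝ} {I : Set ℝ} (hI : MeasurableSet I)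
    (h : MemLqLp q p I u) (huw : EqOn u w I) : MemLqLp q p I w :=
  MemLp.ae_eq (by
    filter_upwards [ae_restrict_mem hI] with t ht
    rw [huw ht]) h

theorem MemLqLp.glue {q : ℝ≥0∞} {p : ℝ} {s t : ℝ} (hs : 0 ≤ s) (ht : 0 ≤ t)
    (h₁ : MemLqLp q p (Ico 0 s) w) (h₂ : MemLqLp q p (Ico 0 t) (fun τ => w (s + τ))) :
    MemLqLp q p (Ico 0 (s + t)) w := by
  unfold MemLqLp at *
  set f := fun t => eLpNorm (w t) (ENNReal.ofReal p) volume with hf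
  have hp : MeasurePreserving (fun τ => τ - s) (volume.restrict (Ico s (s + t)))
      (volume.restrict (Ico 0 t)) := by
    have h := (measurePreserving_sub_right volume s).restrict_preimage
      (measurableSet_Ico (a := (0 : ℝ)) (b := t))
    simpa [add_comm] using h
  have h₃ : MemLp f q (volume.restrict (Ico s (s + t))) := by
    have := h₂.comp_measurePreserving hp
    refine this.ae_eq (.of_forall fun τ => ?_)
    simp [f]
  rw [← memLp_indicator_iff_restrict measurableSet_Ico] at h₁ h₃ ⊢
  have h4 : (Ico 0 (s + t)).indicator f = (Ico 0 s).indicator f + (Ico s (s + t)).indicator f := by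
    have h5 := indicator_union_of_disjoint (Ico_disjoint_Ico_same (a := 0) (b := s) (c := s + t)) f
    rwa [Ico_union_Ico_eq_Ico hs (by linarith)] at h5
  rw [h4]
  exact h₁.add h₃

theorem MemLqLp.mono {q : ℝ≥0∞} {p : ℝ} {I J : Set ℝ} (h : MemLqLp q p J u) (hIJ : I ⊆ J) :
    MemLqLp q p I u :=
  MemLp.mono_measure (Measure.restrict_mono_set volume hIJ) h

variable {α b ε : ℝ} [Fact (1 ≤ ENNReal.ofReal r)] {s T T₁ : ℝ}
  {φ : Lp 𝕜 (ENNReal.ofReal r) (volume : Measure (EuclideanSpace ℝ (Fin n)))}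

/-- A mild solution followed, from time `s` on, by a mild solution with datum `u s`. -/
theorem IsMildSolution.exists_glue (hα : 0 < α) (hn : 0 < (n : ℝ) / (2 * α)) (hb : 0 < b)
    (hε : |ε| = 1) (h1 : 1 < n / (2 * α) * b) (hη : n / (2 * α) * b ≤ r)
    (hu : IsMildSolution α b ε (Ico 0 T) φ u) (huc : ContinuousOn u (Ico 0 T)) (hs : s ∈ Ico 0 T)
    (hT₁ : 0 < T₁) (hv : IsMildSolution α b ε (Ico 0 T₁) (u s) v)
    (hvX : ∀ (q : ℝ≥0∞) (p : ℝ), IsAdmissible n α q p r → MemX q p (Ico 0 T₁) v) :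
    ∃ w, IsMildSolution α b ε (Ico 0 (s + T₁)) φ w ∧ ∀ (q : ℝ≥0∞) (p : ℝ),
      IsAdmissible n α q p r → MemLqLp q p (Ico 0 s) u → MemX q p (Ico 0 (s + T₁)) w := by
  have hr1 : 1 < r := by linarith
  have hr0 : 0 < r := by linarith
  have hb1 : 0 < b + 1 := by linarith
  obtain ⟨c, hS⟩ := exists_heatSemigroup (n := n) hα
  obtain ⟨q', p', had, hp', hreg⟩ := hu.regular
  have hvc := (hvX q' p' had).1
  -- One formula for u up to time s and v(· - s) afterwards: before s the bracket vanishes because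
  -- v(0) = u(s), after s the two copies of u(s) cancel. Continuity is then immediate.
  set w : ℝ → Lp 𝕜 (ENNReal.ofReal r) (volume : Measure (EuclideanSpace ℝ (Fin n))) :=
    fun t => u (min t s) + (v (max (t - s) 0) - u s) with hw
  have hw1 : ∀ t ≤ s, w t = u t := fun t ht => by
    simp [hw, ht, hv.initial]
  have hw2 : ∀ τ, 0 ≤ τ → w (s + τ) = v τ := fun τ hτ => by
    simp [hw, hτ]
  have hwc : ContinuousOn w (Ico 0 (s + T₁)) := by
    refine (huc.comp (by fun_prop) fun t ht => ?_).add
      ((hvc.comp (by fun_prop) fun t ht => ?_).sub continuousOn_const)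
    · exact ⟨le_min ht.1 hs.1, (min_le_right _ _).trans_lt hs.2⟩
    · exact ⟨le_max_right _ _, max_lt (by linarith [ht.2]) hT₁⟩
  have hwm : ∀ (q : ℝ≥0∞) (p : ℝ), IsAdmissible n α q p r → MemLqLp q p (Ico 0 s) u →
      MemLqLp q p (Ico 0 (s + T₁)) w := fun q p had h =>
    (h.congr measurableSet_Ico fun t ht => (hw1 t ht.2.le).symm).glue hs.1 hT₁.le
      ((hvX q p had).2.congr measurableSet_Ico fun t ht => (hw2 t ht.1).symm)
  have hwreg : ∃ (q' : ℝ≥0∞) (p' : ℝ), IsAdmissible n α q' p' r ∧ b + 1 < p' ∧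
      ∀ t ∈ Ico 0 (s + T₁), MemLqLp q' p' (Ico 0 t) w :=
    ⟨q', p', had, hp', fun t ht => (hwm q' p' had (hreg s hs)).mono (Ico_subset_Ico_right ht.2.le)⟩
  obtain ⟨W, hWm, hWw⟩ := exists_measurable_rep hr1.le measurableSet_Ico hwc
  obtain ⟨P, Q, hP, hQ, hfin, -⟩ :=
    exists_common_exponents hα hn hb h1 hη hwreg hwreg hwc hwc hWm hWm hWw hWw
  have ha : 1 ≤ P / (b + 1) := by rwa [le_div_iff₀ hb1, one_mul]
  have hD : ∀ t ∈ Ico 0 (s + T₁), lpn volume (P / (b + 1)) (absDuh n α b 0 W t) < ∞ :=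
    fun t ht => lpn_absDuh_lt_top hS hb hP hQ.le hWm
      ((mixed_mono_set Ioo_subset_Ico_self (by linarith) _).trans_lt (hfin t ht).1)
  have hφ : lpn volume r (fun x => ‖φ x‖ₑ) < ∞ := by
    rw [lpn_rep hr0]; exact ENNReal.ofReal_lt_top
  have heq1 : ∀ t, 0 ≤ t → t ≤ s → ∀ᵐ x, W t x = heatFlow n α φ t x + nlDuh n α b ε 0 W t x := by
    intro t ht0 hts
    refine hu.ae_eq hS hb hε hWm ⟨ht0, hts.trans_lt hs.2⟩ ht0 (fun τ hτ => ?_) ha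
      (hD t ⟨ht0, by linarith⟩)
    rw [← hw1 τ (hτ.2.trans hts)]
    exact hWw τ ⟨hτ.1, by linarith [hτ.2]⟩
  have hus : (u s : EuclideanSpace ℝ (Fin n) → 𝕜) =ᵐ[volume]
      fun y => heatFlow n α φ s y + nlDuh n α b ε 0 W s y := by
    filter_upwards [heq1 s hs.1 le_rfl, hWw s ⟨hs.1, by linarith⟩] with x hx hx'
    rw [← hx, hx', hw1 s le_rfl]
  -- After time s, the equation of v is shifted back to start at s. Its datum u(s) is replaced by
  -- its own integral formula, and the semigroup merges the two Duhamel integrals.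
  have heq2 : ∀ τ, 0 < τ → τ < T₁ → ∀ᵐ x, W (s + τ) x =
      heatFlow n α φ (s + τ) x + nlDuh n α b ε 0 W (s + τ) x := by
    intro τ hτ0 hτ
    have hsτ : s + τ ∈ Ico 0 (s + T₁) := ⟨by linarith [hs.1], by linarith⟩
    have hVm : Measurable (Function.uncurry fun σ => W (s + σ)) :=
      hWm.comp ((measurable_fst.const_add s).prodMk measurable_snd)
    have hle : ∀ x, absDuh n α b 0 (fun σ => W (s + σ)) τ x ≤ absDuh n α b 0 W (s + τ) x := by
      intro x
      refine (pduh_shift (absK (kernel n α)) (fun σ y => ‖W σ y‖ₑ ^ (b + 1)) s τ x).trans_le ?_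
      exact lintegral_mono_set (Ioo_subset_Ioo_left hs.1)
    have hDV : lpn volume (P / (b + 1)) (absDuh n α b 0 (fun σ => W (s + σ)) τ) < ∞ :=
      (lpn_mono (by linarith) hle).trans_lt (hD _ hsτ)
    filter_upwards [hv.ae_eq hS hb hε hVm ⟨hτ0.le, hτ⟩ hτ0.le (fun σ hσ => by
      rw [← hw2 σ hσ.1]
      exact hWw _ ⟨by linarith [hs.1, hσ.1], by linarith [hσ.2]⟩) ha hDV,
      ae_absDuh_lt_top hS hWm ha (hD _ hsτ)] with x hx hx'
    have e1 : nlDuh n α b ε 0 (fun σ => W (s + σ)) τ x = nlDuh n α b ε s W (s + τ) x :=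
      duh_shift (kernel n α) (fun σ y => nonlin b ε (W σ y)) s τ x
    have e2 := sconv_heatFlow_add_nlDuh hS hb hε hr1.le (measurable_rep φ) hφ hWm ha hs.1
      (by linarith : s < s + τ) (hD s ⟨hs.1, by linarith⟩) hx'
    rw [hx, e1, ← e2, heatFlow_of_pos hτ0, sconv_congr hus, add_sub_cancel_left]
  have hF : FMild n α b ε (Ico 0 (s + T₁)) φ W := by
    refine ⟨hWm, ⟨_, ha, hD⟩, fun t ht => ?_⟩
    rcases le_or_gt t s with hts | hts
    · exact heq1 t ht.1 hts
    · have := heq2 (t - s) (by linarith) (by linarith [ht.2])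
      rwa [add_sub_cancel] at this
  have hduh := fun t (ht : t ∈ Ico 0 (s + T₁)) (ht0 : 0 < t) =>
    ae_integrable_and_duhamel hS hb hε hF (ae_eq_refl φ) hWw ht ht0
      fun τ hτ => ⟨hτ.1.le, hτ.2.trans ht.2⟩
  refine ⟨w, ⟨hwreg, ?_, fun t ht ht0 => (hduh t ht ht0).mono fun x hx => hx.1,
    fun t ht ht0 => (hduh t ht ht0).mono fun x hx => hx.2⟩, fun q p had h => ⟨hwc, hwm q p had h⟩⟩
  rw [hw1 0 hs.1, hu.initial]

theorem IsMildSolution.mono {I J : Set ℝ} (h : IsMildSolution α b ε J φ u) (hIJ : I ⊆ J) :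
    IsMildSolution α b ε I φ u := by
  obtain ⟨⟨q', p', had, hp', hreg⟩, h0, hc, hd⟩ := h
  exact ⟨⟨q', p', had, hp', fun t ht => hreg t (hIJ ht)⟩, h0, fun t ht => hc t (hIJ ht),
    fun t ht => hd t (hIJ ht)⟩

/-- A maximal solution is large, relatively to the time that it has left. -/
theorem IsMaximal.lt_of_lt (hα : 0 < α) (hn : 0 < (n : ℝ) / (2 * α)) (hb : 0 < b)
    (hε : |ε| = 1) (h1 : 1 < n / (2 * α) * b) (hη : n / (2 * α) * b ≤ r) {κ : ℝ}
    (hκ : ∀ T > 0, ∀ φ : Lp 𝕜 (ENNReal.ofReal r) (volume : Measure (EuclideanSpace ℝ (Fin n))),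
      T ^ (1 - n / (2 * α) * b / r) * ‖φ‖ ^ b ≤ κ →
      ∃ u, IsMildSolution α b ε (Ico 0 T) φ u ∧
        ∀ (q' : ℝ≥0∞) (p' : ℝ), IsAdmissible n α q' p' r → MemX q' p' (Ico 0 T) u)
    {q : ℝ≥0∞} {p : ℝ} (had : IsAdmissible n α q p r) (hu : IsMaximal α b ε q p T φ u)
    (hs : s ∈ Ico 0 T) (hT₁ : T - s < T₁) :
    κ < T₁ ^ (1 - n / (2 * α) * b / r) * ‖u s‖ ^ b := by
  by_contra hcon
  obtain ⟨hT, hum, huX, hmax⟩ := hu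
  have hT₁0 : 0 < T₁ := by linarith [hs.2]
  have huc : ContinuousOn u (Ico 0 T) := by
    intro t ht
    have h2 : t < (t + T) / 2 := by linarith [ht.2]
    have h3 := (huX ((t + T) / 2) (by linarith [ht.2])).1 t ⟨ht.1, h2⟩
    refine h3.mono_of_mem_nhdsWithin ?_
    filter_upwards [self_mem_nhdsWithin, mem_nhdsWithin_of_mem_nhds (Iio_mem_nhds h2)] with τ h4 h5
    exact ⟨h4.1, h5⟩
  -- If u(s) were small enough, it would launch a solution of duration T₁ > T - s. Glued to u, it
  -- lives beyond T and agrees with u before T by uniqueness, which maximality forbids.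
  obtain ⟨v, hv, hvX⟩ := hκ T₁ hT₁0 (u s) (not_lt.1 hcon)
  obtain ⟨w, hw, hwX⟩ := hum.exists_glue hα hn hb hε h1 hη huc hs hT₁0 hv hvX
  have hwX := hwX q p had (huX s hs.2).2
  obtain ⟨t, ht, hne⟩ := hmax (s + T₁) (by linarith) w hw hwX
  have hsub : Ico 0 T ⊆ Ico 0 (s + T₁) := Ico_subset_Ico_right (by linarith)
  exact hne ((hw.mono hsub).unique hα hn hb hε h1 hη hum (hwX.1.mono hsub) huc t ht)

end Glue

end FracHeat

end

/-! ### Assembly of the theorem. -/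

theorem theorem4p1 {𝕜 : Type*} [RCLike 𝕜] (n : ℕ) (α b ε p r : ℝ) (q : ℝ≥0∞)
    [Fact (1 ≤ ENNReal.ofReal r)] (hα : 0 < α) (hb : 0 < b) (hε : ε = 1 ∨ ε = -1)
    (hr₀ : 1 < n * b / (2 * α)) (hr : n * b / (2 * α) ≤ r)
    (hadm : FracHeat.IsAdmissible n α q p r) :
    -- (i) local existence, `r > r₀`: the time depends on a bound for the norm of the data only
    (n * b / (2 * α) < r → ∀ M : ℝ, ∃ T > 0,
      ∀ φ : Lp 𝕜 (ENNReal.ofReal r) (volume : Measure (EuclideanSpace ℝ (Fin n))), ‖φ‖ ≤ M →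
        ∃ u, FracHeat.IsMildSolution α b ε (Ico 0 T) φ u ∧ FracHeat.MemX q p (Ico 0 T) u) ∧
    -- (i) local existence, `r = r₀`: the time depends on the data
    (r = n * b / (2 * α) →
      ∀ φ : Lp 𝕜 (ENNReal.ofReal r) (volume : Measure (EuclideanSpace ℝ (Fin n))), ∃ T > 0,
        ∃ u, FracHeat.IsMildSolution α b ε (Ico 0 T) φ u ∧ FracHeat.MemX q p (Ico 0 T) u) ∧
    -- (i) uniqueness on every interval
    (∀ (φ : Lp 𝕜 (ENNReal.ofReal r) (volume : Measure (EuclideanSpace ℝ (Fin n)))) (T : ℝ)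
      (u v : ℝ → Lp 𝕜 (ENNReal.ofReal r) (volume : Measure (EuclideanSpace ℝ (Fin n)))), 0 < T →
      FracHeat.IsMildSolution α b ε (Ico 0 T) φ u → FracHeat.MemX q p (Ico 0 T) u →
      FracHeat.IsMildSolution α b ε (Ico 0 T) φ v → FracHeat.MemX q p (Ico 0 T) v →
      ∀ t ∈ Ico 0 T, u t = v t) ∧
    -- (ii) global existence for small data, `r = r₀`
    (r = n * b / (2 * α) → ∃ δ > 0,
      ∀ φ : Lp 𝕜 (ENNReal.ofReal r) (volume : Measure (EuclideanSpace ℝ (Fin n))), ‖φ‖ ≤ δ →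
        ∃ u, FracHeat.IsMildSolution α b ε (Ici 0) φ u ∧ FracHeat.MemX q p (Ici 0) u ∧
          ∃ B : ℝ, ∀ t ≥ 0, ‖u t‖ ≤ B) ∧
    -- (iii) lower bound for the blow-up rate, `r > r₀`
    (n * b / (2 * α) < r → ∃ C > 0,
      ∀ (φ : Lp 𝕜 (ENNReal.ofReal r) (volume : Measure (EuclideanSpace ℝ (Fin n)))) (T : ℝ)
        (u : ℝ → Lp 𝕜 (ENNReal.ofReal r) (volume : Measure (EuclideanSpace ℝ (Fin n)))),
        FracHeat.IsMaximal α b ε q p T φ u →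
        ∀ s ∈ Ico 0 T, C / (T - s) ^ (1 / b - n / (2 * r * α)) ≤ ‖u s‖) := by 
  have hcom : (n : ℝ) * b / (2 * α) = n / (2 * α) * b := by ring
  rw [hcom] at hr₀ hr ⊢
  have hε' : |ε| = 1 := by rcases hε with rfl | rfl <;> simp
  -- The dimension is positive because r₀ > 1.
  have hn : 0 < (n : ℝ) / (2 * α) := by
    by_contra h
    have := mul_nonpos_of_nonpos_of_nonneg (not_lt.1 h) hb.le
    linarith
  have hr0 : 0 < r := by linarith
  obtain ⟨κ, hκ, hsmall⟩ :=
    FracHeat.exists_isMildSolution_of_small (𝕜 := 𝕜) hα hn hb hε' hr₀ hr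
  refine ⟨fun hsub M => ?_, fun hcrit φ => ?_, fun φ T u v _ hu huX hv hvX =>
    hu.unique hα hn hb hε' hr₀ hr hv huX.1 hvX.1, fun hcrit => ?_, fun hsub => ?_⟩
  · have hη : 0 < 1 - n / (2 * α) * b / r := by rwa [sub_pos, div_lt_one hr0]
    have hM : 0 < |M| + 1 := by positivity
    -- This T solves T^{1-r₀/r} (|M| + 1)^b = κ; replacing M by |M| + 1 keeps the base positive for
    -- every real M.
    refine ⟨(κ / (|M| + 1) ^ b) ^ (1 / (1 - n / (2 * α) * b / r)), by positivity,
      fun φ hφ => ?_⟩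
    obtain ⟨u, hu, huX⟩ := hsmall ((κ / (|M| + 1) ^ b) ^ (1 / (1 - n / (2 * α) * b / r)))
      (by positivity) φ (by
        rw [← Real.rpow_mul (by positivity), one_div_mul_cancel hη.ne', Real.rpow_one,
          div_mul_eq_mul_div]
        refine div_le_of_le_mul₀ (by positivity) hκ.le (mul_le_mul_of_nonneg_left ?_ hκ.le)
        exact Real.rpow_le_rpow (norm_nonneg φ) (by linarith [le_abs_self M]) hb.le)
    exact ⟨u, hu, huX q p hadm⟩
  · obtain ⟨T, hT, u, hu, huX⟩ :=
      FracHeat.exists_isMildSolution_critical hα hn hb hε' hr₀ hcrit.symm φ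
    exact ⟨T, hT, u, hu, huX q p hadm⟩
  · obtain ⟨δ, hδ, H⟩ :=
      FracHeat.exists_isMildSolution_global (𝕜 := 𝕜) hα hn hb hε' hr₀ hcrit.symm
    refine ⟨δ, hδ, fun φ hφ => ?_⟩
    obtain ⟨u, hu, huX, hB⟩ := H φ hφ
    exact ⟨u, hu, huX q p hadm, hB⟩
  -- The constant results from raising κ ≤ (T - s)^{1-r₀/r} ‖u(s)‖^b to the power 1/b.
  · refine ⟨κ ^ (1 / b), by positivity, fun φ T u hu s hs => ?_⟩
    have hTs : 0 < T - s := sub_pos.2 hs.2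
    have hle : κ ≤ (T - s) ^ (1 - n / (2 * α) * b / r) * ‖u s‖ ^ b := by
      -- The bound is known for every T₁ > T - s, since gluing needs an interval reaching strictly
      -- beyond T; T₁ then decreases to T - s.
      have hlim : Filter.Tendsto (fun T₁ : ℝ => T₁ ^ (1 - n / (2 * α) * b / r) * ‖u s‖ ^ b)
          (nhdsWithin (T - s) (Ioi (T - s)))
          (nhds ((T - s) ^ (1 - n / (2 * α) * b / r) * ‖u s‖ ^ b)) :=
        (((Real.continuousAt_rpow_const _ _ (Or.inl hTs.ne')).mul continuousAt_const).tendsto).mono_left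
          nhdsWithin_le_nhds
      refine ge_of_tendsto hlim ?_
      filter_upwards [self_mem_nhdsWithin] with T₁ hT₁
      exact (hu.lt_of_lt hα hn hb hε' hr₀ hr hsmall hadm hs hT₁).le
    have hexp : (1 - n / (2 * α) * b / r) * (1 / b) = 1 / b - n / (2 * r * α) := by
      field_simp
    rw [div_le_iff₀ (Real.rpow_pos_of_pos hTs _), mul_comm]
    refine (Real.rpow_le_rpow hκ.le hle (by positivity)).trans_eq ?_
    rw [Real.mul_rpow (by positivity) (by positivity), ← Real.rpow_mul hTs.le,
      ← Real.rpow_mul (norm_nonneg _), mul_one_div_cancel hb.ne', Real.rpow_one, hexp]
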